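/- **Conventions.** Let $R$ be a commutative Noetherian ring. For a free $R$-module $V$ of finite rank, $V^*=\operatorname{Hom}_R(V,R)$; $\bigwedge^nV$ and $\operatorname{Sym}_nV$ are the exterior and symmetric powers, and $D_n(V^*)$ is the divided power, identified with $\operatorname{Hom}_R(\operatorname{Sym}_nV,R)$, on which $v\in V$ acts as a map $D_n(V^*)\to D_{n-1}(V^*)$ dual to multiplication by $v$; all of these are zero for $n<0$. Let $v_1,\dots,v_d$ be a basis of $V$ and $v_1^*,\dots,v_d^*$ the dual basis. Put $$\kappa:\textstyle\bigwedge^pV\otimes\operatorname{Sym}_qV\to\bigwedge^{p-1}V\otimes\operatorname{Sym}_{q+1}V,\quad \kappa(x\otimes s)=\sum_l v_l^*(x)\otimes v_ls,$$ where $v_l^*$ acts on $\bigwedge V$ by contraction, and $$\eta:\textstyle\bigwedge^p(V^*)\otimes D_q(V^*)\to\bigwedge^{p+1}(V^*)\otimes D_{q-1}(V^*),\quad \eta(x\otimes w)=\sum_l x\wedge v_l^*\otimes v_l(w).$$ Let $L^p_qV=\ker\kappa$ on $\bigwedge^pV\otimes\operatorname{Sym}_qV$ (hook Schur module) and $K^p_q(V^*)=\ker\eta$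 on $\bigwedge^p(V^*)\otimes D_q(V^*)$ (hook Weyl module). In particular $K^p_0(V^*)=\bigwedge^p(V^*)$. Let $F$ and $G$ be free $R$-modules of ranks $f\ge g$, let $\Phi:G^*\to F$ be $R$-linear, and let $i,a$ be integers with $1\le a\le g$. Let $x_1,\dots,x_g$ be a basis of $G$ with dual basis $x_1^*,\dots,x_g^*$. The complex $\mathcal C^{i,a}_\Phi$ has the modules $$[\mathcal C^{i,a}_\Phi]_j=\begin{cases}\bigwedge^{f-j}F\otimes L^{g-a}_{i+1-j}G,&j\le i,\\ \bigwedge^{f-g+a-i-1}F,&j=i+1,\\ \bigwedge^{f-g+1-j}F\otimes K^a_{j-i-2}(G^*),&j\ge i+2,\end{cases}$$ and the following differentials $d_j:[\mathcal C^{i,a}_\Phi]_j\to[\mathcal C^{i,a}_\Phi]_{j-1}$. For $j\le i$, $d_j$ is induced by $y\otimes x\otimes s\mapsto\sum_l (y\wedge\Phi(x_l^*))\otimes x\otimes x_ls$. For $j\ge i+3$, $d_j$ is induced by $y\otimes x\otimes w\mapsto\sum_l (y\wedge\Phi(x_l^*))\otimes x\otimes x_l(w)$. For $j=i+2$, $d_j(y\otimes\gamma)=y\wedge(\bigwedge^a\Phi)(\gamma)$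 for $\gamma\in\bigwedge^a(G^*)$. For $j=i+1$, $$d_j(y)=\sum_S y\wedge\Phi(x^*_{s_1})\wedge\dots\wedge\Phi(x^*_{s_p})\otimes\kappa\bigl((x_{s_1}\wedge\dots\wedge x_{s_p})\otimes 1\bigr),\qquad p=g+1-a,$$ where $S=\{s_1<\dots<s_p\}$ runs over the $p$-element subsets of $\{1,\dots,g\}$. $I_g(\Phi)$ is the ideal generated by the $g\times g$ minors of a matrix of $\Phi$. The grade of a proper ideal of $R$ is the length of a maximal $R$-regular sequence in it. A complex is split exact if its identity map is null-homotopic. A complex $C$ is a resolution of $M$ if $H_0(C)\cong M$ and $H_j(C)=0$ for all $j\ne0$. Binomial coefficients $\binom nk$ with $k<0$ are $0$. **Lemma.** Suppose that $F=F'\oplus F''$ and $G=G'\oplus G''$ with $F',F'',G',G''$ free and $\operatorname{rank}F''=\operatorname{rank}G''=r$, where $1\le r\le g-1$ and $g\le f$, and that $$\Phi=\begin{bmatrix}\Phi'_r&0\\0&\Phi''_r\end{bmatrix}$$ with $\Phi'_r:G'^*\to F'$ a homomorphism and $\Phi''_r:G''^*\to F''$ an isomorphism. Let $i$ and $a$ be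 integers with $1\le a\le g$. (a) For every integer $j$, $$H_j(\mathcal C^{i,a}_\Phi)\cong\bigoplus_{\beta=1}^{g-r}H_j(\mathcal C^{i,\beta}_{\Phi'_r})^{\binom r{a-\beta}}.$$ (b) If $r=g-1$, then: (i) $H_j(\mathcal C^{i,a}_\Phi)\cong H_j(\mathcal C^{i,1}_{\Phi'_{g-1}})^{\binom{g-1}{a-1}}$ for every integer $j$; (ii) if $I_g(\Phi)=R$, then $\mathcal C^{i,a}_\Phi$ is split exact; (iii) if $I_g(\Phi)$ is a proper ideal of grade at least $f-g+1$, then $\mathcal C^{i,a}_\Phi$ is a resolution of $(R/I_g(\Phi))^{\binom{g-1}{a-1}}$; moreover, $[\mathcal C^{i,a}_\Phi]_j=0$ for all $j<0$ if $i\ge-1$. -/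

import Mathlib

open TensorProduct CategoryTheory

universe u

namespace HookComplex

/-- The exterior power `⋀ⁿ M` for an integer `n` (zero for negative `n`), inside the exterior
algebra. -/
def ext (R : Type*) [CommRing R] (M : Type*) [AddCommGroup M] [Module R M] :
    ℤ → Submodule R (ExteriorAlgebra R M)
  | Int.ofNat n => ⋀[R]^n M
  | Int.negSucc _ => ⊥

/-- The symmetric power `Symⁿ M` for an integer `n` (zero for negative `n`), inside the symmetric
algebra: the span of the products of `n` elements of `M`. -/
def sym (R : Type*) [CommRing R] (M : Type*) [AddCommGroup M] [Module R M] :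
    ℤ → Submodule R (SymmetricAlgebra R M)
  | Int.ofNat n => LinearMap.range (SymmetricAlgebra.ι R M) ^ n
  | Int.negSucc _ => ⊥

/-- The divided power `Dₙ(M^*)` of the dual of a finite free module `M`, that is, the degree `n`
part of the graded dual of the symmetric algebra of `M`. -/
def divPow (R : Type*) [CommRing R] (M : Type*) [AddCommGroup M] [Module R M] (n : ℤ) : Type _ :=
  Module.Dual R (sym R M n)

instance (R : Type*) [CommRing R] (M : Type*) [AddCommGroup M] [Module R M] (n : ℤ) :
    AddCommGroup (divPow R M n) :=
  inferInstanceAs (AddCommGroup (Module.Dual R (sym R M n)))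

instance (R : Type*) [CommRing R] (M : Type*) [AddCommGroup M] [Module R M] (n : ℤ) :
    Module R (divPow R M n) :=
  inferInstanceAs (Module R (Module.Dual R (sym R M n)))

section Pieces

variable {R : Type*} [CommRing R] {M N : Type*} [AddCommGroup M] [Module R M]
  [AddCommGroup N] [Module R N]

theorem ext_mul_mem {r t r' : ℤ} (h : r' = r + t) {x y : ExteriorAlgebra R M}
    (hx : x ∈ ext R M r) (hy : y ∈ ext R M t) : x * y ∈ ext R M r' := by
  subst h
  rcases r with r | r
  · rcases t with t | t
    · change x ∈ _ ^ r at hx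
      change y ∈ _ ^ t at hy
      change x * y ∈ _ ^ (r + t)
      rw [pow_add]
      exact Submodule.mul_mem_mul hx hy
    · have hy0 : y = 0 := hy
      rw [hy0, mul_zero]
      exact Submodule.zero_mem _
  · have hx0 : x = 0 := hx
    rw [hx0, zero_mul]
    exact Submodule.zero_mem _

theorem ι_mem_ext (v : M) : ExteriorAlgebra.ι R v ∈ ext R M 1 := by
  change _ ∈ LinearMap.range (ExteriorAlgebra.ι R) ^ 1
  rw [pow_one]
  exact ⟨v, rfl⟩

theorem sym_mul_mem {q q' : ℤ} (h : q' = q + 1) (v : M) {s : SymmetricAlgebra R M}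
    (hs : s ∈ sym R M q) : SymmetricAlgebra.ι R M v * s ∈ sym R M q' := by
  subst h
  rcases q with q | q
  · change s ∈ _ ^ q at hs
    change _ ∈ _ ^ (q + 1)
    rw [pow_succ']
    exact Submodule.mul_mem_mul ⟨v, rfl⟩ hs
  · have hs0 : s = 0 := hs
    rw [hs0, mul_zero]
    exact Submodule.zero_mem _

theorem contract_mem {r r' : ℤ} (h : r = r' + 1) (d : Module.Dual R M) {x : ExteriorAlgebra R M}
    (hx : x ∈ ext R M r) :
    CliffordAlgebra.contractLeft (Q := (0 : QuadraticForm R M)) d x ∈ ext R M r' := by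
  rcases r with n | r
  · induction n generalizing x r' with
    | zero =>
      change x ∈ _ ^ 0 at hx
      rw [pow_zero] at hx
      obtain ⟨c, rfl⟩ := Submodule.mem_one.1 hx
      have := CliffordAlgebra.contractLeft_algebraMap (Q := (0 : QuadraticForm R M)) d c
      rw [show algebraMap R (ExteriorAlgebra R M) c = algebraMap R (CliffordAlgebra 0) c from rfl,
        this]
      exact Submodule.zero_mem _
    | succ n ih =>
      change x ∈ _ ^ (n + 1) at hx
      obtain rfl : r' = (n : ℤ) := by
        have : ((n + 1 : ℕ) : ℤ) = r' + 1 := h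
        omega
      rw [pow_succ'] at hx
      refine Submodule.mul_induction_on hx ?_ ?_
      · rintro _ ⟨v, rfl⟩ y hy
        have := CliffordAlgebra.contractLeft_ι_mul (Q := (0 : QuadraticForm R M)) (d := d) v y
        rw [show ExteriorAlgebra.ι R v = CliffordAlgebra.ι 0 v from rfl, this]
        refine Submodule.sub_mem _ (Submodule.smul_mem _ _ hy) ?_
        exact ext_mul_mem (r := 1) (t := n - 1) (by ring) (ι_mem_ext v)
          (ih (by simp) hy)
      · intro y z hy hz
        rw [map_add]
        exact Submodule.add_mem _ hy hz
  · have hx0 : x = 0 := hx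
    rw [hx0, map_zero]
    exact Submodule.zero_mem _

theorem map_mem_ext (f : M →ₗ[R] N) {r : ℤ} {x : ExteriorAlgebra R M} (hx : x ∈ ext R M r) :
    ExteriorAlgebra.map f x ∈ ext R N r := by
  rcases r with n | r
  · change x ∈ _ ^ n at hx
    change _ ∈ _ ^ n
    have h1 : (LinearMap.range (ExteriorAlgebra.ι R (M := M))).map
        (ExteriorAlgebra.map f).toLinearMap ≤ LinearMap.range (ExteriorAlgebra.ι R (M := N)) := by
      rintro _ ⟨_, ⟨v, rfl⟩, rfl⟩
      exact ⟨f v, by simp⟩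
    have h2 : ExteriorAlgebra.map f x ∈ (LinearMap.range (ExteriorAlgebra.ι R (M := M)) ^ n).map
        (ExteriorAlgebra.map f).toLinearMap := ⟨x, hx, rfl⟩
    rw [Submodule.map_pow] at h2
    exact pow_le_pow_left' h1 n h2
  · have hx0 : x = 0 := hx
    rw [hx0, map_zero]
    exact Submodule.zero_mem _

/-- The multiplication `⋀ʳ M × ⋀ᵗ M → ⋀ʳ⁺ᵗ M`. -/
def extMul {r t r' : ℤ} (h : r' = r + t) : ext R M r →ₗ[R] ext R M t →ₗ[R] ext R M r' :=
  LinearMap.mk₂ R (fun x y => ⟨x.1 * y.1, ext_mul_mem h x.2 y.2⟩)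
    (fun _ _ _ => Subtype.ext (add_mul _ _ _)) (fun _ _ _ => Subtype.ext (smul_mul_assoc _ _ _))
    (fun _ _ _ => Subtype.ext (mul_add _ _ _)) (fun _ _ _ => Subtype.ext (mul_smul_comm _ _ _))

/-- The map `x ↦ x ∧ v` from `⋀ʳ M` to `⋀ʳ⁺¹ M`. -/
def wedge {r r' : ℤ} (h : r' = r + 1) (v : M) : ext R M r →ₗ[R] ext R M r' :=
  (extMul h).flip ⟨ExteriorAlgebra.ι R v, ι_mem_ext v⟩

/-- The action of `d ∈ M^*` on the exterior algebra of `M`, from `⋀ʳ M` to `⋀ʳ⁻¹ M`. -/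
def contract {r r' : ℤ} (h : r = r' + 1) (d : Module.Dual R M) : ext R M r →ₗ[R] ext R M r' :=
  (CliffordAlgebra.contractLeft (Q := (0 : QuadraticForm R M)) d).restrict
    fun _ hx => contract_mem h d hx

/-- The map `⋀ʳ f` from `⋀ʳ M` to `⋀ʳ N`. -/
def extMap (f : M →ₗ[R] N) (r : ℤ) : ext R M r →ₗ[R] ext R N r :=
  (ExteriorAlgebra.map f).toLinearMap.restrict fun _ hx => map_mem_ext f hx

/-- Multiplication by `v ∈ M` from `Sym^q M` to `Sym^{q+1} M`. -/
def symMul {q q' : ℤ} (h : q' = q + 1) (v : M) : sym R M q →ₗ[R] sym R M q' :=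
  (LinearMap.mulLeft R (SymmetricAlgebra.ι R M v)).restrict fun _ hs => sym_mul_mem h v hs

/-- The action of `v ∈ M` on the divided power algebra of `M^*`, from `D_q(M^*)` to
`D_{q-1}(M^*)`: it is dual to multiplication by `v` on the symmetric algebra. -/
def divAct {q q' : ℤ} (h : q = q' + 1) (v : M) : divPow R M q →ₗ[R] divPow R M q' :=
  LinearMap.dualMap (symMul h v)

end Pieces

section Hooks

variable (R : Type*) [CommRing R] (G : Type*) [AddCommGroup G] [Module R G]
  [Module.Free R G] [Module.Finite R G]

/-- A basis of a finite free module, indexed by an initial segment of the natural numbers. -/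
noncomputable def freeBasis :
    Module.Basis (Fin (Fintype.card (Module.Free.ChooseBasisIndex R G))) R G :=
  (Module.Free.chooseBasis R G).reindex (Fintype.equivFin _)

/-- The Koszul map `κ : ⋀ᵖ G ⊗ Sym_q G → ⋀ᵖ⁻¹ G ⊗ Sym_{q+1} G`. -/
noncomputable def kappa {p q p' q' : ℤ} (hp : p = p' + 1) (hq : q' = q + 1) :
    ext R G p ⊗[R] sym R G q →ₗ[R] ext R G p' ⊗[R] sym R G q' :=
  ∑ l, TensorProduct.map (contract hp ((freeBasis R G).coord l)) (symMul hq (freeBasis R G l))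

/-- The map `η : ⋀ᵖ(G^*) ⊗ D_q(G^*) → ⋀ᵖ⁺¹(G^*) ⊗ D_{q-1}(G^*)`. -/
noncomputable def eta {p q p' q' : ℤ} (hp : p' = p + 1) (hq : q = q' + 1) :
    ext R (Module.Dual R G) p ⊗[R] divPow R G q →ₗ[R]
      ext R (Module.Dual R G) p' ⊗[R] divPow R G q' :=
  ∑ l, TensorProduct.map (wedge hp ((freeBasis R G).coord l)) (divAct hq (freeBasis R G l))

/-- The hook Schur module `L^p_q G`, the kernel of `κ` on `⋀ᵖ G ⊗ Sym_q G`. -/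
noncomputable def schur (p q : ℤ) : Submodule R (ext R G p ⊗[R] sym R G q) :=
  LinearMap.ker (kappa R G (p' := p - 1) (by ring) rfl)

/-- The hook Weyl module `K^p_q (G^*)`, the kernel of `η` on `⋀ᵖ(G^*) ⊗ D_q(G^*)`. -/
noncomputable def weyl (p q : ℤ) :
    Submodule R (ext R (Module.Dual R G) p ⊗[R] divPow R G q) :=
  LinearMap.ker (eta R G (q' := q - 1) rfl (by ring))

end Hooks
section Antisymmetry

theorem sum_sum_eq_zero {ι A : Type*} [AddCommMonoid A] (s : Finset ι) (B : ι → ι → A)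
    (h0 : ∀ i, B i i = 0) (h1 : ∀ i j, B i j + B j i = 0) : ∑ i ∈ s, ∑ j ∈ s, B i j = 0 := by
  classical
  induction s using Finset.induction_on with
  | empty => simp
  | insert a s ha ih =>
    simp only [Finset.sum_insert ha, Finset.sum_add_distrib, ih, h0, zero_add, add_zero]
    rw [← Finset.sum_add_distrib]
    exact Finset.sum_eq_zero fun i _ => h1 a i

theorem sum_comp' {R A B C ι : Type*} [CommSemiring R] [AddCommMonoid A] [Module R A] [AddCommMonoid B]
    [Module R B] [AddCommMonoid C] [Module R C] (s : Finset ι) (f : ι → B →ₗ[R] C)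
    (g : A →ₗ[R] B) : (∑ i ∈ s, f i) ∘ₗ g = ∑ i ∈ s, f i ∘ₗ g := by
  ext x
  simp

theorem comp_sum' {R A B C ι : Type*} [CommSemiring R] [AddCommMonoid A] [Module R A] [AddCommMonoid B]
    [Module R B] [AddCommMonoid C] [Module R C] (s : Finset ι) (f : ι → A →ₗ[R] B)
    (g : B →ₗ[R] C) : g ∘ₗ (∑ i ∈ s, f i) = ∑ i ∈ s, g ∘ₗ f i := by
  ext x
  simp

theorem tensor_sum_comp_eq_zero {R A A' A'' B B' B'' ι : Type*} [CommSemiring R]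
    [AddCommMonoid A] [Module R A] [AddCommMonoid A'] [Module R A'] [AddCommMonoid A'']
    [Module R A''] [AddCommMonoid B] [Module R B] [AddCommMonoid B'] [Module R B']
    [AddCommMonoid B''] [Module R B''] [Fintype ι] (a : ι → A →ₗ[R] A') (a' : ι → A' →ₗ[R] A'')
    (b : ι → B →ₗ[R] B') (b' : ι → B' →ₗ[R] B'') (h0 : ∀ i, a' i ∘ₗ a i = 0)
    (h1 : ∀ i j, a' i ∘ₗ a j + a' j ∘ₗ a i = 0) (h2 : ∀ i j, b' i ∘ₗ b j = b' j ∘ₗ b i) :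
    (∑ i, TensorProduct.map (a' i) (b' i)) ∘ₗ (∑ i, TensorProduct.map (a i) (b i)) = 0 := by
  simp only [sum_comp', comp_sum', ← TensorProduct.map_comp]
  refine sum_sum_eq_zero _ _ (fun i => ?_) (fun i j => ?_)
  · rw [h0, TensorProduct.map_zero_left]
  · rw [h2 i j, ← TensorProduct.map_add_left, h1, TensorProduct.map_zero_left]

variable {R : Type*} [CommRing R] {M : Type*} [AddCommGroup M] [Module R M]

theorem wedge_wedge_self {r r' r'' : ℤ} (h : r' = r + 1) (h' : r'' = r' + 1) (v : M) :
    wedge (R := R) h' v ∘ₗ wedge h v = 0 := by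
  ext x
  change x.1 * ExteriorAlgebra.ι R v * ExteriorAlgebra.ι R v = 0
  rw [mul_assoc, ExteriorAlgebra.ι_sq_zero, mul_zero]

theorem wedge_wedge_comm {r r' r'' : ℤ} (h : r' = r + 1) (h' : r'' = r' + 1) (v w : M) :
    wedge (R := R) h' v ∘ₗ wedge h w + wedge h' w ∘ₗ wedge h v = 0 := by
  ext x
  change x.1 * ExteriorAlgebra.ι R w * ExteriorAlgebra.ι R v +
    x.1 * ExteriorAlgebra.ι R v * ExteriorAlgebra.ι R w = 0
  rw [mul_assoc, mul_assoc, ← mul_add, ExteriorAlgebra.ι_add_mul_swap, mul_zero]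

theorem contract_contract_self {r r' r'' : ℤ} (h : r = r' + 1) (h' : r' = r'' + 1)
    (d : Module.Dual R M) : contract (R := R) h' d ∘ₗ contract h d = 0 := by
  ext x
  exact CliffordAlgebra.contractLeft_contractLeft (Q := (0 : QuadraticForm R M)) (d := d) x.1

theorem contract_contract_comm {r r' r'' : ℤ} (h : r = r' + 1) (h' : r' = r'' + 1)
    (d e : Module.Dual R M) :
    contract (R := R) h' d ∘ₗ contract h e + contract h' e ∘ₗ contract h d = 0 := by
  ext x
  exact add_eq_zero_iff_eq_neg.2
    (CliffordAlgebra.contractLeft_comm (Q := (0 : QuadraticForm R M)) (d := d) (d' := e) x.1)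

theorem symMul_comm {q q' q'' s : ℤ} (h : q' = q + 1) (h' : q'' = q' + 1) (k : s = q + 1)
    (k' : q'' = s + 1) (v w : M) :
    symMul (R := R) h' v ∘ₗ symMul h w = symMul k' w ∘ₗ symMul k v := by
  ext x
  exact mul_left_comm (SymmetricAlgebra.ι R M v) (SymmetricAlgebra.ι R M w) x.1

theorem divAct_comm {q q' q'' s : ℤ} (h : q = q' + 1) (h' : q' = q'' + 1) (k : q = s + 1)
    (k' : s = q'' + 1) (v w : M) :
    divAct (R := R) h' v ∘ₗ divAct h w = divAct k' w ∘ₗ divAct k v := by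
  refine LinearMap.ext fun φ => LinearMap.ext fun x => ?_
  exact congrArg (DFunLike.coe (F := Module.Dual R (sym R M q)) φ)
    (LinearMap.congr_fun (symMul_comm k' k h' h w v) x)

end Antisymmetry

section Hooks

variable {R : Type*} [CommRing R] {G : Type*} [AddCommGroup G] [Module R G]
  [Module.Free R G] [Module.Finite R G]

theorem kappa_comp_kappa {p q p' q' p'' q'' : ℤ} (hp : p = p' + 1) (hq : q' = q + 1)
    (hp' : p' = p'' + 1) (hq' : q'' = q' + 1) :
    kappa R G hp' hq' ∘ₗ kappa R G hp hq = 0 :=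
  tensor_sum_comp_eq_zero _ _ _ _ (fun _ => contract_contract_self hp hp' _)
    (fun _ _ => contract_contract_comm hp hp' _ _) (fun _ _ => symMul_comm hq hq' hq hq' _ _)

theorem kappa_comp_symMul {p q p' q' s s' : ℤ} (hp : p = p' + 1) (hq : q' = q + 1)
    (hs : s = q + 1) (hs' : s' = s + 1) (hq' : s' = q' + 1) (v : G) :
    kappa R G hp hs' ∘ₗ TensorProduct.map LinearMap.id (symMul hs v) =
      TensorProduct.map LinearMap.id (symMul hq' v) ∘ₗ kappa R G hp hq := by
  simp only [kappa, sum_comp', comp_sum', ← TensorProduct.map_comp,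
    LinearMap.id_comp, LinearMap.comp_id]
  exact Finset.sum_congr rfl fun l _ => by rw [symMul_comm hs hs' hq hq']

theorem eta_comp_divAct {p q p' q' s s' : ℤ} (hp : p' = p + 1) (hq : q = q' + 1)
    (hs : q = s + 1) (hs' : s = s' + 1) (hq' : q' = s' + 1) (v : G) :
    eta R G hp hs' ∘ₗ TensorProduct.map LinearMap.id (divAct hs v) =
      TensorProduct.map LinearMap.id (divAct hq' v) ∘ₗ eta R G hp hq := by
  simp only [eta, sum_comp', comp_sum', ← TensorProduct.map_comp,
    LinearMap.id_comp, LinearMap.comp_id]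
  exact Finset.sum_congr rfl fun l _ => by rw [divAct_comm hs hs' hq hq']

/-- Multiplication by `v ∈ G` from `L^p_q G` to `L^p_{q+1} G`. -/
noncomputable def schurMul {p q q' : ℤ} (h : q' = q + 1) (v : G) :
    schur R G p q →ₗ[R] schur R G p q' :=
  (TensorProduct.map LinearMap.id (symMul h v)).restrict fun x hx => by
    have := LinearMap.congr_fun
      (kappa_comp_symMul (p := p) (p' := p - 1) (by ring) rfl h rfl (by rw [h]) v) x
    have hx0 : kappa R G (p := p) (p' := p - 1) (q := q) (by ring) rfl x = 0 := hx
    rw [LinearMap.comp_apply, LinearMap.comp_apply, hx0, map_zero] at this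
    exact this

/-- The action of `v ∈ G` from `K^p_q (G^*)` to `K^p_{q-1} (G^*)`. -/
noncomputable def weylAct {p q q' : ℤ} (h : q = q' + 1) (v : G) :
    weyl R G p q →ₗ[R] weyl R G p q' :=
  (TensorProduct.map LinearMap.id (divAct h v)).restrict fun x hx => by
    have := LinearMap.congr_fun
      (eta_comp_divAct (p := p) (q' := q - 1) (s' := q' - 1) rfl (by ring) h (by ring)
        (by rw [h]; ring) v) x
    have hx0 : eta R G (p := p) (q := q) (q' := q - 1) rfl (by ring) x = 0 := hx
    rw [LinearMap.comp_apply, LinearMap.comp_apply, hx0, map_zero] at this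
    exact this

theorem schurMul_comm {p q q' q'' : ℤ} (h : q' = q + 1) (h' : q'' = q' + 1) (v w : G) :
    schurMul (R := R) (p := p) h' v ∘ₗ schurMul h w = schurMul h' w ∘ₗ schurMul h v := by
  refine LinearMap.ext fun x => Subtype.ext ?_
  have h2 (y : ext R G p ⊗[R] sym R G q) :
      TensorProduct.map LinearMap.id (symMul h' v) (TensorProduct.map LinearMap.id (symMul h w) y) =
      TensorProduct.map LinearMap.id (symMul h' w)
        (TensorProduct.map LinearMap.id (symMul h v) y) := by
    rw [TensorProduct.map_map, TensorProduct.map_map, symMul_comm h h' h h']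
  exact h2 x.1

theorem weylAct_comm {p q q' q'' : ℤ} (h : q = q' + 1) (h' : q' = q'' + 1) (v w : G) :
    weylAct (R := R) (p := p) h' v ∘ₗ weylAct h w = weylAct h' w ∘ₗ weylAct h v := by
  refine LinearMap.ext fun x => Subtype.ext ?_
  have h2 (y : ext R (Module.Dual R G) p ⊗[R] divPow R G q) :
      TensorProduct.map LinearMap.id (divAct h' v) (TensorProduct.map LinearMap.id (divAct h w) y) =
      TensorProduct.map LinearMap.id (divAct h' w)
        (TensorProduct.map LinearMap.id (divAct h v) y) := by
    rw [TensorProduct.map_map, TensorProduct.map_map, divAct_comm h h' h h']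
  exact h2 x.1

theorem one_mem_sym {R : Type*} [CommRing R] {G : Type*} [AddCommGroup G] [Module R G] :
    (1 : SymmetricAlgebra R G) ∈ sym R G 0 := by
  change _ ∈ _ ^ 0
  rw [pow_zero]
  exact Submodule.one_le.1 le_rfl

/-- The identification of `D_0(G^*)` with `R`, by evaluation at `1 ∈ Sym_0 G`. -/
def divZero (R : Type*) [CommRing R] (G : Type*) [AddCommGroup G] [Module R G] :
    divPow R G 0 →ₗ[R] R :=
  Module.Dual.eval R (sym R G 0) ⟨1, one_mem_sym⟩

/-- The identification of `⋀ᵖ(G^*) ⊗ D_0(G^*)` with `⋀ᵖ(G^*)`. -/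
noncomputable def evalZero (R : Type*) [CommRing R] (G : Type*) [AddCommGroup G] [Module R G]
    (p : ℤ) : ext R (Module.Dual R G) p ⊗[R] divPow R G 0 →ₗ[R] ext R (Module.Dual R G) p :=
  (TensorProduct.rid R _).toLinearMap ∘ₗ TensorProduct.map LinearMap.id (divZero R G)

/-- The identification of `K^p_0 (G^*)` with `⋀ᵖ(G^*)`. -/
noncomputable def weylZero (p : ℤ) : weyl R G p 0 →ₗ[R] ext R (Module.Dual R G) p :=
  evalZero R G p ∘ₗ (weyl R G p 0).subtype

/-- The map `κ : ⋀ᵖ⁺¹ G = ⋀ᵖ⁺¹ G ⊗ Sym_0 G → L^p_1 G`. -/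
noncomputable def kappaZero {p s : ℤ} (h : s = p + 1) : ext R G s →ₗ[R] schur R G p 1 :=
  LinearMap.codRestrict (schur R G p 1)
    (kappa R G h (zero_add 1).symm ∘ₗ (TensorProduct.mk R _ _).flip ⟨1, one_mem_sym⟩)
    fun x => LinearMap.congr_fun (kappa_comp_kappa h (zero_add 1).symm (p'' := p - 1) (by ring)
      rfl) (x ⊗ₜ ⟨1, one_mem_sym⟩)

/-- The exterior product of the vectors `v l`, `l ∈ S`, in increasing order of `l`. -/
noncomputable def wedgeProd {M : Type*} [AddCommGroup M] [Module R M] {n : ℕ} {s : ℤ}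
    (v : Fin n → M) (S : {S : Finset (Fin n) // (S.card : ℤ) = s}) : ext R M s :=
  ⟨ExteriorAlgebra.ιMulti_family R S.1.card v (Set.powersetCard.ofCard rfl), by
    obtain ⟨S, rfl⟩ := S
    exact ExteriorAlgebra.ιMulti_range R S.card ⟨_, rfl⟩⟩

variable {F : Type*} [AddCommGroup F] [Module R F] (Φ : Module.Dual R G →ₗ[R] F)

/-- The map `Kos_Φ : ⋀ʳ F ⊗ L^p_q G → ⋀ʳ⁺¹ F ⊗ L^p_{q+1} G`. -/
noncomputable def kosMap {r r' p q q' : ℤ} (hr : r' = r + 1) (hq : q' = q + 1) :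
    ext R F r ⊗[R] schur R G p q →ₗ[R] ext R F r' ⊗[R] schur R G p q' :=
  ∑ l, TensorProduct.map (wedge hr (Φ ((freeBasis R G).coord l))) (schurMul hq (freeBasis R G l))

/-- The map `η_Φ : ⋀ʳ F ⊗ K^p_q (G^*) → ⋀ʳ⁺¹ F ⊗ K^p_{q-1} (G^*)`. -/
noncomputable def etaMap {r r' p q q' : ℤ} (hr : r' = r + 1) (hq : q = q' + 1) :
    ext R F r ⊗[R] weyl R G p q →ₗ[R] ext R F r' ⊗[R] weyl R G p q' :=
  ∑ l, TensorProduct.map (wedge hr (Φ ((freeBasis R G).coord l))) (weylAct hq (freeBasis R G l))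

/-- The map `⋀ʳ F ⊗ K^p_0 (G^*) → ⋀ʳ⁺ᵖ F`, `f ⊗ γ ↦ f ∧ (⋀ᵖ Φ)(γ)`. -/
noncomputable def spliceIn {r r' p : ℤ} (h : r' = r + p) :
    ext R F r ⊗[R] weyl R G p 0 →ₗ[R] ext R F r' :=
  TensorProduct.lift ((extMul h).compl₂ (extMap Φ p ∘ₗ weylZero p))

/-- The map `⋀ʳ F → ⋀ʳ⁺ᵖ⁺¹ F ⊗ L^p_1 G`, `f ↦ ∑ f ∧ (⋀ᵖ⁺¹ Φ)(m^*) ⊗ κ(m)`, with `m` in a basis of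
`⋀ᵖ⁺¹ G` and `m^*` in the dual basis of `⋀ᵖ⁺¹ (G^*)`. -/
noncomputable def spliceOut {r r' p : ℤ} (h : r' = r + (p + 1)) :
    ext R F r →ₗ[R] ext R F r' ⊗[R] schur R G p 1 :=
  ∑ S : {S : Finset (Fin _) // (S.card : ℤ) = p + 1},
    ((TensorProduct.mk R _ _).flip (kappaZero rfl (wedgeProd (freeBasis R G) S))) ∘ₗ
      (extMul h).flip (extMap Φ (p + 1) (wedgeProd (freeBasis R G).coord S))

theorem kosMap_comp_kosMap {r r' r'' p q q' q'' : ℤ} (hr : r' = r + 1) (hq : q' = q + 1)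
    (hr' : r'' = r' + 1) (hq' : q'' = q' + 1) :
    kosMap Φ (p := p) hr' hq' ∘ₗ kosMap Φ (p := p) hr hq = 0 :=
  tensor_sum_comp_eq_zero _ _ _ _ (fun _ => wedge_wedge_self hr hr' _)
    (fun _ _ => wedge_wedge_comm hr hr' _ _) (fun _ _ => schurMul_comm hq hq' _ _)

theorem etaMap_comp_etaMap {r r' r'' p q q' q'' : ℤ} (hr : r' = r + 1) (hq : q = q' + 1)
    (hr' : r'' = r' + 1) (hq' : q' = q'' + 1) :
    etaMap Φ (p := p) hr' hq' ∘ₗ etaMap Φ (p := p) hr hq = 0 :=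
  tensor_sum_comp_eq_zero _ _ _ _ (fun _ => wedge_wedge_self hr hr' _)
    (fun _ _ => wedge_wedge_comm hr hr' _ _) (fun _ _ => weylAct_comm hq hq' _ _)

theorem eta_eq_zero {p q p' q' : ℤ} (hp : p' = p + 1) (hq : q = q' + 1) (k : weyl R G p q) :
    eta R G hp hq k.1 = 0 := by
  subst hp
  obtain rfl : q' = q - 1 := by omega
  exact k.2

theorem ι_mul_ext {M : Type*} [AddCommGroup M] [Module R M] (p : ℤ) :
    ∃ ε : ℤ, ε * ε = 1 ∧ ∀ (v : M), ∀ w ∈ ext R M p,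
      ExteriorAlgebra.ι R v * w = ε • (w * ExteriorAlgebra.ι R v) := by
  rcases p with n | n
  · induction n with
    | zero =>
      refine ⟨1, one_mul 1, fun v w hw => ?_⟩
      change w ∈ _ ^ 0 at hw
      rw [pow_zero] at hw
      obtain ⟨c, rfl⟩ := Submodule.mem_one.1 hw
      rw [one_smul, Algebra.commutes]
    | succ n ih =>
      obtain ⟨ε, hε, h⟩ := ih
      refine ⟨-ε, by rw [neg_mul_neg, hε], fun v w hw => ?_⟩
      change w ∈ _ ^ (n + 1) at hw
      rw [pow_succ'] at hw
      refine Submodule.mul_induction_on hw ?_ ?_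
      · rintro _ ⟨u, rfl⟩ y hy
        rw [← mul_assoc, eq_neg_of_add_eq_zero_left (ExteriorAlgebra.ι_add_mul_swap v u),
          neg_mul, mul_assoc, h v y hy, neg_smul, mul_smul_comm, mul_assoc]
      · intro y z hy hz
        rw [mul_add, hy, hz, add_mul, smul_add]
  · refine ⟨1, one_mul 1, fun v w hw => ?_⟩
    have hw0 : w = 0 := hw
    rw [hw0, mul_zero, zero_mul, smul_zero]

theorem evalZero_wedge {R : Type*} [CommRing R] {G : Type*} [AddCommGroup G] [Module R G]
    {p p' q : ℤ} (hp : p' = p + 1) (hq : q = 0 + 1) (c : Module.Dual R G)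
    (v : G) (x : ext R (Module.Dual R G) p ⊗[R] divPow R G q) :
    evalZero R G p' (TensorProduct.map (wedge hp c) (divAct hq v) x) =
      wedge hp c (evalZero R G p (TensorProduct.map LinearMap.id (divAct hq v) x)) := by
  induction x using TensorProduct.induction_on with
  | zero => simp only [map_zero]
  | add x y hx hy => simp only [map_add, hx, hy]
  | tmul x φ => simp [evalZero]

theorem sum_weylZero {p : ℤ} (k : weyl R G p 1) :
    ∑ l, wedge rfl ((freeBasis R G).coord l)
      (weylZero p (weylAct (zero_add 1).symm (freeBasis R G l) k)) = 0 := by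
  have h := congrArg (evalZero R G (p + 1)) (eta_eq_zero rfl (zero_add 1).symm k)
  rw [map_zero, eta, LinearMap.sum_apply, map_sum] at h
  simp only [evalZero_wedge] at h
  exact h

theorem etaMap_tmul {r r' p q q' : ℤ} (hr : r' = r + 1) (hq : q = q' + 1) (f : ext R F r)
    (k : weyl R G p q) : etaMap Φ hr hq (f ⊗ₜ k) =
      ∑ l, wedge hr (Φ ((freeBasis R G).coord l)) f ⊗ₜ weylAct hq (freeBasis R G l) k := by
  simp only [etaMap, LinearMap.sum_apply, TensorProduct.map_tmul]

theorem spliceIn_tmul {r r' p : ℤ} (h : r' = r + p) (f : ext R F r) (k : weyl R G p 0) :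
    (spliceIn Φ h (f ⊗ₜ k)).1 = f.1 * ExteriorAlgebra.map Φ (weylZero p k).1 := rfl

theorem wedge_coe {M : Type*} [AddCommGroup M] [Module R M] {r r' : ℤ} (h : r' = r + 1) (v : M)
    (x : ext R M r) : (wedge h v x).1 = x.1 * ExteriorAlgebra.ι R v := rfl

theorem extMul_coe {M : Type*} [AddCommGroup M] [Module R M] {r t r' : ℤ} (h : r' = r + t)
    (x : ext R M r) (y : ext R M t) : (extMul h x y).1 = x.1 * y.1 := rfl

theorem extMap_coe {M : Type*} [AddCommGroup M] [Module R M] {N : Type*} [AddCommGroup N]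
    [Module R N] (f : M →ₗ[R] N) (r : ℤ) (x : ext R M r) :
    (extMap f r x).1 = ExteriorAlgebra.map f x.1 := rfl

theorem spliceIn_wedge {r r' r'' p : ℤ} (hr : r' = r + 1) (h : r'' = r' + p) (f : ext R F r)
    (c : Module.Dual R G) (k : weyl R G p 0) (ε : ℤ)
    (hε : ExteriorAlgebra.ι R c * (weylZero p k).1 =
      ε • ((weylZero p k).1 * ExteriorAlgebra.ι R c)) :
    (spliceIn Φ h (wedge hr (Φ c) f ⊗ₜ k)).1 =
      f.1 * ε • ExteriorAlgebra.map Φ (wedge rfl c (weylZero p k)).1 := by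
  refine (spliceIn_tmul Φ h _ k).trans ?_
  have e := congrArg (ExteriorAlgebra.map Φ) hε
  rw [map_mul, ExteriorAlgebra.map_apply_ι, map_zsmul] at e
  exact (mul_assoc f.1 (ExteriorAlgebra.ι R (Φ c)) _).trans (congrArg (f.1 * ·) e)

set_option maxHeartbeats 1000000 in
theorem spliceIn_comp_etaMap {r r' r'' p : ℤ} (hr : r' = r + 1) (h : r'' = r' + p) :
    spliceIn Φ h ∘ₗ etaMap Φ (p := p) hr (zero_add 1).symm = 0 := by
  refine TensorProduct.ext' fun f k => Subtype.ext ?_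
  obtain ⟨ε, -, hε⟩ := ι_mul_ext (R := R) (M := Module.Dual R G) p
  have h1 (l) := spliceIn_wedge Φ hr h f ((freeBasis R G).coord l)
    (weylAct (zero_add 1).symm (freeBasis R G l) k) ε (hε _ _ (weylZero p _).2)
  have h2 := congrArg (fun x => f.1 * ε • ExteriorAlgebra.map Φ x.1) (sum_weylZero k)
  simp only [AddSubmonoidClass.coe_finsetSum, map_sum, Finset.smul_sum, Finset.mul_sum] at h2
  rw [LinearMap.comp_apply, etaMap_tmul, map_sum, AddSubmonoidClass.coe_finsetSum]
  refine (Finset.sum_congr rfl fun l _ => h1 l).trans (h2.trans ?_)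
  rw [ZeroMemClass.coe_zero, map_zero, smul_zero, mul_zero]
  rfl

theorem ext_eq_zero {n : ℤ} (hn : (Module.finrank R G : ℤ) < n)
    (x : ext R (Module.Dual R G) n) : x.1 = 0 := by
  rcases subsingleton_or_nontrivial R with hR | hR
  · have := Module.subsingleton R (ExteriorAlgebra R (Module.Dual R G))
    exact Subsingleton.elim _ _
  rcases n with n | n
  · have hb : Fintype.card (Module.Free.ChooseBasisIndex R G) < n := by
      rw [← Module.finrank_eq_card_chooseBasisIndex]
      exact Int.ofNat_lt.1 hn
    have hE : IsEmpty (Set.powersetCard (Fin (Fintype.card (Module.Free.ChooseBasisIndex R G))) n) :=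
      ⟨fun S => by
        have h1 := Finset.card_le_univ S.1
        rw [show S.1.card = n from S.2, Fintype.card_fin] at h1
        omega⟩
    have : Subsingleton (⋀[R]^n (Module.Dual R G)) :=
      ((freeBasis R G).dualBasis.exteriorPower n).repr.toEquiv.subsingleton
    exact congrArg Subtype.val (Subsingleton.elim (α := ⋀[R]^n (Module.Dual R G)) x 0)
  · exact x.2

theorem spliceOut_apply {r r' p : ℤ} (h : r' = r + (p + 1)) (f : ext R F r) :
    spliceOut Φ h f = ∑ S : {S : Finset (Fin _) // (S.card : ℤ) = p + 1},
      extMul h f (extMap Φ (p + 1) (wedgeProd (freeBasis R G).coord S)) ⊗ₜ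
        kappaZero rfl (wedgeProd (freeBasis R G) S) := by
  simp only [spliceOut, LinearMap.sum_apply]
  rfl

theorem spliceOut_comp_spliceIn {r r' r'' p a : ℤ} (h : r' = r + a) (h' : r'' = r' + (p + 1))
    (hg : (Module.finrank R G : ℤ) < a + (p + 1)) :
    spliceOut (p := p) Φ h' ∘ₗ spliceIn Φ h = 0 := by
  refine TensorProduct.ext' fun f k => ?_
  rw [LinearMap.comp_apply, spliceOut_apply, LinearMap.zero_apply]
  refine Finset.sum_eq_zero fun S _ => ?_
  have h0 : extMul h' (spliceIn Φ h (f ⊗ₜ k))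
      (extMap Φ (p + 1) (wedgeProd (freeBasis R G).coord S)) = 0 := by
    refine Subtype.ext ?_
    have h1 := ext_eq_zero hg (extMul rfl (weylZero a k) (wedgeProd (freeBasis R G).coord S))
    rw [extMul_coe] at h1
    rw [extMul_coe, spliceIn_tmul, extMap_coe, mul_assoc, ← map_mul, h1, map_zero, mul_zero,
      ZeroMemClass.coe_zero]
  rw [h0, TensorProduct.zero_tmul]

section WedgeProd

variable {V W X : Type*} [AddCommGroup V] [Module R V] [AddCommGroup W] [Module R W]
  [AddCommGroup X] [Module R X]

theorem ιMulti_family_congr {n m k : ℕ} (v : Fin n → V) (s : Set.powersetCard (Fin n) m)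
    (t : Set.powersetCard (Fin n) k) (h : s.1 = t.1) :
    ExteriorAlgebra.ιMulti_family R m v s = ExteriorAlgebra.ιMulti_family R k v t := by
  obtain ⟨S, hS⟩ := s
  obtain ⟨T, hT⟩ := t
  obtain rfl : S = T := h
  obtain rfl : S.card = m := hS
  obtain rfl : S.card = k := hT
  rfl

theorem ι_eq_ιMulti_family {n : ℕ} (v : Fin n → V) (l : Fin n) :
    ExteriorAlgebra.ι R (v l) = ExteriorAlgebra.ιMulti_family R 1 v
      (Set.powersetCard.ofSingleton l) := by
  have hm : Set.powersetCard.ofFinEmbEquiv.symm (Set.powersetCard.ofSingleton l) 0 ∈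
      Set.powersetCard.ofSingleton l :=
    (Set.powersetCard.mem_range_ofFinEmbEquiv_symm_iff_mem _ _).1 ⟨0, rfl⟩
  have hm' : Set.powersetCard.ofFinEmbEquiv.symm (Set.powersetCard.ofSingleton l) 0 = l :=
    Finset.mem_singleton.1 hm
  rw [ExteriorAlgebra.ιMulti_family, ExteriorAlgebra.ιMulti_succ_apply,
    ExteriorAlgebra.ιMulti_zero_apply, mul_one, Function.comp_apply, hm']

theorem ι_mul_wedgeProd_aux {n : ℕ} {s s' : ℤ} (l : Fin n)
    (S : {S : Finset (Fin n) // (S.card : ℤ) = s}) (T : {S : Finset (Fin n) // (S.card : ℤ) = s'})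
    (hT : T.1 = insert l S.1)
    (hd : Disjoint (Set.powersetCard.ofSingleton l).1
      (Set.powersetCard.ofCard (s := S.1) rfl).1) (v : Fin n → V) :
    ExteriorAlgebra.ι R (v l) * (wedgeProd (R := R) v S).1 =
      (Set.powersetCard.permOfDisjoint hd).sign • (wedgeProd (R := R) v T).1 := by
  have hval : (Set.powersetCard.disjUnion hd).1 = T.1 := by
    rw [hT]
    ext x
    change x ∈ Finset.disjUnion _ _ hd ↔ _
    rw [Finset.mem_disjUnion, Finset.mem_insert]
    change x ∈ ({l} : Finset _) ∨ _ ↔ _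
    rw [Finset.mem_singleton]
    rfl
  rw [ι_eq_ιMulti_family]
  refine (ExteriorAlgebra.ιMulti_family_mul_of_disjoint R v _ _ hd).trans ?_
  congr 1
  exact ιMulti_family_congr v _ _ hval

theorem ι_mul_wedgeProd {n : ℕ} {s s' : ℤ} (l : Fin n)
    (S : {S : Finset (Fin n) // (S.card : ℤ) = s}) (T : {S : Finset (Fin n) // (S.card : ℤ) = s'})
    (hl : l ∉ S.1) (hT : T.1 = insert l S.1) :
    ∃ ε : ℤˣ, (∀ v : Fin n → V, ExteriorAlgebra.ι R (v l) * (wedgeProd (R := R) v S).1 =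
        ε • (wedgeProd (R := R) v T).1) ∧
      ∀ w : Fin n → W, ExteriorAlgebra.ι R (w l) * (wedgeProd (R := R) w S).1 =
        ε • (wedgeProd (R := R) w T).1 := by
  have hd : Disjoint (Set.powersetCard.ofSingleton l).1
      (Set.powersetCard.ofCard (s := S.1) rfl).1 := by
    change Disjoint {l} S.1
    exact Finset.disjoint_singleton_left.2 hl
  exact ⟨(Set.powersetCard.permOfDisjoint hd).sign, fun v => ι_mul_wedgeProd_aux l S T hT hd v,
    fun v => ι_mul_wedgeProd_aux l S T hT hd v⟩

end WedgeProd
section WedgeSum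

variable {V W X : Type*} [AddCommGroup V] [Module R V] [AddCommGroup W] [Module R W]
  [AddCommGroup X] [Module R X]

theorem contract_ιMulti (d : Module.Dual R W) {m : ℕ} (u : Fin m → W) (hu : ∀ i, d (u i) = 0) :
    CliffordAlgebra.contractLeft (Q := (0 : QuadraticForm R W)) d
      (ExteriorAlgebra.ιMulti R m u) = 0 := by
  induction m with
  | zero =>
    rw [ExteriorAlgebra.ιMulti_zero_apply]
    exact CliffordAlgebra.contractLeft_one (Q := (0 : QuadraticForm R W)) (d := d)
  | succ m ih =>
    rw [ExteriorAlgebra.ιMulti_succ_apply]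
    refine (CliffordAlgebra.contractLeft_ι_mul (Q := (0 : QuadraticForm R W)) (d := d) _ _).trans ?_
    rw [hu 0, zero_smul, zero_sub, neg_eq_zero]
    have h0 := ih (Matrix.vecTail u) fun i => hu i.succ
    rw [h0, mul_zero]

theorem contract_wedgeProd {n : ℕ} {s s' : ℤ} (h : s = s' + 1) (d : Module.Dual R W)
    (w : Fin n → W) (S : {S : Finset (Fin n) // (S.card : ℤ) = s}) (hd : ∀ k ∈ S.1, d (w k) = 0) :
    contract h d (wedgeProd w S) = 0 :=
  Subtype.ext (contract_ιMulti d _ fun i => hd _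
    ((Set.powersetCard.mem_range_ofFinEmbEquiv_symm_iff_mem
      (Set.powersetCard.ofCard (s := S.1) rfl) _).1 ⟨i, rfl⟩))

/-- The map `x ↦ v ∧ x` from `⋀ˢ V` to `⋀ˢ⁺¹ V`. -/
def wedgeLeft {s s' : ℤ} (h : s' = 1 + s) (v : V) : ext R V s →ₗ[R] ext R V s' :=
  extMul h ⟨ExteriorAlgebra.ι R v, ι_mem_ext v⟩

theorem wedgeLeft_wedgeProd {n : ℕ} {s s' : ℤ} (h : s' = 1 + s) (v : Fin n → V) (l : Fin n)
    (S : {S : Finset (Fin n) // (S.card : ℤ) = s}) (hl : l ∈ S.1) :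
    wedgeLeft (R := R) h (v l) (wedgeProd v S) = 0 := by
  refine Subtype.ext ?_
  change ExteriorAlgebra.ι R (v l) * ExteriorAlgebra.ιMulti_family R _ v _ = 0
  rw [ι_eq_ιMulti_family]
  refine ExteriorAlgebra.ιMulti_family_mul_of_not_disjoint R v _ _ fun hd => ?_
  exact Finset.disjoint_singleton_left.1 (show Disjoint {l} S.1 from hd) hl

theorem wedge_contract_pair {n : ℕ} {s s' : ℤ} (h : s' = 1 + s) (h' : s' = s + 1)
    (B : ext R V s' →ₗ[R] ext R W s →ₗ[R] X) (v : Fin n → V) (w : Fin n → W) (l : Fin n)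
    (d : Module.Dual R W) (hd : ∀ k, d (w k) = if k = l then 1 else 0)
    (S : {S : Finset (Fin n) // (S.card : ℤ) = s}) (T : {S : Finset (Fin n) // (S.card : ℤ) = s'})
    (hl : l ∉ S.1) (hT : T.1 = insert l S.1) :
    B (wedgeLeft h (v l) (wedgeProd v S)) (wedgeProd w S) =
      B (wedgeProd v T) (contract h' d (wedgeProd w T)) := by
  obtain ⟨ε, h1, h2⟩ := ι_mul_wedgeProd (R := R) (V := V) (W := W) l S T hl hT
  have e1 : wedgeLeft h (v l) (wedgeProd (R := R) v S) = ε • wedgeProd v T := Subtype.ext (h1 v)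
  have e2 : wedgeLeft h (w l) (wedgeProd (R := R) w S) = ε • wedgeProd w T := Subtype.ext (h2 w)
  have e3 : contract h' d (wedgeLeft h (w l) (wedgeProd (R := R) w S)) = wedgeProd w S := by
    refine Subtype.ext ?_
    refine (CliffordAlgebra.contractLeft_ι_mul (Q := (0 : QuadraticForm R W)) (d := d) (w l)
      (wedgeProd (R := R) w S).1).trans ?_
    have h0 : CliffordAlgebra.contractLeft (Q := (0 : QuadraticForm R W)) d
        (wedgeProd (R := R) w S).1 = 0 :=
      congrArg Subtype.val (contract_wedgeProd (s' := s - 1) (by ring) d w S fun k hk => by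
        have hkl : k ≠ l := fun e => hl (e ▸ hk)
        rw [hd, if_neg hkl])
    rw [h0, hd, if_pos rfl, one_smul, mul_zero, sub_zero]
  have hε : (((ε : ℤ) * (ε : ℤ) : ℤ)) = 1 := Int.units_coe_mul_self ε
  rw [e2, Units.smul_def, map_zsmul] at e3
  rw [e1, Units.smul_def, map_zsmul, LinearMap.smul_apply, ← e3, map_zsmul, smul_smul, hε,
    one_smul]

theorem sum_wedge_contract {n : ℕ} {s s' : ℤ} (h : s' = 1 + s) (h' : s' = s + 1)
    (B : ext R V s' →ₗ[R] ext R W s →ₗ[R] X) (v : Fin n → V) (w : Fin n → W) (l : Fin n)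
    (d : Module.Dual R W) (hd : ∀ k, d (w k) = if k = l then 1 else 0) :
    ∑ S : {S : Finset (Fin n) // (S.card : ℤ) = s},
        B (wedgeLeft h (v l) (wedgeProd v S)) (wedgeProd w S) =
      ∑ T : {S : Finset (Fin n) // (S.card : ℤ) = s'},
        B (wedgeProd v T) (contract h' d (wedgeProd w T)) := by
  rw [← Finset.sum_filter_add_sum_filter_not Finset.univ
      (fun S : {S : Finset (Fin n) // (S.card : ℤ) = s} => l ∈ S.1),
    ← Finset.sum_filter_add_sum_filter_not Finset.univ
      (fun S : {S : Finset (Fin n) // (S.card : ℤ) = s'} => l ∈ S.1),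
    Finset.sum_eq_zero, zero_add]
  · symm
    rw [add_comm, Finset.sum_eq_zero, zero_add]
    · symm
      refine Finset.sum_bij'
        (fun S hS => ⟨insert l S.1, by
          rw [Finset.card_insert_of_notMem (Finset.mem_filter.1 hS).2, h', Nat.cast_succ, S.2]⟩)
        (fun T hT => ⟨T.1.erase l, by
          have h1 := Finset.card_erase_add_one (Finset.mem_filter.1 hT).2
          have h2 := T.2
          omega⟩) ?_ ?_ ?_ ?_ ?_
      · intro S hS
        exact Finset.mem_filter.2 ⟨Finset.mem_univ _, Finset.mem_insert_self _ _⟩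
      · intro T hT
        exact Finset.mem_filter.2 ⟨Finset.mem_univ _, Finset.notMem_erase _ _⟩
      · intro S hS
        exact Subtype.ext (Finset.erase_insert (Finset.mem_filter.1 hS).2)
      · intro T hT
        exact Subtype.ext (Finset.insert_erase (Finset.mem_filter.1 hT).2)
      · intro S hS
        exact wedge_contract_pair h h' B v w l d hd S _ (Finset.mem_filter.1 hS).2 rfl
    · intro T hT
      rw [contract_wedgeProd h' d w T fun k hk => ?_, map_zero]
      have hkl : k ≠ l := fun e => (Finset.mem_filter.1 hT).2 (e ▸ hk)
      rw [hd, if_neg hkl]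
  · intro S hS
    rw [wedgeLeft_wedgeProd h v l S (Finset.mem_filter.1 hS).2, map_zero, LinearMap.zero_apply]

end WedgeSum

theorem sum_schurMul_kappaZero {p s s' : ℤ} (h : s = p + 1) (h' : s' = s + 1) (m : ext R G s') :
    ∑ l, schurMul (q' := 2) (one_add_one_eq_two).symm (freeBasis R G l)
      (kappaZero h (contract h' ((freeBasis R G).coord l) m)) = 0 := by
  refine Subtype.ext ?_
  rw [AddSubmonoidClass.coe_finsetSum, ZeroMemClass.coe_zero]
  have h1 (l) : (schurMul (q' := 2) (one_add_one_eq_two).symm (freeBasis R G l)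
      (kappaZero h (contract h' ((freeBasis R G).coord l) m))).1 =
      kappa R G h (q := 1) (q' := 2) (one_add_one_eq_two).symm
        (contract h' ((freeBasis R G).coord l) m ⊗ₜ
          symMul (zero_add 1).symm (freeBasis R G l) ⟨1, one_mem_sym⟩) :=
    (LinearMap.congr_fun (kappa_comp_symMul h (zero_add 1).symm (zero_add 1).symm
      (one_add_one_eq_two).symm (one_add_one_eq_two).symm (freeBasis R G l))
      (contract h' ((freeBasis R G).coord l) m ⊗ₜ ⟨1, one_mem_sym⟩)).symm
  rw [Finset.sum_congr rfl fun l _ => h1 l, ← map_sum]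
  have h2 := LinearMap.congr_fun (kappa_comp_kappa (R := R) (G := G) h' (zero_add 1).symm h
    (one_add_one_eq_two).symm) (m ⊗ₜ ⟨1, one_mem_sym⟩)
  refine Eq.trans ?_ h2
  rw [LinearMap.comp_apply]
  congr 1
  rw [kappa, LinearMap.sum_apply]
  rfl

theorem kosMap_tmul {r r' p q q' : ℤ} (hr : r' = r + 1) (hq : q' = q + 1) (f : ext R F r)
    (k : schur R G p q) : kosMap Φ hr hq (f ⊗ₜ k) =
      ∑ l, wedge hr (Φ ((freeBasis R G).coord l)) f ⊗ₜ schurMul hq (freeBasis R G l) k := by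
  simp only [kosMap, LinearMap.sum_apply, TensorProduct.map_tmul]

set_option synthInstance.maxHeartbeats 200000 in
/-- The bilinear map used to evaluate `kosMap ∘ spliceOut`. -/
noncomputable def kosPair {r r' p s : ℤ} (h : r' = r + s) (ε : ℤ) (f : ext R F r)
    (v : G) {t : ℤ} (ht : t = p + 1) :
    ext R (Module.Dual R G) s →ₗ[R] ext R G t →ₗ[R] ext R F r' ⊗[R] schur R G p 2 :=
  ε • (TensorProduct.mk R _ _).compl₁₂ (extMul h f ∘ₗ extMap Φ s)
    (schurMul (q' := 2) (one_add_one_eq_two).symm v ∘ₗ kappaZero ht)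

theorem kosPair_wedgeLeft {r r' r'' p s s' : ℤ} (h : r' = r + s) (hr : r'' = r' + 1)
    (h' : r'' = r + s') (hs : s' = 1 + s) (ε : ℤ) (f : ext R F r) (v : G) (ht : s = p + 1)
    (c : Module.Dual R G) (x : ext R (Module.Dual R G) s) (y : ext R G s)
    (hε : x.1 * ExteriorAlgebra.ι R c = ε • (ExteriorAlgebra.ι R c * x.1)) :
    wedge hr (Φ c) (extMul h f (extMap Φ s x)) ⊗ₜ[R]
        schurMul (q' := 2) (one_add_one_eq_two).symm v (kappaZero ht y) =
      kosPair Φ h' ε f v ht (wedgeLeft hs c x) y := by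
  have e := congrArg (ExteriorAlgebra.map Φ) hε
  rw [map_mul, ExteriorAlgebra.map_apply_ι, map_zsmul] at e
  have e1 : wedge hr (Φ c) (extMul h f (extMap Φ s x)) =
      ε • extMul h' f (extMap Φ s' (wedgeLeft hs c x)) := by
    refine Subtype.ext ?_
    refine (mul_assoc f.1 (ExteriorAlgebra.map Φ x.1) (ExteriorAlgebra.ι R (Φ c))).trans ?_
    rw [e, mul_smul_comm]
    rfl
  rw [e1, ← TensorProduct.smul_tmul']
  rfl

theorem sum_kosPair {r r' p s s' : ℤ} (h : r' = r + s') (ht : s = p + 1) (hs : s' = s + 1) (ε : ℤ)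
    (f : ext R F r) (x : ext R (Module.Dual R G) s') (y : ext R G s') :
    ∑ l, kosPair Φ h ε f (freeBasis R G l) ht x (contract hs ((freeBasis R G).coord l) y) = 0 := by
  have h1 (l) : kosPair Φ h ε f (freeBasis R G l) ht x (contract hs ((freeBasis R G).coord l) y) =
      ε • (extMul h f (extMap Φ s' x) ⊗ₜ schurMul (q' := 2) (one_add_one_eq_two).symm
        (freeBasis R G l) (kappaZero ht (contract hs ((freeBasis R G).coord l) y))) := rfl
  rw [Finset.sum_congr rfl fun l _ => h1 l, ← Finset.smul_sum, ← TensorProduct.tmul_sum,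
    sum_schurMul_kappaZero, TensorProduct.tmul_zero, smul_zero]

theorem sum_kosPair_wedgeLeft {r r' p : ℤ} (h : r' = r + (p + 1 + 1)) (hs : p + 1 + 1 = 1 + (p + 1))
    (ε : ℤ) (f : ext R F r) :
    ∑ S : {S : Finset (Fin _) // (S.card : ℤ) = p + 1}, ∑ l,
      kosPair Φ h ε f (freeBasis R G l) rfl
        (wedgeLeft hs ((freeBasis R G).coord l) (wedgeProd (freeBasis R G).coord S))
        (wedgeProd (freeBasis R G) S) = 0 := by
  have h3 (l) := sum_wedge_contract (V := Module.Dual R G) (W := G)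
    (X := ext R F r' ⊗[R] schur R G p 2) hs rfl (kosPair (p := p) Φ h ε f (freeBasis R G l) rfl)
    (freeBasis R G).coord (freeBasis R G) l ((freeBasis R G).coord l) fun k => by
      rw [Module.Basis.coord_apply, Module.Basis.repr_self, Finsupp.single_apply]
  rw [Finset.sum_comm, Finset.sum_congr rfl fun l _ => h3 l, Finset.sum_comm]
  exact Finset.sum_eq_zero fun T _ => sum_kosPair Φ h rfl rfl ε f _ _

theorem kosMap_comp_spliceOut {r r' r'' p : ℤ} (h : r' = r + (p + 1)) (hr : r'' = r' + 1) :
    kosMap Φ (q' := 2) hr (one_add_one_eq_two).symm ∘ₗ spliceOut (p := p) Φ h = 0 := by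
  refine LinearMap.ext fun f => ?_
  obtain ⟨ε, hε, hc⟩ := ι_mul_ext (R := R) (M := Module.Dual R G) (p + 1)
  have h' : r'' = r + (p + 1 + 1) := by rw [hr, h]; ring
  have hs : p + 1 + 1 = 1 + (p + 1) := by ring
  have h1 (S : {S : Finset (Fin _) // (S.card : ℤ) = p + 1}) (l) :=
    kosPair_wedgeLeft Φ h hr h' hs ε f
      (freeBasis R G l) rfl ((freeBasis R G).coord l) (wedgeProd (freeBasis R G).coord S)
      (wedgeProd (freeBasis R G) S) (by
        rw [hc _ _ (wedgeProd (freeBasis R G).coord S).2, smul_smul, hε, one_smul])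
  rw [LinearMap.comp_apply, spliceOut_apply, map_sum]
  simp only [kosMap_tmul]
  exact (Finset.sum_congr rfl fun S _ => Finset.sum_congr rfl fun l _ => h1 S l).trans
    (sum_kosPair_wedgeLeft Φ h' hs ε f)

end Hooks

section Complex


variable {R : Type u} [CommRing R] {F G : Type u} [AddCommGroup F] [Module R F]
  [AddCommGroup G] [Module R G] [Module.Free R G] [Module.Finite R G]
  (Φ : Module.Dual R G →ₗ[R] F)

/-- The modules of the complex `C^{i,a}_Φ`. The module in homological degree `i + 1 + m` is
`⋀^{f-g+a-i-1} F` if `m = 0`, it is `⋀^{f-g+1-j} F ⊗ K^a_{j-i-2}(G^*)` with `j = i + 1 + m` if `m`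
is positive, and it is `⋀^{f-j} F ⊗ L^{g-a}_{i+1-j} G` with `j = i + 1 + m` if `m` is negative.
Here `f` is the rank of `F` and `g` is the rank of `G`. -/
noncomputable def hookX (R : Type u) [CommRing R] (F G : Type u) [AddCommGroup F] [Module R F]
    [AddCommGroup G] [Module R G] [Module.Free R G] [Module.Finite R G] (i a : ℤ) :
    ℤ → ModuleCat.{u} R
  | Int.ofNat 0 => ModuleCat.of R
      (ext R F ((Module.finrank R F : ℤ) - Module.finrank R G + a - i - 1))
  | Int.ofNat (k + 1) => ModuleCat.of R
      (ext R F ((Module.finrank R F : ℤ) - Module.finrank R G - i - 1 - k) ⊗[R] weyl R G a k)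
  | Int.negSucc k => ModuleCat.of R
      (ext R F ((Module.finrank R F : ℤ) - i + k) ⊗[R]
        schur R G ((Module.finrank R G : ℤ) - a) (k + 1))

/-- The differentials of the complex `C^{i,a}_Φ`, from homological degree `i + 1 + (m + 1)` to
homological degree `i + 1 + m`. -/
noncomputable def hookD (i a : ℤ) : ∀ m : ℤ, hookX R F G i a (m + 1) ⟶ hookX R F G i a m
  | Int.ofNat 0 => ModuleCat.ofHom (spliceIn (r := (Module.finrank R F : ℤ) -
      Module.finrank R G - i - 1 - (0 : ℕ)) (p := a) Φ (by push_cast; ring))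
  | Int.ofNat (k + 1) => ModuleCat.ofHom (etaMap (r := (Module.finrank R F : ℤ) -
      Module.finrank R G - i - 1 - (k + 1 : ℕ)) (p := a) (q := (k + 1 : ℕ)) Φ
      (by push_cast; ring) (by push_cast; ring))
  | Int.negSucc 0 => ModuleCat.ofHom (spliceOut (p := (Module.finrank R G : ℤ) - a) Φ
      (by push_cast; ring))
  | Int.negSucc (k + 1) => ModuleCat.ofHom (kosMap (r := (Module.finrank R F : ℤ) - i + k)
      (p := (Module.finrank R G : ℤ) - a) (q := (k : ℤ) + 1) Φ
      (by push_cast; ring) (by push_cast; ring))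

theorem hookD_comp (i a m : ℤ) : hookD Φ i a (m + 1) ≫ hookD Φ i a m = 0 := by
  rcases m with (_ | k) | (_ | _ | k)
  · refine ModuleCat.hom_ext ?_
    exact spliceIn_comp_etaMap (p := a) Φ _ _
  · refine ModuleCat.hom_ext ?_
    exact etaMap_comp_etaMap (p := a) Φ _ _ _ _
  · refine ModuleCat.hom_ext ?_
    exact spliceOut_comp_spliceIn (p := (Module.finrank R G : ℤ) - a) (a := a) Φ _ _ (by linarith)
  · refine ModuleCat.hom_ext ?_
    exact kosMap_comp_spliceOut (p := (Module.finrank R G : ℤ) - a) Φ _ _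
  · refine ModuleCat.hom_ext ?_
    exact kosMap_comp_kosMap (p := (Module.finrank R G : ℤ) - a) Φ _ _ _ _

/-- The complex `C^{i,a}_Φ`, in homological degrees starting at `i + 1`: its term in degree `m` is
the term of `C^{i,a}_Φ` in homological degree `i + 1 + m`. -/
noncomputable def hookComplexShifted (i a : ℤ) : ChainComplex (ModuleCat.{u} R) ℤ :=
  ChainComplex.of (hookX R F G i a) (hookD Φ i a) (hookD_comp Φ i a)

/-- The complex `C^{i,a}_Φ`. -/
noncomputable def hookComplex (i a : ℤ) : ChainComplex (ModuleCat.{u} R) ℤ where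
  X j := (hookComplexShifted Φ i a).X (j - i - 1)
  d j j' := (hookComplexShifted Φ i a).d (j - i - 1) (j' - i - 1)
  shape j j' h := (hookComplexShifted Φ i a).shape _ _ fun h' => h (by
    simp only [ComplexShape.down_Rel] at h' ⊢
    omega)
  d_comp_d' _ _ _ _ _ := (hookComplexShifted Φ i a).d_comp_d _ _ _

/-- The binomial coefficient `n` over `k` for an integer `k`, which is zero for negative `k`. -/
def intChoose (n : ℕ) : ℤ → ℕ
  | Int.ofNat k => n.choose k
  | Int.negSucc _ => 0

end Complex

section Conclusions


variable {R : Type u} [CommRing R]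

/-- The complex `C` is split exact: its identity map is null-homotopic. -/
def SplitExact (C : ChainComplex (ModuleCat.{u} R) ℤ) : Prop :=
  Nonempty (Homotopy (𝟙 C) 0)

/-- The only homology of the complex `C` is in degree zero, and it is isomorphic to `M` there. -/
def Resolves (C : ChainComplex (ModuleCat.{u} R) ℤ) (M : Type u) [AddCommGroup M] [Module R M] :
    Prop :=
  (∀ j : ℤ, j ≠ 0 → Subsingleton (C.homology j)) ∧ Nonempty (C.homology 0 ≃ₗ[R] M)

/-- The block diagonal map from `(G' × G'')^*`, which is the
direct sum of the duals of `G'` and `G''`, to `F' × F''`. -/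
def blockDiag {F' F'' G' G'' : Type*} [AddCommGroup F'] [Module R F'] [AddCommGroup F'']
    [Module R F''] [AddCommGroup G'] [Module R G'] [AddCommGroup G''] [Module R G'']
    (Φ' : Module.Dual R G' →ₗ[R] F') (Φ'' : Module.Dual R G'' →ₗ[R] F'') :
    Module.Dual R (G' × G'') →ₗ[R] F' × F'' :=
  Φ'.prodMap Φ'' ∘ₗ (Module.dualProdDualEquivDual R G' G'').symm.toLinearMap

end Conclusions

section Ideals

variable {R : Type*} [CommRing R]

/-- The ideal `I_k(φ)` generated by the `k × k` minors of a matrix of a homomorphism `φ` of finite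
free modules; it does not depend on the bases. -/
noncomputable def minors {M N : Type*} [AddCommGroup M] [Module R M] [Module.Free R M]
    [Module.Finite R M] [AddCommGroup N] [Module R N] [Module.Free R N] [Module.Finite R N]
    (k : ℕ) (φ : M →ₗ[R] N) : Ideal R :=
  Ideal.span (Set.range fun p : (Fin k → Fin _) × (Fin k → Fin _) =>
    ((LinearMap.toMatrix (freeBasis R M) (freeBasis R N) φ).submatrix p.1 p.2).det)

open Classical in
/-- The grade of an ideal of a Noetherian ring: the supremum of the lengths of the regular
sequences in the ideal if the ideal is proper, and `∞` otherwise. -/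
noncomputable def grade (I : Ideal R) : ℕ∞ :=
  if I = ⊤ then ⊤ else
    ⨆ (s : List R) (_ : RingTheory.Sequence.IsRegular R s ∧ ∀ x ∈ s, x ∈ I), (s.length : ℕ∞)

end Ideals

end HookComplex

open DirectSum

/-!
# The homology of the complexes `C^{i,a}_Φ` after splitting off an isomorphism

The idea is to split off the isomorphism one rank at a time. Let `G = G₁ ⊕ R e` and
`F = F₁ ⊕ R u`, and let `Φ` be the direct sum of `Φ₁ : G₁^* → F₁` and the map that takes the dual
vector `ε` of `e` to `u` (`IsSplit`). Each term of `C^{i,a}_Φ` decomposes into pieces built from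
`F₁` and `G₁`, and one component of the differential is, up to sign, multiplication by `e` on hook
Schur modules, or the action of `e` on hook Weyl modules. The former is injective, and its cokernel
on `L^p_q G` is `L^p_q G₁ ⊕ L^{p-1}_q G₁`; the latter is surjective, and its kernel on `K^a_q(G^*)`
is `K^a_q(G₁^*) ⊕ K^{a-1}_q(G₁^*)`. These facts (`exists_schurProj_eq`, `exists_schurMul_eq`,
`exists_weylInc_eq`, `weylAct_surjective`) follow from the exactness of the Koszul complexes
(`kappa_exact`, `eta_exact`), which is proved by dividing by one basis vector after the other.
Cancelling the acyclic part shows that the homology of `C^{i,a}_Φ` is the sum of the homology of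
`C^{i,a}_{Φ₁}` and of `C^{i,a-1}_{Φ₁}` (`IsSplit.hookHomology_equiv_prod`), where the complexes for
`a = 0` are acyclic (`subsingleton_hookHomology_zero`). This recursion is Pascal's rule, and its
solution is a direct sum with binomial multiplicities (`blockDiag_homology_equiv`).

The homology is compared in each degree by explicit maps between the modules of cycles. The ranks
and degrees are integers, so equalities between them are carried as hypotheses such as
`r' = r + 1`, in order that no term has to be transported along an equality of degrees.

If `G'` has rank one with generator `v`, then all hook modules with `a = 1` are free of rank one,
and `C^{i,1}_{Φ'}` is the Koszul complex of the vector `φ ∈ F'` which is the image of the dual generator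
(`hookHomology_equiv_koszulHomology`). Its maximal minors, and those of `Φ`, generate the ideal `I`
of the coordinates of `φ` (`minors_blockDiag`). If `I` is the unit ideal, contraction with a linear
form that takes the value `1` at `φ` is a contraction of the Koszul complex; if `I` contains a
regular sequence of length the rank of `F'`, an induction on the sequence shows that the Koszul
complex is acyclic outside its last term (`exists_rTensor_wedge_eq`), where its homology is `R / I`.
Finally, the terms of `C^{i,a}_Φ` are projective, by dimension shifting along the Koszul complexes
(`projective_schur`, `projective_weyl`), so that acyclic complexes `C^{i,a}_Φ` are split exact
(`splitExact_of_projective`).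
-/

namespace HookComplex

/-! ### Functoriality and division in symmetric and divided powers -/

section Symmetric

variable {R : Type*} [CommRing R] {M N L : Type*} [AddCommGroup M] [Module R M]
  [AddCommGroup N] [Module R N] [AddCommGroup L] [Module R L]

/-- The algebra map `Sym M → Sym N` induced by a linear map `M → N`. -/
noncomputable def symAlgMap (f : M →ₗ[R] N) : SymmetricAlgebra R M →ₐ[R] SymmetricAlgebra R N :=
  SymmetricAlgebra.lift (SymmetricAlgebra.ι R N ∘ₗ f)

theorem symAlgMap_ι (f : M →ₗ[R] N) (v : M) :
    symAlgMap f (SymmetricAlgebra.ι R M v) = SymmetricAlgebra.ι R N (f v) := by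
  simp [symAlgMap]

theorem symAlgMap_comp (f : M →ₗ[R] N) (g : N →ₗ[R] L) (s : SymmetricAlgebra R M) :
    symAlgMap g (symAlgMap f s) = symAlgMap (g ∘ₗ f) s := by
  have : (symAlgMap g).comp (symAlgMap f) = symAlgMap (g ∘ₗ f) :=
    SymmetricAlgebra.algHom_ext (LinearMap.ext fun v => by simp [symAlgMap_ι])
  exact DFunLike.congr_fun this s

theorem symAlgMap_id (s : SymmetricAlgebra R M) : symAlgMap LinearMap.id s = s := by
  have : symAlgMap (LinearMap.id : M →ₗ[R] M) = AlgHom.id R _ :=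
    SymmetricAlgebra.algHom_ext (LinearMap.ext fun v => by simp [symAlgMap_ι])
  exact DFunLike.congr_fun this s

/-- Induction principle for the elements of a symmetric power. -/
theorem sym_induction {C : ℤ → SymmetricAlgebra R M → Prop}
    (h0 : ∀ c : R, C 0 (algebraMap R _ c)) (hneg : ∀ q, q < 0 → C q 0)
    (hadd : ∀ q s t, C q s → C q t → C q (s + t))
    (hmul : ∀ q v s, 0 ≤ q → s ∈ sym R M q → C q s → C (q + 1) (SymmetricAlgebra.ι R M v * s))
    {q : ℤ} {s : SymmetricAlgebra R M} (hs : s ∈ sym R M q) : C q s := by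
  rcases q with n | n
  · change s ∈ _ ^ n at hs
    induction n generalizing s with
    | zero =>
      rw [pow_zero] at hs
      obtain ⟨c, rfl⟩ := Submodule.mem_one.1 hs
      exact h0 c
    | succ n ih =>
      rw [pow_succ'] at hs
      refine Submodule.mul_induction_on hs ?_ fun x y hx hy => hadd _ x y hx hy
      rintro _ ⟨v, rfl⟩ y hy
      exact hmul n v y (by positivity) hy (ih hy)
  · have hs0 : s = 0 := hs
    rw [hs0]
    exact hneg _ (Int.negSucc_lt_zero n)

theorem algebraMap_mem_sym (c : R) : algebraMap R (SymmetricAlgebra R M) c ∈ sym R M 0 := by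
  rw [Algebra.algebraMap_eq_smul_one]
  exact Submodule.smul_mem _ _ one_mem_sym

theorem symAlgMap_mem (f : M →ₗ[R] N) {q : ℤ} {s : SymmetricAlgebra R M} (hs : s ∈ sym R M q) :
    symAlgMap f s ∈ sym R N q := by
  refine sym_induction (C := fun q s => symAlgMap f s ∈ sym R N q) ?_ ?_ ?_ ?_ hs
  · intro c
    rw [AlgHom.commutes]
    exact algebraMap_mem_sym c
  · intro q _
    rw [map_zero]
    exact Submodule.zero_mem _
  · intro q s t hs ht
    rw [map_add]
    exact Submodule.add_mem _ hs ht
  · intro q v s _ _ hs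
    rw [map_mul, symAlgMap_ι]
    exact sym_mul_mem rfl _ hs

/-- The map `Sym_q M → Sym_q N` induced by a linear map `M → N`. -/
noncomputable def symMap (f : M →ₗ[R] N) (q : ℤ) : sym R M q →ₗ[R] sym R N q :=
  (symAlgMap f).toLinearMap.restrict fun _ hs => symAlgMap_mem f hs

/-- The map `D_q(N^*) → D_q(M^*)` induced by a linear map `M → N`. -/
noncomputable def divMap (f : M →ₗ[R] N) (q : ℤ) : divPow R N q →ₗ[R] divPow R M q :=
  LinearMap.dualMap (symMap f q)

theorem symMap_comp (f : M →ₗ[R] N) (g : N →ₗ[R] L) (q : ℤ) :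
    symMap g q ∘ₗ symMap f q = symMap (g ∘ₗ f) q :=
  LinearMap.ext fun s => Subtype.ext (symAlgMap_comp f g s.1)

theorem symMap_id (q : ℤ) : symMap (LinearMap.id : M →ₗ[R] M) q = LinearMap.id :=
  LinearMap.ext fun s => Subtype.ext (symAlgMap_id s.1)

theorem divMap_comp (f : M →ₗ[R] N) (g : N →ₗ[R] L) (q : ℤ) :
    divMap f q ∘ₗ divMap g q = divMap (g ∘ₗ f) q := by
  rw [divMap, divMap, divMap, ← symMap_comp]
  rfl

theorem divMap_id (q : ℤ) : divMap (LinearMap.id : M →ₗ[R] M) q = LinearMap.id := by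
  rw [divMap, symMap_id]
  rfl

theorem symMap_symMul (f : M →ₗ[R] N) {q q' : ℤ} (h : q' = q + 1) (v : M) :
    symMap f q' ∘ₗ symMul h v = symMul h (f v) ∘ₗ symMap f q := by
  refine LinearMap.ext fun s => Subtype.ext ?_
  change symAlgMap f (SymmetricAlgebra.ι R M v * s.1) = SymmetricAlgebra.ι R N
    (f v) * symAlgMap f s.1
  rw [map_mul, symAlgMap_ι]

theorem divMap_divAct (f : M →ₗ[R] N) {q q' : ℤ} (h : q = q' + 1) (v : M) :
    divAct h v ∘ₗ divMap f q = divMap f q' ∘ₗ divAct h (f v) := by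
  have := congrArg LinearMap.dualMap (symMap_symMul f h v)
  exact this

/-- A symmetric power of the zero map is zero in nonzero degrees. -/
theorem symMap_zero {q : ℤ} (hq : q ≠ 0) : symMap (0 : M →ₗ[R] N) q = 0 := by
  refine LinearMap.ext fun s => Subtype.ext ?_
  refine sym_induction (C := fun q s => q ≠ 0 → symAlgMap (0 : M →ₗ[R] N) s = 0)
    ?_ ?_ ?_ ?_ s.2 hq
  · exact fun c h => absurd rfl h
  · exact fun q _ _ => map_zero _
  · intro q s t hs ht h
    rw [map_add, hs h, ht h, add_zero]
  · intro q v s _ _ _ _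
    rw [map_mul, symAlgMap_ι, LinearMap.zero_apply, map_zero, zero_mul]

theorem divMap_zero {q : ℤ} (hq : q ≠ 0) : divMap (0 : M →ₗ[R] N) q = 0 := by
  rw [divMap, symMap_zero hq]
  exact LinearMap.ext fun φ => LinearMap.ext fun s => map_zero (M := sym R N q) φ

/-- The multiplication `M × Sym_q M → Sym_{q+1} M`. -/
def symMulHom {q q' : ℤ} (h : q' = q + 1) : M →ₗ[R] sym R M q →ₗ[R] sym R M q' where
  toFun := symMul h
  map_add' v w := LinearMap.ext fun s => Subtype.ext (by
    change SymmetricAlgebra.ι R M (v + w) * s.1 =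
      SymmetricAlgebra.ι R M v * s.1 + SymmetricAlgebra.ι R M w * s.1
    rw [map_add, add_mul])
  map_smul' c v := LinearMap.ext fun s => Subtype.ext (by
    change SymmetricAlgebra.ι R M (c • v) * s.1 = c • (SymmetricAlgebra.ι R M v * s.1)
    rw [map_smul, smul_mul_assoc])

/-- The action `M × D_q(M^*) → D_{q-1}(M^*)`. -/
def divActHom {q q' : ℤ} (h : q = q' + 1) : M →ₗ[R] divPow R M q →ₗ[R] divPow R M q' where
  toFun := divAct h
  map_add' v w := by
    have := congrArg LinearMap.dualMap ((symMulHom (R := R) (M := M) h).map_add v w)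
    exact this.trans (LinearMap.ext fun φ => LinearMap.ext fun s => map_add φ _ _)
  map_smul' c v := by
    have := congrArg LinearMap.dualMap ((symMulHom (R := R) (M := M) h).map_smul c v)
    exact this.trans (LinearMap.ext fun φ => LinearMap.ext fun s => map_smul φ _ _)

/-- The projection of `M` along `e`, `v ↦ v - ε(v) e`. -/
def alongProj (e : M) (ε : Module.Dual R M) : M →ₗ[R] M := LinearMap.id - ε.smulRight e

theorem alongProj_apply (e : M) (ε : Module.Dual R M) (v : M) :
    alongProj e ε v = v - ε v • e := rfl

/-- The algebra map `Sym M → (Sym M)[X]` which sends `v` to `v - ε(v) e + ε(v) X`: it writes an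
element of the symmetric algebra as a polynomial in `e`. -/
noncomputable def symExpand (e : M) (ε : Module.Dual R M) :
    SymmetricAlgebra R M →ₐ[R] Polynomial (SymmetricAlgebra R M) :=
  SymmetricAlgebra.lift
    ((Polynomial.CAlgHom (R := R)).toLinearMap ∘ₗ SymmetricAlgebra.ι R M ∘ₗ alongProj e ε +
      ε.smulRight Polynomial.X)

theorem symExpand_ι (e : M) (ε : Module.Dual R M) (v : M) :
    symExpand e ε (SymmetricAlgebra.ι R M v) =
      Polynomial.C (SymmetricAlgebra.ι R M (alongProj e ε v)) + ε v • Polynomial.X := by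
  simp [symExpand]

theorem eval_symExpand (e : M) (ε : Module.Dual R M) (s : SymmetricAlgebra R M) :
    (symExpand e ε s).eval (SymmetricAlgebra.ι R M e) = s := by
  have : ((Polynomial.aeval (R := SymmetricAlgebra R M)
      (SymmetricAlgebra.ι R M e)).restrictScalars R).comp (symExpand e ε) = AlgHom.id R _ := by
    refine SymmetricAlgebra.algHom_ext (LinearMap.ext fun v => ?_)
    simp [symExpand_ι, alongProj_apply]
  have := DFunLike.congr_fun this s
  simpa [Polynomial.coe_aeval_eq_eval] using this

theorem coeff_symExpand (e : M) (ε : Module.Dual R M) (s : SymmetricAlgebra R M) :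
    (symExpand e ε s).coeff 0 = symAlgMap (alongProj e ε) s := by
  have : ((Polynomial.aeval (R := SymmetricAlgebra R M)
      (0 : SymmetricAlgebra R M)).restrictScalars R).comp (symExpand e ε) =
        symAlgMap (alongProj e ε) := by
    refine SymmetricAlgebra.algHom_ext (LinearMap.ext fun v => ?_)
    simp [symExpand_ι, symAlgMap_ι]
  rw [Polynomial.coeff_zero_eq_aeval_zero, ← this]
  rfl

/-- The quotient of the division by `e` in the symmetric algebra of `M = ker ε ⊕ R e`. -/
noncomputable def symAlgQuot (e : M) (ε : Module.Dual R M) :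
    SymmetricAlgebra R M →ₗ[R] SymmetricAlgebra R M where
  toFun s := (symExpand e ε s).divX.eval (SymmetricAlgebra.ι R M e)
  map_add' s t := by rw [map_add, Polynomial.divX_add, Polynomial.eval_add]
  map_smul' c s := by
    have h : (c • symExpand e ε s).divX = c • (symExpand e ε s).divX := by
      ext n
      simp [Polynomial.coeff_divX]
    rw [map_smul, h, RingHom.id_apply, Polynomial.eval_smul]

theorem mul_symAlgQuot (e : M) (ε : Module.Dual R M) (s : SymmetricAlgebra R M) :
    SymmetricAlgebra.ι R M e * symAlgQuot e ε s + symAlgMap (alongProj e ε) s = s := by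
  have h := congrArg (Polynomial.eval (SymmetricAlgebra.ι R M e))
    (Polynomial.divX_mul_X_add (symExpand e ε s))
  rw [eval_symExpand, Polynomial.eval_add, Polynomial.eval_mul, Polynomial.eval_X,
    Polynomial.eval_C, coeff_symExpand] at h
  rw [mul_comm]
  exact h

theorem symAlgQuot_ι_mul (e : M) (ε : Module.Dual R M) (v : M) (s : SymmetricAlgebra R M) :
    symAlgQuot e ε (SymmetricAlgebra.ι R M v * s) =
      SymmetricAlgebra.ι R M v * symAlgQuot e ε s + ε v • symAlgMap (alongProj e ε) s := by
  have h : (symExpand e ε (SymmetricAlgebra.ι R M v * s)).divX =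
      Polynomial.C (SymmetricAlgebra.ι R M (alongProj e ε v)) * (symExpand e ε s).divX +
        ε v • symExpand e ε s := by
    rw [map_mul, symExpand_ι, add_mul, Polynomial.divX_add, Polynomial.divX_C_mul]
    congr 1
    ext n
    simp [Polynomial.coeff_divX]
  change (Polynomial.divX _).eval _ = _
  rw [h, Polynomial.eval_add, Polynomial.eval_C_mul, Polynomial.eval_smul, eval_symExpand]
  change _ * symAlgQuot e ε s + _ = _
  conv_lhs => rw [← mul_symAlgQuot e ε s]
  have h2 : symAlgQuot e ε (SymmetricAlgebra.ι R M e * symAlgQuot e ε s +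
    symAlgMap (alongProj e ε) s) = symAlgQuot e ε s := by rw [mul_symAlgQuot e ε s]
  rw [h2, alongProj_apply, map_sub, map_smul, sub_mul, smul_add, smul_mul_assoc]
  abel

theorem symAlgQuot_mem (e : M) (ε : Module.Dual R M) {q q' : ℤ} (h : q' = q + 1)
    {s : SymmetricAlgebra R M} (hs : s ∈ sym R M q') : symAlgQuot e ε s ∈ sym R M q := by
  obtain rfl : q = q' - 1 := by omega
  refine sym_induction (C := fun q' s => symAlgQuot e ε s ∈ sym R M (q' - 1)) ?_ ?_ ?_ ?_ hs
  · intro c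
    have : symAlgQuot e ε (algebraMap R (SymmetricAlgebra R M) c) = 0 := by
      change (Polynomial.divX _).eval _ = 0
      rw [AlgHom.commutes, Polynomial.algebraMap_apply, Polynomial.divX_C, Polynomial.eval_zero]
    rw [this]
    exact Submodule.zero_mem _
  · intro q _
    rw [map_zero]
    exact Submodule.zero_mem _
  · intro q s t hs ht
    rw [map_add]
    exact Submodule.add_mem _ hs ht
  · intro q v s _ hs hs'
    rw [symAlgQuot_ι_mul, add_sub_cancel_right]
    exact Submodule.add_mem _ (sym_mul_mem (by ring) v hs')
      (Submodule.smul_mem _ _ (symAlgMap_mem _ hs))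

/-- The quotient of the division by `e`, from `Sym_{q+1} M` to `Sym_q M`. -/
noncomputable def symQuot (e : M) (ε : Module.Dual R M) {q q' : ℤ} (h : q' = q + 1) :
    sym R M q' →ₗ[R] sym R M q :=
  (symAlgQuot e ε).restrict fun _ hs => symAlgQuot_mem e ε h hs

theorem symMul_symQuot (e : M) (ε : Module.Dual R M) {q q' : ℤ} (h : q' = q + 1) :
    symMul h e ∘ₗ symQuot e ε h + symMap (alongProj e ε) q' = LinearMap.id :=
  LinearMap.ext fun s => Subtype.ext (mul_symAlgQuot e ε s.1)

theorem symQuot_symMul (e : M) (ε : Module.Dual R M) {q q' q'' : ℤ} (h : q' = q + 1)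
    (h' : q'' = q' + 1) (v : M) : symQuot e ε h' ∘ₗ symMul h' v =
      symMul h v ∘ₗ symQuot e ε h + ε v • symMap (alongProj e ε) q' :=
  LinearMap.ext fun s => Subtype.ext (symAlgQuot_ι_mul e ε v s.1)

theorem symQuot_symMul_self (e : M) (ε : Module.Dual R M) (he : ε e = 1) {q q' : ℤ}
    (h : q' = q + 1) : symQuot e ε h ∘ₗ symMul h e = LinearMap.id := by
  rw [symQuot_symMul e ε (q := q - 1) (by ring), he, one_smul, symMul_symQuot]

/-- The map `D_{q-1}(M^*) → D_q(M^*)` dual to the division by `e`. -/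
noncomputable def divLift (e : M) (ε : Module.Dual R M) {q q' : ℤ} (h : q = q' + 1) :
    divPow R M q' →ₗ[R] divPow R M q :=
  LinearMap.dualMap (symQuot e ε h)

theorem divAct_divLift (e : M) (ε : Module.Dual R M) (he : ε e = 1) {q q' : ℤ}
    (h : q = q' + 1) : divAct h e ∘ₗ divLift e ε h = LinearMap.id := by
  have := congrArg LinearMap.dualMap (symQuot_symMul_self e ε he h)
  exact this

theorem divLift_divAct (e : M) (ε : Module.Dual R M) {q q' : ℤ} (h : q = q' + 1) :
    divLift e ε h ∘ₗ divAct h e + divMap (alongProj e ε) q = LinearMap.id := by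
  refine LinearMap.ext fun (φ : Module.Dual R (sym R M q)) => LinearMap.ext fun s => ?_
  have := congrArg φ (LinearMap.congr_fun (symMul_symQuot e ε h) s)
  rw [LinearMap.add_apply, map_add] at this
  exact this

theorem divAct_divLift_comm (e : M) (ε : Module.Dual R M) {q q' q'' : ℤ} (h : q' = q + 1)
    (h' : q'' = q' + 1) (v : M) : divAct h' v ∘ₗ divLift e ε h' =
      divLift e ε h ∘ₗ divAct h v + ε v • divMap (alongProj e ε) q' := by
  refine LinearMap.ext fun (φ : Module.Dual R (sym R M q')) => LinearMap.ext fun s => ?_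
  have := congrArg φ (LinearMap.congr_fun (symQuot_symMul e ε h h' v) s)
  rw [LinearMap.add_apply, map_add, LinearMap.smul_apply, map_smul] at this
  exact this

end Symmetric

/-! ### Exterior powers of a module with a rank one summand split off -/

section Exterior

variable {R : Type*} [CommRing R] {M N L : Type*} [AddCommGroup M] [Module R M]
  [AddCommGroup N] [Module R N] [AddCommGroup L] [Module R L]

/-- Induction principle for the elements of an exterior power. -/
theorem ext_induction {C : ℤ → ExteriorAlgebra R M → Prop}
    (h0 : ∀ c : R, C 0 (algebraMap R _ c)) (hneg : ∀ q, q < 0 → C q 0)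
    (hadd : ∀ q x y, C q x → C q y → C q (x + y))
    (hmul : ∀ q v x, 0 ≤ q → x ∈ ext R M q → C q x → C (q + 1) (ExteriorAlgebra.ι R v * x))
    {q : ℤ} {x : ExteriorAlgebra R M} (hx : x ∈ ext R M q) : C q x := by
  rcases q with n | n
  · change x ∈ _ ^ n at hx
    induction n generalizing x with
    | zero =>
      rw [pow_zero] at hx
      obtain ⟨c, rfl⟩ := Submodule.mem_one.1 hx
      exact h0 c
    | succ n ih =>
      rw [pow_succ'] at hx
      refine Submodule.mul_induction_on hx ?_ fun x y hx hy => hadd _ x y hx hy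
      rintro _ ⟨v, rfl⟩ y hy
      exact hmul n v y (by positivity) hy (ih hy)
  · have hx0 : x = 0 := hx
    rw [hx0]
    exact hneg _ (Int.negSucc_lt_zero n)

/-- The sign `(-1)^q` as an integer. -/
def sgn (q : ℤ) : ℤ := q.negOnePow

theorem sgn_succ (q : ℤ) : sgn (q + 1) = -sgn q := by
  rw [sgn, Int.negOnePow_succ, Units.val_neg, sgn]

theorem sgn_mul_self (q : ℤ) : sgn q * sgn q = 1 := Int.units_coe_mul_self _

theorem sgn_smul_sgn_smul (q : ℤ) {A : Type*} [AddCommGroup A] (x : A) : sgn q • sgn q • x = x := by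
  rw [smul_smul, sgn_mul_self, one_smul]

theorem ι_mul_eq_sgn_smul (v : M) {q : ℤ} {x : ExteriorAlgebra R M} (hx : x ∈ ext R M q) :
    ExteriorAlgebra.ι R v * x = sgn q • (x * ExteriorAlgebra.ι R v) := by
  refine ext_induction (C := fun q x => ExteriorAlgebra.ι R v * x =
    sgn q • (x * ExteriorAlgebra.ι R v)) ?_ ?_ ?_ ?_ hx
  · intro c
    rw [← Algebra.commutes]
    simp [sgn]
  · intro q _
    simp
  · intro q x y hx hy
    rw [mul_add, hx, hy, add_mul, smul_add]
  · intro q w x _ _ hx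
    rw [← mul_assoc, eq_neg_of_add_eq_zero_left (ExteriorAlgebra.ι_add_mul_swap v w),
      neg_mul, mul_assoc, hx, sgn_succ, neg_smul, mul_smul_comm, mul_assoc]

theorem contractLeft_ι_mul' (d : Module.Dual R M) (v : M) (x : ExteriorAlgebra R M) :
    CliffordAlgebra.contractLeft (Q := (0 : QuadraticForm R M)) d (ExteriorAlgebra.ι R v * x) =
      d v • x - ExteriorAlgebra.ι R v *
        CliffordAlgebra.contractLeft (Q := (0 : QuadraticForm R M)) d x :=
  CliffordAlgebra.contractLeft_ι_mul (Q := (0 : QuadraticForm R M)) (d := d) v x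

theorem contractLeft_algebraMap' (d : Module.Dual R M) (c : R) :
    CliffordAlgebra.contractLeft (Q := (0 : QuadraticForm R M)) d
      (algebraMap R (ExteriorAlgebra R M) c) = 0 :=
  CliffordAlgebra.contractLeft_algebraMap (Q := (0 : QuadraticForm R M)) d c

theorem contractLeft_mul_ι (d : Module.Dual R M) (v : M) {q : ℤ} {x : ExteriorAlgebra R M}
    (hx : x ∈ ext R M q) :
    CliffordAlgebra.contractLeft (Q := (0 : QuadraticForm R M)) d (x * ExteriorAlgebra.ι R v) =
      CliffordAlgebra.contractLeft (Q := (0 : QuadraticForm R M)) d x * ExteriorAlgebra.ι R v +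
        sgn q • d v • x := by
  refine ext_induction (C := fun q x => CliffordAlgebra.contractLeft (Q := (0 : QuadraticForm R M))
    d (x * ExteriorAlgebra.ι R v) = CliffordAlgebra.contractLeft
      (Q := (0 : QuadraticForm R M)) d x *
      ExteriorAlgebra.ι R v + sgn q • d v • x) ?_ ?_ ?_ ?_ hx
  · intro c
    have h := contractLeft_ι_mul' d v (algebraMap R (ExteriorAlgebra R M) c)
    rw [← Algebra.commutes, contractLeft_algebraMap', mul_zero, sub_zero] at h
    rw [h, contractLeft_algebraMap', zero_mul, zero_add]
    simp [sgn]
  · intro q _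
    simp
  · intro q x y hx hy
    rw [add_mul, map_add, hx, hy, map_add, add_mul, smul_add, smul_add]
    abel
  · intro q w x _ _ hx
    rw [mul_assoc, contractLeft_ι_mul', hx, contractLeft_ι_mul', sgn_succ, mul_add, sub_mul,
      neg_smul, mul_smul_comm, mul_smul_comm, smul_mul_assoc, mul_assoc]
    abel

theorem contractLeft_map (f : M →ₗ[R] N) (d : Module.Dual R N) (x : ExteriorAlgebra R M) :
    CliffordAlgebra.contractLeft (Q := (0 : QuadraticForm R N)) d (ExteriorAlgebra.map f x) =
      ExteriorAlgebra.map f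
        (CliffordAlgebra.contractLeft (Q := (0 : QuadraticForm R M)) (d ∘ₗ f) x) := by
  induction x using CliffordAlgebra.left_induction with
  | algebraMap c =>
    have h : ExteriorAlgebra.map f (algebraMap R (ExteriorAlgebra R M) c) =
      algebraMap R (ExteriorAlgebra R N) c := AlgHom.commutes _ _
    refine (congrArg _ h).trans ?_
    rw [contractLeft_algebraMap']
    refine Eq.symm ((congrArg _ (contractLeft_algebraMap' (d ∘ₗ f) c)).trans (map_zero _))
  | add x y hx hy => simp only [map_add, hx, hy]
  | ι_mul x v hx =>
    have h : ExteriorAlgebra.map f (ExteriorAlgebra.ι R v * x) =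
      ExteriorAlgebra.ι R (f v) * ExteriorAlgebra.map f x := by
      rw [map_mul, ExteriorAlgebra.map_apply_ι]
    refine (congrArg _ h).trans ?_
    rw [contractLeft_ι_mul', hx]
    refine Eq.symm ((congrArg _ (contractLeft_ι_mul' (d ∘ₗ f) v x)).trans ?_)
    rw [map_sub, map_mul, ExteriorAlgebra.map_apply_ι, map_smul]
    rfl

/-- In the exterior algebra of `M = ker ε ⊕ R e`, every element `x` is the sum of its projection
along `e` and of `e ∧ (ε ⌋ x)`. -/
theorem map_alongProj_add (e : M) (ε : Module.Dual R M) (x : ExteriorAlgebra R M) :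
    ExteriorAlgebra.map (alongProj e ε) x + ExteriorAlgebra.ι R e *
      CliffordAlgebra.contractLeft (Q := (0 : QuadraticForm R M)) ε x = x := by
  induction x using CliffordAlgebra.left_induction with
  | algebraMap c =>
    have h := contractLeft_algebraMap' ε c
    refine (congrArg (fun y => ExteriorAlgebra.map (alongProj e ε)
      (algebraMap R (ExteriorAlgebra R M) c) + ExteriorAlgebra.ι R e * y) h).trans ?_
    rw [mul_zero, add_zero]
    exact AlgHom.commutes _ _
  | add x y hx hy =>
    conv_rhs => rw [← hx, ← hy]
    rw [map_add, map_add, mul_add]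
    abel
  | ι_mul x v hx =>
    have h := contractLeft_ι_mul' ε v x
    refine (congrArg (fun y => ExteriorAlgebra.map (alongProj e ε)
      (ExteriorAlgebra.ι R v * x) + ExteriorAlgebra.ι R e * y) h).trans ?_
    have h1 : ExteriorAlgebra.map (alongProj e ε) x = x - ExteriorAlgebra.ι R e *
        CliffordAlgebra.contractLeft (Q := (0 : QuadraticForm R M)) ε x := eq_sub_of_add_eq hx
    rw [map_mul, ExteriorAlgebra.map_apply_ι, h1, alongProj_apply, map_sub, map_smul, sub_mul,
      mul_sub, mul_sub, mul_sub, smul_mul_assoc, smul_mul_assoc, mul_smul_comm,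
      ← mul_assoc (ExteriorAlgebra.ι R e) (ExteriorAlgebra.ι R e), ExteriorAlgebra.ι_sq_zero,
      zero_mul, smul_zero, ← mul_assoc, ← mul_assoc,
      eq_neg_of_add_eq_zero_left (ExteriorAlgebra.ι_add_mul_swap e v), neg_mul]
    change _ = ExteriorAlgebra.ι R v * x
    abel

theorem extMap_comp (f : M →ₗ[R] N) (g : N →ₗ[R] L) (r : ℤ) :
    extMap g r ∘ₗ extMap f r = extMap (g ∘ₗ f) r := by
  refine LinearMap.ext fun x => Subtype.ext ?_
  change ExteriorAlgebra.map g (ExteriorAlgebra.map f x.1) = ExteriorAlgebra.map (g ∘ₗ f) x.1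
  rw [← ExteriorAlgebra.map_comp_map]
  rfl

theorem extMap_id (r : ℤ) : extMap (LinearMap.id : M →ₗ[R] M) r = LinearMap.id := by
  refine LinearMap.ext fun x => Subtype.ext ?_
  change ExteriorAlgebra.map (LinearMap.id : M →ₗ[R] M) x.1 = x.1
  rw [ExteriorAlgebra.map_id]
  rfl

/-- An exterior power of the zero map is zero in nonzero degrees. -/
theorem extMap_zero {r : ℤ} (hr : r ≠ 0) : extMap (0 : M →ₗ[R] N) r = 0 := by
  refine LinearMap.ext fun x => Subtype.ext ?_
  refine ext_induction (C := fun r x => r ≠ 0 → ExteriorAlgebra.map (0 : M →ₗ[R] N) x = 0)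
    ?_ ?_ ?_ ?_ x.2 hr
  · exact fun c h => absurd rfl h
  · exact fun q _ _ => map_zero _
  · intro q s t hs ht h
    rw [map_add, hs h, ht h, add_zero]
  · intro q v s _ _ _ _
    rw [map_mul, ExteriorAlgebra.map_apply_ι, LinearMap.zero_apply, map_zero, zero_mul]

theorem extMap_wedge (f : M →ₗ[R] N) {r r' : ℤ} (h : r' = r + 1) (v : M) :
    extMap f r' ∘ₗ wedge h v = wedge h (f v) ∘ₗ extMap f r := by
  refine LinearMap.ext fun x => Subtype.ext ?_
  change ExteriorAlgebra.map f (x.1 * ExteriorAlgebra.ι R v) =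
    ExteriorAlgebra.map f x.1 * ExteriorAlgebra.ι R (f v)
  rw [map_mul, ExteriorAlgebra.map_apply_ι]

theorem extMap_wedgeLeft (f : M →ₗ[R] N) {r r' : ℤ} (h : r' = 1 + r) (v : M) :
    extMap f r' ∘ₗ wedgeLeft h v = wedgeLeft h (f v) ∘ₗ extMap f r := by
  refine LinearMap.ext fun x => Subtype.ext ?_
  change ExteriorAlgebra.map f (ExteriorAlgebra.ι R v * x.1) =
    ExteriorAlgebra.ι R (f v) * ExteriorAlgebra.map f x.1
  rw [map_mul, ExteriorAlgebra.map_apply_ι]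

theorem contract_extMap (f : M →ₗ[R] N) {r r' : ℤ} (h : r = r' + 1) (d : Module.Dual R N) :
    contract h d ∘ₗ extMap f r = extMap f r' ∘ₗ contract h (d ∘ₗ f) :=
  LinearMap.ext fun x => Subtype.ext (contractLeft_map f d x.1)

theorem contract_wedgeLeft {s s' t : ℤ} (h : s' = 1 + s) (h' : s' = s + 1) (k : s = t + 1)
    (k' : s = 1 + t) (d : Module.Dual R M) (v : M) :
    contract h' d ∘ₗ wedgeLeft h v + wedgeLeft k' v ∘ₗ contract k d =
      d v • (LinearMap.id : ext R M s →ₗ[R] ext R M s) := by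
  refine LinearMap.ext fun x => Subtype.ext ?_
  change CliffordAlgebra.contractLeft (Q := (0 : QuadraticForm R M)) d
    (ExteriorAlgebra.ι R v * x.1) + ExteriorAlgebra.ι R v *
      CliffordAlgebra.contractLeft (Q := (0 : QuadraticForm R M)) d x.1 = d v • x.1
  rw [contractLeft_ι_mul', sub_add_cancel]

theorem contract_wedge {s s' t : ℤ} (h' : s' = s + 1) (k : s = t + 1)
    (d : Module.Dual R M) (v : M) :
    contract h' d ∘ₗ wedge h' v = wedge k v ∘ₗ contract k d +
      sgn s • d v • (LinearMap.id : ext R M s →ₗ[R] ext R M s) :=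
  LinearMap.ext fun x => Subtype.ext (contractLeft_mul_ι d v x.2)

theorem wedge_wedgeLeft {s s' t t' : ℤ} (h : s' = s + 1) (h' : t' = t + 1) (k : t = 1 + s)
    (k' : t' = 1 + s') (v w : M) :
    wedge (R := R) h' v ∘ₗ wedgeLeft k w = wedgeLeft k' w ∘ₗ wedge h v :=
  LinearMap.ext fun _ => Subtype.ext (mul_assoc _ _ _)

theorem wedge_eq_wedgeLeft {s s' : ℤ} (h : s' = s + 1) (k : s' = 1 + s) (v : M) :
    wedge (R := R) h v = sgn s • wedgeLeft k v := by
  refine LinearMap.ext fun x => Subtype.ext ?_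
  change x.1 * ExteriorAlgebra.ι R v = sgn s • (ExteriorAlgebra.ι R v * x.1)
  rw [ι_mul_eq_sgn_smul v x.2, sgn_smul_sgn_smul]

theorem wedgeLeft_wedgeLeft_self {s s' s'' : ℤ} (h : s' = 1 + s) (h' : s'' = 1 + s') (v : M) :
    wedgeLeft (R := R) h' v ∘ₗ wedgeLeft h v = 0 := by
  refine LinearMap.ext fun x => Subtype.ext ?_
  change ExteriorAlgebra.ι R v * (ExteriorAlgebra.ι R v * x.1) = 0
  rw [← mul_assoc, ExteriorAlgebra.ι_sq_zero, zero_mul]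

theorem extMap_alongProj (e : M) (ε : Module.Dual R M) {s t : ℤ} (h : s = t + 1) (k : s = 1 + t) :
    extMap (alongProj e ε) s + wedgeLeft k e ∘ₗ contract h ε = LinearMap.id :=
  LinearMap.ext fun x => Subtype.ext (map_alongProj_add e ε x.1)

/-- The exterior multiplication by vectors, as a bilinear map. -/
def wedgeHom {r r' : ℤ} (h : r' = r + 1) : M →ₗ[R] ext R M r →ₗ[R] ext R M r' where
  toFun := wedge h
  map_add' v w := LinearMap.ext fun x => Subtype.ext (by
    change x.1 * ExteriorAlgebra.ι R (v + w) =
      x.1 * ExteriorAlgebra.ι R v + x.1 * ExteriorAlgebra.ι R w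
    rw [map_add, mul_add])
  map_smul' c v := LinearMap.ext fun x => Subtype.ext (by
    change x.1 * ExteriorAlgebra.ι R (c • v) = c • (x.1 * ExteriorAlgebra.ι R v)
    rw [map_smul, mul_smul_comm])

/-- The contraction by linear forms, as a bilinear map. -/
def contractHom {r r' : ℤ} (h : r = r' + 1) : Module.Dual R M →ₗ[R] ext R M r →ₗ[R] ext R M r' where
  toFun := contract h
  map_add' c d := LinearMap.ext fun x => Subtype.ext (by
    change CliffordAlgebra.contractLeft (Q := (0 : QuadraticForm R M)) (c + d) x.1 = _
    rw [map_add]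
    rfl)
  map_smul' a d := LinearMap.ext fun x => Subtype.ext (by
    change CliffordAlgebra.contractLeft (Q := (0 : QuadraticForm R M)) (a • d) x.1 = _
    rw [map_smul]
    rfl)

/-- A decomposition `M = M₁ ⊕ R e` with coordinate `ε : M → R` on the second summand. -/
structure SplitOff (R : Type*) [CommRing R] (M M₁ : Type*) [AddCommGroup M] [Module R M]
    [AddCommGroup M₁] [Module R M₁] where
  /-- The inclusion of the first summand. -/
  inc : M₁ →ₗ[R] M
  /-- The projection to the first summand. -/
  proj : M →ₗ[R] M₁
  /-- The generator of the second summand. -/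
  e : M
  /-- The coordinate on the second summand. -/
  ε : Module.Dual R M
  proj_inc : ∀ x, proj (inc x) = x
  ε_inc : ∀ x, ε (inc x) = 0
  proj_e : proj e = 0
  ε_e : ε e = 1
  decomp : ∀ x, inc (proj x) + ε x • e = x

namespace SplitOff

variable {M₁ : Type*} [AddCommGroup M₁] [Module R M₁] (σ : SplitOff R M M₁)

/-- The dual decomposition `M^* = M₁^* ⊕ R ε`. -/
def dual : SplitOff R (Module.Dual R M) (Module.Dual R M₁) where
  inc := σ.proj.dualMap
  proj := σ.inc.dualMap
  e := σ.ε
  ε := Module.Dual.eval R M σ.e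
  proj_inc c := LinearMap.ext fun x => congrArg c (σ.proj_inc x)
  ε_inc c := by
    change c (σ.proj σ.e) = 0
    rw [σ.proj_e, map_zero]
  proj_e := LinearMap.ext σ.ε_inc
  ε_e := σ.ε_e
  decomp c := LinearMap.ext fun x => by
    conv_rhs => rw [← σ.decomp x, map_add, map_smul]
    change c (σ.inc (σ.proj x)) + c σ.e * σ.ε x = _
    rw [smul_eq_mul, mul_comm]

theorem alongProj_eq : alongProj σ.e σ.ε = σ.inc ∘ₗ σ.proj :=
  LinearMap.ext fun x => by
    rw [alongProj_apply, LinearMap.comp_apply, eq_comm, eq_sub_iff_add_eq, σ.decomp]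

theorem proj_comp_inc : σ.proj ∘ₗ σ.inc = LinearMap.id := LinearMap.ext σ.proj_inc

theorem ε_comp_inc : σ.ε ∘ₗ σ.inc = 0 := LinearMap.ext σ.ε_inc

/-- The map `x ↦ e ∧ x` from `⋀ʳ M₁` to `⋀ʳ⁺¹ M`. -/
def extIncE {r r' : ℤ} (h : r' = r + 1) : ext R M₁ r →ₗ[R] ext R M r' :=
  wedgeLeft (h.trans (add_comm r 1)) σ.e ∘ₗ extMap σ.inc r

/-- The coefficient of `e`, from `⋀ʳ⁺¹ M` to `⋀ʳ M₁`. -/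
def extProjE {r r' : ℤ} (h : r' = r + 1) : ext R M r' →ₗ[R] ext R M₁ r :=
  extMap σ.proj r ∘ₗ contract h σ.ε

theorem extProj_extInc (r : ℤ) : extMap σ.proj r ∘ₗ extMap σ.inc r = LinearMap.id := by
  rw [extMap_comp, proj_comp_inc, extMap_id]

theorem extProj_extIncE {r r' : ℤ} (h : r' = r + 1) : extMap σ.proj r' ∘ₗ σ.extIncE h = 0 := by
  rw [extIncE, ← LinearMap.comp_assoc, extMap_wedgeLeft, σ.proj_e]
  refine LinearMap.ext fun x => Subtype.ext ?_
  change ExteriorAlgebra.ι R 0 * _ = 0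
  rw [map_zero, zero_mul]

theorem contract_zero {r r' : ℤ} (h : r = r' + 1) : contract h (0 : Module.Dual R M) = 0 :=
  (contractHom h).map_zero

theorem contract_extInc {r r' : ℤ} (h : r' = r + 1) : contract h σ.ε ∘ₗ extMap σ.inc r' = 0 := by
  rw [contract_extMap, ε_comp_inc, contract_zero, LinearMap.comp_zero]

theorem extProjE_extInc {r r' : ℤ} (h : r' = r + 1) : σ.extProjE h ∘ₗ extMap σ.inc r' = 0 := by
  rw [extProjE, LinearMap.comp_assoc, contract_extInc, LinearMap.comp_zero]

theorem contract_extIncE {r r' : ℤ} (h : r' = r + 1) :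
    contract h σ.ε ∘ₗ σ.extIncE h = extMap σ.inc r := by
  have h1 := contract_wedgeLeft (h.trans (add_comm r 1)) h (t := r - 1) (by ring) (by ring) σ.ε σ.e
  rw [σ.ε_e, one_smul] at h1
  have h2 : contract h σ.ε ∘ₗ wedgeLeft (h.trans (add_comm r 1)) σ.e = _ := eq_sub_of_add_eq h1
  rw [extIncE, ← LinearMap.comp_assoc, h2, LinearMap.sub_comp, LinearMap.comp_assoc,
    contract_extInc, LinearMap.comp_zero, LinearMap.id_comp]
  exact LinearMap.ext fun x => by rw [LinearMap.sub_apply, LinearMap.zero_apply, sub_zero]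

theorem extProjE_extIncE {r r' : ℤ} (h : r' = r + 1) :
    σ.extProjE h ∘ₗ σ.extIncE h = LinearMap.id := by
  rw [extProjE, LinearMap.comp_assoc, contract_extIncE, extProj_extInc]

theorem ext_decomp {r r' : ℤ} (h : r' = r + 1) :
    extMap σ.inc r' ∘ₗ extMap σ.proj r' + σ.extIncE h ∘ₗ σ.extProjE h = LinearMap.id := by
  have h1 := extMap_alongProj σ.e σ.ε h (h.trans (add_comm r 1))
  have h2 := extMap_alongProj σ.e σ.ε (s := r) (t := r - 1) (by ring) (by ring)
  have h3 : extMap (alongProj σ.e σ.ε) r = _ := eq_sub_of_add_eq h2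
  rw [alongProj_eq, ← extMap_comp] at h1 h3
  have h4 : σ.extIncE h ∘ₗ σ.extProjE h = wedgeLeft (h.trans (add_comm r 1)) σ.e ∘ₗ
      contract h σ.ε := by
    rw [extIncE, extProjE, LinearMap.comp_assoc, ← LinearMap.comp_assoc (contract h σ.ε),
      h3, LinearMap.sub_comp, LinearMap.comp_sub, LinearMap.comp_assoc, ← LinearMap.comp_assoc,
      ← LinearMap.comp_assoc, wedgeLeft_wedgeLeft_self, LinearMap.zero_comp, LinearMap.comp_id]
    exact LinearMap.ext fun x => by rw [LinearMap.sub_apply, LinearMap.zero_apply, sub_zero]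
  rw [h4, h1]

end SplitOff

end Exterior

/-! ### Exactness of the Koszul complexes -/

section Canonical

variable {R : Type*} [CommRing R] {G G' : Type*} [AddCommGroup G] [Module R G]
  [AddCommGroup G'] [Module R G']

/-- Naturality of the canonical element `∑ vₗ^* ⊗ vₗ` of `G^* ⊗ G`. -/
theorem sum_dual_basis {ι κ X : Type*} [Fintype ι] [Fintype κ] [AddCommMonoid X] [Module R X]
    (b : Module.Basis ι R G) (b' : Module.Basis κ R G') (f : G →ₗ[R] G')
    (B : Module.Dual R G →ₗ[R] G' →ₗ[R] X) :
    ∑ k, B (b'.coord k ∘ₗ f) (b' k) = ∑ l, B (b.coord l) (f (b l)) := by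
  classical
  have h1 (γ : Module.Dual R G) : γ = ∑ l, γ (b l) • b.coord l := by
    refine b.ext fun i => ?_
    simp
  have h2 (k) : B (b'.coord k ∘ₗ f) (b' k) =
      ∑ l, B (b.coord l) (b'.coord k (f (b l)) • b' k) := by
    conv_lhs => rw [h1 (b'.coord k ∘ₗ f)]
    simp
  rw [Finset.sum_congr rfl fun k _ => h2 k, Finset.sum_comm]
  refine Finset.sum_congr rfl fun l _ => ?_
  rw [← map_sum]
  congr 1
  simp

variable [Module.Free R G] [Module.Finite R G] [Module.Free R G'] [Module.Finite R G']
  {A A' N N' : Type*} [AddCommMonoid A] [Module R A] [AddCommMonoid A'] [Module R A']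
  [AddCommMonoid N] [Module R N] [AddCommMonoid N'] [Module R N']

/-- The map `A ⊗ N → A' ⊗ N'` given by the canonical element `∑ vₗ^* ⊗ vₗ` of `G^* ⊗ G`, when
`G^*` acts from `A` to `A'` and `G` acts from `N` to `N'`. The four differentials `kappa`, `eta`,
`kosMap` and `etaMap` are of this form. -/
noncomputable def koszulMap (c : Module.Dual R G →ₗ[R] A →ₗ[R] A') (s : G →ₗ[R] N →ₗ[R] N') :
    A ⊗[R] N →ₗ[R] A' ⊗[R] N' :=
  ∑ l, TensorProduct.map (c ((freeBasis R G).coord l)) (s (freeBasis R G l))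

theorem koszulMap_dualMap (f : G →ₗ[R] G') (c : Module.Dual R G →ₗ[R] A →ₗ[R] A')
    (s : G' →ₗ[R] N →ₗ[R] N') :
    koszulMap (c ∘ₗ f.dualMap) s = koszulMap c (s ∘ₗ f) :=
  sum_dual_basis (freeBasis R G) (freeBasis R G') f
    ((TensorProduct.mapBilinear (RingHom.id R) A N A' N').compl₁₂ c s)

theorem koszulMap_add (c c' : Module.Dual R G →ₗ[R] A →ₗ[R] A') (s : G →ₗ[R] N →ₗ[R] N') :
    koszulMap (c + c') s = koszulMap c s + koszulMap c' s := by
  simp only [koszulMap, LinearMap.add_apply, TensorProduct.map_add_left, Finset.sum_add_distrib]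

theorem koszulMap_smulRight (v : G) (φ : A →ₗ[R] A') (s : G →ₗ[R] N →ₗ[R] N') :
    koszulMap ((Module.Dual.eval R G v).smulRight φ) s = TensorProduct.map φ (s v) := by
  have h : s v = ∑ l, (freeBasis R G).repr v l • s (freeBasis R G l) := by
    conv_lhs => rw [← (freeBasis R G).sum_repr v]
    rw [map_sum]
    exact Finset.sum_congr rfl fun l _ => map_smul _ _ _
  rw [h, koszulMap]
  change _ = TensorProduct.mapBilinear (RingHom.id R) A N A' N' φ _
  rw [map_sum]
  refine Finset.sum_congr rfl fun l _ => ?_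
  rw [map_smul]
  exact TensorProduct.map_smul_left _ _ _

theorem koszulMap_smulRight' (γ : Module.Dual R G) (c : Module.Dual R G →ₗ[R] A →ₗ[R] A')
    (ψ : N →ₗ[R] N') :
    koszulMap c (γ.smulRight ψ) = TensorProduct.map (c γ) ψ := by
  have h1 : γ = ∑ l, γ (freeBasis R G l) • (freeBasis R G).coord l := by
    refine (freeBasis R G).ext fun i => ?_
    simp
  have h : c γ = ∑ l, γ (freeBasis R G l) • c ((freeBasis R G).coord l) := by
    conv_lhs => rw [h1]
    rw [map_sum]
    exact Finset.sum_congr rfl fun l _ => map_smul _ _ _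
  rw [h, koszulMap]
  change _ = (TensorProduct.mapBilinear (RingHom.id R) A N A' N').flip ψ _
  rw [map_sum]
  refine Finset.sum_congr rfl fun l _ => ?_
  rw [map_smul]
  exact TensorProduct.map_smul_right _ _ _

theorem koszulMap_comp {B P : Type*} [AddCommMonoid B] [Module R B] [AddCommMonoid P] [Module R P]
    (c : Module.Dual R G →ₗ[R] A →ₗ[R] A') (s : G →ₗ[R] N →ₗ[R] N') (α : B →ₗ[R] A)
    (ν : P →ₗ[R] N) :
    koszulMap c s ∘ₗ TensorProduct.map α ν = koszulMap (LinearMap.lcomp R A' α ∘ₗ c)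
      (LinearMap.lcomp R N' ν ∘ₗ s) := by
  simp only [koszulMap, sum_comp', ← TensorProduct.map_comp]
  rfl

theorem comp_koszulMap {B P : Type*} [AddCommMonoid B] [Module R B] [AddCommMonoid P] [Module R P]
    (c : Module.Dual R G →ₗ[R] A →ₗ[R] A') (s : G →ₗ[R] N →ₗ[R] N') (α : A' →ₗ[R] B)
    (ν : N' →ₗ[R] P) :
    TensorProduct.map α ν ∘ₗ koszulMap c s = koszulMap (α.compRight R ∘ₗ c)
      (ν.compRight R ∘ₗ s) := by
  simp only [koszulMap, comp_sum', ← TensorProduct.map_comp]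
  rfl

/-- Covariant naturality of `koszulMap` in `G`. -/
theorem koszulMap_natural {B B' P P' : Type*} [AddCommMonoid B] [Module R B] [AddCommMonoid B']
    [Module R B'] [AddCommMonoid P] [Module R P] [AddCommMonoid P'] [Module R P'] (f : G →ₗ[R] G')
    {c : Module.Dual R G →ₗ[R] A →ₗ[R] A'} {s : G →ₗ[R] N →ₗ[R] N'}
    {c' : Module.Dual R G' →ₗ[R] B →ₗ[R] B'} {s' : G' →ₗ[R] P →ₗ[R] P'}
    {α : A →ₗ[R] B} {α' : A' →ₗ[R] B'} {ν : N →ₗ[R] P} {ν' : N' →ₗ[R] P'}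
    (hα : ∀ γ, c' γ ∘ₗ α = α' ∘ₗ c (γ ∘ₗ f)) (hν : ∀ v, s' (f v) ∘ₗ ν = ν' ∘ₗ s v) :
    koszulMap c' s' ∘ₗ TensorProduct.map α ν = TensorProduct.map α' ν' ∘ₗ koszulMap c s := by
  rw [koszulMap_comp, comp_koszulMap]
  have h1 : LinearMap.lcomp R B' α ∘ₗ c' = (α'.compRight R ∘ₗ c) ∘ₗ f.dualMap :=
    LinearMap.ext hα
  have h2 : ν'.compRight R ∘ₗ s = (LinearMap.lcomp R P' ν ∘ₗ s') ∘ₗ f :=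
    LinearMap.ext fun v => (hν v).symm
  rw [h1, h2, koszulMap_dualMap]

/-- Contravariant naturality of `koszulMap` in `G`. -/
theorem koszulMap_natural' {B B' P P' : Type*} [AddCommMonoid B] [Module R B] [AddCommMonoid B']
    [Module R B'] [AddCommMonoid P] [Module R P] [AddCommMonoid P'] [Module R P'] (f : G' →ₗ[R] G)
    {c : Module.Dual R G →ₗ[R] A →ₗ[R] A'} {s : G →ₗ[R] N →ₗ[R] N'}
    {c' : Module.Dual R G' →ₗ[R] B →ₗ[R] B'} {s' : G' →ₗ[R] P →ₗ[R] P'}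
    {α : A →ₗ[R] B} {α' : A' →ₗ[R] B'} {ν : N →ₗ[R] P} {ν' : N' →ₗ[R] P'}
    (hα : ∀ γ, c' (γ ∘ₗ f) ∘ₗ α = α' ∘ₗ c γ) (hν : ∀ v, s' v ∘ₗ ν = ν' ∘ₗ s (f v)) :
    koszulMap c' s' ∘ₗ TensorProduct.map α ν = TensorProduct.map α' ν' ∘ₗ koszulMap c s := by
  rw [koszulMap_comp, comp_koszulMap]
  have h1 : α'.compRight R ∘ₗ c = (LinearMap.lcomp R B' α ∘ₗ c') ∘ₗ f.dualMap :=
    LinearMap.ext fun γ => (hα γ).symm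
  have h2 : LinearMap.lcomp R P' ν ∘ₗ s' = (ν'.compRight R ∘ₗ s) ∘ₗ f := LinearMap.ext hν
  rw [h1, h2, koszulMap_dualMap]

section Homotopy

variable {A'' N'' : Type*} [AddCommMonoid A''] [Module R A''] [AddCommMonoid N'']
  [Module R N''] (e : G) (ε : Module.Dual R G)
  {c₂ : Module.Dual R G →ₗ[R] A'' →ₗ[R] A} {s₂ : G →ₗ[R] N'' →ₗ[R] N}
  {c₁ : Module.Dual R G →ₗ[R] A →ₗ[R] A'} {s₁ : G →ₗ[R] N →ₗ[R] N'}
  {k : A →ₗ[R] A''} {k' : A' →ₗ[R] A} {d : N →ₗ[R] N''} {d' : N' →ₗ[R] N} {π : N →ₗ[R] N}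

theorem koszulMap_comp_add (hk : ∀ γ, c₂ γ ∘ₗ k + k' ∘ₗ c₁ γ = γ e • LinearMap.id) :
    koszulMap c₂ s₂ ∘ₗ TensorProduct.map k d +
      koszulMap (k'.compRight R ∘ₗ c₁) (LinearMap.lcomp R N d ∘ₗ s₂) =
        TensorProduct.map LinearMap.id (s₂ e ∘ₗ d) := by
  rw [koszulMap_comp]
  have h1 : LinearMap.lcomp R A k ∘ₗ c₂ + k'.compRight R ∘ₗ c₁ =
      (Module.Dual.eval R G e).smulRight LinearMap.id := LinearMap.ext hk
  have h3 := koszulMap_add (LinearMap.lcomp R A k ∘ₗ c₂) (k'.compRight R ∘ₗ c₁)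
    (LinearMap.lcomp R N d ∘ₗ s₂)
  rw [h1, koszulMap_smulRight] at h3
  exact h3.symm

theorem koszulMap_add_smulRight (c : Module.Dual R G →ₗ[R] A →ₗ[R] A')
    (s : G →ₗ[R] N →ₗ[R] N') (ψ : N →ₗ[R] N') :
    koszulMap c (s + ε.smulRight ψ) = koszulMap c s + TensorProduct.map (c ε) ψ := by
  rw [← koszulMap_smulRight']
  simp only [koszulMap, LinearMap.add_apply, TensorProduct.map_add_right, Finset.sum_add_distrib]

/-- The homotopy of the Koszul complex for one variable `e` with coordinate `ε`: multiplication by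
`e` on the exterior factor and division by `e` on the symmetric factor. -/
theorem koszulMap_homotopy {α : A →ₗ[R] A}
    (hk : ∀ γ, c₂ γ ∘ₗ k + k' ∘ₗ c₁ γ = γ e • LinearMap.id)
    (hd : ∀ v, d' ∘ₗ s₁ v = s₂ v ∘ₗ d + ε v • π) (h2 : s₂ e ∘ₗ d + π = LinearMap.id)
    (h1 : k' ∘ₗ c₁ ε + α = LinearMap.id) (x : A ⊗[R] N) (hx : koszulMap c₁ s₁ x = 0) :
    koszulMap c₂ s₂ (TensorProduct.map k d x) + TensorProduct.map α π x = x := by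
  have e1 := LinearMap.congr_fun (koszulMap_comp_add e (s₂ := s₂) (d := d) hk) x
  have e2 := comp_koszulMap c₁ s₁ k' d'
  have e3 : d'.compRight R ∘ₗ s₁ = LinearMap.lcomp R N d ∘ₗ s₂ + ε.smulRight π :=
    LinearMap.ext hd
  rw [e3, koszulMap_add_smulRight] at e2
  replace e2 := LinearMap.congr_fun e2 x
  rw [LinearMap.comp_apply, hx, map_zero, LinearMap.add_apply] at e2
  rw [LinearMap.add_apply, LinearMap.comp_apply] at e1
  have e4 : TensorProduct.map (LinearMap.id : A →ₗ[R] A) (s₂ e ∘ₗ d) x +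
      TensorProduct.map LinearMap.id π x = x := by
    rw [← LinearMap.add_apply, ← TensorProduct.map_add_right, h2, TensorProduct.map_id,
      LinearMap.id_apply]
  have e5 : TensorProduct.map (LinearMap.id : A →ₗ[R] A) π x =
      TensorProduct.map (k' ∘ₗ c₁ ε) π x + TensorProduct.map α π x := by
    rw [← LinearMap.add_apply, ← TensorProduct.map_add_left, h1]
  rw [← e1, e5, add_add_add_comm] at e4
  have e6 : TensorProduct.map ((k'.compRight R ∘ₗ c₁) ε) π = TensorProduct.map (k' ∘ₗ c₁ ε) π := rfl
  rw [e6] at e2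
  have aux (a b c d y : A ⊗[R] N) (h : a + c + (b + d) = y) (h' : 0 = b + c) : a + d = y := by
    rw [← h, ← add_assoc, add_assoc a c b, add_comm c b, ← h', add_zero]
  exact aux _ _ _ _ _ e4 e2

/-- The homotopy of the dual Koszul complex for one variable `e` with coordinate `ε`: contraction
by `e` on the exterior factor and the dual of the division by `e` on the divided factor. -/
theorem koszulMap_homotopy' {α : A →ₗ[R] A} (hk : ∀ γ, c₂ γ ∘ₗ k + k' ∘ₗ c₁ γ = γ e • LinearMap.id)
    (hd : ∀ v, s₂ v ∘ₗ d = d' ∘ₗ s₁ v + ε v • π) (h2 : s₂ e ∘ₗ d = LinearMap.id)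
    (h1 : k' ∘ₗ c₁ ε = α) (x : A ⊗[R] N) (hx : koszulMap c₁ s₁ x = 0) :
    koszulMap c₂ s₂ (TensorProduct.map k d x) + TensorProduct.map α π x = x := by
  subst h1
  have e1 := LinearMap.congr_fun (koszulMap_comp_add e (s₂ := s₂) (d := d) hk) x
  have e2 := comp_koszulMap c₁ s₁ k' d'
  have e3 : LinearMap.lcomp R N d ∘ₗ s₂ = d'.compRight R ∘ₗ s₁ + ε.smulRight π :=
    LinearMap.ext hd
  rw [e3, koszulMap_add_smulRight, ← e2, h2, TensorProduct.map_id] at e1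
  rw [LinearMap.add_apply, LinearMap.add_apply, LinearMap.comp_apply, LinearMap.comp_apply, hx,
    map_zero, zero_add] at e1
  exact e1

end Homotopy

end Canonical

section Contract

variable {R : Type*} [CommRing R]

theorem contract_comp_wedge {M : Type*} [AddCommGroup M] [Module R M] (e : M) (ε : Module.Dual R M)
    (he : ε e = 1) {p p' : ℤ}
    (hp : p = p' + 1) :
    (sgn p • contract (r := p + 1) rfl (Module.Dual.eval R M e)) ∘ₗ wedge rfl ε =
      extMap (alongProj e ε).dualMap p := by
  have hs : sgn p = -sgn p' := by rw [hp, sgn_succ]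
  have h3 : (alongProj e ε).dualMap = alongProj ε (Module.Dual.eval R M e) := by
    refine LinearMap.ext fun γ => LinearMap.ext fun v => ?_
    change γ (v - ε v • e) = γ v - γ e * ε v
    rw [map_sub, map_smul, smul_eq_mul, mul_comm]
  have h4 := extMap_alongProj ε (Module.Dual.eval R M e) hp (by omega)
  rw [h3]
  refine LinearMap.ext fun x => ?_
  have h5 := LinearMap.congr_fun (contract_wedge rfl hp (Module.Dual.eval R M e) ε) x
  have h6 := LinearMap.congr_fun h4 x
  have h7 := LinearMap.congr_fun (wedge_eq_wedgeLeft hp (by omega) ε)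
    (contract hp (Module.Dual.eval R M e) x)
  rw [LinearMap.comp_apply] at h5
  change sgn p • contract rfl (Module.Dual.eval R M e) (wedge rfl ε x) = _
  rw [h5, LinearMap.add_apply, LinearMap.comp_apply, h7, LinearMap.smul_apply, smul_add,
    LinearMap.smul_apply, sgn_smul_sgn_smul, LinearMap.smul_apply, hs, neg_smul,
    sgn_smul_sgn_smul]
  change _ + ε e • x = _
  rw [he, one_smul, neg_add_eq_sub, sub_eq_iff_eq_add]
  exact h6.symm

theorem wedge_contract_add {M : Type*} [AddCommGroup M] [Module R M] (e : M) (γ : Module.Dual R M)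
    {p p' : ℤ} (hp : p = p' + 1) :
    wedge hp γ ∘ₗ (sgn p' • contract hp (Module.Dual.eval R M e)) +
      (sgn p • contract (r := p + 1) rfl (Module.Dual.eval R M e)) ∘ₗ wedge rfl γ =
        γ e • LinearMap.id := by
  have hs : sgn p = -sgn p' := by rw [hp, sgn_succ]
  refine LinearMap.ext fun x => ?_
  have h1 := LinearMap.congr_fun (contract_wedge rfl hp (Module.Dual.eval R M e) γ) x
  change wedge hp γ (sgn p' • contract hp (Module.Dual.eval R M e) x) +
    sgn p • contract rfl (Module.Dual.eval R M e) (wedge rfl γ x) = γ e • x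
  rw [LinearMap.comp_apply] at h1
  rw [h1, map_zsmul, LinearMap.add_apply, smul_add, LinearMap.smul_apply, sgn_smul_sgn_smul,
    hs, neg_smul]
  exact add_neg_cancel_left _ _

end Contract

section Exactness

variable {R : Type*} [CommRing R] {G G' : Type*} [AddCommGroup G] [Module R G]
  [AddCommGroup G'] [Module R G']
  [Module.Free R G] [Module.Finite R G] [Module.Free R G'] [Module.Finite R G']

theorem kappa_eq_koszulMap {p q p' q' : ℤ} (hp : p = p' + 1) (hq : q' = q + 1) :
    kappa R G hp hq = koszulMap (contractHom hp) (symMulHom hq) := rfl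

theorem eta_eq_koszulMap {p q p' q' : ℤ} (hp : p' = p + 1) (hq : q = q' + 1) :
    eta R G hp hq = koszulMap (wedgeHom hp) (divActHom hq) := rfl

theorem kappa_natural (f : G →ₗ[R] G') {p q p' q' : ℤ} (hp : p = p' + 1) (hq : q' = q + 1) :
    kappa R G' hp hq ∘ₗ TensorProduct.map (extMap f p) (symMap f q) =
      TensorProduct.map (extMap f p') (symMap f q') ∘ₗ kappa R G hp hq := by
  rw [kappa_eq_koszulMap, kappa_eq_koszulMap]
  refine koszulMap_natural f ?_ ?_
  · intro γ
    exact contract_extMap f hp γ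
  · intro v
    exact (symMap_symMul f hq v).symm

private theorem eta_natural (f : G →ₗ[R] G') {p q p' q' : ℤ} (hp : p' = p + 1) (hq : q = q' + 1) :
    eta R G hp hq ∘ₗ TensorProduct.map (extMap f.dualMap p) (divMap f q) =
      TensorProduct.map (extMap f.dualMap p') (divMap f q') ∘ₗ eta R G' hp hq := by
  rw [eta_eq_koszulMap, eta_eq_koszulMap]
  refine koszulMap_natural' f ?_ ?_
  · intro γ
    exact (extMap_wedge f.dualMap hp γ).symm
  · intro v
    exact divMap_divAct f hq v

/-- On the kernel of `κ`, the projection along `e` differs from the identity by a boundary: the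
homotopy is multiplication by `e` in the exterior algebra and division by `e` in the symmetric
algebra. -/
theorem kappa_homotopy (e : G) (ε : Module.Dual R G) {p q p' q' p'' : ℤ} (hp : p' = p + 1)
    (hq : q = q' + 1) (hp'' : p = p'' + 1) (x : ext R G p ⊗[R] sym R G q)
    (hx : kappa R G hp'' (q' := q + 1) rfl x = 0) :
    ∃ y, kappa R G hp hq y +
      TensorProduct.map (extMap (alongProj e ε) p) (symMap (alongProj e ε) q) x = x := by
  refine ⟨TensorProduct.map (wedgeLeft (by omega) e) (symQuot e ε hq) x, ?_⟩
  rw [kappa_eq_koszulMap] at hx ⊢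
  have h1 : p = 1 + p'' := by omega
  refine koszulMap_homotopy e ε (k' := wedgeLeft h1 e) (d' := symQuot e ε rfl)
    ?_ ?_ ?_ ?_ x hx
  · intro γ
    exact contract_wedgeLeft (by omega) hp hp'' h1 γ e
  · intro v
    exact symQuot_symMul e ε hq rfl v
  · exact symMul_symQuot e ε hq
  · rw [add_comm]
    exact extMap_alongProj e ε hp'' h1

/-- The dual of `kappa_homotopy`: on the kernel of `η`, the map induced by the projection along `e`
differs from the identity by a boundary. -/
theorem eta_homotopy (e : G) (ε : Module.Dual R G) (he : ε e = 1) {p q p' q' q'' : ℤ}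
    (hp : p = p' + 1) (hq : q' = q + 1) (hq'' : q = q'' + 1)
    (x : ext R (Module.Dual R G) p ⊗[R] divPow R G q)
    (hx : eta R G (p := p) (p' := p + 1) rfl hq'' x = 0) :
    ∃ y, eta R G hp hq y +
      TensorProduct.map (extMap (alongProj e ε).dualMap p) (divMap (alongProj e ε) q) x = x := by
  refine ⟨TensorProduct.map (sgn p' • contract hp (Module.Dual.eval R G e))
    (divLift e ε hq) x, ?_⟩
  rw [eta_eq_koszulMap] at hx ⊢
  refine koszulMap_homotopy' e ε
    (k' := sgn p • contract (r := p + 1) rfl (Module.Dual.eval R G e)) (d' := divLift e ε hq'')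
    ?_ ?_ ?_ ?_ x hx
  · intro γ
    exact wedge_contract_add e γ hp
  · intro v
    exact divAct_divLift_comm e ε hq'' hq v
  · exact divAct_divLift e ε he hq
  · exact contract_comp_wedge e ε he hp

/-- The Koszul complex `⋀ G ⊗ Sym G` is exact outside bidegree `(0, 0)`. -/
theorem kappa_exact {p q p' q' p'' q'' : ℤ} (hp : p = p' + 1) (hq : q' = q + 1) (hp' : p'' = p + 1)
    (hq' : q = q'' + 1) (h0 : p ≠ 0 ∨ q ≠ 0) (x : ext R G p ⊗[R] sym R G q)
    (hx : kappa R G hp hq x = 0) : ∃ y, kappa R G hp' hq' y = x := by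
  obtain rfl : p' = p - 1 := by omega
  subst hq
  have key (s : Finset (Fin (Fintype.card (Module.Free.ChooseBasisIndex R G)))) :
      ∃ f : G →ₗ[R] G, (∀ k ∈ s, f (freeBasis R G k) = 0) ∧
        ∀ x, kappa R G hp rfl x = 0 → ∃ y, kappa R G hp' hq' y +
          TensorProduct.map (extMap f p) (symMap f q) x = x := by
    induction s using Finset.induction_on with
    | empty =>
      refine ⟨LinearMap.id, by simp, fun x _ => ⟨0, ?_⟩⟩
      rw [extMap_id, symMap_id, TensorProduct.map_id, LinearMap.id_apply, map_zero, zero_add]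
    | insert l s _ ih =>
      obtain ⟨f, hf, hfx⟩ := ih
      refine ⟨f ∘ₗ alongProj (freeBasis R G l) ((freeBasis R G).coord l), ?_, fun x hx => ?_⟩
      · intro k hk
        rw [LinearMap.comp_apply, alongProj_apply, Module.Basis.coord_apply,
          Module.Basis.repr_self, Finsupp.single_apply]
        split_ifs with hkl
        · rw [hkl, one_smul, sub_self, map_zero]
        · rw [zero_smul, sub_zero]
          exact hf k ((Finset.mem_insert.1 hk).resolve_left hkl)
      · set P := alongProj (freeBasis R G l) ((freeBasis R G).coord l)
        obtain ⟨w, hw⟩ := kappa_homotopy (freeBasis R G l) ((freeBasis R G).coord l) hp' hq' hp x hx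
        obtain ⟨y, hy⟩ := hfx (TensorProduct.map (extMap P p) (symMap P q) x) (by
          have := LinearMap.congr_fun (kappa_natural P hp (rfl : q + 1 = q + 1)) x
          rw [LinearMap.comp_apply, LinearMap.comp_apply, hx, map_zero] at this
          exact this)
        rw [← extMap_comp, ← symMap_comp, TensorProduct.map_comp, LinearMap.comp_apply]
        exact ⟨w + y, by rw [map_add, add_assoc, hy, hw]⟩
  obtain ⟨f, hf, hfx⟩ := key Finset.univ
  obtain ⟨y, hy⟩ := hfx x hx
  obtain rfl : f = 0 := (freeBasis R G).ext fun k => hf k (Finset.mem_univ k)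
  refine ⟨y, ?_⟩
  rw [← hy]
  rcases h0 with h0 | h0
  · rw [extMap_zero h0, TensorProduct.map_zero_left, LinearMap.zero_apply, add_zero]
  · rw [symMap_zero h0, TensorProduct.map_zero_right, LinearMap.zero_apply, add_zero]

/-- The dual Koszul complex `⋀ G^* ⊗ D(G^*)` is exact outside bidegree `(0, 0)`. -/
theorem eta_exact {p q p' q' p'' q'' : ℤ} (hp : p' = p + 1) (hq : q = q' + 1) (hp' : p = p'' + 1)
    (hq' : q'' = q + 1) (h0 : p ≠ 0 ∨ q ≠ 0) (x : ext R (Module.Dual R G) p ⊗[R] divPow R G q)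
    (hx : eta R G hp hq x = 0) : ∃ y, eta R G hp' hq' y = x := by
  obtain rfl : q' = q - 1 := by omega
  subst hp
  have key (s : Finset (Fin (Fintype.card (Module.Free.ChooseBasisIndex R G)))) :
      ∃ f : G →ₗ[R] G, (∀ k ∈ s, f (freeBasis R G k) = 0) ∧
        ∀ x, eta R G rfl hq x = 0 → ∃ y, eta R G hp' hq' y +
          TensorProduct.map (extMap f.dualMap p) (divMap f q) x = x := by
    induction s using Finset.induction_on with
    | empty =>
      refine ⟨LinearMap.id, by simp, fun x _ => ⟨0, ?_⟩⟩
      rw [LinearMap.dualMap_id, extMap_id, divMap_id, TensorProduct.map_id, LinearMap.id_apply,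
        map_zero, zero_add]
    | insert l s _ ih =>
      obtain ⟨f, hf, hfx⟩ := ih
      refine ⟨f ∘ₗ alongProj (freeBasis R G l) ((freeBasis R G).coord l), ?_, fun x hx => ?_⟩
      · intro k hk
        rw [LinearMap.comp_apply, alongProj_apply, Module.Basis.coord_apply,
          Module.Basis.repr_self, Finsupp.single_apply]
        split_ifs with hkl
        · rw [hkl, one_smul, sub_self, map_zero]
        · rw [zero_smul, sub_zero]
          exact hf k ((Finset.mem_insert.1 hk).resolve_left hkl)
      · obtain ⟨y, hy⟩ := hfx x hx
        obtain ⟨w, hw⟩ := eta_homotopy (freeBasis R G l) ((freeBasis R G).coord l)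
          (by simp) hp' hq' hq
          (TensorProduct.map (extMap f.dualMap p) (divMap f q) x) (by
          have := LinearMap.congr_fun (eta_natural f (rfl : p + 1 = p + 1) hq) x
          rw [LinearMap.comp_apply, LinearMap.comp_apply, hx, map_zero] at this
          exact this)
        set P := alongProj (freeBasis R G l) ((freeBasis R G).coord l)
        have h2 : (f ∘ₗ P).dualMap = P.dualMap ∘ₗ f.dualMap := rfl
        rw [h2, ← extMap_comp, ← divMap_comp, TensorProduct.map_comp, LinearMap.comp_apply]
        exact ⟨y + w, by rw [map_add, add_assoc, hw, hy]⟩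
  obtain ⟨f, hf, hfx⟩ := key Finset.univ
  obtain ⟨y, hy⟩ := hfx x hx
  obtain rfl : f = 0 := (freeBasis R G).ext fun k => hf k (Finset.mem_univ k)
  refine ⟨y, ?_⟩
  rw [← hy]
  have h2 : (0 : G →ₗ[R] G).dualMap = 0 := by
    refine LinearMap.ext fun γ => LinearMap.ext fun v => ?_
    exact map_zero γ
  rcases h0 with h0 | h0
  · rw [h2, extMap_zero h0, TensorProduct.map_zero_left, LinearMap.zero_apply, add_zero]
  · rw [divMap_zero h0, TensorProduct.map_zero_right, LinearMap.zero_apply, add_zero]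

end Exactness

/-! ### Hook Schur and Weyl modules of a module with a rank one summand split off -/

section Tensor

variable {R : Type*} [CommRing R] {V A N N' : Type*} [AddCommGroup V] [Module R V]
  [AddCommGroup A] [Module R A] [AddCommGroup N] [Module R N] [AddCommGroup N'] [Module R N']

/-- The restriction to submodules of the maps `1 ⊗ s(v)`, linear in `v`. -/
noncomputable def restrictHom (s : V →ₗ[R] N →ₗ[R] N') (S : Submodule R (A ⊗[R] N))
    (S' : Submodule R (A ⊗[R] N'))
    (h : ∀ v, ∀ x ∈ S, TensorProduct.map LinearMap.id (s v) x ∈ S') : V →ₗ[R] S →ₗ[R] S' where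
  toFun v := (TensorProduct.map LinearMap.id (s v)).restrict (h v)
  map_add' v w := LinearMap.ext fun x => Subtype.ext (by
    change TensorProduct.map LinearMap.id (s (v + w)) x.1 = _
    rw [map_add, TensorProduct.map_add_right]
    rfl)
  map_smul' c v := LinearMap.ext fun x => Subtype.ext (by
    change TensorProduct.map LinearMap.id (s (c • v)) x.1 = _
    rw [map_smul, TensorProduct.map_smul_right]
    rfl)

theorem tensor_eq_zero (h : ∀ b : N, b = 0) (z : A ⊗[R] N) : z = 0 := by
  induction z using TensorProduct.induction_on with
  | zero => rfl
  | tmul a b => rw [h b, TensorProduct.tmul_zero]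
  | add a b ha hb => rw [ha, hb, add_zero]

theorem tensor_eq_zero' (h : ∀ b : A, b = 0) (z : A ⊗[R] N) : z = 0 := by
  induction z using TensorProduct.induction_on with
  | zero => rfl
  | tmul a b => rw [h a, TensorProduct.zero_tmul]
  | add a b ha hb => rw [ha, hb, add_zero]

end Tensor

section HookMaps

variable {R : Type*} [CommRing R] {G G' : Type*} [AddCommGroup G] [Module R G]
  [AddCommGroup G'] [Module R G']
  [Module.Free R G] [Module.Finite R G] [Module.Free R G'] [Module.Finite R G']

/-- Membership in `L^p_q G` for free indices in the target of `κ`. -/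
theorem mem_schur {p q p' q' : ℤ} (hp : p = p' + 1) (hq : q' = q + 1)
    {x : ext R G p ⊗[R] sym R G q} : x ∈ schur R G p q ↔ kappa R G hp hq x = 0 := by
  obtain rfl : p' = p - 1 := by omega
  subst hq
  exact Iff.rfl

/-- Membership in `K^p_q(G^*)` for free indices in the target of `η`. -/
theorem mem_weyl {p q p' q' : ℤ} (hp : p' = p + 1) (hq : q = q' + 1)
    {x : ext R (Module.Dual R G) p ⊗[R] divPow R G q} :
    x ∈ weyl R G p q ↔ eta R G hp hq x = 0 := by
  obtain rfl : q' = q - 1 := by omega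
  subst hp
  exact Iff.rfl

/-- The map `L^p_q G → L^p_q G'` induced by a linear map `G → G'`. -/
noncomputable def schurMap (f : G →ₗ[R] G') (p q : ℤ) : schur R G p q →ₗ[R] schur R G' p q :=
  (TensorProduct.map (extMap f p) (symMap f q)).restrict fun x hx => by
    have h := LinearMap.congr_fun
      (kappa_natural f (p := p) (p' := p - 1) (by ring) (rfl : q + 1 = q + 1)) x
    have hx0 := (mem_schur (p' := p - 1) (by ring) rfl).1 hx
    rw [LinearMap.comp_apply, LinearMap.comp_apply, hx0, map_zero] at h
    exact (mem_schur _ _).2 h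

/-- The map `K^p_q(G'^*) → K^p_q(G^*)` induced by a linear map `G → G'`; it is contravariant in `G`.
-/
noncomputable def weylMap (f : G →ₗ[R] G') (p q : ℤ) : weyl R G' p q →ₗ[R] weyl R G p q :=
  (TensorProduct.map (extMap f.dualMap p) (divMap f q)).restrict fun x hx => by
    have h := LinearMap.congr_fun
      (eta_natural f (rfl : p + 1 = p + 1) (q := q) (q' := q - 1) (by ring)) x
    have hx0 := (mem_weyl (q' := q - 1) rfl (by ring)).1 hx
    rw [LinearMap.comp_apply, LinearMap.comp_apply, hx0, map_zero] at h
    exact (mem_weyl _ _).2 h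

theorem kappa_contract {p q p' q' p'' : ℤ} (hp : p = p' + 1) (hp' : p' = p'' + 1)
    (hq : q' = q + 1) (d : Module.Dual R G) (x : ext R G p ⊗[R] sym R G q) :
    kappa R G hp' hq (TensorProduct.map (contract hp d) LinearMap.id x) +
      TensorProduct.map (contract hp' d) LinearMap.id (kappa R G hp hq x) = 0 := by
  simp only [kappa, LinearMap.sum_apply, map_sum]
  rw [← Finset.sum_add_distrib]
  refine Finset.sum_eq_zero fun l _ => ?_
  rw [← LinearMap.comp_apply, ← LinearMap.comp_apply, ← TensorProduct.map_comp,
    ← TensorProduct.map_comp, LinearMap.id_comp, LinearMap.comp_id, ← LinearMap.add_apply,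
    ← TensorProduct.map_add_left, contract_contract_comm, TensorProduct.map_zero_left]
  rfl

private theorem eta_contract {p q p' q' p'' : ℤ} (hp : p' = p + 1) (hp' : p = p'' + 1)
    (hq : q = q' + 1) (v : G) (x : ext R (Module.Dual R G) p ⊗[R] divPow R G q) :
    TensorProduct.map (contract hp (Module.Dual.eval R G v)) LinearMap.id (eta R G hp hq x) =
      eta R G hp' hq (TensorProduct.map (contract hp' (Module.Dual.eval R G v)) LinearMap.id x) +
        TensorProduct.map (sgn p • LinearMap.id) (divAct hq v) x := by
  have h1 := koszulMap_smulRight (A := ext R (Module.Dual R G) p) v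
    (sgn p • (LinearMap.id : ext R (Module.Dual R G) p →ₗ[R] _)) (divActHom hq)
  replace h1 := LinearMap.congr_fun h1 x
  refine Eq.trans ?_ (congrArg _ h1)
  simp only [eta, koszulMap, LinearMap.sum_apply, map_sum]
  rw [← Finset.sum_add_distrib]
  refine Finset.sum_congr rfl fun l _ => ?_
  rw [← LinearMap.comp_apply, ← LinearMap.comp_apply, ← TensorProduct.map_comp,
    ← TensorProduct.map_comp, LinearMap.id_comp, LinearMap.comp_id, contract_wedge hp hp',
    TensorProduct.map_add_left, LinearMap.add_apply, smul_comm]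
  rfl

/-- The multiplication `G × L^p_q G → L^p_{q+1} G`. -/
noncomputable def schurMulHom {p q q' : ℤ} (h : q' = q + 1) :
    G →ₗ[R] schur R G p q →ₗ[R] schur R G p q' :=
  restrictHom (symMulHom h) _ _ fun v x hx => (schurMul h v ⟨x, hx⟩).2

/-- The action `G × K^p_q(G^*) → K^p_{q-1}(G^*)`. -/
noncomputable def weylActHom {p q q' : ℤ} (h : q = q' + 1) :
    G →ₗ[R] weyl R G p q →ₗ[R] weyl R G p q' :=
  restrictHom (divActHom h) _ _ fun v x hx => (weylAct h v ⟨x, hx⟩).2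

theorem schurMulHom_apply {p q q' : ℤ} (h : q' = q + 1) (v : G) :
    schurMulHom (R := R) (p := p) h v = schurMul h v := rfl

private theorem weylActHom_apply {p q q' : ℤ} (h : q = q' + 1) (v : G) :
    weylActHom (R := R) (p := p) h v = weylAct h v := rfl

private theorem schurMap_schurMul (f : G →ₗ[R] G') {p q q' : ℤ} (h : q' = q + 1) (v : G) :
    schurMap f p q' ∘ₗ schurMul h v = schurMul h (f v) ∘ₗ schurMap f p q := by
  refine LinearMap.ext fun x => Subtype.ext ?_
  change TensorProduct.map (extMap f p) (symMap f q')
    (TensorProduct.map LinearMap.id (symMul h v) x.1)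
    = TensorProduct.map LinearMap.id (symMul h (f v))
      (TensorProduct.map (extMap f p) (symMap f q) x.1)
  rw [← LinearMap.comp_apply, ← LinearMap.comp_apply, ← TensorProduct.map_comp,
    ← TensorProduct.map_comp, LinearMap.id_comp, LinearMap.comp_id, symMap_symMul]

private theorem weylAct_weylMap (f : G →ₗ[R] G') {p q q' : ℤ} (h : q = q' + 1) (v : G) :
    weylAct h v ∘ₗ weylMap f p q = weylMap f p q' ∘ₗ weylAct h (f v) := by
  refine LinearMap.ext fun x => Subtype.ext ?_
  change TensorProduct.map LinearMap.id (divAct h v)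
      (TensorProduct.map (extMap f.dualMap p) (divMap f q) x.1) =
    TensorProduct.map (extMap f.dualMap p) (divMap f q')
      (TensorProduct.map LinearMap.id (divAct h (f v)) x.1)
  rw [← LinearMap.comp_apply, ← LinearMap.comp_apply, ← TensorProduct.map_comp,
    ← TensorProduct.map_comp, LinearMap.id_comp, LinearMap.comp_id, divMap_divAct]

theorem subsingleton_ext_of_neg {M : Type*} [AddCommGroup M] [Module R M] {r : ℤ} (hr : r < 0) :
    Subsingleton (ext R M r) := by
  obtain ⟨n, rfl⟩ := Int.eq_negSucc_of_lt_zero hr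
  exact inferInstanceAs (Subsingleton (⊥ : Submodule R (ExteriorAlgebra R M)))

theorem schur_zero_eq {p : ℤ} (hp : p ≠ 0) (x : schur R G p 0) : x = 0 := by
  refine Subtype.ext ?_
  obtain ⟨y, hy⟩ := kappa_exact (p' := p - 1) (by ring) (zero_add 1).symm (p'' := p + 1)
    (q'' := -1) rfl (by ring) (Or.inl hp) x.1 ((mem_schur _ _).1 x.2)
  have h2 : y = 0 := tensor_eq_zero (fun b => Subtype.ext b.2) y
  rw [← hy, h2, map_zero]
  rfl

theorem schurMap_kappaZero (f : G →ₗ[R] G') {p s : ℤ} (h : s = p + 1) :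
    schurMap f p 1 ∘ₗ kappaZero h = kappaZero h ∘ₗ extMap f s := by
  refine LinearMap.ext fun x => Subtype.ext ?_
  have h1 := LinearMap.congr_fun (kappa_natural f h (zero_add 1).symm) (x ⊗ₜ ⟨1, one_mem_sym⟩)
  rw [LinearMap.comp_apply, LinearMap.comp_apply, TensorProduct.map_tmul] at h1
  refine h1.symm.trans ?_
  have h2 : symMap f 0 ⟨1, one_mem_sym⟩ = ⟨1, one_mem_sym⟩ := Subtype.ext (map_one (symAlgMap f))
  rw [h2]
  rfl

private theorem weylZero_weylMap (f : G →ₗ[R] G') (p : ℤ) :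
    weylZero p ∘ₗ weylMap f p 0 = extMap f.dualMap p ∘ₗ weylZero p := by
  refine LinearMap.ext fun x => ?_
  change evalZero R G p (TensorProduct.map (extMap f.dualMap p) (divMap f 0) x.1) =
    extMap f.dualMap p (evalZero R G' p x.1)
  induction x.1 using TensorProduct.induction_on with
  | zero => simp only [map_zero]
  | add x y hx hy => simp only [map_add, hx, hy]
  | tmul a φ =>
    have h2 : symMap f 0 ⟨1, one_mem_sym⟩ = ⟨1, one_mem_sym⟩ := Subtype.ext (map_one (symAlgMap f))
    have h3 : divZero R G (divMap f 0 φ) = divZero R G' φ :=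
      congrArg (DFunLike.coe (F := Module.Dual R (sym R G' 0)) φ) h2
    simp [evalZero, h3]

end HookMaps

theorem neg_one_smul_eq_of_add_eq_zero {R M : Type*} [Ring R] [AddCommMonoid M] [Module R M]
    {b x : M} (h : b + x = 0) : (-1 : R) • b = x := by
  rw [← add_zero ((-1 : R) • b), ← h, ← add_assoc]
  nth_rw 2 [← one_smul R b]
  rw [← add_smul, neg_add_cancel, zero_smul, zero_add]

section SplitHooks

variable {R : Type*} [CommRing R] {G G₁ : Type*} [AddCommGroup G] [Module R G]
  [AddCommGroup G₁] [Module R G₁]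
  [Module.Free R G] [Module.Finite R G] [Module.Free R G₁] [Module.Finite R G₁]

/-- The contraction of `L^p_q G` to `L^{p-1}_q G` by a linear form on `G`. -/
noncomputable def schurContract {p p' : ℤ} (hp : p = p' + 1) (d : Module.Dual R G) (q : ℤ) :
    schur R G p q →ₗ[R] schur R G p' q :=
  (TensorProduct.map (contract hp d) LinearMap.id).restrict fun x hx => by
    have h := kappa_contract hp (p'' := p' - 1) (by ring) (rfl : q + 1 = q + 1) d x
    rw [(mem_schur hp rfl).1 hx, map_zero, add_zero] at h
    exact (mem_schur _ _).2 h

/-- The map `K^a_q(G^*) → K^{a+1}_q(G^*)` given by the exterior product with a linear form. -/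
noncomputable def weylWedge {a a' : ℤ} (ha : a' = 1 + a) (c : Module.Dual R G) (q : ℤ) :
    weyl R G a q →ₗ[R] weyl R G a' q :=
  (TensorProduct.map (wedgeLeft ha c) LinearMap.id).restrict fun x hx => by
    have h0 := (mem_weyl rfl (q' := q - 1) (by ring)).1 hx
    refine (mem_weyl (p' := a' + 1) rfl (q' := q - 1) (by ring)).2 ?_
    have h1 : eta R G (rfl : a' + 1 = a' + 1) (q := q) (q' := q - 1) (by ring) ∘ₗ
        TensorProduct.map (wedgeLeft ha c) LinearMap.id =
        TensorProduct.map (wedgeLeft (by rw [ha]; ring) c) LinearMap.id ∘ₗ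
          eta R G (rfl : a + 1 = a + 1) (q := q) (q' := q - 1) (by ring) := by
      simp only [eta, sum_comp', comp_sum', ← TensorProduct.map_comp, LinearMap.id_comp,
        LinearMap.comp_id]
      exact Finset.sum_congr rfl fun l _ => by rw [wedge_wedgeLeft]
    have h2 := LinearMap.congr_fun h1 x
    rw [LinearMap.comp_apply, LinearMap.comp_apply, h0, map_zero] at h2
    exact h2

private theorem schurContract_schurMul {p p' q q' : ℤ} (hp : p = p' + 1) (d : Module.Dual R G)
    (h : q' = q + 1) (v : G) :
    schurContract hp d q' ∘ₗ schurMul h v = schurMul h v ∘ₗ schurContract hp d q := by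
  refine LinearMap.ext fun x => Subtype.ext ?_
  change TensorProduct.map _ _ (TensorProduct.map _ _ x.1) =
    TensorProduct.map _ _ (TensorProduct.map _ _ x.1)
  rw [TensorProduct.map_map, TensorProduct.map_map]
  rfl

private theorem weylAct_weylWedge {a a' q q' : ℤ} (ha : a' = 1 + a) (c : Module.Dual R G)
    (h : q = q' + 1) (v : G) :
    weylAct h v ∘ₗ weylWedge ha c q = weylWedge ha c q' ∘ₗ weylAct h v := by
  refine LinearMap.ext fun x => Subtype.ext ?_
  change TensorProduct.map _ _ (TensorProduct.map _ _ x.1) =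
    TensorProduct.map _ _ (TensorProduct.map _ _ x.1)
  rw [TensorProduct.map_map, TensorProduct.map_map]
  rfl

theorem schurContract_kappaZero {p p' s s' : ℤ} (hp : p = p' + 1) (h : s = p + 1)
    (h' : s' = p' + 1) (hs : s = s' + 1) (d : Module.Dual R G) (x : ext R G s) :
    schurContract hp d 1 (kappaZero h x) + kappaZero h' (contract hs d x) = 0 := by
  obtain rfl : p = s' := by omega
  refine Subtype.ext ?_
  have h1 := kappa_contract hs h' (zero_add 1).symm d (x ⊗ₜ[R] (⟨1, one_mem_sym⟩ : sym R G 0))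
  exact (add_comm _ _).trans h1

/-- The Koszul map, as a map to the hook Schur module. -/
noncomputable def kappaCod {p q p' q' : ℤ} (hp : p = p' + 1) (hq : q' = q + 1) :
    ext R G p ⊗[R] sym R G q →ₗ[R] schur R G p' q' :=
  (kappa R G hp hq).codRestrict _ fun x => (mem_schur (p' := p' - 1) (by ring) rfl).2
    (LinearMap.congr_fun (kappa_comp_kappa hp hq (by ring) rfl) x)

theorem eta_comp_eta {p q p' q' p'' q'' : ℤ} (hp : p' = p + 1) (hq : q = q' + 1)
    (hp' : p'' = p' + 1) (hq' : q' = q'' + 1) :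
    eta R G hp' hq' ∘ₗ eta R G hp hq = 0 :=
  tensor_sum_comp_eq_zero _ _ _ _ (fun _ => wedge_wedge_self hp hp' _)
    (fun _ _ => wedge_wedge_comm hp hp' _ _) (fun _ _ => divAct_comm hq hq' hq hq' _ _)

/-- The map `η`, as a map to the hook Weyl module. -/
noncomputable def etaCod {p q p' q' : ℤ} (hp : p' = p + 1) (hq : q = q' + 1) :
    ext R (Module.Dual R G) p ⊗[R] divPow R G q →ₗ[R] weyl R G p' q' :=
  (eta R G hp hq).codRestrict _ fun x => (mem_weyl rfl (q' := q' - 1) (by ring)).2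
    (LinearMap.congr_fun (eta_comp_eta hp hq rfl (by ring)) x)

theorem kappaCod_surjective {p q p' q' : ℤ} (hp : p = p' + 1) (hq : q' = q + 1)
    (h0 : p' ≠ 0 ∨ q' ≠ 0) : Function.Surjective (kappaCod (R := R) (G := G) hp hq) := fun x => by
  obtain ⟨y, hy⟩ := kappa_exact (p' := p' - 1) (by ring) (rfl : q' + 1 = q' + 1) hp hq h0 x.1
    ((mem_schur _ _).1 x.2)
  exact ⟨y, Subtype.ext hy⟩

theorem etaCod_surjective {p q p' q' : ℤ} (hp : p' = p + 1) (hq : q = q' + 1)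
    (h0 : p' ≠ 0 ∨ q' ≠ 0) : Function.Surjective (etaCod (R := R) (G := G) hp hq) := fun x => by
  obtain ⟨y, hy⟩ := eta_exact (rfl : p' + 1 = p' + 1) (q' := q' - 1) (by ring) hp hq h0 x.1
    ((mem_weyl _ _).1 x.2)
  exact ⟨y, Subtype.ext hy⟩

theorem schurMap_kappaCod (f : G →ₗ[R] G₁) {p q p' q' : ℤ} (hp : p = p' + 1) (hq : q' = q + 1)
    (x : ext R G p ⊗[R] sym R G q) :
    schurMap f p' q' (kappaCod hp hq x) =
      kappaCod hp hq (TensorProduct.map (extMap f p) (symMap f q) x) :=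
  Subtype.ext (LinearMap.congr_fun (kappa_natural f hp hq) x).symm

theorem schurContract_kappaCod {p q p' q' p'' : ℤ} (hp : p = p' + 1) (hp' : p' = p'' + 1)
    (hq : q' = q + 1) (d : Module.Dual R G) (x : ext R G p ⊗[R] sym R G q) :
    kappaCod hp' hq (TensorProduct.map (contract hp d) LinearMap.id x) +
      schurContract hp' d q' (kappaCod hp hq x) = 0 :=
  Subtype.ext (kappa_contract hp hp' hq d x)

private theorem weylAct_etaCod {p q p' q' t : ℤ} (hp : p' = p + 1) (hq : q = q' + 1)
    (ht : q' = t + 1)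
    (v : G) (x : ext R (Module.Dual R G) p ⊗[R] divPow R G q) :
    weylAct ht v (etaCod hp hq x) =
      etaCod hp ht (TensorProduct.map LinearMap.id (divAct hq v) x) :=
  Subtype.ext (LinearMap.congr_fun (eta_comp_divAct hp hq hq ht ht v) x).symm

variable (σ : SplitOff R G G₁)

/-- The component of `L^p_q G → L^{p-1}_q G₁` that takes the coefficient of `e` in the exterior
factor and drops the terms divisible by `e` in the symmetric factor. -/
noncomputable def schurProjE {p p' : ℤ} (hp : p = p' + 1) (q : ℤ) :
    schur R G p q →ₗ[R] schur R G₁ p' q :=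
  schurMap σ.proj p' q ∘ₗ schurContract hp σ.ε q

/-- The map `K^a_q(G₁^*) → K^{a+1}_q(G^*)` given by the exterior product with `ε`. -/
noncomputable def weylIncE {a a' : ℤ} (ha : a' = 1 + a) (q : ℤ) :
    weyl R G₁ a q →ₗ[R] weyl R G a' q :=
  weylWedge ha σ.ε q ∘ₗ weylMap σ.proj a q

theorem schurProjE_coe {p p' : ℤ} (hp : p = p' + 1) (q : ℤ) (x : schur R G p q) :
    (schurProjE σ hp q x).1 = TensorProduct.map (σ.extProjE hp) (symMap σ.proj q) x.1 := by
  change TensorProduct.map _ _ (TensorProduct.map _ _ x.1) = _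
  rw [TensorProduct.map_map]
  rfl

private theorem weylIncE_coe {a a' : ℤ} (ha : a' = 1 + a) (q : ℤ) (x : weyl R G₁ a q) :
    (weylIncE σ ha q x).1 = TensorProduct.map (σ.dual.extIncE (ha.trans (add_comm 1 a)))
      (divMap σ.proj q) x.1 := by
  change TensorProduct.map _ _ (TensorProduct.map _ _ x.1) = _
  rw [TensorProduct.map_map]
  rfl

theorem schurMul_zero {p q q' : ℤ} (h : q' = q + 1) :
    schurMul (R := R) (G := G) (p := p) h 0 = 0 := (schurMulHom h).map_zero

private theorem weylAct_zero {p q q' : ℤ} (h : q = q' + 1) :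
    weylAct (R := R) (G := G) (p := p) h 0 = 0 := (weylActHom h).map_zero

theorem schurProjE_schurMul {p p' q q' : ℤ} (hp : p = p' + 1) (h : q' = q + 1) (v : G) :
    schurProjE σ hp q' ∘ₗ schurMul h v = schurMul h (σ.proj v) ∘ₗ schurProjE σ hp q := by
  rw [schurProjE, LinearMap.comp_assoc, schurContract_schurMul, ← LinearMap.comp_assoc,
    schurMap_schurMul, LinearMap.comp_assoc]
  rfl

private theorem weylAct_weylIncE {a a' q q' : ℤ} (ha : a' = 1 + a) (h : q = q' + 1) (v : G) :
    weylAct h v ∘ₗ weylIncE σ ha q = weylIncE σ ha q' ∘ₗ weylAct h (σ.proj v) := by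
  rw [weylIncE, ← LinearMap.comp_assoc, weylAct_weylWedge, LinearMap.comp_assoc,
    weylAct_weylMap, ← LinearMap.comp_assoc]
  rfl

/-- The two projections of `L^p_q G` to hook Schur modules of `G₁` are jointly surjective. -/
theorem exists_schurProj_eq {p p' q : ℤ} (hp : p = p' + 1) (hq : q ≠ 0) (x : schur R G₁ p' q)
    (y : schur R G₁ p q) :
    ∃ z : schur R G p q, schurProjE σ hp q z = x ∧ schurMap σ.proj p q z = y := by
  obtain ⟨w, rfl⟩ := kappaCod_surjective hp (q := q - 1) (by ring) (Or.inr hq) x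
  have hp1 : p + 1 = p + 1 := rfl
  have hq1 : q = q - 1 + 1 := by ring
  have e1 : schurProjE σ hp q (kappaCod hp1 hq1 (TensorProduct.map (σ.extIncE hp1)
      (symMap σ.inc (q - 1)) w)) + kappaCod hp hq1 w = 0 := by
    have h1 := congrArg (schurMap σ.proj p' q) (schurContract_kappaCod hp1 hp hq1 σ.ε
      (TensorProduct.map (σ.extIncE hp1) (symMap σ.inc (q - 1)) w))
    rw [map_add, map_zero, schurMap_kappaCod, TensorProduct.map_map, TensorProduct.map_map] at h1
    have h2 : (extMap σ.proj p ∘ₗ contract hp1 σ.ε) ∘ₗ σ.extIncE hp1 = LinearMap.id :=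
      σ.extProjE_extIncE hp1
    have h3 : (symMap σ.proj (q - 1) ∘ₗ LinearMap.id) ∘ₗ symMap σ.inc (q - 1) = LinearMap.id := by
      rw [LinearMap.comp_id, symMap_comp, σ.proj_comp_inc, symMap_id]
    rw [h2, h3, TensorProduct.map_id] at h1
    rwa [add_comm] at h1
  have e2 : schurMap σ.proj p q (kappaCod hp1 hq1 (TensorProduct.map (σ.extIncE hp1)
      (symMap σ.inc (q - 1)) w)) = 0 := by
    rw [schurMap_kappaCod, TensorProduct.map_map, σ.extProj_extIncE, TensorProduct.map_zero_left,
      LinearMap.zero_apply, map_zero]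
  have e3 : schurProjE σ hp q (schurMap σ.inc p q y) = 0 := by
    refine Subtype.ext ?_
    rw [schurProjE_coe]
    change TensorProduct.map _ _ (TensorProduct.map _ _ y.1) = 0
    rw [TensorProduct.map_map, σ.extProjE_extInc, TensorProduct.map_zero_left]
    rfl
  have e4 : schurMap σ.proj p q (schurMap σ.inc p q y) = y := by
    refine Subtype.ext ?_
    change TensorProduct.map _ _ (TensorProduct.map _ _ y.1) = y.1
    rw [TensorProduct.map_map, σ.extProj_extInc, symMap_comp, σ.proj_comp_inc, symMap_id,
      TensorProduct.map_id]
    rfl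
  refine ⟨schurMap σ.inc p q y + (-1 : R) • kappaCod hp1 hq1 (TensorProduct.map (σ.extIncE hp1)
      (symMap σ.inc (q - 1)) w), ?_, ?_⟩
  · rw [map_add, map_smul, e3, zero_add, neg_one_smul_eq_of_add_eq_zero e1]
  · rw [map_add, map_smul, e2, e4, smul_zero, add_zero]

/-- Multiplication by a basis vector is injective on `Sym G`, hence on hook Schur modules. -/
theorem schurMul_injective {p q q' : ℤ} (h : q' = q + 1) :
    Function.Injective (schurMul (R := R) (p := p) h σ.e) := by
  intro x y hxy
  have h1 := congrArg (TensorProduct.map (LinearMap.id : ext R G p →ₗ[R] _)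
    (symQuot σ.e σ.ε h)) (congrArg Subtype.val hxy)
  change TensorProduct.map _ _ (TensorProduct.map _ _ x.1) =
    TensorProduct.map _ _ (TensorProduct.map _ _ y.1) at h1
  rw [TensorProduct.map_map, TensorProduct.map_map, symQuot_symMul_self _ _ σ.ε_e,
    LinearMap.id_comp, TensorProduct.map_id] at h1
  exact Subtype.ext h1

/-- The common kernel of the two projections consists of the multiples of `e`. -/
theorem exists_schurMul_eq {p p' q q' : ℤ} (hp : p = p' + 1) (h : q' = q + 1)
    (z : schur R G p q') (h1 : schurProjE σ hp q' z = 0) (h2 : schurMap σ.proj p q' z = 0) :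
    ∃ y, schurMul h σ.e y = z := by
  have e1 : TensorProduct.map (LinearMap.id : ext R G p →ₗ[R] _) (symMap σ.proj q') z.1 = 0 := by
    rw [← σ.ext_decomp hp, TensorProduct.map_add_left, LinearMap.add_apply]
    have f1 : TensorProduct.map (extMap σ.proj p) (symMap σ.proj q') z.1 = 0 :=
      congrArg Subtype.val h2
    have f2 := congrArg Subtype.val h1
    rw [schurProjE_coe] at f2
    have f3 := TensorProduct.map_map (extMap σ.inc p) LinearMap.id (extMap σ.proj p)
      (symMap σ.proj q') z.1
    have f4 := TensorProduct.map_map (σ.extIncE hp) LinearMap.id (σ.extProjE hp)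
      (symMap σ.proj q') z.1
    rw [LinearMap.id_comp] at f3 f4
    rw [← f3, ← f4, f1, f2, ZeroMemClass.coe_zero, map_zero, map_zero, add_zero]
  have e2 : TensorProduct.map (LinearMap.id : ext R G p →ₗ[R] _) (symMul h σ.e)
      (TensorProduct.map LinearMap.id (symQuot σ.e σ.ε h) z.1) = z.1 := by
    have f1 := LinearMap.congr_fun (congrArg (TensorProduct.map (LinearMap.id : ext R G p →ₗ[R] _))
      (symMul_symQuot σ.e σ.ε h)) z.1
    have f2 := congrArg (TensorProduct.map (LinearMap.id : ext R G p →ₗ[R] _) (symMap σ.inc q')) e1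
    rw [TensorProduct.map_map, symMap_comp, ← σ.alongProj_eq, map_zero, LinearMap.id_comp] at f2
    rw [TensorProduct.map_add_right, LinearMap.add_apply, f2, add_zero, TensorProduct.map_id] at f1
    rw [TensorProduct.map_map, LinearMap.id_comp]
    exact f1
  refine ⟨⟨TensorProduct.map LinearMap.id (symQuot σ.e σ.ε h) z.1, ?_⟩, Subtype.ext e2⟩
  refine (mem_schur hp h).2 ?_
  have f1 := LinearMap.congr_fun (kappa_comp_symMul hp h h (rfl : q' + 1 = q' + 1) rfl σ.e)
    (TensorProduct.map LinearMap.id (symQuot σ.e σ.ε h) z.1)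
  rw [LinearMap.comp_apply, e2, (mem_schur hp rfl).1 z.2] at f1
  have f2 := congrArg (TensorProduct.map (LinearMap.id : ext R G p' →ₗ[R] _)
    (symQuot σ.e σ.ε (rfl : q' + 1 = q' + 1))) f1
  rw [LinearMap.comp_apply, map_zero, TensorProduct.map_map, symQuot_symMul_self _ _ σ.ε_e,
    LinearMap.id_comp, TensorProduct.map_id] at f2
  exact f2.symm

/-- The two maps from hook Weyl modules of `G₁` to `K^a_q(G^*)` are jointly injective. -/
private theorem weylInc_injective {a a' q : ℤ} (ha : a' = 1 + a) (x : weyl R G₁ a' q)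
    (y : weyl R G₁ a q)
    (h : weylMap σ.proj a' q x + weylIncE σ ha q y = 0) : x = 0 ∧ y = 0 := by
  have h1 : TensorProduct.map (extMap σ.proj.dualMap a') (divMap σ.proj q) x.1 +
      (weylIncE σ ha q y).1 = 0 := congrArg Subtype.val h
  rw [weylIncE_coe] at h1
  have hd : divMap σ.inc q ∘ₗ divMap σ.proj q = LinearMap.id := by
    rw [divMap_comp, σ.proj_comp_inc, divMap_id]
  have ha' := ha.trans (add_comm 1 a)
  have e1 : extMap σ.dual.proj a' ∘ₗ extMap σ.proj.dualMap a' = LinearMap.id :=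
    σ.dual.extProj_extInc a'
  have e2 := σ.dual.extProj_extIncE ha'
  have e3 : σ.dual.extProjE ha' ∘ₗ extMap σ.proj.dualMap a' = 0 := σ.dual.extProjE_extInc ha'
  have e4 := σ.dual.extProjE_extIncE ha'
  constructor
  · have h2 := congrArg (TensorProduct.map (extMap σ.dual.proj a') (divMap σ.inc q)) h1
    rw [map_add, TensorProduct.map_map, TensorProduct.map_map, e1, e2, hd,
      TensorProduct.map_zero_left, TensorProduct.map_id, map_zero, LinearMap.zero_apply,
      add_zero] at h2
    exact Subtype.ext h2
  · have h2 := congrArg (TensorProduct.map (σ.dual.extProjE ha') (divMap σ.inc q)) h1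
    rw [map_add, TensorProduct.map_map, TensorProduct.map_map, e3, e4, hd,
      TensorProduct.map_zero_left, TensorProduct.map_id, map_zero, LinearMap.zero_apply,
      zero_add] at h2
    exact Subtype.ext h2

/-- The kernel of the action of `e` on `K^a_q(G^*)` is the sum of the images of the two
inclusions. -/
private theorem exists_weylInc_eq {a a' q q' : ℤ} (ha : a' = 1 + a) (h : q = q' + 1)
    (z : weyl R G a' q) (hz : weylAct h σ.e z = 0) :
    ∃ x y, weylMap σ.proj a' q x + weylIncE σ ha q y = z := by
  have ha' := ha.trans (add_comm 1 a)
  have hz1 : TensorProduct.map LinearMap.id (divAct h σ.e) z.1 = 0 := congrArg Subtype.val hz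
  have hc : TensorProduct.map (contract ha' (Module.Dual.eval R G σ.e)) LinearMap.id z.1 ∈
      weyl R G a q := by
    refine (mem_weyl ha' h).2 ?_
    have f1 := eta_contract (rfl : a' + 1 = a' + 1) ha' h σ.e z.1
    have f2 := congrArg (TensorProduct.map (sgn a' • LinearMap.id :
      ext R (Module.Dual R G) a' →ₗ[R] _) LinearMap.id) hz1
    rw [TensorProduct.map_map, map_zero, LinearMap.comp_id, LinearMap.id_comp] at f2
    rw [f2, add_zero, (mem_weyl rfl h).1 z.2, map_zero] at f1
    exact f1.symm
  refine ⟨weylMap σ.inc a' q z, weylMap σ.inc a q ⟨_, hc⟩, Subtype.ext ?_⟩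
  have e1 : TensorProduct.map (LinearMap.id : ext R (Module.Dual R G) a' →ₗ[R] _)
      (divMap σ.proj q ∘ₗ divMap σ.inc q) z.1 = z.1 := by
    have f1 := LinearMap.congr_fun (congrArg (TensorProduct.map
      (LinearMap.id : ext R (Module.Dual R G) a' →ₗ[R] _)) (divLift_divAct σ.e σ.ε h)) z.1
    have f2 := congrArg (TensorProduct.map (LinearMap.id : ext R (Module.Dual R G) a' →ₗ[R] _)
      (divLift σ.e σ.ε h)) hz1
    rw [TensorProduct.map_map, map_zero, LinearMap.id_comp] at f2
    rw [TensorProduct.map_add_right, LinearMap.add_apply, f2, zero_add, TensorProduct.map_id] at f1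
    rw [divMap_comp, ← σ.alongProj_eq]
    exact f1
  have e2 := LinearMap.congr_fun (congrArg (fun α => TensorProduct.map α
    (divMap σ.proj q ∘ₗ divMap σ.inc q)) (σ.dual.ext_decomp ha')) z.1
  simp only [TensorProduct.map_add_left, LinearMap.add_apply, e1] at e2
  refine Eq.trans ?_ e2
  change TensorProduct.map _ _ (TensorProduct.map _ _ z.1) + (weylIncE σ ha q _).1 = _
  rw [weylIncE_coe]
  change _ + TensorProduct.map _ _ (TensorProduct.map _ _ (TensorProduct.map _ _ z.1)) = _
  rw [TensorProduct.map_map, TensorProduct.map_map, TensorProduct.map_map]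
  rfl

/-- The action of a basis vector is surjective on hook Weyl modules: lift along the surjection `η`,
on whose source the action is surjective. -/
private theorem weylAct_surjective {a q q' : ℤ} (h : q = q' + 1) (h0 : a ≠ 0 ∨ q' ≠ 0) :
    Function.Surjective (weylAct (R := R) (p := a) h σ.e) := by
  intro y
  have ha : a = a - 1 + 1 := by ring
  have hq : q + 1 = q + 1 := rfl
  obtain ⟨w, rfl⟩ := etaCod_surjective ha h h0 y
  refine ⟨etaCod ha hq (TensorProduct.map LinearMap.id (divLift σ.e σ.ε hq) w), ?_⟩
  rw [weylAct_etaCod, TensorProduct.map_map, divAct_divLift _ _ σ.ε_e, LinearMap.id_comp,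
    TensorProduct.map_id]
  rfl

theorem schur_eq_zero_of_neg {p q : ℤ} (hp : p < 0) (x : schur R G p q) : x = 0 :=
  Subtype.ext (tensor_eq_zero' (fun b => (subsingleton_ext_of_neg hp).elim b 0) x.1)

theorem weyl_eq_zero_of_lt {a q : ℤ} (ha : (Module.finrank R G : ℤ) < a) (x : weyl R G a q) :
    x = 0 :=
  Subtype.ext (tensor_eq_zero' (fun b => Subtype.ext (ext_eq_zero ha b)) x.1)

theorem weyl_neg_eq_zero {a q : ℤ} (hq : q < 0) (x : weyl R G a q) : x = 0 := by
  obtain ⟨n, rfl⟩ := Int.eq_negSucc_of_lt_zero hq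
  refine Subtype.ext (tensor_eq_zero (fun b => ?_) x.1)
  have : Subsingleton (sym R G (Int.negSucc n)) := ⟨fun s t => Subtype.ext (s.2.trans t.2.symm)⟩
  exact Subsingleton.elim (α := Module.Dual R (sym R G (Int.negSucc n))) _ _

theorem weyl_zero_eq {q : ℤ} (hq : q ≠ 0) (x : weyl R G 0 q) : x = 0 := by
  obtain ⟨y, rfl⟩ := etaCod_surjective (p := -1) (by ring) (rfl : q + 1 = q + 1) (Or.inr hq) x
  rw [tensor_eq_zero' (fun b => (subsingleton_ext_of_neg (by norm_num)).elim b 0) y, map_zero]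

theorem ext_eq_zero_of_lt {n : ℤ} (hn : (Module.finrank R G : ℤ) < n) (x : ext R G n) : x = 0 := by
  rcases subsingleton_or_nontrivial R with hR | hR
  · have := Module.subsingleton R (ext R G n)
    exact Subsingleton.elim _ _
  have h1 : extMap (Module.evalEquiv R G).toLinearMap n x = 0 := by
    refine Subtype.ext (ext_eq_zero ?_ _)
    have h2 : Module.finrank R (Module.Dual R G) = Module.finrank R G :=
      Module.finrank_linearMap_self R R G
    rwa [h2]
  have h2 := LinearMap.congr_fun (extMap_comp (Module.evalEquiv R G).toLinearMap
    (Module.evalEquiv R G).symm.toLinearMap n) x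
  rw [LinearMap.comp_apply, h1, map_zero] at h2
  rw [LinearEquiv.comp_coe, LinearEquiv.self_trans_symm, LinearEquiv.refl_toLinearMap,
    extMap_id] at h2
  exact h2.symm

theorem schur_eq_zero_of_le {p q : ℤ} (hp : (Module.finrank R G : ℤ) ≤ p) (hq : q ≠ 0)
    (x : schur R G p q) : x = 0 := by
  obtain ⟨y, rfl⟩ := kappaCod_surjective (rfl : p + 1 = p + 1) (q := q - 1) (by ring)
    (Or.inr hq) x
  rw [tensor_eq_zero' (fun b => ext_eq_zero_of_lt (by omega) b) y, map_zero]

end SplitHooks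

/-! ### The canonical element of `⋀ˢ(G^*) ⊗ ⋀ˢ G` -/

section Canonical

variable {R : Type*} [CommRing R] {G G₁ X : Type*} [AddCommGroup G] [Module R G]
  [AddCommGroup G₁] [Module R G₁] [AddCommMonoid X] [Module R X]

theorem pairingDual_map (f : G →ₗ[R] G₁) (n : ℕ) (y : ⋀[R]^n (Module.Dual R G₁))
    (x : ⋀[R]^n G) :
    exteriorPower.pairingDual R G n (exteriorPower.map n f.dualMap y) x =
      exteriorPower.pairingDual R G₁ n y (exteriorPower.map n f x) := by
  have h : exteriorPower.pairingDual R G n ∘ₗ exteriorPower.map n f.dualMap =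
      (exteriorPower.map n f).dualMap ∘ₗ exteriorPower.pairingDual R G₁ n := by
    ext c v
    simp
  exact LinearMap.congr_fun (LinearMap.congr_fun h y) x

/-- The expansion of an element of `⋀ⁿ(G^*)` in the basis dual to the standard basis of `⋀ⁿ G`. -/
theorem sum_pairingDual_smul {m n : ℕ} (b : Module.Basis (Fin m) R G)
    (y : ⋀[R]^n (Module.Dual R G)) :
    ∑ S, exteriorPower.pairingDual R G n y (b.exteriorPower n S) •
      exteriorPower.ιMulti_family R n b.coord S = y := by
  have hd : ⇑b.dualBasis = b.coord := b.coe_dualBasis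
  have h : LinearMap.id = ∑ S, ((Module.Dual.eval R _ (b.exteriorPower n S)) ∘ₗ
      exteriorPower.pairingDual R G n).smulRight (exteriorPower.ιMulti_family R n b.coord S) := by
    refine (b.dualBasis.exteriorPower n).ext fun T => ?_
    rw [exteriorPower.basis_apply, LinearMap.sum_apply, Finset.sum_eq_single T]
    · have h1 := exteriorPower.ιMultiDual_apply_diag R n b T
      rw [exteriorPower.ιMultiDual] at h1
      simp [hd, h1]
    · intro S _ hS
      have h1 := exteriorPower.ιMultiDual_apply_nondiag R n b T S hS.symm
      rw [exteriorPower.ιMultiDual] at h1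
      simp [hd, h1]
    · simp
  conv_rhs => rw [← LinearMap.id_apply (R := R) y, h]
  rw [LinearMap.sum_apply]
  rfl

theorem sum_ιMulti_family_natural {m m₁ n : ℕ} (b : Module.Basis (Fin m) R G)
    (c : Module.Basis (Fin m₁) R G₁) (f : G →ₗ[R] G₁)
    (B : ⋀[R]^n (Module.Dual R G) →ₗ[R] ⋀[R]^n G₁ →ₗ[R] X) :
    ∑ S, B (exteriorPower.ιMulti_family R n b.coord S)
        (exteriorPower.map n f (exteriorPower.ιMulti_family R n b S)) =
      ∑ T, B (exteriorPower.map n f.dualMap (exteriorPower.ιMulti_family R n c.coord T))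
        (exteriorPower.ιMulti_family R n c T) := by
  have h1 (T) : exteriorPower.map n f.dualMap (exteriorPower.ιMulti_family R n c.coord T) =
      ∑ S, (c.exteriorPower n).repr (exteriorPower.map n f (exteriorPower.ιMulti_family R n b S)) T
        • exteriorPower.ιMulti_family R n b.coord S := by
    conv_lhs => rw [← sum_pairingDual_smul b (exteriorPower.map n f.dualMap _)]
    refine Finset.sum_congr rfl fun S _ => ?_
    rw [pairingDual_map, exteriorPower.basis_repr_apply, exteriorPower.ιMultiDual,
      exteriorPower.basis_apply]
  have h2 (S) := (c.exteriorPower n).sum_repr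
    (exteriorPower.map n f (exteriorPower.ιMulti_family R n b S))
  simp only [exteriorPower.basis_apply] at h2
  simp only [h1, map_sum, LinearMap.sum_apply, map_smul, LinearMap.smul_apply]
  rw [Finset.sum_comm]
  refine Finset.sum_congr rfl fun S _ => ?_
  conv_lhs => rw [← h2 S]
  simp only [map_sum, map_smul]

/-- The two indexings of the standard basis of an exterior power. -/
def cardEquiv (m n : ℕ) : {S : Finset (Fin m) // (S.card : ℤ) = Int.ofNat n} ≃
    Set.powersetCard (Fin m) n :=
  Equiv.subtypeEquivRight fun _ => Int.ofNat_inj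

theorem wedgeProd_eq_ιMulti_family {m n : ℕ} (v : Fin m → G)
    (S : {S : Finset (Fin m) // (S.card : ℤ) = Int.ofNat n}) :
    wedgeProd v S = exteriorPower.ιMulti_family R n v (cardEquiv m n S) :=
  Subtype.ext (ιMulti_family_congr v _ _ rfl)

theorem extMap_eq_map {n : ℕ} (h : G →ₗ[R] G₁) (x : ⋀[R]^n G) :
    extMap h (Int.ofNat n) x = exteriorPower.map n h x := by
  have h1 : (ExteriorAlgebra.map h).toLinearMap ∘ₗ (⋀[R]^n G).subtype =
      (⋀[R]^n G₁).subtype ∘ₗ exteriorPower.map n h := by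
    refine exteriorPower.linearMap_ext ?_
    ext v
    simp
  exact Subtype.ext (LinearMap.congr_fun h1 x)

/-- Naturality in `G` of the canonical element of `⋀ˢ(G^*) ⊗ ⋀ˢ G`. -/
theorem sum_wedgeProd_natural {m m₁ : ℕ} {s : ℤ} (b : Module.Basis (Fin m) R G)
    (c : Module.Basis (Fin m₁) R G₁) (f : G →ₗ[R] G₁)
    (B : ext R (Module.Dual R G) s →ₗ[R] ext R G₁ s →ₗ[R] X) :
    ∑ S : {S : Finset (Fin m) // (S.card : ℤ) = s},
        B (wedgeProd b.coord S) (extMap f s (wedgeProd b S)) =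
      ∑ T : {S : Finset (Fin m₁) // (S.card : ℤ) = s},
        B (extMap f.dualMap s (wedgeProd c.coord T)) (wedgeProd c T) := by
  rcases s with n | n
  · refine Eq.trans ?_ ((sum_ιMulti_family_natural (n := n) b c f B).trans ?_)
    · exact Fintype.sum_equiv (cardEquiv m n) _ _ fun S =>
        congrArg₂ (fun x y => B x y) (wedgeProd_eq_ιMulti_family _ S)
          ((congrArg (extMap f _) (wedgeProd_eq_ιMulti_family _ S)).trans (extMap_eq_map f _))
    · exact (Fintype.sum_equiv (cardEquiv m₁ n) _ _ fun S =>
        congrArg₂ (fun x y => B x y) ((congrArg (extMap f.dualMap _)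
          (wedgeProd_eq_ιMulti_family _ S)).trans (extMap_eq_map f.dualMap _))
          (wedgeProd_eq_ιMulti_family _ S)).symm
  · have h (k : ℕ) : IsEmpty {S : Finset (Fin k) // (S.card : ℤ) = Int.negSucc n} :=
      ⟨fun S => by have := S.2; omega⟩
    rw [Finset.sum_of_isEmpty, Finset.sum_of_isEmpty]

/-- Contraction of the second factor of the canonical element of `⋀ˢ(G^*) ⊗ ⋀ˢ G` by a linear
form agrees with exterior multiplication of the first factor by this form. -/
theorem sum_wedgeProd_contract {m : ℕ} {s s' : ℤ} (h : s' = 1 + s) (h' : s' = s + 1)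
    (b : Module.Basis (Fin m) R G) (d : Module.Dual R G)
    (B : ext R (Module.Dual R G) s' →ₗ[R] ext R G s →ₗ[R] X) :
    ∑ T : {S : Finset (Fin m) // (S.card : ℤ) = s'},
        B (wedgeProd b.coord T) (contract h' d (wedgeProd b T)) =
      ∑ S : {S : Finset (Fin m) // (S.card : ℤ) = s},
        B (wedgeLeft h d (wedgeProd b.coord S)) (wedgeProd b S) := by
  have hd : d = ∑ l, d (b l) • b.coord l := b.ext fun i => by simp
  have h1 (x : ext R G s') : contract h' d x = ∑ l, d (b l) • contract h' (b.coord l) x := by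
    have := congrArg (fun c => contractHom h' c x) hd
    simp only [map_sum, map_smul, LinearMap.sum_apply, LinearMap.smul_apply] at this
    exact this
  have h2 (x : ext R (Module.Dual R G) s) :
      wedgeLeft h d x = ∑ l, d (b l) • wedgeLeft h (b.coord l) x := by
    refine Subtype.ext ?_
    have := congrArg (fun c => ExteriorAlgebra.ι R c * x.1) hd
    simp only [map_sum, map_smul, Finset.sum_mul, smul_mul_assoc] at this
    refine this.trans ?_
    rw [AddSubmonoidClass.coe_finsetSum]
    rfl
  simp only [h1, h2, map_sum, map_smul, LinearMap.sum_apply, LinearMap.smul_apply]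
  rw [Finset.sum_comm]
  conv_rhs => rw [Finset.sum_comm]
  refine Finset.sum_congr rfl fun l _ => ?_
  rw [← Finset.smul_sum, ← Finset.smul_sum]
  congr 1
  let := Module.addCommMonoidToAddCommGroup R (M := X)
  exact (sum_wedge_contract h h' B b.coord b l (b.coord l) fun k => by
    rw [Module.Basis.coord_apply, Module.Basis.repr_self, Finsupp.single_apply]).symm

theorem ι_eq_wedgeProd {m : ℕ} (v : Fin m → G) (l : Fin m) :
    (⟨ExteriorAlgebra.ι R (v l), ι_mem_ext _⟩ : ext R G 1) = wedgeProd v ⟨{l}, by simp⟩ :=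
  Subtype.ext ((ι_eq_ιMulti_family v l).trans (ιMulti_family_congr v _ _ rfl))

theorem sum_wedgeProd_one {m : ℕ} {s : ℤ} (hs : 1 = s) (b : Module.Basis (Fin m) R G)
    (B : ext R (Module.Dual R G) s →ₗ[R] ext R G s →ₗ[R] X) :
    ∑ S : {S : Finset (Fin m) // (S.card : ℤ) = s}, B (wedgeProd b.coord S) (wedgeProd b S) =
      ∑ l, B ⟨ExteriorAlgebra.ι R (b.coord l), hs ▸ ι_mem_ext _⟩
        ⟨ExteriorAlgebra.ι R (b l), hs ▸ ι_mem_ext _⟩ := by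
  subst hs
  symm
  refine Fintype.sum_bijective (fun l : Fin m => (⟨{l}, by simp⟩ :
    {S : Finset (Fin m) // (S.card : ℤ) = 1})) ⟨fun i j hij => ?_, fun S => ?_⟩ _ _ fun l =>
    congrArg₂ (fun x y => B x y) (ι_eq_wedgeProd b.coord l) (ι_eq_wedgeProd b l)
  · exact Finset.singleton_injective (congrArg Subtype.val hij)
  · obtain ⟨l, hl⟩ := Finset.card_eq_one.1 (Nat.cast_eq_one.1 S.2 : S.1.card = 1)
    exact ⟨l, Subtype.ext hl.symm⟩

end Canonical

/-! ### The differentials after splitting off an isomorphism of rank one -/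

theorem map_zsmul_id {R A N N' : Type*} [CommRing R] [AddCommGroup A] [Module R A]
    [AddCommMonoid N] [Module R N] [AddCommMonoid N'] [Module R N'] (n : ℤ) (f : N →ₗ[R] N')
    (y : A ⊗[R] N) : TensorProduct.map (n • (LinearMap.id : A →ₗ[R] A)) f y =
      (n : R) • TensorProduct.map LinearMap.id f y := by
  rw [← Int.cast_smul_eq_zsmul R n (LinearMap.id : A →ₗ[R] A), TensorProduct.map_smul_left,
    LinearMap.smul_apply]

section ExtSplit

variable {R : Type*} [CommRing R] {F F₁ : Type*} [AddCommGroup F] [Module R F]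
  [AddCommGroup F₁] [Module R F₁] (τ : SplitOff R F F₁)

theorem wedge_zero {r r' : ℤ} (h : r' = r + 1) : wedge (R := R) h (0 : F) = 0 :=
  (wedgeHom h).map_zero

theorem extProjE_wedge_e {r s : ℤ} (h : r = s + 1) (h' : r + 1 = r + 1) :
    τ.extProjE h' ∘ₗ wedge h' τ.e = sgn r • extMap τ.proj r := by
  rw [SplitOff.extProjE, LinearMap.comp_assoc, contract_wedge h' h, LinearMap.comp_add,
    ← LinearMap.comp_assoc, extMap_wedge, τ.proj_e, wedge_zero, τ.ε_e, one_smul]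
  refine LinearMap.ext fun x => ?_
  simp only [LinearMap.add_apply, LinearMap.comp_apply, LinearMap.zero_apply, LinearMap.smul_apply,
    zero_add, map_zsmul, LinearMap.id_apply]

theorem extProjE_wedge_inc {r r' s : ℤ} (h : r = s + 1) (h' : r' = r + 1) (v : F₁) :
    τ.extProjE h' ∘ₗ wedge h' (τ.inc v) = wedge h v ∘ₗ τ.extProjE h := by
  rw [SplitOff.extProjE, LinearMap.comp_assoc, contract_wedge h' h, LinearMap.comp_add,
    ← LinearMap.comp_assoc, extMap_wedge, τ.proj_inc, τ.ε_inc, zero_smul]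
  refine LinearMap.ext fun x => ?_
  simp only [LinearMap.add_apply, LinearMap.comp_apply, LinearMap.zero_apply,
    add_zero, smul_zero, map_zero]
  rfl

theorem extProjE_wedge_extInc {r r' : ℤ} (h' : r' = r + 1) (v : F) :
    τ.extProjE h' ∘ₗ wedge h' v ∘ₗ extMap τ.inc r = τ.ε v • sgn r • LinearMap.id := by
  have h : r = r - 1 + 1 := by ring
  rw [← LinearMap.comp_assoc, SplitOff.extProjE, LinearMap.comp_assoc (wedge h' v),
    contract_wedge h' h]
  refine LinearMap.ext fun x => ?_
  have h1 := LinearMap.congr_fun (τ.contract_extInc h) x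
  have h2 := LinearMap.congr_fun (τ.extProj_extInc r) x
  simp only [LinearMap.comp_apply, LinearMap.zero_apply, LinearMap.id_apply] at h1 h2
  simp only [LinearMap.add_apply, LinearMap.comp_apply, LinearMap.smul_apply, h1, map_zero,
    zero_add, map_zsmul, map_smul, LinearMap.id_apply, h2]
  rw [smul_comm]

theorem contractLeft_mul_map_inc (x : ExteriorAlgebra R F) (y : ExteriorAlgebra R F₁) :
    CliffordAlgebra.contractLeft (Q := (0 : QuadraticForm R F)) τ.ε
      (x * ExteriorAlgebra.map τ.inc y) =
      CliffordAlgebra.contractLeft (Q := (0 : QuadraticForm R F)) τ.ε x *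
        ExteriorAlgebra.map τ.inc y := by
  induction x using CliffordAlgebra.left_induction with
  | algebraMap c =>
    have h0 := contractLeft_map τ.inc τ.ε y
    rw [τ.ε_comp_inc, map_zero] at h0
    have h1 := contractLeft_algebraMap' τ.ε c
    have h2 : (algebraMap R (ExteriorAlgebra R F) c) * ExteriorAlgebra.map τ.inc y =
      c • ExteriorAlgebra.map τ.inc y := (Algebra.smul_def _ _).symm
    refine (congrArg _ h2).trans ?_
    rw [map_smul, h0]
    refine Eq.trans ?_ (congrArg (· * ExteriorAlgebra.map τ.inc y) h1).symm
    rw [zero_mul, LinearMap.zero_apply, map_zero, smul_zero]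
  | add x x' hx hx' => simp only [add_mul, map_add, hx, hx']
  | ι_mul x v hx =>
    have h1 := contractLeft_ι_mul' τ.ε v x
    refine Eq.trans ?_ (congrArg (· * ExteriorAlgebra.map τ.inc y) h1).symm
    have h2 := contractLeft_ι_mul' τ.ε v (x * ExteriorAlgebra.map τ.inc y)
    refine (congrArg _ (mul_assoc (ExteriorAlgebra.ι R v) x _)).trans (h2.trans ?_)
    rw [hx, sub_mul, smul_mul_assoc, mul_assoc]

/-- Taking the coefficient of `e` is linear over `⋀ F₁`, acting from the right. -/
theorem extProjE_extMul {r r₁ t s s₁ : ℤ} (h : s = r + t) (h₁ : s₁ = r₁ + t) (hr : r = r₁ + 1)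
    (hs : s = s₁ + 1) (x : ext R F r) (y : ext R F₁ t) :
    τ.extProjE hs (extMul h x (extMap τ.inc t y)) = extMul h₁ (τ.extProjE hr x) y := by
  refine Subtype.ext ?_
  change ExteriorAlgebra.map τ.proj (CliffordAlgebra.contractLeft (Q := (0 : QuadraticForm R F)) τ.ε
    (x.1 * ExteriorAlgebra.map τ.inc y.1)) = ExteriorAlgebra.map τ.proj
      (CliffordAlgebra.contractLeft (Q := (0 : QuadraticForm R F)) τ.ε x.1) * y.1
  rw [contractLeft_mul_map_inc τ x.1 y.1]
  refine (map_mul (ExteriorAlgebra.map τ.proj) _ _).trans ?_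
  congr 1
  exact congrArg Subtype.val (LinearMap.congr_fun (τ.extProj_extInc t) y)

end ExtSplit

section Differentials

variable {R : Type*} [CommRing R] {G G₁ F F₁ : Type*} [AddCommGroup G] [Module R G]
  [AddCommGroup G₁] [Module R G₁] [AddCommGroup F] [Module R F]
  [AddCommGroup F₁] [Module R F₁]
  [Module.Free R G] [Module.Finite R G] [Module.Free R G₁] [Module.Finite R G₁]
  {σ : SplitOff R G G₁} {τ : SplitOff R F F₁} {Φ : Module.Dual R G →ₗ[R] F}
  {Φ₁ : Module.Dual R G₁ →ₗ[R] F₁}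

/-- The map `Φ` is the direct sum of `Φ₁` and of the isomorphism of rank one that takes the
coordinate `ε` of `G` to the generator `e` of the complement of `F₁`. -/
def IsSplit (σ : SplitOff R G G₁) (τ : SplitOff R F F₁) (Φ : Module.Dual R G →ₗ[R] F)
    (Φ₁ : Module.Dual R G₁ →ₗ[R] F₁) : Prop :=
  ∀ ψ, Φ ψ = τ.inc (Φ₁ (ψ ∘ₗ σ.inc)) + ψ σ.e • τ.e

theorem IsSplit.comp_proj (H : IsSplit σ τ Φ Φ₁) (γ : Module.Dual R G₁) :
    Φ (γ ∘ₗ σ.proj) = τ.inc (Φ₁ γ) := by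
  rw [H, LinearMap.comp_assoc, σ.proj_comp_inc, LinearMap.comp_id, LinearMap.comp_apply, σ.proj_e,
    map_zero, zero_smul, add_zero]

theorem IsSplit.apply_ε (H : IsSplit σ τ Φ Φ₁) : Φ σ.ε = τ.e := by
  rw [H, σ.ε_comp_inc, map_zero, map_zero, zero_add, σ.ε_e, one_smul]

theorem IsSplit.ε_apply (H : IsSplit σ τ Φ Φ₁) (ψ : Module.Dual R G) : τ.ε (Φ ψ) = ψ σ.e := by
  rw [H, map_add, τ.ε_inc, zero_add, map_smul, τ.ε_e, smul_eq_mul, mul_one]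

theorem IsSplit.comp_dualMap (H : IsSplit σ τ Φ Φ₁) : Φ ∘ₗ σ.proj.dualMap = τ.inc ∘ₗ Φ₁ :=
  LinearMap.ext (IsSplit.comp_proj H)

private theorem kosMap_eq_koszulMap {r r' p q q' : ℤ} (hr : r' = r + 1) (hq : q' = q + 1) :
    kosMap Φ (p := p) hr hq = koszulMap (wedgeHom hr ∘ₗ Φ) (schurMulHom hq) := rfl

private theorem etaMap_eq_koszulMap {r r' p q q' : ℤ} (hr : r' = r + 1) (hq : q = q' + 1) :
    etaMap Φ (p := p) hr hq = koszulMap (wedgeHom hr ∘ₗ Φ) (weylActHom hq) := rfl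

/-- The component of the differential from `⋀ F₁` to `e ∧ ⋀ F₁` is, up to sign, the action
of `e ∈ G` on the second factor. -/
theorem IsSplit.map_koszulMap (H : IsSplit σ τ Φ Φ₁) {N N' : Type*} [AddCommMonoid N] [Module R N]
    [AddCommMonoid N']
    [Module R N'] {r r' : ℤ} (hr : r' = r + 1) (s : G →ₗ[R] N →ₗ[R] N') (y : ext R F₁ r ⊗[R] N) :
    TensorProduct.map (τ.extProjE hr) LinearMap.id (koszulMap (wedgeHom hr ∘ₗ Φ) s
      (TensorProduct.map (extMap τ.inc r) LinearMap.id y)) =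
        ((sgn r : ℤ) : R) • TensorProduct.map LinearMap.id (s σ.e) y := by
  have h1 := koszulMap_smulRight σ.e (sgn r • (LinearMap.id : ext R F₁ r →ₗ[R] _)) s
  have h3 : koszulMap ((Module.Dual.eval R G σ.e).smulRight
      (sgn r • (LinearMap.id : ext R F₁ r →ₗ[R] _))) s = TensorProduct.map (τ.extProjE hr)
        LinearMap.id ∘ₗ koszulMap (wedgeHom hr ∘ₗ Φ) s ∘ₗ
          TensorProduct.map (extMap τ.inc r) LinearMap.id := by
    simp only [koszulMap, sum_comp', comp_sum', ← TensorProduct.map_comp, LinearMap.id_comp,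
      LinearMap.comp_id]
    refine Finset.sum_congr rfl fun l _ => ?_
    congr 1
    have h4 := extProjE_wedge_extInc τ hr (Φ ((freeBasis R G).coord l))
    rw [IsSplit.ε_apply H] at h4
    exact h4.symm
  have h5 := LinearMap.congr_fun (h3.symm.trans h1) y
  refine h5.trans ?_
  exact map_zsmul_id _ _ y

/-- The projection of `⋀ F ⊗ L^p_q G` to `⋀ F₁ ⊗ L^p_q G₁`, which takes the coefficient of `e` in `⋀
F`, commutes with the differentials. -/
private theorem IsSplit.schurProj_kosMap (H : IsSplit σ τ Φ Φ₁) {r r₁ r' p q q' : ℤ}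
    (hr : r' = r + 1) (hr₁ : r = r₁ + 1)
    (hq : q' = q + 1) :
    TensorProduct.map (τ.extProjE hr) (schurMap σ.proj p q') ∘ₗ kosMap Φ hr hq =
      kosMap Φ₁ hr₁ hq ∘ₗ TensorProduct.map (τ.extProjE hr₁) (schurMap σ.proj p q) := by
  rw [kosMap_eq_koszulMap, kosMap_eq_koszulMap]
  refine (koszulMap_natural σ.proj ?_ ?_).symm
  · intro γ
    have h := extProjE_wedge_inc τ hr₁ hr (Φ₁ γ)
    rw [← IsSplit.comp_proj H] at h
    exact h.symm
  · intro v
    exact (schurMap_schurMul σ.proj hq v).symm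

/-- The projection of `⋀ F ⊗ L^p_q G` to `⋀ F₁ ⊗ L^{p-1}_q G₁`, which takes the coefficient of `e`
in both exterior powers, commutes with the differentials. -/
private theorem IsSplit.schurProjE_kosMap (H : IsSplit σ τ Φ Φ₁) {r r₁ r' p p' q q' : ℤ}
    (hr : r' = r + 1) (hr₁ : r = r₁ + 1)
    (hp : p = p' + 1) (hq : q' = q + 1) :
    TensorProduct.map (τ.extProjE hr) (schurProjE σ hp q') ∘ₗ kosMap Φ hr hq =
      kosMap Φ₁ hr₁ hq ∘ₗ TensorProduct.map (τ.extProjE hr₁) (schurProjE σ hp q) := by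
  rw [kosMap_eq_koszulMap, kosMap_eq_koszulMap]
  refine (koszulMap_natural σ.proj ?_ ?_).symm
  · intro γ
    have h := extProjE_wedge_inc τ hr₁ hr (Φ₁ γ)
    rw [← IsSplit.comp_proj H] at h
    exact h.symm
  · intro v
    exact (schurProjE_schurMul σ hp hq v).symm

/-- The inclusion of `⋀ F₁ ⊗ K^a_q(G₁^*)` commutes with the differentials. -/
private theorem IsSplit.etaMap_weylMap (H : IsSplit σ τ Φ Φ₁) {r r' a q q' : ℤ} (hr : r' = r + 1)
    (hq : q = q' + 1) :
    etaMap Φ hr hq ∘ₗ TensorProduct.map (extMap τ.inc r) (weylMap σ.proj a q) =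
      TensorProduct.map (extMap τ.inc r') (weylMap σ.proj a q') ∘ₗ etaMap Φ₁ hr hq := by
  rw [etaMap_eq_koszulMap, etaMap_eq_koszulMap]
  refine koszulMap_natural' σ.proj ?_ ?_
  · intro γ
    have h := extMap_wedge τ.inc hr (Φ₁ γ)
    rw [← IsSplit.comp_proj H] at h
    exact h.symm
  · intro v
    exact weylAct_weylMap σ.proj hq v

/-- The inclusion of `⋀ F₁ ⊗ K^{a-1}_q(G₁^*)` given by the exterior product with `ε` commutes with
the differentials. -/
private theorem IsSplit.etaMap_weylIncE (H : IsSplit σ τ Φ Φ₁) {r r' a a' q q' : ℤ}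
    (hr : r' = r + 1) (ha : a' = 1 + a)
    (hq : q = q' + 1) :
    etaMap Φ hr hq ∘ₗ TensorProduct.map (extMap τ.inc r) (weylIncE σ ha q) =
      TensorProduct.map (extMap τ.inc r') (weylIncE σ ha q') ∘ₗ etaMap Φ₁ hr hq := by
  rw [etaMap_eq_koszulMap, etaMap_eq_koszulMap]
  refine koszulMap_natural' σ.proj ?_ ?_
  · intro γ
    have h := extMap_wedge τ.inc hr (Φ₁ γ)
    rw [← IsSplit.comp_proj H] at h
    exact h.symm
  · intro v
    exact weylAct_weylIncE σ ha hq v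

private theorem weylZero_weylIncE {a a' : ℤ} (ha : a' = 1 + a) :
    weylZero a' ∘ₗ weylIncE σ ha 0 =
      wedgeLeft ha σ.ε ∘ₗ extMap σ.proj.dualMap a ∘ₗ weylZero a := by
  have h1 : ∀ x : weyl R G a 0, weylZero a' (weylWedge ha σ.ε 0 x) =
      wedgeLeft ha σ.ε (weylZero a x) := fun x => by
    change evalZero R G a' (TensorProduct.map _ _ x.1) = wedgeLeft ha σ.ε (evalZero R G a x.1)
    induction x.1 using TensorProduct.induction_on with
    | zero => simp only [map_zero]
    | add x y hx hy => simp only [map_add, hx, hy]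
    | tmul x φ => simp [evalZero]
  rw [← weylZero_weylMap]
  exact LinearMap.ext fun x => h1 _

private theorem IsSplit.spliceIn_weylMap (H : IsSplit σ τ Φ Φ₁) {r r' a : ℤ} (h : r' = r + a) :
    spliceIn Φ h ∘ₗ TensorProduct.map (extMap τ.inc r) (weylMap σ.proj a 0) =
      extMap τ.inc r' ∘ₗ spliceIn Φ₁ h := by
  refine TensorProduct.ext' fun x k => Subtype.ext ?_
  have h1 := LinearMap.congr_fun (weylZero_weylMap σ.proj a) k
  rw [LinearMap.comp_apply, LinearMap.comp_apply] at h1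
  have h2 := LinearMap.congr_fun (extMap_comp σ.proj.dualMap Φ a) (weylZero a k)
  rw [IsSplit.comp_dualMap H, ← extMap_comp] at h2
  change ExteriorAlgebra.map τ.inc x.1 * ExteriorAlgebra.map Φ
    (weylZero a (weylMap σ.proj a 0 k)).1 =
    ExteriorAlgebra.map τ.inc (x.1 * ExteriorAlgebra.map Φ₁ (weylZero a k).1)
  rw [h1, map_mul]
  congr 1
  exact congrArg Subtype.val h2

set_option maxHeartbeats 1000000 in
private theorem IsSplit.spliceIn_weylIncE (H : IsSplit σ τ Φ Φ₁) {r r' r'' a a' : ℤ}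
    (ha : a' = 1 + a) (h : r'' = r + a')
    (h' : r' = r + a) (hr : r'' = r' + 1) :
    spliceIn Φ h ∘ₗ TensorProduct.map (extMap τ.inc r) (weylIncE σ ha 0) =
      sgn r • τ.extIncE hr ∘ₗ spliceIn Φ₁ h' := by
  refine TensorProduct.ext' fun x k => Subtype.ext ?_
  have h1 := LinearMap.congr_fun (weylZero_weylIncE (σ := σ) ha) k
  rw [LinearMap.comp_apply, LinearMap.comp_apply, LinearMap.comp_apply] at h1
  have h2 := LinearMap.congr_fun (extMap_comp σ.proj.dualMap Φ a) (weylZero a k)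
  rw [IsSplit.comp_dualMap H, ← extMap_comp] at h2
  replace h2 : ExteriorAlgebra.map Φ (extMap σ.proj.dualMap a (weylZero a k)).1 =
    ExteriorAlgebra.map τ.inc (ExteriorAlgebra.map Φ₁ (weylZero a k).1) := congrArg Subtype.val h2
  change ExteriorAlgebra.map τ.inc x.1 * ExteriorAlgebra.map Φ (weylZero a' (weylIncE σ ha 0 k)).1 =
    sgn r • (ExteriorAlgebra.ι R τ.e * ExteriorAlgebra.map τ.inc
      (x.1 * ExteriorAlgebra.map Φ₁ (weylZero a k).1))
  rw [h1]
  change ExteriorAlgebra.map τ.inc x.1 * ExteriorAlgebra.map Φ (ExteriorAlgebra.ι R σ.ε *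
    (extMap σ.proj.dualMap a (weylZero a k)).1) = _
  rw [map_mul, h2, ExteriorAlgebra.map_apply_ι, IsSplit.apply_ε H, map_mul, ← mul_assoc,
    ← mul_assoc, ι_mul_eq_sgn_smul τ.e (map_mem_ext τ.inc x.2), smul_mul_assoc, smul_smul,
    sgn_mul_self, one_smul]

private theorem IsSplit.schurProj_spliceOut (H : IsSplit σ τ Φ Φ₁) {r r₁ r' r₁' p : ℤ}
    (h : r' = r + (p + 1))
    (h₁ : r₁' = r₁ + (p + 1)) (hr : r = r₁ + 1) (hr' : r' = r₁' + 1) :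
    TensorProduct.map (τ.extProjE hr') (schurMap σ.proj p 1) ∘ₗ spliceOut Φ h =
      spliceOut Φ₁ h₁ ∘ₗ τ.extProjE hr := by
  refine LinearMap.ext fun f => ?_
  rw [LinearMap.comp_apply, LinearMap.comp_apply, spliceOut_apply, spliceOut_apply, map_sum]
  let B : ext R (Module.Dual R G) (p + 1) →ₗ[R] ext R G₁ (p + 1) →ₗ[R]
      ext R F₁ r₁' ⊗[R] schur R G₁ p 1 :=
    (TensorProduct.mk R _ _).compl₁₂ (τ.extProjE hr' ∘ₗ extMul h f ∘ₗ extMap Φ (p + 1))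
      (kappaZero rfl)
  have key := sum_wedgeProd_natural (freeBasis R G) (freeBasis R G₁) σ.proj B
  refine Eq.trans (Finset.sum_congr rfl fun S _ => ?_) (key.trans
    (Finset.sum_congr rfl fun T _ => ?_))
  · rw [TensorProduct.map_tmul]
    have h1 := LinearMap.congr_fun (schurMap_kappaZero σ.proj (rfl : p + 1 = p + 1))
      (wedgeProd (freeBasis R G) S)
    exact congrArg (fun z => τ.extProjE hr' (extMul h f (extMap Φ (p + 1)
      (wedgeProd (freeBasis R G).coord S))) ⊗ₜ[R] z) h1
  · have h2 := LinearMap.congr_fun (extMap_comp σ.proj.dualMap Φ (p + 1))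
      (wedgeProd (freeBasis R G₁).coord T)
    rw [IsSplit.comp_dualMap H, ← extMap_comp] at h2
    have h3 := extProjE_extMul τ h h₁ hr hr' f
      (extMap Φ₁ (p + 1) (wedgeProd (freeBasis R G₁).coord T))
    exact congrArg (fun z => z ⊗ₜ[R] kappaZero rfl (wedgeProd (freeBasis R G₁) T))
      ((congrArg (fun z => τ.extProjE hr' (extMul h f z)) h2).trans h3)

private theorem IsSplit.schurProjE_spliceOut (H : IsSplit σ τ Φ Φ₁) {r r' r₁' p p' : ℤ}
    (h : r' = r + (p + 1)) (h₁ : r₁' = r + (p' + 1)) (hp : p = p' + 1) (hr' : r' = r₁' + 1)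
    (f : ext R F r) :
    TensorProduct.map (τ.extProjE hr') (schurProjE σ hp 1) (spliceOut Φ h f) +
      ((sgn r : ℤ) : R) • spliceOut Φ₁ h₁ (extMap τ.proj r f) = 0 := by
  have hs : p + 1 = 1 + (p' + 1) := by rw [hp]; ring
  have hs' : p + 1 = p' + 1 + 1 := by rw [hp]
  let B : ext R (Module.Dual R G) (p + 1) →ₗ[R] ext R G (p' + 1) →ₗ[R]
      ext R F₁ r₁' ⊗[R] schur R G₁ p' 1 :=
    (TensorProduct.mk R _ _).compl₁₂ (τ.extProjE hr' ∘ₗ extMul h f ∘ₗ extMap Φ (p + 1))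
      (kappaZero rfl ∘ₗ extMap σ.proj (p' + 1))
  let B' : ext R (Module.Dual R G) (p' + 1) →ₗ[R] ext R G₁ (p' + 1) →ₗ[R]
      ext R F₁ r₁' ⊗[R] schur R G₁ p' 1 :=
    (TensorProduct.mk R _ _).compl₁₂ (τ.extProjE hr' ∘ₗ extMul h f ∘ₗ extMap Φ (p + 1) ∘ₗ
      wedgeLeft hs σ.ε) (kappaZero rfl)
  have k1 := sum_wedgeProd_contract hs hs' (freeBasis R G) σ.ε B
  have k2 := sum_wedgeProd_natural (freeBasis R G) (freeBasis R G₁) σ.proj B'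
  have k3 (T) : B' (extMap σ.proj.dualMap (p' + 1) (wedgeProd (freeBasis R G₁).coord T))
      (wedgeProd (freeBasis R G₁) T) = ((sgn r : ℤ) : R) • (extMul h₁ (extMap τ.proj r f)
        (extMap Φ₁ (p' + 1) (wedgeProd (freeBasis R G₁).coord T)) ⊗ₜ[R]
          kappaZero rfl (wedgeProd (freeBasis R G₁) T)) := by
    have h2 := LinearMap.congr_fun (extMap_comp σ.proj.dualMap Φ (p' + 1))
      (wedgeProd (freeBasis R G₁).coord T)
    rw [IsSplit.comp_dualMap H, ← extMap_comp, LinearMap.comp_apply, LinearMap.comp_apply] at h2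
    have h3 := LinearMap.congr_fun (extMap_wedgeLeft Φ hs σ.ε)
      (extMap σ.proj.dualMap (p' + 1) (wedgeProd (freeBasis R G₁).coord T))
    rw [LinearMap.comp_apply, LinearMap.comp_apply, IsSplit.apply_ε H, h2] at h3
    have hr₁ : r + 1 = r + 1 := rfl
    have h4 : extMul h f (wedgeLeft hs τ.e (extMap τ.inc (p' + 1)
        (extMap Φ₁ (p' + 1) (wedgeProd (freeBasis R G₁).coord T)))) =
        extMul (by rw [h, hp]; ring) (wedge hr₁ τ.e f) (extMap τ.inc (p' + 1)
        (extMap Φ₁ (p' + 1) (wedgeProd (freeBasis R G₁).coord T))) :=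
      Subtype.ext (mul_assoc _ _ _).symm
    have h5 := extProjE_extMul τ (by rw [h, hp]; ring) h₁ hr₁ hr' (wedge hr₁ τ.e f)
      (extMap Φ₁ (p' + 1) (wedgeProd (freeBasis R G₁).coord T))
    have h6 := LinearMap.congr_fun (extProjE_wedge_e τ (s := r - 1) (by ring) hr₁) f
    rw [LinearMap.comp_apply, ← Int.cast_smul_eq_zsmul R, LinearMap.smul_apply] at h6
    rw [← h4, h6, map_smul, LinearMap.smul_apply] at h5
    rw [TensorProduct.smul_tmul']
    exact congrArg (fun z => z ⊗ₜ[R] kappaZero rfl (wedgeProd (freeBasis R G₁) T))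
      ((congrArg (fun z => τ.extProjE hr' (extMul h f z)) h3).trans h5)
  rw [spliceOut_apply, spliceOut_apply, Finset.smul_sum, ← Finset.sum_congr rfl fun T _ => k3 T,
    ← k2]
  refine (congrArg₂ (· + ·) rfl k1.symm).trans ?_
  rw [map_sum, ← Finset.sum_add_distrib]
  refine Finset.sum_eq_zero fun S _ => ?_
  have h1 := congrArg (schurMap σ.proj p' 1) (schurContract_kappaZero hp rfl rfl hs' σ.ε
    (wedgeProd (freeBasis R G) S))
  rw [map_add, map_zero] at h1
  have h2 := LinearMap.congr_fun (schurMap_kappaZero σ.proj (rfl : p' + 1 = p' + 1))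
    (contract hs' σ.ε (wedgeProd (freeBasis R G) S))
  rw [LinearMap.comp_apply] at h2
  rw [h2] at h1
  rw [TensorProduct.map_tmul]
  refine (TensorProduct.tmul_add _ _ _).symm.trans ?_
  refine (congrArg (fun z => τ.extProjE hr' (extMul h f (extMap Φ (p + 1)
    (wedgeProd (freeBasis R G).coord S))) ⊗ₜ[R] z) h1).trans ?_
  exact TensorProduct.tmul_zero _ _

end Differentials

/-! ### Homology of three-term complexes of modules -/

section Homology

variable {R : Type*} [CommRing R] {X Y Z XA YA ZA XB YB ZB : Type*}
  [AddCommGroup X] [Module R X] [AddCommGroup Y] [Module R Y] [AddCommGroup Z] [Module R Z]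
  [AddCommGroup XA] [Module R XA] [AddCommGroup YA] [Module R YA] [AddCommGroup ZA] [Module R ZA]
  [AddCommGroup XB] [Module R XB] [AddCommGroup YB] [Module R YB] [AddCommGroup ZB] [Module R ZB]

/-- The homology `ker g / range f` of `X → Y → Z`; when `g ∘ f` is not zero, the range of `f` is
intersected with the kernel of `g`. -/
abbrev Hmod (f : X →ₗ[R] Y) (g : Y →ₗ[R] Z) : Type _ :=
  LinearMap.ker g ⧸ (LinearMap.range f).submoduleOf (LinearMap.ker g)

/-- A surjection from the cycles whose kernel is the module of boundaries computes the homology. -/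
theorem Hmod_equiv_of_surjective {Q : Type*} [AddCommGroup Q] [Module R Q] (f : X →ₗ[R] Y)
    (g : Y →ₗ[R] Z) (ψ : LinearMap.ker g →ₗ[R] Q) (hs : Function.Surjective ψ)
    (hk : ∀ y, ψ y = 0 ↔ y.1 ∈ LinearMap.range f) : Nonempty (Hmod f g ≃ₗ[R] Q) := by
  have h : (LinearMap.range f).submoduleOf (LinearMap.ker g) = LinearMap.ker ψ :=
    Submodule.ext fun y => (hk y).symm
  exact ⟨(Submodule.quotEquivOfEq _ _ h).trans (ψ.quotKerEquivOfSurjective hs)⟩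

theorem Hmod_subsingleton (f : X →ₗ[R] Y) (g : Y →ₗ[R] Z)
    (h : ∀ y, g y = 0 → ∃ x, f x = y) : Subsingleton (Hmod f g) :=
  Submodule.Quotient.subsingleton_iff.2 (eq_top_iff.2 fun y _ => h y.1 y.2)

theorem exists_eq_of_Hmod_subsingleton (f : X →ₗ[R] Y) (g : Y →ₗ[R] Z) [Subsingleton (Hmod f g)]
    {y : Y} (hy : g y = 0) : ∃ x, f x = y := by
  have hs : Subsingleton (Hmod f g) := inferInstance
  have h := Submodule.Quotient.subsingleton_iff.1 hs
  have h1 : (⟨y, hy⟩ : LinearMap.ker g) ∈ (LinearMap.range f).submoduleOf (LinearMap.ker g) :=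
    h ▸ Submodule.mem_top
  exact h1

theorem mk_Hmod_eq_zero {f : X →ₗ[R] Y} {g : Y →ₗ[R] Z} (y : LinearMap.ker g) :
    ((LinearMap.range f).submoduleOf (LinearMap.ker g)).mkQ y = 0 ↔ y.1 ∈ LinearMap.range f := by
  rw [Submodule.mkQ_apply, Submodule.Quotient.mk_eq_zero]
  rfl

variable (f : X →ₗ[R] Y) (g : Y →ₗ[R] Z) (fA : XA →ₗ[R] YA) (gA : YA →ₗ[R] ZA)
  (fB : XB →ₗ[R] YB) (gB : YB →ₗ[R] ZB)

/-- A map from `X → Y → Z` to the direct sum of two complexes, given in the middle term by two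
jointly surjective maps with acyclic common kernel, identifies the homology. -/
theorem Hmod_equiv_prod_of_surjective (φA : Y →ₗ[R] YA) (φB : Y →ₗ[R] YB)
    (hA : ∀ y, g y = 0 → gA (φA y) = 0) (hB : ∀ y, g y = 0 → gB (φB y) = 0)
    (hs : ∀ a b, ∃ y, φA y = a ∧ φB y = b) (h1A : ∀ x, ∃ a, fA a = φA (f x))
    (h1B : ∀ x, ∃ b, fB b = φB (f x))
    (h2 : ∀ a b, ∃ x, φA (f x) = fA a ∧ φB (f x) = fB b) (hgf : ∀ x, g (f x) = 0)
    (ac1 : ∀ y, φA y = 0 → φB y = 0 → g y = 0 → ∃ x, f x = y)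
    (ac2 : ∀ y, gA (φA y) = 0 → gB (φB y) = 0 → ∃ k, φA k = 0 ∧ φB k = 0 ∧ g k = g y) :
    Nonempty (Hmod f g ≃ₗ[R] Hmod fA gA × Hmod fB gB) := by
  let ψA : LinearMap.ker g →ₗ[R] Hmod fA gA := Submodule.mkQ _ ∘ₗ
    (φA.restrict (p := LinearMap.ker g) (q := LinearMap.ker gA) fun y hy => hA y hy)
  let ψB : LinearMap.ker g →ₗ[R] Hmod fB gB := Submodule.mkQ _ ∘ₗ
    (φB.restrict (p := LinearMap.ker g) (q := LinearMap.ker gB) fun y hy => hB y hy)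
  refine Hmod_equiv_of_surjective f g (ψA.prod ψB) ?_ ?_
  · rintro ⟨u, v⟩
    obtain ⟨a, rfl⟩ := Submodule.mkQ_surjective _ u
    obtain ⟨b, rfl⟩ := Submodule.mkQ_surjective _ v
    obtain ⟨y, hya, hyb⟩ := hs a.1 b.1
    obtain ⟨k, hk1, hk2, hk3⟩ := ac2 y (hya ▸ a.2) (hyb ▸ b.2)
    refine ⟨⟨y - k, ?_⟩, Prod.ext ?_ ?_⟩
    · rw [LinearMap.mem_ker, map_sub, hk3, sub_self]
    · refine congrArg (Submodule.mkQ _) (Subtype.ext ?_)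
      change φA (y - k) = a.1
      rw [map_sub, hk1, sub_zero, hya]
    · refine congrArg (Submodule.mkQ _) (Subtype.ext ?_)
      change φB (y - k) = b.1
      rw [map_sub, hk2, sub_zero, hyb]
  · intro y
    rw [LinearMap.prod_apply]
    change (ψA y, ψB y) = 0 ↔ _
    rw [Prod.mk_eq_zero, LinearMap.comp_apply, LinearMap.comp_apply, mk_Hmod_eq_zero,
      mk_Hmod_eq_zero]
    constructor
    · rintro ⟨⟨a, ha⟩, ⟨b, hb⟩⟩
      obtain ⟨x, hx1, hx2⟩ := h2 a b
      change fA a = φA y.1 at ha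
      change fB b = φB y.1 at hb
      obtain ⟨z, hz⟩ := ac1 (y.1 - f x) (by rw [map_sub, hx1, ha, sub_self])
        (by rw [map_sub, hx2, hb, sub_self]) (by rw [map_sub, hgf, sub_zero]; exact y.2)
      exact ⟨z + x, by rw [map_add, hz, sub_add_cancel]⟩
    · rintro ⟨x, hx⟩
      refine ⟨?_, ?_⟩
      · obtain ⟨a, ha⟩ := h1A x
        refine ⟨a, ?_⟩
        rw [ha, hx]
        rfl
      · obtain ⟨b, hb⟩ := h1B x
        refine ⟨b, ?_⟩
        rw [hb, hx]
        rfl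

theorem Hmod_prod : Nonempty (Hmod (fA.prodMap fB) (gA.prodMap gB) ≃ₗ[R]
    Hmod fA gA × Hmod fB gB) := by
  let ψA : LinearMap.ker (gA.prodMap gB) →ₗ[R] Hmod fA gA := Submodule.mkQ _ ∘ₗ
    ((LinearMap.fst R YA YB).restrict (p := LinearMap.ker (gA.prodMap gB))
      (q := LinearMap.ker gA) fun y hy => congrArg Prod.fst hy)
  let ψB : LinearMap.ker (gA.prodMap gB) →ₗ[R] Hmod fB gB := Submodule.mkQ _ ∘ₗ
    ((LinearMap.snd R YA YB).restrict (p := LinearMap.ker (gA.prodMap gB))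
      (q := LinearMap.ker gB) fun y hy => congrArg Prod.snd hy)
  refine Hmod_equiv_of_surjective _ _ (ψA.prod ψB) ?_ ?_
  · rintro ⟨u, v⟩
    obtain ⟨a, rfl⟩ := Submodule.mkQ_surjective _ u
    obtain ⟨b, rfl⟩ := Submodule.mkQ_surjective _ v
    exact ⟨⟨(a.1, b.1), Prod.ext a.2 b.2⟩, rfl⟩
  · intro y
    rw [LinearMap.prod_apply]
    change (ψA y, ψB y) = 0 ↔ _
    rw [Prod.mk_eq_zero, LinearMap.comp_apply, LinearMap.comp_apply, mk_Hmod_eq_zero,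
      mk_Hmod_eq_zero]
    constructor
    · rintro ⟨⟨a, ha⟩, ⟨b, hb⟩⟩
      exact ⟨(a, b), Prod.ext ha hb⟩
    · rintro ⟨x, hx⟩
      exact ⟨⟨x.1, congrArg Prod.fst hx⟩, ⟨x.2, congrArg Prod.snd hx⟩⟩

/-- A map from the direct sum of two complexes to `X → Y → Z`, given in the middle term by two
jointly injective maps with acyclic cokernel, identifies the homology. -/
theorem Hmod_equiv_prod_of_injective (φA : YA →ₗ[R] Y) (φB : YB →ₗ[R] Y)
    (hg : ∀ a b, g (φA a + φB b) = 0 ↔ gA a = 0 ∧ gB b = 0)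
    (h1A : ∀ a, ∃ x, f x = φA (fA a)) (h1B : ∀ b, ∃ x, f x = φB (fB b))
    (hgf : ∀ x, g (f x) = 0)
    (ac1 : ∀ y, g y = 0 → ∃ x a b, f x + (φA a + φB b) = y)
    (ac2 : ∀ x a b, f x = φA a + φB b → (∃ a', fA a' = a) ∧ ∃ b', fB b' = b) :
    Nonempty (Hmod f g ≃ₗ[R] Hmod fA gA × Hmod fB gB) := by
  let ψ : LinearMap.ker (gA.prodMap gB) →ₗ[R] Hmod f g := Submodule.mkQ _ ∘ₗ
    ((φA.coprod φB).restrict (p := LinearMap.ker (gA.prodMap gB)) (q := LinearMap.ker g)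
      fun y hy => (hg y.1 y.2).2 ⟨congrArg Prod.fst hy, congrArg Prod.snd hy⟩)
  obtain ⟨e⟩ := Hmod_equiv_of_surjective (fA.prodMap fB) (gA.prodMap gB) ψ
    (fun u => by
      obtain ⟨y, rfl⟩ := Submodule.mkQ_surjective _ u
      obtain ⟨x, a, b, h⟩ := ac1 y.1 y.2
      have h0 : g (φA a + φB b) = 0 := by
        have := congrArg g h
        rw [map_add, hgf, zero_add] at this
        exact this.trans y.2
      refine ⟨⟨(a, b), Prod.ext ((hg a b).1 h0).1 ((hg a b).1 h0).2⟩, ?_⟩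
      refine sub_eq_zero.1 ?_
      rw [LinearMap.comp_apply, ← map_sub, mk_Hmod_eq_zero]
      refine ⟨-x, ?_⟩
      change f (-x) = (φA a + φB b) - y.1
      rw [← h, map_neg]
      abel)
    (fun y => by
      rw [LinearMap.comp_apply, mk_Hmod_eq_zero]
      constructor
      · rintro ⟨x, hx⟩
        obtain ⟨⟨a, ha⟩, b, hb⟩ := ac2 x y.1.1 y.1.2 hx
        exact ⟨(a, b), Prod.ext ha hb⟩
      · rintro ⟨x, hx⟩
        obtain ⟨u, hu⟩ := h1A x.1
        obtain ⟨v, hv⟩ := h1B x.2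
        refine ⟨u + v, ?_⟩
        rw [map_add, hu, hv]
        have h3 : fA x.1 = y.1.1 := congrArg Prod.fst hx
        have h4 : fB x.2 = y.1.2 := congrArg Prod.snd hx
        rw [h3, h4]
        rfl)
  obtain ⟨e'⟩ := Hmod_prod fA gA fB gB
  exact ⟨e.symm.trans e'⟩

end Homology

/-! ### Exactness after tensoring with a free module -/

section TensorExact

variable {R : Type*} [CommRing R] {E : Type*} [AddCommGroup E] [Module R E]

theorem exists_lTensor_eq_of_group {L₀ L L' L'' : Type*} [AddCommGroup L₀] [Module R L₀]
    [AddCommGroup L] [Module R L] [AddCommGroup L'] [Module R L'] [AddCommGroup L'']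
    [Module R L''] (e : L₀ →ₗ[R] L) (A : L →ₗ[R] L') (B : L →ₗ[R] L'')
    (hs : ∀ x y, ∃ l, A l = x ∧ B l = y) (hA : A ∘ₗ e = 0) (hB : B ∘ₗ e = 0)
    (hk : ∀ l, A l = 0 → B l = 0 → ∃ l₀, e l₀ = l) (y : E ⊗[R] L)
    (h1 : TensorProduct.map LinearMap.id A y = 0) (h2 : TensorProduct.map LinearMap.id B y = 0) :
    ∃ y₀, TensorProduct.map LinearMap.id e y₀ = y := by
  have hex : Function.Exact e (A.prod B) := fun l => by
    constructor
    · intro h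
      exact hk l (congrArg Prod.fst h) (congrArg Prod.snd h)
    · rintro ⟨l₀, rfl⟩
      exact Prod.ext (LinearMap.congr_fun hA l₀) (LinearMap.congr_fun hB l₀)
  have hsur : Function.Surjective (A.prod B) := fun x => by
    obtain ⟨l, h1, h2⟩ := hs x.1 x.2
    exact ⟨l, Prod.ext h1 h2⟩
  refine (lTensor_exact E hex hsur y).1 ?_
  refine (TensorProduct.prodRight R R E L' L'').injective ?_
  rw [map_zero]
  have key : ∀ y : E ⊗[R] L, TensorProduct.prodRight R R E L' L'' ((A.prod B).lTensor E y) =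
      (TensorProduct.map LinearMap.id A y, TensorProduct.map LinearMap.id B y) := fun y => by
    induction y using TensorProduct.induction_on with
    | zero => simp only [map_zero]; rfl
    | tmul a b => rfl
    | add a b ha hb => rw [map_add, map_add, map_add, map_add, ha, hb]; rfl
  rw [key, h1, h2]
  rfl

/-- If `L₀ → L → L' × L'' → 0` is exact, then so is its tensor product with `E`. -/
theorem exists_lTensor_eq {L₀ L L' L'' : Type*} [AddCommMonoid L₀] [Module R L₀]
    [AddCommMonoid L] [Module R L] [AddCommMonoid L'] [Module R L'] [AddCommMonoid L'']
    [Module R L''] (e : L₀ →ₗ[R] L) (A : L →ₗ[R] L') (B : L →ₗ[R] L'')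
    (hs : ∀ x y, ∃ l, A l = x ∧ B l = y) (hA : A ∘ₗ e = 0) (hB : B ∘ₗ e = 0)
    (hk : ∀ l, A l = 0 → B l = 0 → ∃ l₀, e l₀ = l) (y : E ⊗[R] L)
    (h1 : TensorProduct.map LinearMap.id A y = 0) (h2 : TensorProduct.map LinearMap.id B y = 0) :
    ∃ y₀, TensorProduct.map LinearMap.id e y₀ = y := by
  let := Module.addCommMonoidToAddCommGroup R (M := L₀)
  let := Module.addCommMonoidToAddCommGroup R (M := L)
  let := Module.addCommMonoidToAddCommGroup R (M := L')
  let := Module.addCommMonoidToAddCommGroup R (M := L'')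
  exact exists_lTensor_eq_of_group e A B hs hA hB hk y h1 h2

theorem exists_lTensor_prod_eq {L L' L'' : Type*} [AddCommMonoid L] [Module R L]
    [AddCommMonoid L'] [Module R L'] [AddCommMonoid L''] [Module R L''] (A : L →ₗ[R] L')
    (B : L →ₗ[R] L'') (hs : ∀ x y, ∃ l, A l = x ∧ B l = y) (x : E ⊗[R] L') (y : E ⊗[R] L'') :
    ∃ z, TensorProduct.map LinearMap.id A z = x ∧ TensorProduct.map LinearMap.id B z = y := by
  have h1 : ∃ z, TensorProduct.map (LinearMap.id : E →ₗ[R] E) A z = x ∧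
      TensorProduct.map (LinearMap.id : E →ₗ[R] E) B z = 0 := by
    induction x using TensorProduct.induction_on with
    | zero => exact ⟨0, by simp⟩
    | tmul a b =>
      obtain ⟨l, h1, h2⟩ := hs b 0
      exact ⟨a ⊗ₜ l, by rw [TensorProduct.map_tmul, h1]; rfl,
        by rw [TensorProduct.map_tmul, h2, TensorProduct.tmul_zero]⟩
    | add a b ha hb =>
      obtain ⟨u, h1, h2⟩ := ha
      obtain ⟨v, h3, h4⟩ := hb
      exact ⟨u + v, by rw [map_add, h1, h3], by rw [map_add, h2, h4, add_zero]⟩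
  have h2 : ∃ z, TensorProduct.map (LinearMap.id : E →ₗ[R] E) A z = 0 ∧
      TensorProduct.map (LinearMap.id : E →ₗ[R] E) B z = y := by
    induction y using TensorProduct.induction_on with
    | zero => exact ⟨0, by simp⟩
    | tmul a b =>
      obtain ⟨l, h1, h2⟩ := hs 0 b
      exact ⟨a ⊗ₜ l, by rw [TensorProduct.map_tmul, h1, TensorProduct.tmul_zero],
        by rw [TensorProduct.map_tmul, h2]; rfl⟩
    | add a b ha hb =>
      obtain ⟨u, h1, h2⟩ := ha
      obtain ⟨v, h3, h4⟩ := hb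
      exact ⟨u + v, by rw [map_add, h1, h3, add_zero], by rw [map_add, h2, h4]⟩
  obtain ⟨u, h3, h4⟩ := h1
  obtain ⟨v, h5, h6⟩ := h2
  exact ⟨u + v, by rw [map_add, h3, h5, add_zero], by rw [map_add, h4, h6, zero_add]⟩

theorem exists_lTensor_add_eq_of_group {L₀ L L' L'' : Type*} [AddCommGroup L₀] [Module R L₀]
    [AddCommGroup L] [Module R L] [AddCommGroup L'] [Module R L'] [AddCommGroup L'']
    [Module R L''] (e : L →ₗ[R] L₀) (A : L' →ₗ[R] L) (B : L'' →ₗ[R] L)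
    (hs : Function.Surjective e) (hA : e ∘ₗ A = 0) (hB : e ∘ₗ B = 0)
    (hk : ∀ l, e l = 0 → ∃ x y, A x + B y = l) (y : E ⊗[R] L)
    (h1 : TensorProduct.map LinearMap.id e y = 0) :
    ∃ u v, TensorProduct.map LinearMap.id A u + TensorProduct.map LinearMap.id B v = y := by
  have hex : Function.Exact (A.coprod B) e := fun l => by
    constructor
    · intro h
      obtain ⟨x, y, h⟩ := hk l h
      exact ⟨(x, y), h⟩
    · rintro ⟨x, rfl⟩
      rw [LinearMap.coprod_apply, map_add]
      have h1 := LinearMap.congr_fun hA x.1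
      have h2 := LinearMap.congr_fun hB x.2
      rw [LinearMap.comp_apply] at h1 h2
      rw [h1, h2]
      exact add_zero 0
  obtain ⟨w, hw⟩ := (lTensor_exact E hex hs y).1 h1
  have key : ∀ w : E ⊗[R] (L' × L''), (A.coprod B).lTensor E w =
      TensorProduct.map LinearMap.id A (TensorProduct.prodRight R R E L' L'' w).1 +
      TensorProduct.map LinearMap.id B (TensorProduct.prodRight R R E L' L'' w).2 := fun w => by
    induction w using TensorProduct.induction_on with
    | zero => simp only [map_zero, Prod.fst_zero, Prod.snd_zero, add_zero]
    | tmul a b => exact TensorProduct.tmul_add a _ _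
    | add a b ha hb =>
      rw [map_add, map_add, ha, hb, Prod.fst_add, Prod.snd_add, map_add, map_add]
      abel
  exact ⟨_, _, (key w).symm.trans hw⟩

/-- If `L' × L'' → L → L₀ → 0` is exact, then so is its tensor product with `E`. -/
theorem exists_lTensor_add_eq {L₀ L L' L'' : Type*} [AddCommMonoid L₀] [Module R L₀]
    [AddCommMonoid L] [Module R L] [AddCommMonoid L'] [Module R L'] [AddCommMonoid L'']
    [Module R L''] (e : L →ₗ[R] L₀) (A : L' →ₗ[R] L) (B : L'' →ₗ[R] L)
    (hs : Function.Surjective e) (hA : e ∘ₗ A = 0) (hB : e ∘ₗ B = 0)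
    (hk : ∀ l, e l = 0 → ∃ x y, A x + B y = l) (y : E ⊗[R] L)
    (h1 : TensorProduct.map LinearMap.id e y = 0) :
    ∃ u v, TensorProduct.map LinearMap.id A u + TensorProduct.map LinearMap.id B v = y := by
  let := Module.addCommMonoidToAddCommGroup R (M := L₀)
  let := Module.addCommMonoidToAddCommGroup R (M := L)
  let := Module.addCommMonoidToAddCommGroup R (M := L')
  let := Module.addCommMonoidToAddCommGroup R (M := L'')
  exact exists_lTensor_add_eq_of_group e A B hs hA hB hk y h1

theorem lTensor_add_eq_zero_of_group [Module.Flat R E] {L L' L'' : Type*}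
    [AddCommGroup L] [Module R L] [AddCommGroup L'] [Module R L'] [AddCommGroup L'']
    [Module R L''] (A : L' →ₗ[R] L) (B : L'' →ₗ[R] L)
    (hk : ∀ x y, A x + B y = 0 → x = 0 ∧ y = 0) (u : E ⊗[R] L') (v : E ⊗[R] L'')
    (h1 : TensorProduct.map LinearMap.id A u + TensorProduct.map LinearMap.id B v = 0) :
    u = 0 ∧ v = 0 := by
  have hinj : Function.Injective (A.coprod B) := by
    refine (injective_iff_map_eq_zero _).2 fun x hx => ?_
    exact Prod.ext (hk x.1 x.2 hx).1 (hk x.1 x.2 hx).2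
  have h2 := Module.Flat.lTensor_preserves_injective_linearMap (M := E) _ hinj
  have key : ∀ w : E ⊗[R] (L' × L''), (A.coprod B).lTensor E w =
      TensorProduct.map LinearMap.id A (TensorProduct.prodRight R R E L' L'' w).1 +
      TensorProduct.map LinearMap.id B (TensorProduct.prodRight R R E L' L'' w).2 := fun w => by
    induction w using TensorProduct.induction_on with
    | zero => simp only [map_zero, Prod.fst_zero, Prod.snd_zero, add_zero]
    | tmul a b => exact TensorProduct.tmul_add a _ _
    | add a b ha hb =>
      rw [map_add, map_add, ha, hb, Prod.fst_add, Prod.snd_add, map_add, map_add]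
      abel
  have h3 := key ((TensorProduct.prodRight R R E L' L'').symm (u, v))
  rw [LinearEquiv.apply_symm_apply, h1] at h3
  have h4 := h2 (h3.trans (map_zero _).symm)
  rw [LinearEquiv.map_eq_zero_iff] at h4
  exact ⟨congrArg Prod.fst h4, congrArg Prod.snd h4⟩

theorem lTensor_add_eq_zero [Module.Flat R E] {L L' L'' : Type*}
    [AddCommMonoid L] [Module R L] [AddCommMonoid L'] [Module R L'] [AddCommMonoid L'']
    [Module R L''] (A : L' →ₗ[R] L) (B : L'' →ₗ[R] L)
    (hk : ∀ x y, A x + B y = 0 → x = 0 ∧ y = 0) (u : E ⊗[R] L') (v : E ⊗[R] L'')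
    (h1 : TensorProduct.map LinearMap.id A u + TensorProduct.map LinearMap.id B v = 0) :
    u = 0 ∧ v = 0 := by
  let := Module.addCommMonoidToAddCommGroup R (M := L)
  let := Module.addCommMonoidToAddCommGroup R (M := L')
  let := Module.addCommMonoidToAddCommGroup R (M := L'')
  exact lTensor_add_eq_zero_of_group A B hk u v h1

end TensorExact

/-! ### The homology after splitting off an isomorphism of rank one -/

section Flat

variable {R : Type*} [CommRing R] {M : Type*} [AddCommGroup M] [Module R M]

instance [Module.Free R M] (r : ℤ) : Module.Flat R (ext R M r) := by
  rcases r with n | n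
  · exact inferInstanceAs (Module.Flat R (⋀[R]^n M))
  · have : Subsingleton (ext R M (Int.negSucc n)) := subsingleton_ext_of_neg (by omega)
    exact Module.Flat.of_free

variable {M₁ N : Type*} [AddCommGroup M₁] [Module R M₁] [AddCommMonoid N] [Module R N]
  (τ : SplitOff R M M₁)

theorem ext_tensor_decomp {r r' : ℤ} (h : r' = r + 1) (y : ext R M r' ⊗[R] N) :
    TensorProduct.map (extMap τ.inc r') LinearMap.id
        (TensorProduct.map (extMap τ.proj r') LinearMap.id y) +
      TensorProduct.map (τ.extIncE h) LinearMap.id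
        (TensorProduct.map (τ.extProjE h) LinearMap.id y) = y := by
  rw [TensorProduct.map_map, TensorProduct.map_map, ← LinearMap.add_apply,
    LinearMap.id_comp, ← TensorProduct.map_add_left, τ.ext_decomp, TensorProduct.map_id]
  rfl

theorem exists_extInc_of_extProjE_eq_zero {r r' : ℤ} (h : r' = r + 1) (y : ext R M r' ⊗[R] N)
    (hy : TensorProduct.map (τ.extProjE h) LinearMap.id y = 0) :
    ∃ y₀, TensorProduct.map (extMap τ.inc r') LinearMap.id y₀ = y := by
  have h1 := ext_tensor_decomp τ h y
  rw [hy, map_zero, add_zero] at h1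
  exact ⟨_, h1⟩

theorem extProjE_tensor_extInc {N' : Type*} [AddCommMonoid N'] [Module R N'] {r r' : ℤ}
    (h : r' = r + 1) (f : N →ₗ[R] N') (y : ext R M₁ r' ⊗[R] N) :
    TensorProduct.map (τ.extProjE h) f
      (TensorProduct.map (extMap τ.inc r') LinearMap.id y) = 0 := by
  rw [TensorProduct.map_map, τ.extProjE_extInc, TensorProduct.map_zero_left, LinearMap.zero_apply]

theorem extProjE_tensor_extIncE {N' : Type*} [AddCommMonoid N'] [Module R N'] {r r' : ℤ}
    (h : r' = r + 1) (f : N →ₗ[R] N') (y : ext R M₁ r ⊗[R] N) :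
    TensorProduct.map (τ.extProjE h) f (TensorProduct.map (τ.extIncE h) LinearMap.id y) =
      TensorProduct.map LinearMap.id f y := by
  rw [TensorProduct.map_map, τ.extProjE_extIncE, LinearMap.comp_id]

end Flat

section Acyclic

variable {R : Type*} [CommRing R]

theorem _root_.LinearMap.map_eq_zero_of_eq_zero {A B : Type*} [AddCommMonoid A] [Module R A]
    [AddCommMonoid B] [Module R B] (f : A →ₗ[R] B) {x : A} (hx : x = 0) : f x = 0 := by
  rw [hx, map_zero]

theorem sgn_smul_sgn_smul' (r : ℤ) {A : Type*} [AddCommMonoid A] [Module R A] (x : A) :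
    ((sgn r : ℤ) : R) • ((sgn r : ℤ) : R) • x = x := by
  rw [smul_smul, ← Int.cast_mul, sgn_mul_self, Int.cast_one, one_smul]

/-- A cycle `y` with `o y` in the image of `e` is a boundary, where `j` identifies `W'` with the
kernel of `o`, and where the components `o ∘ d₀` and `o₂ ∘ d ∘ j` of the differential are `e` and
the injective map `e'` up to sign. -/
theorem exists_eq_of_acyclic {X₀ X W W' X₂ V : Type*} [AddCommMonoid X₀] [Module R X₀]
    [AddCommGroup X] [Module R X] [AddCommMonoid W] [Module R W] [AddCommMonoid W'] [Module R W']
    [AddCommMonoid X₂] [Module R X₂] [AddCommMonoid V] [Module R V] (n m : ℤ) (d₀ : X₀ →ₗ[R] X)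
    (d : X →ₗ[R] X₂) (o : X →ₗ[R] W) (j : W' →ₗ[R] X) (o₂ : X₂ →ₗ[R] V) (e : X₀ →ₗ[R] W)
    (e' : W' →ₗ[R] V) (h₀ : ∀ x, o (d₀ x) = ((sgn n : ℤ) : R) • e x) (hd : ∀ x, d (d₀ x) = 0)
    (hj : ∀ x, o x = 0 → ∃ w, j w = x)
    (h₂ : ∀ w, o₂ (d (j w)) = ((sgn m : ℤ) : R) • e' w) (he : ∀ w, e' w = 0 → w = 0)
    (y : X) (hy : d y = 0) (z : X₀) (hz : e z = o y) : ∃ x, d₀ x = y := by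
  refine ⟨((sgn n : ℤ) : R) • z, ?_⟩
  have ho : o ((-1 : R) • d₀ (((sgn n : ℤ) : R) • z) + y) = 0 := by
    rw [map_add, map_smul, h₀, map_smul, sgn_smul_sgn_smul', ← hz]
    conv_lhs => rw [← one_smul R (e z), smul_smul, ← add_smul]
    rw [mul_one, neg_add_cancel, zero_smul]
  obtain ⟨w, hw⟩ := hj _ ho
  have h3 : d (j w) = 0 := by rw [hw, map_add, map_smul, hd, smul_zero, zero_add, hy]
  have h4 := h₂ w
  rw [h3, map_zero] at h4
  have h5 : e' w = 0 := by rw [← sgn_smul_sgn_smul' (R := R) m (e' w), ← h4, smul_zero]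
  rw [he w h5, map_zero, neg_one_smul, eq_comm, neg_add_eq_zero] at hw
  exact hw

end Acyclic

section Step

variable {R : Type*} [CommRing R] {G G₁ F F₁ : Type*} [AddCommGroup G] [Module R G]
  [AddCommGroup G₁] [Module R G₁] [AddCommGroup F] [Module R F]
  [AddCommGroup F₁] [Module R F₁]
  [Module.Free R G] [Module.Finite R G] [Module.Free R G₁] [Module.Finite R G₁] [Module.Free R F₁]
  {σ : SplitOff R G G₁} {τ : SplitOff R F F₁} {Φ : Module.Dual R G →ₗ[R] F}
  {Φ₁ : Module.Dual R G₁ →ₗ[R] F₁}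

/-- The common kernel of the two maps from the complex of hook Schur modules of `G` to those of
`G₁` is acyclic. -/
private theorem IsSplit.exists_kosMap_eq (H : IsSplit σ τ Φ Φ₁) {r r' r'' p p' q q' q'' : ℤ}
    (hr : r' = r + 1) (hr' : r'' = r' + 1) (hp : p = p' + 1) (hq : q' = q + 1)
    (hq' : q'' = q' + 1) (hq0 : q' ≠ 0) (y : ext R F r' ⊗[R] schur R G p q')
    (h1 : TensorProduct.map (τ.extProjE hr) (schurProjE σ hp q') y = 0)
    (h2 : TensorProduct.map (τ.extProjE hr) (schurMap σ.proj p q') y = 0)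
    (h3 : kosMap Φ hr' hq' y = 0) :
    ∃ x, kosMap Φ hr hq (TensorProduct.map (extMap τ.inc r) LinearMap.id x) = y := by
  obtain ⟨z, hz⟩ := exists_lTensor_eq (E := ext R F₁ r) (schurMul hq σ.e) (schurProjE σ hp q')
    (schurMap σ.proj p q') (exists_schurProj_eq σ hp hq0)
    (by rw [schurProjE_schurMul, σ.proj_e, schurMul_zero, LinearMap.zero_comp])
    (by rw [schurMap_schurMul, σ.proj_e, schurMul_zero, LinearMap.zero_comp])
    (exists_schurMul_eq σ hp hq)
    (TensorProduct.map (τ.extProjE hr) LinearMap.id y)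
    (by rw [TensorProduct.map_map]; exact h1) (by rw [TensorProduct.map_map]; exact h2)
  have hinj := Module.Flat.lTensor_preserves_injective_linearMap (M := ext R F₁ r')
    _ (schurMul_injective (p := p) σ hq')
  refine exists_eq_of_acyclic (X := ext R F r' ⊗[R] schur R G p q') r r'
    (kosMap Φ hr hq ∘ₗ TensorProduct.map (extMap τ.inc r) LinearMap.id) (kosMap Φ hr' hq')
    (TensorProduct.map (τ.extProjE hr) LinearMap.id)
    (TensorProduct.map (extMap τ.inc r') LinearMap.id)
    (TensorProduct.map (τ.extProjE hr') LinearMap.id)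
    (TensorProduct.map LinearMap.id (schurMul hq σ.e))
    (TensorProduct.map LinearMap.id (schurMul hq' σ.e)) ?_ ?_ ?_ ?_ ?_ y h3 z hz
  · exact fun x => IsSplit.map_koszulMap H hr (schurMulHom hq) x
  · exact fun x => LinearMap.congr_fun (kosMap_comp_kosMap Φ hr hq hr' hq') _
  · exact fun x hx => exists_extInc_of_extProjE_eq_zero τ hr x hx
  · exact fun x => IsSplit.map_koszulMap H hr' (schurMulHom hq') x
  · exact fun w hw => hinj (Eq.trans hw (map_zero _).symm)

private theorem exists_schurProj_tensor_eq {r r' p p' q : ℤ} (hr : r' = r + 1) (hp : p = p' + 1)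
    (hq : q ≠ 0) (x : ext R F₁ r ⊗[R] schur R G₁ p' q) (y : ext R F₁ r ⊗[R] schur R G₁ p q) :
    ∃ z : ext R F r' ⊗[R] schur R G p q,
      TensorProduct.map (τ.extProjE hr) (schurProjE σ hp q) z = x ∧
        TensorProduct.map (τ.extProjE hr) (schurMap σ.proj p q) z = y := by
  obtain ⟨z, h1, h2⟩ := exists_lTensor_prod_eq (schurProjE σ hp q) (schurMap σ.proj p q)
    (exists_schurProj_eq σ hp hq) x y
  refine ⟨TensorProduct.map (τ.extIncE hr) LinearMap.id z, ?_, ?_⟩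
  · rw [extProjE_tensor_extIncE, h1]
  · rw [extProjE_tensor_extIncE, h2]

/-- The homology at `⋀ʳ F ⊗ L^p_q G`, when the adjacent terms are of the same kind. -/
abbrev schurHomology (Φ : Module.Dual R G →ₗ[R] F) (p : ℤ) {r₀ r r₂ q₀ q q₂ : ℤ} (hr : r = r₀ + 1)
    (hr₂ : r₂ = r + 1) (hq : q = q₀ + 1) (hq₂ : q₂ = q + 1) : Type _ :=
  Hmod (X := ext R F r₀ ⊗[R] schur R G p q₀) (Y := ext R F r ⊗[R] schur R G p q)
    (Z := ext R F r₂ ⊗[R] schur R G p q₂) (kosMap Φ hr hq) (kosMap Φ hr₂ hq₂)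

attribute [local irreducible] kosMap schurMap schurProjE

/-- The homology at a term `⋀ F ⊗ L^p_q G` with `q ≥ 2`. -/
theorem IsSplit.schurHomology_equiv (H : IsSplit σ τ Φ Φ₁) {s₀ s r r₂ p p' q₀ q q₂ : ℤ}
    (hs : s = s₀ + 1) (hr : r = s + 1) (hr₂ : r₂ = r + 1)
    (hp : p = p' + 1) (hq : q = q₀ + 1) (hq₂ : q₂ = q + 1) (h0 : 0 < q₀) :
    Nonempty (schurHomology Φ p hr hr₂ hq hq₂ ≃ₗ[R]
      schurHomology Φ₁ p' hs hr hq hq₂ × schurHomology Φ₁ p hs hr hq hq₂) := by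
  have cA (x : ext R F s ⊗[R] schur R G p q₀) :
      TensorProduct.map (τ.extProjE hr) (schurProjE σ hp q) (kosMap Φ hr hq x) =
        kosMap Φ₁ hs hq (TensorProduct.map (τ.extProjE hs) (schurProjE σ hp q₀) x) :=
    LinearMap.congr_fun (IsSplit.schurProjE_kosMap H hr hs hp hq) x
  have cB (x : ext R F s ⊗[R] schur R G p q₀) :
      TensorProduct.map (τ.extProjE hr) (schurMap σ.proj p q) (kosMap Φ hr hq x) =
        kosMap Φ₁ hs hq (TensorProduct.map (τ.extProjE hs) (schurMap σ.proj p q₀) x) :=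
    LinearMap.congr_fun (IsSplit.schurProj_kosMap H hr hs (p := p) hq) x
  have cA₂ (x : ext R F r ⊗[R] schur R G p q) :
      TensorProduct.map (τ.extProjE hr₂) (schurProjE σ hp q₂) (kosMap Φ hr₂ hq₂ x) =
        kosMap Φ₁ hr hq₂ (TensorProduct.map (τ.extProjE hr) (schurProjE σ hp q) x) :=
    LinearMap.congr_fun (IsSplit.schurProjE_kosMap H hr₂ hr hp hq₂) x
  have cB₂ (x : ext R F r ⊗[R] schur R G p q) :
      TensorProduct.map (τ.extProjE hr₂) (schurMap σ.proj p q₂) (kosMap Φ hr₂ hq₂ x) =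
        kosMap Φ₁ hr hq₂ (TensorProduct.map (τ.extProjE hr) (schurMap σ.proj p q) x) :=
    LinearMap.congr_fun (IsSplit.schurProj_kosMap H hr₂ hr (p := p) hq₂) x
  have key := Hmod_equiv_prod_of_surjective (X := ext R F s ⊗[R] schur R G p q₀)
    (Y := ext R F r ⊗[R] schur R G p q) (Z := ext R F r₂ ⊗[R] schur R G p q₂)
    (XA := ext R F₁ s₀ ⊗[R] schur R G₁ p' q₀) (YA := ext R F₁ s ⊗[R] schur R G₁ p' q)
    (ZA := ext R F₁ r ⊗[R] schur R G₁ p' q₂)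
    (XB := ext R F₁ s₀ ⊗[R] schur R G₁ p q₀) (YB := ext R F₁ s ⊗[R] schur R G₁ p q)
    (ZB := ext R F₁ r ⊗[R] schur R G₁ p q₂)
    (kosMap Φ hr hq) (kosMap Φ hr₂ hq₂) (kosMap Φ₁ hs hq) (kosMap Φ₁ hr hq₂)
    (kosMap Φ₁ hs hq) (kosMap Φ₁ hr hq₂)
    (TensorProduct.map (τ.extProjE hr) (schurProjE σ hp q))
    (TensorProduct.map (τ.extProjE hr) (schurMap σ.proj p q))
  refine key ?_ ?_ ?_ ?_ ?_ ?_ ?_ ?_ ?_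
  · intro y hy
    exact (cA₂ y).symm.trans (LinearMap.map_eq_zero_of_eq_zero _ hy)
  · intro y hy
    exact (cB₂ y).symm.trans (LinearMap.map_eq_zero_of_eq_zero _ hy)
  · intro a b
    exact exists_schurProj_tensor_eq (σ := σ) (τ := τ) hr hp (by omega) a b
  · exact fun x => ⟨_, (cA x).symm⟩
  · exact fun x => ⟨_, (cB x).symm⟩
  · intro a b
    obtain ⟨x, rfl, rfl⟩ := exists_schurProj_tensor_eq (σ := σ) (τ := τ) hs hp (by omega) a b
    exact ⟨x, cA x, cB x⟩
  · exact LinearMap.congr_fun (kosMap_comp_kosMap Φ hr hq hr₂ hq₂)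
  · intro y h1 h2 h3
    obtain ⟨x, hx⟩ := IsSplit.exists_kosMap_eq H hr hr₂ hp hq hq₂ (by omega) y h1 h2 h3
    exact ⟨_, hx⟩
  · intro y h1 h2
    obtain ⟨x, hx⟩ := IsSplit.exists_kosMap_eq H hr₂ (r'' := r₂ + 1) rfl hp hq₂ (q'' := q₂ + 1)
      rfl (by omega) (kosMap Φ hr₂ hq₂ y) ((cA₂ y).trans h1) ((cB₂ y).trans h2)
      (LinearMap.congr_fun (kosMap_comp_kosMap Φ hr₂ hq₂ rfl rfl) y)
    exact ⟨_, extProjE_tensor_extInc τ hr _ _, extProjE_tensor_extInc τ hr _ _, hx⟩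

end Step

section SchurOne

variable {R : Type*} [CommRing R] {G F : Type*} [AddCommGroup G] [Module R G]
  [AddCommGroup F] [Module R F] [Module.Free R G] [Module.Finite R G]

theorem one_mem_ext {M : Type*} [AddCommGroup M] [Module R M] :
    (1 : ExteriorAlgebra R M) ∈ ext R M 0 := by
  change _ ∈ _ ^ 0
  rw [pow_zero]
  exact Submodule.one_le.1 le_rfl

/-- The generator `1 ⊗ 1` of `L^0_0 G`. -/
noncomputable def schurOne : schur R G 0 0 :=
  ⟨⟨1, one_mem_ext⟩ ⊗ₜ ⟨1, one_mem_sym⟩, (mem_schur (p' := -1) (by ring) rfl).2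
    (tensor_eq_zero' (fun b => (subsingleton_ext_of_neg (by norm_num)).elim b 0) _)⟩

theorem exists_smul_one_of_mem_ext {M : Type*} [AddCommGroup M] [Module R M] (x : ext R M 0) :
    ∃ c : R, x = c • (⟨1, one_mem_ext⟩ : ext R M 0) := by
  obtain ⟨x, hx⟩ := x
  change x ∈ _ ^ 0 at hx
  rw [pow_zero] at hx
  obtain ⟨c, rfl⟩ := Submodule.mem_one.1 hx
  exact ⟨c, Subtype.ext (Algebra.algebraMap_eq_smul_one c)⟩

theorem exists_smul_one_of_mem_sym {M : Type*} [AddCommGroup M] [Module R M] (x : sym R M 0) :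
    ∃ c : R, x = c • (⟨1, one_mem_sym⟩ : sym R M 0) := by
  obtain ⟨x, hx⟩ := x
  change x ∈ _ ^ 0 at hx
  rw [pow_zero] at hx
  obtain ⟨c, rfl⟩ := Submodule.mem_one.1 hx
  exact ⟨c, Subtype.ext (Algebra.algebraMap_eq_smul_one c)⟩

theorem exists_smul_schurOne (k : schur R G 0 0) : ∃ c : R, k = c • schurOne := by
  have h (x : ext R G 0 ⊗[R] sym R G 0) : ∃ c : R, x = c •
    (⟨1, one_mem_ext⟩ ⊗ₜ[R] ⟨1, one_mem_sym⟩) := by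
    induction x using TensorProduct.induction_on with
    | zero => exact ⟨0, (zero_smul _ _).symm⟩
    | tmul a b =>
      obtain ⟨c, rfl⟩ := exists_smul_one_of_mem_ext a
      obtain ⟨d, rfl⟩ := exists_smul_one_of_mem_sym b
      exact ⟨c * d, TensorProduct.smul_tmul_smul c d _ _⟩
    | add a b ha hb =>
      obtain ⟨c, hc⟩ := ha
      obtain ⟨d, hd⟩ := hb
      exact ⟨c + d, by rw [add_smul, ← hc, ← hd]⟩
  obtain ⟨c, hc⟩ := h k.1
  exact ⟨c, Subtype.ext hc⟩

/-- The isomorphism `L^0_0 G → R`. -/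
noncomputable def schurEval : schur R G 0 0 →ₗ[R] R :=
  TensorProduct.lift ((LinearMap.mul R R).compl₁₂
    ((ExteriorAlgebra.algebraMapInv (R := R) (M := G)).toLinearMap ∘ₗ (ext R G 0).subtype)
    ((SymmetricAlgebra.algebraMapInv (R := R) (M := G)).toLinearMap ∘ₗ (sym R G 0).subtype)) ∘ₗ
      (schur R G 0 0).subtype

theorem schurEval_schurOne : schurEval (schurOne : schur R G 0 0) = 1 := by
  change ExteriorAlgebra.algebraMapInv (R := R) (M := G) 1 *
    SymmetricAlgebra.algebraMapInv (R := R) (M := G) 1 = 1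
  rw [map_one, map_one, one_mul]

theorem exists_tmul_schurOne {E : Type*} [AddCommMonoid E] [Module R E] (x : E ⊗[R] schur R G 0 0) :
    ∃ f, x = f ⊗ₜ schurOne := by
  induction x using TensorProduct.induction_on with
  | zero => exact ⟨0, (TensorProduct.zero_tmul _ _).symm⟩
  | tmul a b =>
    obtain ⟨c, rfl⟩ := exists_smul_schurOne b
    exact ⟨c • a, (TensorProduct.smul_tmul _ _ _).symm⟩
  | add a b ha hb =>
    obtain ⟨c, rfl⟩ := ha
    obtain ⟨d, rfl⟩ := hb
    exact ⟨c + d, (TensorProduct.add_tmul _ _ _).symm⟩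

theorem eq_zero_of_tmul_schurOne {E : Type*} [AddCommMonoid E] [Module R E] (f : E)
    (h : f ⊗ₜ[R] (schurOne : schur R G 0 0) = 0) : f = 0 := by
  have h1 := congrArg
    (fun z => TensorProduct.rid R E (TensorProduct.map LinearMap.id schurEval z)) h
  simp only [TensorProduct.map_tmul, schurEval_schurOne, TensorProduct.rid_tmul, one_smul,
    map_zero] at h1
  exact h1

theorem kappaZero_ι {s : ℤ} (hs : s = 0 + 1) (hs' : 1 = s) (v : G) :
    kappaZero hs (⟨ExteriorAlgebra.ι R v, hs' ▸ ι_mem_ext v⟩ : ext R G s) =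
      schurMul (zero_add 1).symm v schurOne := by
  subst hs'
  refine Subtype.ext ?_
  have h1 (γ : Module.Dual R G) : contract hs γ (⟨ExteriorAlgebra.ι R v, ι_mem_ext v⟩ : ext R G 1) =
      γ v • ⟨1, one_mem_ext⟩ := by
    refine Subtype.ext ((CliffordAlgebra.contractLeft_ι (Q := (0 : QuadraticForm R G))
      (d := γ) v).trans ?_)
    exact Algebra.algebraMap_eq_smul_one (γ v)
  have h2 : v = ∑ l, (freeBasis R G).coord l v • freeBasis R G l :=
    ((freeBasis R G).sum_repr v).symm
  have h3 := congrArg (fun v => (⟨1, one_mem_ext⟩ : ext R G 0) ⊗ₜ[R]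
    symMulHom (zero_add 1).symm v (⟨1, one_mem_sym⟩ : sym R G 0)) h2
  refine Eq.trans ?_ h3.symm
  simp only [map_sum, map_smul, LinearMap.sum_apply, LinearMap.smul_apply, TensorProduct.tmul_sum]
  change kappa R G hs (zero_add 1).symm (_ ⊗ₜ _) = _
  rw [kappa, LinearMap.sum_apply]
  refine Finset.sum_congr rfl fun l _ => ?_
  rw [TensorProduct.map_tmul, h1]
  exact TensorProduct.smul_tmul _ _ _

/-- For `p = 0` the splice map is the Koszul differential on `⋀ F ⊗ L^0_0 G = ⋀ F`. -/
theorem kosMap_schurOne (Φ : Module.Dual R G →ₗ[R] F) {r r' : ℤ} (h : r' = r + 1)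
    (h' : r' = r + (0 + 1)) (f : ext R F r) :
    kosMap Φ h (zero_add 1).symm (f ⊗ₜ schurOne) = spliceOut Φ h' f := by
  let B : ext R (Module.Dual R G) (0 + 1) →ₗ[R] ext R G (0 + 1) →ₗ[R]
      ext R F r' ⊗[R] schur R G 0 1 :=
    (TensorProduct.mk R _ _).compl₁₂ (extMul h' f ∘ₗ extMap Φ (0 + 1)) (kappaZero rfl)
  have key := sum_wedgeProd_one (zero_add 1).symm (freeBasis R G) B
  rw [spliceOut_apply, kosMap_tmul]
  refine Eq.trans (Finset.sum_congr rfl fun l _ => ?_) key.symm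
  have h1 : wedge h (Φ ((freeBasis R G).coord l)) f = extMul h' f (extMap Φ (0 + 1)
      (⟨ExteriorAlgebra.ι R ((freeBasis R G).coord l), (zero_add (1 : ℤ)).symm ▸
        ι_mem_ext _⟩)) := by
    refine Subtype.ext (congrArg (f.1 * ·) ?_)
    exact (ExteriorAlgebra.map_apply_ι Φ _).symm
  rw [h1, ← kappaZero_ι rfl (zero_add 1).symm]
  rfl

end SchurOne

theorem eq_neg_smul_of_add_smul_eq_zero {R A : Type*} [CommRing R] [AddCommMonoid A] [Module R A]
    (c : R) {a b : A} (h : a + c • b = 0) : a = (-c) • b := by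
  have h1 : c • b + (-c) • b = 0 := by rw [← add_smul, add_neg_cancel, zero_smul]
  rw [← add_zero a, ← h1, ← add_assoc, h, zero_add]

theorem neg_sgn_smul_neg_sgn_smul (r : ℤ) {R A : Type*} [CommRing R] [AddCommMonoid A]
    [Module R A] (x : A) : (-((sgn r : ℤ) : R)) • (-((sgn r : ℤ) : R)) • x = x := by
  rw [smul_smul, neg_mul_neg, ← Int.cast_mul, sgn_mul_self, Int.cast_one, one_smul]

theorem tensor_eq_zero_right {R A N : Type*} [CommRing R] [AddCommMonoid A] [Module R A]
    [AddCommMonoid N] [Module R N] (h : ∀ b : N, b = 0) (z : A ⊗[R] N) : z = 0 := by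
  induction z using TensorProduct.induction_on with
  | zero => rfl
  | tmul a b => rw [h b, TensorProduct.tmul_zero]
  | add a b ha hb => rw [ha, hb, add_zero]

section Step

variable {R : Type*} [CommRing R] {G G₁ F F₁ : Type*} [AddCommGroup G] [Module R G]
  [AddCommGroup G₁] [Module R G₁] [AddCommGroup F] [Module R F]
  [AddCommGroup F₁] [Module R F₁]
  [Module.Free R G] [Module.Finite R G] [Module.Free R G₁] [Module.Finite R G₁] [Module.Free R F₁]
  {σ : SplitOff R G G₁} {τ : SplitOff R F F₁} {Φ : Module.Dual R G →ₗ[R] F}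
  {Φ₁ : Module.Dual R G₁ →ₗ[R] F₁}

/-- For `q = 0` the module `L^p_q G` vanishes unless `p = 0`, and then the Koszul differential and
the splice map agree. -/
theorem exists_spliceOut_eq_kosMap (Φ : Module.Dual R G →ₗ[R] F) {r₀ r₁ r p : ℤ}
    (h : r = r₀ + (p + 1)) (hr : r = r₁ + 1) (w : ext R F r₁ ⊗[R] schur R G p 0) :
    ∃ x, spliceOut Φ h x = kosMap Φ hr (zero_add 1).symm w := by
  by_cases hp : p = 0
  · subst hp
    obtain rfl : r₁ = r₀ := by omega
    obtain ⟨f, rfl⟩ := exists_tmul_schurOne (R := R) (G := G) (E := ext R F r₁) w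
    exact ⟨f, (kosMap_schurOne (R := R) (G := G) (F := F) Φ hr h f).symm⟩
  · have h0 : w = 0 := tensor_eq_zero_right (fun b => schur_zero_eq hp b) w
    exact ⟨0, (LinearMap.map_zero (spliceOut Φ h)).trans
      (LinearMap.map_eq_zero_of_eq_zero (kosMap Φ hr (zero_add 1).symm) h0).symm⟩

private theorem IsSplit.schurProjE_spliceOut' (H : IsSplit σ τ Φ Φ₁) {r r' r₁' p p' : ℤ}
    (h : r' = r + (p + 1)) (h₁ : r₁' = r + (p' + 1)) (hp : p = p' + 1) (hr' : r' = r₁' + 1)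
    (f : ext R F r) :
    TensorProduct.map (τ.extProjE hr') (schurProjE σ hp 1) (spliceOut Φ h f) =
      spliceOut Φ₁ h₁ ((-((sgn r : ℤ) : R)) • extMap τ.proj r f) := by
  rw [map_smul]
  exact eq_neg_smul_of_add_smul_eq_zero (R := R) (A := ext R F₁ r₁' ⊗[R] schur R G₁ p' 1)
    ((sgn r : ℤ) : R) (IsSplit.schurProjE_spliceOut H h h₁ hp hr' f)

theorem exists_extProj_eq (τ : SplitOff R F F₁) {r r' : ℤ} (hr : r' = r + 1) (a : ext R F₁ r')
    (b : ext R F₁ r) : ∃ x, extMap τ.proj r' x = a ∧ τ.extProjE hr x = b := by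
  refine ⟨extMap τ.inc r' a + τ.extIncE hr b, ?_, ?_⟩
  · have h1 := LinearMap.congr_fun (τ.extProj_extInc r') a
    have h2 := LinearMap.congr_fun (τ.extProj_extIncE hr) b
    rw [LinearMap.comp_apply] at h1 h2
    rw [map_add, h1, h2]
    exact add_zero a
  · have h1 := LinearMap.congr_fun (τ.extProjE_extInc hr) a
    have h2 := LinearMap.congr_fun (τ.extProjE_extIncE hr) b
    rw [LinearMap.comp_apply] at h1 h2
    rw [map_add, h1, h2]
    exact zero_add b

/-- The homology at `⋀ʳ F ⊗ L^p_1 G`. -/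
abbrev schurOneHomology (Φ : Module.Dual R G →ₗ[R] F) {r₀ r r₂ p : ℤ} (h : r = r₀ + (p + 1))
    (hr₂ : r₂ = r + 1) : Type _ :=
  Hmod (X := ext R F r₀) (Y := ext R F r ⊗[R] schur R G p 1)
    (Z := ext R F r₂ ⊗[R] schur R G p 2) (spliceOut Φ h) (kosMap Φ hr₂ one_add_one_eq_two.symm)

attribute [local irreducible] kosMap schurMap schurProjE spliceOut

theorem IsSplit.schurOneHomology_equiv (H : IsSplit σ τ Φ Φ₁) {s₀ r₀ s r r₂ p p' : ℤ}
    (hs₀ : r₀ = s₀ + 1) (h : r = r₀ + (p + 1)) (hA : s = r₀ + (p' + 1)) (hB : s = s₀ + (p + 1))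
    (hr : r = s + 1) (hr₂ : r₂ = r + 1) (hp : p = p' + 1) :
    Nonempty (schurOneHomology Φ h hr₂ ≃ₗ[R]
      schurOneHomology Φ₁ hA hr × schurOneHomology Φ₁ hB hr) := by
  have cA (x : ext R F r₀) :
      TensorProduct.map (τ.extProjE hr) (schurProjE σ hp 1) (spliceOut Φ h x) =
        spliceOut Φ₁ hA ((-((sgn r₀ : ℤ) : R)) • extMap τ.proj r₀ x) :=
    IsSplit.schurProjE_spliceOut' H h hA hp hr x
  have cB (x : ext R F r₀) :
      TensorProduct.map (τ.extProjE hr) (schurMap σ.proj p 1) (spliceOut Φ h x) =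
        spliceOut Φ₁ hB (τ.extProjE hs₀ x) :=
    LinearMap.congr_fun (IsSplit.schurProj_spliceOut H h hB hs₀ hr) x
  have h2 : (2 : ℤ) = 1 + 1 := one_add_one_eq_two.symm
  have cA₂ (x : ext R F r ⊗[R] schur R G p 1) :
      TensorProduct.map (τ.extProjE hr₂) (schurProjE σ hp 2) (kosMap Φ hr₂ h2 x) =
        kosMap Φ₁ hr h2 (TensorProduct.map (τ.extProjE hr) (schurProjE σ hp 1) x) :=
    LinearMap.congr_fun (IsSplit.schurProjE_kosMap H hr₂ hr hp h2) x
  have cB₂ (x : ext R F r ⊗[R] schur R G p 1) :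
      TensorProduct.map (τ.extProjE hr₂) (schurMap σ.proj p 2) (kosMap Φ hr₂ h2 x) =
        kosMap Φ₁ hr h2 (TensorProduct.map (τ.extProjE hr) (schurMap σ.proj p 1) x) :=
    LinearMap.congr_fun (IsSplit.schurProj_kosMap H hr₂ hr (p := p) h2) x
  have key := Hmod_equiv_prod_of_surjective (X := ext R F r₀)
    (Y := ext R F r ⊗[R] schur R G p 1) (Z := ext R F r₂ ⊗[R] schur R G p 2)
    (XA := ext R F₁ r₀) (YA := ext R F₁ s ⊗[R] schur R G₁ p' 1)
    (ZA := ext R F₁ r ⊗[R] schur R G₁ p' 2)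
    (XB := ext R F₁ s₀) (YB := ext R F₁ s ⊗[R] schur R G₁ p 1)
    (ZB := ext R F₁ r ⊗[R] schur R G₁ p 2)
    (spliceOut Φ h) (kosMap Φ hr₂ h2) (spliceOut Φ₁ hA) (kosMap Φ₁ hr h2)
    (spliceOut Φ₁ hB) (kosMap Φ₁ hr h2)
    (TensorProduct.map (τ.extProjE hr) (schurProjE σ hp 1))
    (TensorProduct.map (τ.extProjE hr) (schurMap σ.proj p 1))
  refine key ?_ ?_ ?_ ?_ ?_ ?_ ?_ ?_ ?_
  · intro y hy
    exact (cA₂ y).symm.trans (LinearMap.map_eq_zero_of_eq_zero _ hy)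
  · intro y hy
    exact (cB₂ y).symm.trans (LinearMap.map_eq_zero_of_eq_zero _ hy)
  · intro a b
    exact exists_schurProj_tensor_eq (σ := σ) (τ := τ) hr hp one_ne_zero a b
  · exact fun x => ⟨_, (cA x).symm⟩
  · exact fun x => ⟨_, (cB x).symm⟩
  · intro a b
    obtain ⟨x, hx1, hx2⟩ := exists_extProj_eq τ hs₀ ((-((sgn r₀ : ℤ) : R)) • a) b
    refine ⟨x, (cA x).trans ?_, (cB x).trans (congrArg (spliceOut Φ₁ hB) hx2)⟩
    refine congrArg (spliceOut Φ₁ hA) ?_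
    rw [hx1, neg_sgn_smul_neg_sgn_smul]
  · exact LinearMap.congr_fun (kosMap_comp_spliceOut Φ h hr₂)
  · intro y h1 h3 h4
    obtain ⟨x, hx⟩ := IsSplit.exists_kosMap_eq H hr hr₂ hp (zero_add 1).symm h2 one_ne_zero
      y h1 h3 h4
    obtain ⟨z, hz⟩ := exists_spliceOut_eq_kosMap Φ h hr
      (TensorProduct.map (extMap τ.inc s) LinearMap.id x)
    exact ⟨z, hz.trans hx⟩
  · intro y h1 h3
    have h4 : (3 : ℤ) = 2 + 1 := by norm_num
    obtain ⟨x, hx⟩ := IsSplit.exists_kosMap_eq H hr₂ (r'' := r₂ + 1) rfl hp h2 h4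
      two_ne_zero (kosMap Φ hr₂ h2 y) ((cA₂ y).trans h1) ((cB₂ y).trans h3)
      (LinearMap.congr_fun (kosMap_comp_kosMap Φ hr₂ h2 rfl h4) y)
    exact ⟨_, extProjE_tensor_extInc τ hr _ _, extProjE_tensor_extInc τ hr _ _, hx⟩

end Step

theorem exists_add_eq_of_surjective {R : Type*} [CommRing R] {X₀ X W W' : Type*}
    [AddCommMonoid X₀] [Module R X₀] [AddCommGroup X] [Module R X] [AddCommMonoid W] [Module R W]
    [AddCommMonoid W'] [Module R W'] (n : ℤ) (d₀ : X₀ →ₗ[R] X) (o : X →ₗ[R] W) (j : W' →ₗ[R] X)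
    (e : X₀ →ₗ[R] W) (h₀ : ∀ x, o (d₀ x) = ((sgn n : ℤ) : R) • e x)
    (he : Function.Surjective e) (hj : ∀ x, o x = 0 → ∃ w, j w = x) (y : X) :
    ∃ x w, d₀ x + j w = y := by
  obtain ⟨z, hz⟩ := he (o y)
  have ho : o ((-1 : R) • d₀ (((sgn n : ℤ) : R) • z) + y) = 0 := by
    rw [map_add, map_smul, h₀, map_smul, sgn_smul_sgn_smul', ← hz]
    conv_lhs => rw [← one_smul R (e z), smul_smul, ← add_smul]
    rw [mul_one, neg_add_cancel, zero_smul]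
  obtain ⟨w, hw⟩ := hj _ ho
  refine ⟨((sgn n : ℤ) : R) • z, w, ?_⟩
  rw [hw, neg_one_smul, add_neg_cancel_left]

theorem map_map_add {R : Type*} [CommRing R] {E E' L L' L'' : Type*} [AddCommMonoid E] [Module R E]
    [AddCommMonoid E'] [Module R E'] [AddCommMonoid L] [Module R L] [AddCommMonoid L']
    [Module R L'] [AddCommMonoid L''] [Module R L''] (f : E →ₗ[R] E') (A : L' →ₗ[R] L)
    (B : L'' →ₗ[R] L) (u : E ⊗[R] L') (v : E ⊗[R] L'') :
    TensorProduct.map f LinearMap.id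
        (TensorProduct.map LinearMap.id A u + TensorProduct.map LinearMap.id B v) =
      TensorProduct.map f A u + TensorProduct.map f B v := by
  rw [map_add, TensorProduct.map_map, TensorProduct.map_map, LinearMap.comp_id,
    LinearMap.id_comp, LinearMap.id_comp]

theorem map_eq_of_add_eq {R : Type*} [CommRing R] {X W : Type*} [AddCommMonoid X] [Module R X]
    [AddCommMonoid W] [Module R W] (o : X →ₗ[R] W) {x y z z' : X} (hx : o x = 0)
    (h : x + z = y) (hz : z = z') : o y = o z' := by
  rw [← h, map_add, hx, hz, zero_add]

theorem map_add_smul_left {R : Type*} [CommRing R] {X W : Type*} [AddCommMonoid X] [Module R X]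
    [AddCommMonoid W] [Module R W] (o : X →ₗ[R] W) (c : R) {x y : X} {w : W} (hx : o x = w)
    (hy : o y = 0) : o (x + c • y) = w := by
  rw [map_add, map_smul, hx, hy, smul_zero, add_zero]

theorem map_add_smul_right {R : Type*} [CommRing R] {X W : Type*} [AddCommMonoid X] [Module R X]
    [AddCommMonoid W] [Module R W] (o : X →ₗ[R] W) (c : R) {x y : X} {w : W} (hx : o x = 0)
    (hy : o y = w) : o (x + c • y) = c • w := by
  rw [map_add, map_smul, hx, hy, zero_add]

theorem nonempty_equiv_of_prod_right {R : Type*} [CommRing R] {A B C : Type*} [AddCommMonoid A]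
    [Module R A] [AddCommMonoid B] [Module R B] [AddCommMonoid C] [Module R C] [Subsingleton A]
    (e : C ≃ₗ[R] A × B) : Nonempty (C ≃ₗ[R] B) := by
  refine ⟨e.trans (LinearEquiv.ofBijective (LinearMap.snd R A B) ⟨fun x y h => ?_, fun b => ?_⟩)⟩
  · exact Prod.ext (Subsingleton.elim _ _) h
  · exact ⟨(0, b), rfl⟩

section Step

variable {R : Type*} [CommRing R] {G G₁ F F₁ : Type*} [AddCommGroup G] [Module R G]
  [AddCommGroup G₁] [Module R G₁] [AddCommGroup F] [Module R F]
  [AddCommGroup F₁] [Module R F₁]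
  [Module.Free R G] [Module.Finite R G] [Module.Free R G₁] [Module.Finite R G₁] [Module.Free R F₁]
  {σ : SplitOff R G G₁} {τ : SplitOff R F F₁} {Φ : Module.Dual R G →ₗ[R] F}
  {Φ₁ : Module.Dual R G₁ →ₗ[R] F₁}

/-- Up to boundaries, every element of `⋀ F ⊗ K^a_q (G^*)` comes from `⋀ F₁ ⊗ K^a_q (G^*)`. -/
private theorem IsSplit.exists_etaMap_add_eq (H : IsSplit σ τ Φ Φ₁) {r r' a q q' : ℤ}
    (hr : r' = r + 1)
    (hq : q = q' + 1) (h0 : a ≠ 0 ∨ q' ≠ 0) (y : ext R F r' ⊗[R] weyl R G a q') :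
    ∃ (x : ext R F₁ r ⊗[R] weyl R G a q) (w : ext R F₁ r' ⊗[R] weyl R G a q'),
      etaMap Φ hr hq (TensorProduct.map (extMap τ.inc r) LinearMap.id x) +
        TensorProduct.map (extMap τ.inc r') LinearMap.id w = y := by
  refine exists_add_eq_of_surjective (X := ext R F r' ⊗[R] weyl R G a q') r
    (etaMap Φ hr hq ∘ₗ TensorProduct.map (extMap τ.inc r) LinearMap.id)
    (TensorProduct.map (τ.extProjE hr) LinearMap.id)
    (TensorProduct.map (extMap τ.inc r') LinearMap.id)
    (TensorProduct.map LinearMap.id (weylAct hq σ.e)) ?_ ?_ ?_ y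
  · exact fun x => IsSplit.map_koszulMap H hr (weylActHom hq) x
  · exact TensorProduct.map_surjective Function.surjective_id (weylAct_surjective σ hq h0)
  · exact fun x hx => exists_extInc_of_extProjE_eq_zero τ hr x hx

/-- The elements of `⋀ F₁ ⊗ K^a'_q (G^*)` killed by `e` come from the two components. -/
private theorem exists_weylMap_add_eq (σ : SplitOff R G G₁) (τ : SplitOff R F F₁) {r a a' q q' : ℤ}
    (ha : a' = 1 + a) (hq : q = q' + 1) (h0 : a' ≠ 0 ∨ q' ≠ 0)
    (w : ext R F₁ r ⊗[R] weyl R G a' q)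
    (hw : TensorProduct.map LinearMap.id (weylAct hq σ.e) w = 0) :
    ∃ (u : ext R F₁ r ⊗[R] weyl R G₁ a' q) (v : ext R F₁ r ⊗[R] weyl R G₁ a q),
      TensorProduct.map (extMap τ.inc r) (weylMap σ.proj a' q) u +
        TensorProduct.map (extMap τ.inc r) (weylIncE σ ha q) v =
          TensorProduct.map (extMap τ.inc r) LinearMap.id w := by
  have h1 : weylAct hq σ.e ∘ₗ weylMap σ.proj a' q = 0 := by
    rw [weylAct_weylMap, σ.proj_e, weylAct_zero, LinearMap.comp_zero]
  have h2 : weylAct hq σ.e ∘ₗ weylIncE σ ha q = 0 := by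
    rw [weylAct_weylIncE, σ.proj_e, weylAct_zero, LinearMap.comp_zero]
  have hs := weylAct_surjective σ hq h0
  have hk := exists_weylInc_eq σ ha hq
  have key := exists_lTensor_add_eq (E := ext R F₁ r) (weylAct hq σ.e)
    (weylMap σ.proj a' q) (weylIncE σ ha q)
  have key' := key hs h1 h2 hk w hw
  obtain ⟨u, v, h⟩ := key'
  refine ⟨u, v, ?_⟩
  exact (map_map_add (extMap τ.inc r) (weylMap σ.proj a' q) (weylIncE σ ha q) u v).symm.trans
    (congrArg (TensorProduct.map (extMap τ.inc r) LinearMap.id) h)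

end Step

section Middle

variable {R : Type*} [CommRing R] {G G₁ F F₁ : Type*} [AddCommGroup G] [Module R G]
  [AddCommGroup G₁] [Module R G₁] [AddCommGroup F] [Module R F]
  [AddCommGroup F₁] [Module R F₁]
  [Module.Free R G] [Module.Finite R G] [Module.Free R G₁] [Module.Finite R G₁] [Module.Free R F₁]
  {σ : SplitOff R G G₁} {τ : SplitOff R F F₁} {Φ : Module.Dual R G →ₗ[R] F}
  {Φ₁ : Module.Dual R G₁ →ₗ[R] F₁}

/-- The two components of the splice map on the sum of the two inclusions are the splice maps of
`Φ₁`, the second one up to sign. -/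
private theorem IsSplit.spliceIn_add (H : IsSplit σ τ Φ Φ₁) {s t t₁ a a' : ℤ} (ha : a' = 1 + a)
    (h : t = s + a') (h₁ : t₁ = s + a) (ht : t = t₁ + 1) (u : ext R F₁ s ⊗[R] weyl R G₁ a' 0)
    (v : ext R F₁ s ⊗[R] weyl R G₁ a 0) :
    extMap τ.proj t (spliceIn Φ h (TensorProduct.map (extMap τ.inc s) (weylMap σ.proj a' 0) u +
        TensorProduct.map (extMap τ.inc s) (weylIncE σ ha 0) v)) = spliceIn Φ₁ h u ∧
      τ.extProjE ht (spliceIn Φ h (TensorProduct.map (extMap τ.inc s) (weylMap σ.proj a' 0) u +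
        TensorProduct.map (extMap τ.inc s) (weylIncE σ ha 0) v)) =
          ((sgn s : ℤ) : R) • spliceIn Φ₁ h₁ v := by
  have h1 := LinearMap.congr_fun (IsSplit.spliceIn_weylMap H h) u
  have h2 := LinearMap.congr_fun (IsSplit.spliceIn_weylIncE H ha h h₁ ht) v
  have h3 : spliceIn Φ h (TensorProduct.map (extMap τ.inc s) (weylIncE σ ha 0) v) =
      ((sgn s : ℤ) : R) • τ.extIncE ht (spliceIn Φ₁ h₁ v) :=
    h2.trans (Int.cast_smul_eq_zsmul R (sgn s) (τ.extIncE ht (spliceIn Φ₁ h₁ v))).symm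
  have h4 := (map_add (spliceIn Φ h) _ _).trans (congrArg₂ (· + ·) h1 h3)
  have e1 := LinearMap.congr_fun (τ.extProj_extInc t) (spliceIn Φ₁ h u)
  have e2 := LinearMap.congr_fun (τ.extProj_extIncE ht) (spliceIn Φ₁ h₁ v)
  have e3 := LinearMap.congr_fun (τ.extProjE_extInc ht) (spliceIn Φ₁ h u)
  have e4 := LinearMap.congr_fun (τ.extProjE_extIncE ht) (spliceIn Φ₁ h₁ v)
  exact ⟨(congrArg _ h4).trans (map_add_smul_left _ _ e1 e2),
    (congrArg _ h4).trans (map_add_smul_right _ _ e3 e4)⟩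

private theorem IsSplit.exists_spliceIn_eq (H : IsSplit σ τ Φ Φ₁) {s t t₁ a a' : ℤ}
    (ha : a' = 1 + a)
    (h : t = s + a') (h₁ : t₁ = s + a) (ht : t = t₁ + 1) (h0 : a' ≠ 0)
    (x : ext R F s ⊗[R] weyl R G a' 0) :
    ∃ (u : ext R F₁ s ⊗[R] weyl R G₁ a' 0) (v : ext R F₁ s ⊗[R] weyl R G₁ a 0),
      spliceIn Φ₁ h u = extMap τ.proj t (spliceIn Φ h x) ∧
        spliceIn Φ₁ h₁ v = τ.extProjE ht (spliceIn Φ h x) := by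
  have hs : s = s - 1 + 1 := by ring
  obtain ⟨z, w, hx⟩ := IsSplit.exists_etaMap_add_eq H hs (zero_add 1).symm (Or.inl h0) x
  obtain ⟨u, v, hw⟩ := exists_weylMap_add_eq σ τ ha (q := 0) (q' := -1) (by ring) (Or.inl h0) w
    (tensor_eq_zero_right (fun b => weyl_neg_eq_zero (by norm_num) b) _)
  have h2 := LinearMap.congr_fun (spliceIn_comp_etaMap (p := a') Φ hs h)
    (TensorProduct.map (extMap τ.inc (s - 1)) LinearMap.id z)
  have h3 : spliceIn Φ h x = spliceIn Φ h
      (TensorProduct.map (extMap τ.inc s) (weylMap σ.proj a' 0) u +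
        TensorProduct.map (extMap τ.inc s) (weylIncE σ ha 0) v) := by
    exact map_eq_of_add_eq (spliceIn Φ h) h2 hx hw.symm
  obtain ⟨e1, e2⟩ := IsSplit.spliceIn_add H ha h h₁ ht u v
  refine ⟨u, ((sgn s : ℤ) : R) • v, ?_, ?_⟩
  · exact ((congrArg _ h3).trans e1).symm
  · exact (map_smul _ _ _).trans ((congrArg _ h3).trans e2).symm

/-- The homology at `⋀ᵗ F`. -/
abbrev middleHomology (Φ : Module.Dual R G →ₗ[R] F) {s t t' a p : ℤ} (h : t = s + a)
    (h' : t' = t + (p + 1)) : Type _ :=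
  Hmod (X := ext R F s ⊗[R] weyl R G a 0) (Y := ext R F t) (Z := ext R F t' ⊗[R] schur R G p 1)
    (spliceIn Φ h) (spliceOut Φ h')

theorem exists_extInc_eq_of_extProjE (τ : SplitOff R F F₁) {r r' : ℤ} (h : r' = r + 1)
    (y : ext R F r') (hy : τ.extProjE h y = 0) : extMap τ.inc r' (extMap τ.proj r' y) = y := by
  have h1 := LinearMap.congr_fun (τ.ext_decomp h) y
  exact (add_eq_left.2 (LinearMap.map_eq_zero_of_eq_zero (τ.extIncE h) hy)).symm.trans h1

theorem eq_zero_of_extProj (τ : SplitOff R F F₁) {r r' : ℤ} (h : r' = r + 1)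
    (y : ext R F r') (hy : τ.extProjE h y = 0) (hy' : extMap τ.proj r' y = 0) : y = 0 :=
  (exists_extInc_eq_of_extProjE τ h y hy).symm.trans
    (LinearMap.map_eq_zero_of_eq_zero (extMap τ.inc r') hy')

/-- A lift to `⋀ F` of a cycle of the two components is a cycle up to an element of `⋀ F₁`. -/
private theorem IsSplit.exists_kosMap_eq_spliceOut (H : IsSplit σ τ Φ Φ₁) {t t₁ t' s p p' : ℤ}
    (hp : p = p' + 1) (ht : t = t₁ + 1) (h' : t' = t + (p + 1)) (hA : s = t + (p' + 1))
    (hB : s = t₁ + (p + 1)) (hs : t' = s + 1) (y : ext R F t)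
    (h1 : spliceOut Φ₁ hA (extMap τ.proj t y) = 0) (h2 : spliceOut Φ₁ hB (τ.extProjE ht y) = 0) :
    ∃ x : ext R F₁ s ⊗[R] schur R G p 0, kosMap Φ hs (zero_add 1).symm
      (TensorProduct.map (extMap τ.inc s) LinearMap.id x) = spliceOut Φ h' y := by
  refine IsSplit.exists_kosMap_eq H hs (r'' := t' + 1) rfl hp (zero_add 1).symm
    one_add_one_eq_two.symm one_ne_zero (spliceOut Φ h' y) ?_ ?_
    (LinearMap.congr_fun (kosMap_comp_spliceOut Φ h' rfl) y)
  · refine (IsSplit.schurProjE_spliceOut' H h' hA hp hs y).trans ?_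
    exact (map_smul _ _ _).trans ((congrArg _ h1).trans (smul_zero _))
  · exact (LinearMap.congr_fun (IsSplit.schurProj_spliceOut H h' hB ht hs) y).trans h2

theorem IsSplit.eq_zero_of_spliceOut_eq_zero (H : IsSplit σ τ Φ Φ₁) {t t' : ℤ}
    (h' : t' = t + (0 + 1)) (f : ext R F₁ t) (hf : spliceOut Φ h' (extMap τ.inc t f) = 0) :
    f = 0 := by
  have hs : t' = t + 1 := h'.trans (by ring)
  have h5 : kosMap Φ hs (zero_add 1).symm (TensorProduct.map (extMap τ.inc t) LinearMap.id
      (f ⊗ₜ[R] (schurOne : schur R G 0 0))) = 0 :=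
    (kosMap_schurOne Φ hs h' (extMap τ.inc t f)).trans hf
  have h6 := (IsSplit.map_koszulMap H hs (schurMulHom (zero_add 1).symm)
    (f ⊗ₜ[R] (schurOne : schur R G 0 0))).symm.trans
    (LinearMap.map_eq_zero_of_eq_zero (TensorProduct.map (τ.extProjE hs) LinearMap.id) h5)
  have h7 : TensorProduct.map LinearMap.id (schurMul (zero_add 1).symm σ.e)
      (f ⊗ₜ[R] (schurOne : schur R G 0 0)) = 0 :=
    (sgn_smul_sgn_smul' (R := R) t _).symm.trans ((congrArg _ h6).trans (smul_zero _))
  have hinj := Module.Flat.lTensor_preserves_injective_linearMap (M := ext R F₁ t)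
    _ (schurMul_injective (p := 0) σ (zero_add 1).symm)
  exact eq_zero_of_tmul_schurOne _ (hinj (Eq.trans h7 (map_zero _).symm))

attribute [local irreducible] kosMap schurMap schurProjE spliceOut spliceIn

/-- The homology at `⋀ᵗ F`, in the case `p ≠ 0`. -/
theorem IsSplit.middleHomology_equiv (H : IsSplit σ τ Φ Φ₁) {s t₁ t t' s' a a' p p' : ℤ}
    (ha : a' = 1 + a) (hp : p = p' + 1) (h0 : a' ≠ 0) (hp0 : p ≠ 0)
    (h : t = s + a') (h₁ : t₁ = s + a) (ht : t = t₁ + 1) (h' : t' = t + (p + 1))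
    (hA : s' = t + (p' + 1)) (hB : s' = t₁ + (p + 1)) (hs : t' = s' + 1)
    (hg : (Module.finrank R G : ℤ) < a' + (p + 1)) :
    Nonempty (middleHomology Φ h h' ≃ₗ[R] middleHomology Φ₁ h hA × middleHomology Φ₁ h₁ hB) := by
  have key := Hmod_equiv_prod_of_surjective (X := ext R F s ⊗[R] weyl R G a' 0)
    (Y := ext R F t) (Z := ext R F t' ⊗[R] schur R G p 1)
    (XA := ext R F₁ s ⊗[R] weyl R G₁ a' 0) (YA := ext R F₁ t)
    (ZA := ext R F₁ s' ⊗[R] schur R G₁ p' 1)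
    (XB := ext R F₁ s ⊗[R] weyl R G₁ a 0) (YB := ext R F₁ t₁)
    (ZB := ext R F₁ s' ⊗[R] schur R G₁ p 1)
    (spliceIn Φ h) (spliceOut Φ h') (spliceIn Φ₁ h) (spliceOut Φ₁ hA)
    (spliceIn Φ₁ h₁) (spliceOut Φ₁ hB) (extMap τ.proj t) (τ.extProjE ht)
  refine key ?_ ?_ ?_ ?_ ?_ ?_ ?_ ?_ ?_
  · intro y hy
    have h1 := (IsSplit.schurProjE_spliceOut' H h' hA hp hs y).symm.trans
      (LinearMap.map_eq_zero_of_eq_zero _ hy)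
    have h2 := (congrArg ((-((sgn t : ℤ) : R)) • ·) ((map_smul _ _ _).symm.trans h1))
    exact (neg_sgn_smul_neg_sgn_smul t _).symm.trans (h2.trans (smul_zero _))
  · intro y hy
    exact (LinearMap.congr_fun (IsSplit.schurProj_spliceOut H h' hB ht hs) y).symm.trans
      (LinearMap.map_eq_zero_of_eq_zero
        (TensorProduct.map (τ.extProjE hs) (schurMap σ.proj p 1)) hy)
  · exact exists_extProj_eq τ ht
  · intro x
    obtain ⟨u, v, h1, h2⟩ := IsSplit.exists_spliceIn_eq H ha h h₁ ht h0 x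
    exact ⟨u, h1⟩
  · intro x
    obtain ⟨u, v, h1, h2⟩ := IsSplit.exists_spliceIn_eq H ha h h₁ ht h0 x
    exact ⟨v, h2⟩
  · intro x y
    obtain ⟨h1, h2⟩ := IsSplit.spliceIn_add H ha h h₁ ht x (((sgn s : ℤ) : R) • y)
    refine ⟨_, h1, h2.trans ?_⟩
    exact (congrArg _ (map_smul _ _ _)).trans (sgn_smul_sgn_smul' s _)
  · exact LinearMap.congr_fun (spliceOut_comp_spliceIn Φ h h' hg)
  · intro y h1 h2 h3
    exact ⟨0, (map_zero _).trans (eq_zero_of_extProj τ ht y h2 h1).symm⟩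
  · intro y h1 h2
    obtain ⟨x, hx⟩ := IsSplit.exists_kosMap_eq_spliceOut H hp ht h' hA hB hs y h1 h2
    refine ⟨0, map_zero _, map_zero _, (map_zero _).trans (Eq.trans ?_ hx)⟩
    have h3 : x = 0 := tensor_eq_zero_right (fun b => schur_zero_eq hp0 b) x
    exact (LinearMap.map_eq_zero_of_eq_zero
      (kosMap Φ hs (zero_add 1).symm ∘ₗ TensorProduct.map (extMap τ.inc s') LinearMap.id)
      h3).symm

/-- The homology at `⋀ᵗ F`, in the case `p = 0`: there is only one component. -/
theorem IsSplit.middleHomology_equiv_zero (H : IsSplit σ τ Φ Φ₁) {s t₁ t t' a a' : ℤ}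
    (ha : a' = 1 + a) (h0 : a' ≠ 0)
    (h : t = s + a') (h₁ : t₁ = s + a) (ht : t = t₁ + 1) (h' : t' = t + (0 + 1))
    (hB : t = t₁ + (0 + 1)) (hg : (Module.finrank R G : ℤ) < a' + (0 + 1)) :
    Nonempty (middleHomology Φ h h' ≃ₗ[R] middleHomology Φ₁ h₁ hB) := by
  have hs : t' = t + 1 := h'.trans (by ring)
  have hA : t = t + (-1 + 1) := by ring
  have key := Hmod_equiv_prod_of_surjective (X := ext R F s ⊗[R] weyl R G a' 0)
    (Y := ext R F t) (Z := ext R F t' ⊗[R] schur R G 0 1)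
    (XA := PUnit.{1}) (YA := PUnit.{1}) (ZA := PUnit.{1})
    (XB := ext R F₁ s ⊗[R] weyl R G₁ a 0) (YB := ext R F₁ t₁)
    (ZB := ext R F₁ t ⊗[R] schur R G₁ 0 1)
    (spliceIn Φ h) (spliceOut Φ h') 0 0
    (spliceIn Φ₁ h₁) (spliceOut Φ₁ hB) 0 (τ.extProjE ht)
  have key2 : Nonempty (middleHomology Φ h h' ≃ₗ[R]
      Hmod (R := R) (X := PUnit.{1}) (Y := PUnit.{1}) (Z := PUnit.{1}) 0 0
        × middleHomology Φ₁ h₁ hB) := by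
    refine key ?_ ?_ ?_ ?_ ?_ ?_ ?_ ?_ ?_
    · intro y hy
      rfl
    · intro y hy
      exact (LinearMap.congr_fun (IsSplit.schurProj_spliceOut H h' hB ht hs) y).symm.trans
        (LinearMap.map_eq_zero_of_eq_zero
          (TensorProduct.map (τ.extProjE hs) (schurMap σ.proj 0 1)) hy)
    · intro x y
      obtain ⟨z, -, hz⟩ := exists_extProj_eq τ ht 0 y
      exact ⟨z, rfl, hz⟩
    · exact fun x => ⟨0, rfl⟩
    · intro x
      obtain ⟨u, v, h1, h2⟩ := IsSplit.exists_spliceIn_eq H ha h h₁ ht h0 x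
      exact ⟨v, h2⟩
    · intro x y
      obtain ⟨h1, h2⟩ := IsSplit.spliceIn_add H ha h h₁ ht 0 (((sgn s : ℤ) : R) • y)
      refine ⟨_, rfl, h2.trans ?_⟩
      exact (congrArg _ (map_smul _ _ _)).trans (sgn_smul_sgn_smul' s _)
    · exact LinearMap.congr_fun (spliceOut_comp_spliceIn Φ h h' hg)
    · intro y h1 h2 h3
      have h4 := exists_extInc_eq_of_extProjE τ ht y h2
      have h8 := IsSplit.eq_zero_of_spliceOut_eq_zero H h' (extMap τ.proj t y)
        ((congrArg _ h4).trans h3)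
      exact ⟨0, (map_zero _).trans (eq_zero_of_extProj τ ht y h2 h8).symm⟩
    · intro y h1 h2
      obtain ⟨x, hx⟩ := IsSplit.exists_kosMap_eq_spliceOut H (p' := -1) (by ring) ht h' hA hB hs y
        (tensor_eq_zero_right (fun b => schur_eq_zero_of_neg (by norm_num) b) _) h2
      obtain ⟨f, rfl⟩ := exists_tmul_schurOne x
      refine ⟨extMap τ.inc t f, rfl, LinearMap.congr_fun (τ.extProjE_extInc ht) f, ?_⟩
      exact (kosMap_schurOne Φ hs h' (extMap τ.inc t f)).symm.trans hx
  obtain ⟨e⟩ := key2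
  have : Subsingleton (Hmod (R := R) (X := PUnit.{1}) (Y := PUnit.{1}) (Z := PUnit.{1}) 0 0) :=
    Hmod_subsingleton _ _ fun y _ => ⟨0, rfl⟩
  exact nonempty_equiv_of_prod_right e

end Middle

theorem eq_and_eq_of_map_add_map_eq {R : Type*} [CommRing R] {E E' L L' L'' : Type*}
    [AddCommGroup E] [Module R E] [AddCommGroup E'] [Module R E'] [AddCommMonoid L] [Module R L]
    [AddCommMonoid L'] [Module R L'] [AddCommMonoid L''] [Module R L''] (A : L' →ₗ[R] L)
    (B : L'' →ₗ[R] L) (o : E' →ₗ[R] E) {j : E →ₗ[R] E'} (hoj : o ∘ₗ j = LinearMap.id)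
    (u u' : E ⊗[R] L') {v v' : E ⊗[R] L''}
    (hk : ∀ (u : E ⊗[R] L') (v : E ⊗[R] L''), TensorProduct.map LinearMap.id A u +
      TensorProduct.map LinearMap.id B v = 0 → u = 0 ∧ v = 0)
    (h : TensorProduct.map j A u + TensorProduct.map j B v =
      TensorProduct.map j A u' + TensorProduct.map j B v') : u = u' ∧ v = v' := by
  have h1 := congrArg (TensorProduct.map o LinearMap.id) h
  simp only [map_add, TensorProduct.map_map, hoj, LinearMap.id_comp] at h1
  have h2 := hk (u - u') (v - v') (by
    rw [map_sub, map_sub, sub_add_sub_comm, sub_eq_zero]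
    exact h1)
  exact ⟨sub_eq_zero.1 h2.1, sub_eq_zero.1 h2.2⟩

theorem map_map_add_map_eq_zero {R : Type*} [CommRing R] {E E' E'' L L' L'' : Type*}
    [AddCommMonoid E] [Module R E] [AddCommMonoid E'] [Module R E'] [AddCommMonoid E'']
    [Module R E''] [AddCommMonoid L] [Module R L]
    [AddCommMonoid L'] [Module R L'] [AddCommMonoid L''] [Module R L''] (o : E' →ₗ[R] E'')
    {j : E →ₗ[R] E'} (hoj : o ∘ₗ j = 0) (A : L' →ₗ[R] L) (B : L'' →ₗ[R] L) (u : E ⊗[R] L')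
    (v : E ⊗[R] L'') : TensorProduct.map o LinearMap.id
      (TensorProduct.map j A u + TensorProduct.map j B v) = 0 := by
  rw [map_add, TensorProduct.map_map, TensorProduct.map_map, hoj, TensorProduct.map_zero_left,
    TensorProduct.map_zero_left, LinearMap.zero_apply, LinearMap.zero_apply, zero_add]

section Lower

variable {R : Type*} [CommRing R] {G G₁ F F₁ : Type*} [AddCommGroup G] [Module R G]
  [AddCommGroup G₁] [Module R G₁] [AddCommGroup F] [Module R F]
  [AddCommGroup F₁] [Module R F₁]
  [Module.Free R G] [Module.Finite R G] [Module.Free R G₁] [Module.Finite R G₁] [Module.Free R F₁]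
  {σ : SplitOff R G G₁} {τ : SplitOff R F F₁} {Φ : Module.Dual R G →ₗ[R] F}
  {Φ₁ : Module.Dual R G₁ →ₗ[R] F₁}

set_option maxHeartbeats 1000000 in
/-- Up to boundaries, the elements of `⋀ F ⊗ K^a'_q (G^*)` whose boundary comes from `⋀ F₁` come
from the two components. -/
private theorem IsSplit.exists_etaMap_add_weyl_eq (H : IsSplit σ τ Φ Φ₁)
    {r r' r'' a a' q q' q'' : ℤ}
    (hr : r' = r + 1) (hr' : r'' = r' + 1) (ha : a' = 1 + a) (hq : q = q' + 1)
    (hq' : q' = q'' + 1) (h0 : a' ≠ 0) (y : ext R F r' ⊗[R] weyl R G a' q')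
    (hy : TensorProduct.map (τ.extProjE hr') LinearMap.id (etaMap Φ hr' hq' y) = 0) :
    ∃ (x : ext R F r ⊗[R] weyl R G a' q) (u : ext R F₁ r' ⊗[R] weyl R G₁ a' q')
      (v : ext R F₁ r' ⊗[R] weyl R G₁ a q'),
      etaMap Φ hr hq x + (TensorProduct.map (extMap τ.inc r') (weylMap σ.proj a' q') u +
        TensorProduct.map (extMap τ.inc r') (weylIncE σ ha q') v) = y := by
  obtain ⟨x, w, hx⟩ := IsSplit.exists_etaMap_add_eq H hr hq (Or.inl h0) y
  have h1 := LinearMap.congr_fun (etaMap_comp_etaMap (p := a') Φ hr hq hr' hq')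
    (TensorProduct.map (extMap τ.inc r) LinearMap.id x)
  have h2 := map_eq_of_add_eq (etaMap Φ hr' hq') h1 hx rfl
  have h3 := (IsSplit.map_koszulMap H hr' (weylActHom hq') w).symm.trans
    ((congrArg (TensorProduct.map (τ.extProjE hr') LinearMap.id) h2.symm).trans hy)
  have h4 : TensorProduct.map LinearMap.id (weylAct hq' σ.e) w = 0 :=
    (sgn_smul_sgn_smul' (R := R) r' _).symm.trans ((congrArg _ h3).trans (smul_zero _))
  obtain ⟨u, v, hw⟩ := exists_weylMap_add_eq σ τ ha hq' (Or.inl h0) w h4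
  exact ⟨_, u, v, (congrArg (_ + ·) hw).trans hx⟩

private theorem eq_and_eq_of_weylMap_add_eq (σ : SplitOff R G G₁) (τ : SplitOff R F F₁)
    {r a a' q : ℤ}
    (ha : a' = 1 + a) {u u' : ext R F₁ r ⊗[R] weyl R G₁ a' q} {v v' : ext R F₁ r ⊗[R] weyl R G₁ a q}
    (h : TensorProduct.map (extMap τ.inc r) (weylMap σ.proj a' q) u +
        TensorProduct.map (extMap τ.inc r) (weylIncE σ ha q) v =
      TensorProduct.map (extMap τ.inc r) (weylMap σ.proj a' q) u' +
        TensorProduct.map (extMap τ.inc r) (weylIncE σ ha q) v') : u = u' ∧ v = v' := by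
  have key := lTensor_add_eq_zero (E := ext R F₁ r) (weylMap σ.proj a' q) (weylIncE σ ha q)
    (fun x y => weylInc_injective σ ha x y)
  exact eq_and_eq_of_map_add_map_eq _ _ (extMap τ.proj r) (τ.extProj_extInc r) _ _ key h

/-- The homology at `⋀ˢ F ⊗ K^a_0 (G^*)`. -/
abbrev weylZeroHomology (Φ : Module.Dual R G →ₗ[R] F) {s₀ s t a : ℤ} (hs : s = s₀ + 1)
    (h : t = s + a) : Type _ :=
  Hmod (X := ext R F s₀ ⊗[R] weyl R G a 1) (Y := ext R F s ⊗[R] weyl R G a 0) (Z := ext R F t)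
    (etaMap Φ hs (zero_add 1).symm) (spliceIn Φ h)

/-- The homology at `⋀ˢ F ⊗ K^a_q (G^*)` for positive `q`. -/
abbrev weylHomology (Φ : Module.Dual R G →ₗ[R] F) (a : ℤ) {s₀ s s₂ q₀ q q₂ : ℤ} (hs : s = s₀ + 1)
    (hs₂ : s₂ = s + 1) (hq : q₀ = q + 1) (hq₂ : q = q₂ + 1) : Type _ :=
  Hmod (X := ext R F s₀ ⊗[R] weyl R G a q₀) (Y := ext R F s ⊗[R] weyl R G a q)
    (Z := ext R F s₂ ⊗[R] weyl R G a q₂) (etaMap Φ hs hq) (etaMap Φ hs₂ hq₂)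

private theorem IsSplit.exists_of_etaMap_eq (H : IsSplit σ τ Φ Φ₁) {r r' r'' a a' q q' q'' : ℤ}
    (hr : r' = r + 1) (hr' : r'' = r' + 1) (ha : a' = 1 + a) (hq : q = q' + 1)
    (hq' : q' = q'' + 1) (h0 : a' ≠ 0) (y : ext R F r' ⊗[R] weyl R G a' q')
    (u : ext R F₁ r'' ⊗[R] weyl R G₁ a' q'') (v : ext R F₁ r'' ⊗[R] weyl R G₁ a q'')
    (hy : etaMap Φ hr' hq' y = TensorProduct.map (extMap τ.inc r'') (weylMap σ.proj a' q'') u +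
      TensorProduct.map (extMap τ.inc r'') (weylIncE σ ha q'') v) :
    (∃ u', etaMap Φ₁ hr' hq' u' = u) ∧ ∃ v', etaMap Φ₁ hr' hq' v' = v := by
  have h1 : TensorProduct.map (τ.extProjE hr') LinearMap.id
      (TensorProduct.map (extMap τ.inc r'') (weylMap σ.proj a' q'') u +
        TensorProduct.map (extMap τ.inc r'') (weylIncE σ ha q'') v) = 0 :=
    map_map_add_map_eq_zero _ (τ.extProjE_extInc hr') _ _ _ _
  obtain ⟨x, u', v', h⟩ := IsSplit.exists_etaMap_add_weyl_eq H hr hr' ha hq hq' h0 y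
    ((congrArg _ hy).trans h1)
  have h2 := LinearMap.congr_fun (etaMap_comp_etaMap (p := a') Φ hr hq hr' hq') x
  have h3 := map_eq_of_add_eq (etaMap Φ hr' hq') h2 h rfl
  have h4 := LinearMap.congr_fun (IsSplit.etaMap_weylMap H (a := a') hr' hq') u'
  have h5 := LinearMap.congr_fun (IsSplit.etaMap_weylIncE H hr' ha hq') v'
  have h6 := ((map_add (etaMap Φ hr' hq') _ _).trans (congrArg₂ (· + ·) h4 h5)).symm.trans
    (h3.symm.trans hy)
  obtain ⟨e1, e2⟩ := eq_and_eq_of_weylMap_add_eq σ τ ha h6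
  exact ⟨⟨u', e1⟩, ⟨v', e2⟩⟩

attribute [local irreducible] etaMap weylMap weylIncE spliceIn

private theorem IsSplit.weylHomology_equiv (H : IsSplit σ τ Φ Φ₁) {s₀ s s₂ a a' q₀ q q₂ : ℤ}
    (hs : s = s₀ + 1) (hs₂ : s₂ = s + 1) (ha : a' = 1 + a) (hq : q₀ = q + 1) (hq₂ : q = q₂ + 1)
    (h0 : a' ≠ 0) :
    Nonempty (weylHomology Φ a' hs hs₂ hq hq₂ ≃ₗ[R]
      weylHomology Φ₁ a' hs hs₂ hq hq₂ × weylHomology Φ₁ a hs hs₂ hq hq₂) := by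
  have cA (u : ext R F₁ s ⊗[R] weyl R G₁ a' q) :
      etaMap Φ hs₂ hq₂ (TensorProduct.map (extMap τ.inc s) (weylMap σ.proj a' q) u) =
        TensorProduct.map (extMap τ.inc s₂) (weylMap σ.proj a' q₂) (etaMap Φ₁ hs₂ hq₂ u) :=
    LinearMap.congr_fun (IsSplit.etaMap_weylMap H (a := a') hs₂ hq₂) u
  have cB (v : ext R F₁ s ⊗[R] weyl R G₁ a q) :
      etaMap Φ hs₂ hq₂ (TensorProduct.map (extMap τ.inc s) (weylIncE σ ha q) v) =
        TensorProduct.map (extMap τ.inc s₂) (weylIncE σ ha q₂) (etaMap Φ₁ hs₂ hq₂ v) :=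
    LinearMap.congr_fun (IsSplit.etaMap_weylIncE H hs₂ ha hq₂) v
  have key := Hmod_equiv_prod_of_injective (X := ext R F s₀ ⊗[R] weyl R G a' q₀)
    (Y := ext R F s ⊗[R] weyl R G a' q) (Z := ext R F s₂ ⊗[R] weyl R G a' q₂)
    (XA := ext R F₁ s₀ ⊗[R] weyl R G₁ a' q₀) (YA := ext R F₁ s ⊗[R] weyl R G₁ a' q)
    (ZA := ext R F₁ s₂ ⊗[R] weyl R G₁ a' q₂)
    (XB := ext R F₁ s₀ ⊗[R] weyl R G₁ a q₀) (YB := ext R F₁ s ⊗[R] weyl R G₁ a q)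
    (ZB := ext R F₁ s₂ ⊗[R] weyl R G₁ a q₂)
    (etaMap Φ hs hq) (etaMap Φ hs₂ hq₂) (etaMap Φ₁ hs hq) (etaMap Φ₁ hs₂ hq₂)
    (etaMap Φ₁ hs hq) (etaMap Φ₁ hs₂ hq₂)
    (TensorProduct.map (extMap τ.inc s) (weylMap σ.proj a' q))
    (TensorProduct.map (extMap τ.inc s) (weylIncE σ ha q))
  refine key ?_ ?_ ?_ ?_ ?_ ?_
  · intro u v
    have h1 := (map_add (etaMap Φ hs₂ hq₂) _ _).trans (congrArg₂ (· + ·) (cA u) (cB v))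
    constructor
    · intro h
      refine eq_and_eq_of_weylMap_add_eq σ τ ha (h1.symm.trans (h.trans ?_))
      exact ((congrArg₂ (· + ·) (map_zero _) (map_zero _)).trans (zero_add 0)).symm
    · rintro ⟨h2, h3⟩
      exact h1.trans ((congrArg₂ (· + ·) (LinearMap.map_eq_zero_of_eq_zero _ h2)
        (LinearMap.map_eq_zero_of_eq_zero _ h3)).trans (zero_add 0))
  · exact fun u => ⟨_, LinearMap.congr_fun (IsSplit.etaMap_weylMap H (a := a') hs hq) u⟩
  · exact fun v => ⟨_, LinearMap.congr_fun (IsSplit.etaMap_weylIncE H hs ha hq) v⟩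
  · exact LinearMap.congr_fun (etaMap_comp_etaMap Φ hs hq hs₂ hq₂)
  · intro y hy
    exact IsSplit.exists_etaMap_add_weyl_eq H hs hs₂ ha hq hq₂ h0 y
      (LinearMap.map_eq_zero_of_eq_zero _ hy)
  · intro x u v h
    exact IsSplit.exists_of_etaMap_eq H (r := s₀ - 1) (by ring) hs ha (rfl : q₀ + 1 = q₀ + 1) hq h0
      x u v h

private theorem IsSplit.weylZeroHomology_equiv (H : IsSplit σ τ Φ Φ₁) {s₀ s t t₁ a a' : ℤ}
    (hs : s = s₀ + 1) (ha : a' = 1 + a) (h : t = s + a') (h₁ : t₁ = s + a) (h0 : a' ≠ 0) :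
    Nonempty (weylZeroHomology Φ hs h ≃ₗ[R] weylZeroHomology Φ₁ hs h
      × weylZeroHomology Φ₁ hs h₁) := by
  have hq : (1 : ℤ) = 0 + 1 := (zero_add 1).symm
  have ht : t = t₁ + 1 := by omega
  have key := Hmod_equiv_prod_of_injective (X := ext R F s₀ ⊗[R] weyl R G a' 1)
    (Y := ext R F s ⊗[R] weyl R G a' 0) (Z := ext R F t)
    (XA := ext R F₁ s₀ ⊗[R] weyl R G₁ a' 1) (YA := ext R F₁ s ⊗[R] weyl R G₁ a' 0)
    (ZA := ext R F₁ t)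
    (XB := ext R F₁ s₀ ⊗[R] weyl R G₁ a 1) (YB := ext R F₁ s ⊗[R] weyl R G₁ a 0)
    (ZB := ext R F₁ t₁)
    (etaMap Φ hs hq) (spliceIn Φ h) (etaMap Φ₁ hs hq) (spliceIn Φ₁ h)
    (etaMap Φ₁ hs hq) (spliceIn Φ₁ h₁)
    (TensorProduct.map (extMap τ.inc s) (weylMap σ.proj a' 0))
    (TensorProduct.map (extMap τ.inc s) (weylIncE σ ha 0))
  refine key ?_ ?_ ?_ ?_ ?_ ?_
  · intro u v
    obtain ⟨h1, h2⟩ := IsSplit.spliceIn_add H ha h h₁ ht u v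
    constructor
    · intro h3
      refine ⟨h1.symm.trans (LinearMap.map_eq_zero_of_eq_zero (extMap τ.proj t) h3), ?_⟩
      have h4 := h2.symm.trans (LinearMap.map_eq_zero_of_eq_zero (τ.extProjE ht) h3)
      exact (sgn_smul_sgn_smul' (R := R) s _).symm.trans ((congrArg _ h4).trans (smul_zero _))
    · rintro ⟨h3, h4⟩
      exact eq_zero_of_extProj τ ht _ (h2.trans ((congrArg _ h4).trans (smul_zero _))) (h1.trans h3)
  · exact fun u => ⟨_, LinearMap.congr_fun (IsSplit.etaMap_weylMap H (a := a') hs hq) u⟩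
  · exact fun v => ⟨_, LinearMap.congr_fun (IsSplit.etaMap_weylIncE H hs ha hq) v⟩
  · exact LinearMap.congr_fun (spliceIn_comp_etaMap Φ hs h)
  · intro y hy
    exact IsSplit.exists_etaMap_add_weyl_eq H hs (r'' := s + 1) rfl ha hq (q'' := -1) (by ring) h0 y
      (tensor_eq_zero_right (fun b => weyl_neg_eq_zero (by norm_num) b) _)
  · intro x u v h
    exact IsSplit.exists_of_etaMap_eq H (r := s₀ - 1) (by ring) hs ha (q := 2) (by ring) hq h0
      x u v h

end Lower

/-! ### The homology of the complexes `C^{i,a}_Φ` -/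

section HookHomology

variable {R : Type u} [CommRing R] {F G : Type u} [AddCommGroup F] [Module R F]
  [AddCommGroup G] [Module R G] [Module.Free R G] [Module.Finite R G]
  (Φ : Module.Dual R G →ₗ[R] F)

/-- The homology of `C^{i,a}_Φ` in homological degree `i + 1 + (n + 1)`. -/
abbrev hookHomology (i a n : ℤ) : Type u :=
  Hmod (X := hookX R F G i a (n + 1 + 1)) (Y := hookX R F G i a (n + 1))
    (Z := hookX R F G i a n) (hookD Φ i a (n + 1)).hom (hookD Φ i a n).hom

theorem Hmod_congr {R X Y Z X' Y' Z' : Type*} [CommRing R] [AddCommGroup X] [Module R X]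
    [AddCommGroup Y] [Module R Y] [AddCommGroup Z] [Module R Z] [AddCommGroup X'] [Module R X']
    [AddCommGroup Y'] [Module R Y'] [AddCommGroup Z'] [Module R Z'] {f : X →ₗ[R] Y} {g : Y →ₗ[R] Z}
    {f' : X' →ₗ[R] Y'} {g' : Y' →ₗ[R] Z'} (eX : X ≃ₗ[R] X') (eY : Y ≃ₗ[R] Y') (eZ : Z ≃ₗ[R] Z')
    (hf : ∀ x, eY (f x) = f' (eX x)) (hg : ∀ y, eZ (g y) = g' (eY y)) :
    Nonempty (Hmod f g ≃ₗ[R] Hmod f' g') := by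
  let ψ : LinearMap.ker g →ₗ[R] Hmod f' g' := Submodule.mkQ _ ∘ₗ
    (eY.toLinearMap.restrict (p := LinearMap.ker g) (q := LinearMap.ker g') fun y hy =>
      (hg y).symm.trans ((congrArg eZ hy).trans (map_zero eZ)))
  refine Hmod_equiv_of_surjective f g ψ (fun u => ?_) fun y => ?_
  · obtain ⟨y, rfl⟩ := Submodule.mkQ_surjective _ u
    refine ⟨⟨eY.symm y.1, eZ.injective ?_⟩, congrArg (Submodule.mkQ _) (Subtype.ext ?_)⟩
    · rw [hg, LinearEquiv.apply_symm_apply, map_zero]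
      exact y.2
    · exact eY.apply_symm_apply y.1
  · rw [LinearMap.comp_apply, mk_Hmod_eq_zero]
    constructor
    · rintro ⟨x, hx⟩
      refine ⟨eX.symm x, eY.injective ?_⟩
      rw [hf, LinearEquiv.apply_symm_apply, hx]
      rfl
    · rintro ⟨x, hx⟩
      refine ⟨eX x, ?_⟩
      rw [← hf, hx]
      rfl

/-- The homology of a short complex of modules is the concrete quotient `Hmod`. -/
theorem moduleCat_homology_equiv (S : ShortComplex (ModuleCat.{u} R)) :
    Nonempty (S.homology ≃ₗ[R] Hmod S.f.hom S.g.hom) := by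
  have h : LinearMap.range S.moduleCatToCycles =
      (LinearMap.range S.f.hom).submoduleOf (LinearMap.ker S.g.hom) := by
    ext y
    constructor
    · rintro ⟨x, rfl⟩
      exact ⟨x, rfl⟩
    · rintro ⟨x, hx⟩
      exact ⟨x, Subtype.ext hx⟩
  exact ⟨S.moduleCatHomologyIso.toLinearEquiv.trans (Submodule.quotEquivOfEq _ _ h)⟩

theorem hookComplexShifted_sc'_equiv (i a n : ℤ) {m₂ m₁ m₀ : ℤ} (h₂ : m₂ = n + 1 + 1)
    (h₁ : m₁ = n + 1) (h₀ : m₀ = n) :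
    Nonempty (((hookComplexShifted Φ i a).sc' m₂ m₁ m₀).homology ≃ₗ[R] hookHomology Φ i a n) := by
  subst h₂ h₁ h₀
  obtain ⟨e⟩ := moduleCat_homology_equiv ((hookComplexShifted Φ i a).sc' (m₀ + 1 + 1) (m₀ + 1) m₀)
  have hf : ((hookComplexShifted Φ i a).sc' (m₀ + 1 + 1) (m₀ + 1) m₀).f = hookD Φ i a (m₀ + 1) :=
    ChainComplex.of_d _ _ _
  have hg : ((hookComplexShifted Φ i a).sc' (m₀ + 1 + 1) (m₀ + 1) m₀).g = hookD Φ i a m₀ :=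
    ChainComplex.of_d _ _ _
  rw [hf, hg] at e
  exact ⟨e⟩

/-- The homology of the chain complex `C^{i,a}_Φ` in degree `j` is `hookHomology` at `j - i - 2`. -/
theorem hookComplex_homology_equiv (i a j n : ℤ) (h : j = n + i + 2) :
    Nonempty ((hookComplex Φ i a).homology j ≃ₗ[R] hookHomology Φ i a n) := by
  obtain ⟨e⟩ := hookComplexShifted_sc'_equiv Φ i a n (m₂ := j + 1 - i - 1) (m₁ := j - i - 1)
    (m₀ := j - 1 - i - 1) (by omega) (by omega) (by omega)
  exact ⟨((hookComplex Φ i a).homologyIsoSc' (j + 1) j (j - 1) (by simp)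
    (by simp)).toLinearEquiv.trans
    e⟩

theorem hookHomology_equiv_schurHomology (i a : ℤ) (k : ℕ) {p r₀ r r₂ q₀ q q₂ : ℤ} (hr : r = r₀ + 1)
    (hr₂ : r₂ = r + 1) (hq : q = q₀ + 1) (hq₂ : q₂ = q + 1)
    (h1 : r₀ = (Module.finrank R F : ℤ) - i + k) (h2 : q₀ = (k : ℤ) + 1)
    (h3 : p = (Module.finrank R G : ℤ) - a) :
    Nonempty (hookHomology Φ i a (Int.negSucc (k + 2)) ≃ₗ[R]
      schurHomology Φ p hr hr₂ hq hq₂) := by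
  obtain rfl : r = (Module.finrank R F : ℤ) - i + (k + 1 : ℕ) := by push_cast; omega
  obtain rfl : r₂ = (Module.finrank R F : ℤ) - i + (k + 2 : ℕ) := by push_cast at *; omega
  obtain rfl : q = ((k + 1 : ℕ) : ℤ) + 1 := by push_cast; omega
  obtain rfl : q₂ = ((k + 2 : ℕ) : ℤ) + 1 := by push_cast at *; omega
  subst h1 h2 h3
  let eX : hookX R F G i a (Int.negSucc (k + 2) + 1 + 1) ≃ₗ[R]
      ext R F ((Module.finrank R F : ℤ) - i + (k : ℕ)) ⊗[R]
      schur R G ((Module.finrank R G : ℤ) - a) (((k : ℕ) : ℤ) + 1) := LinearEquiv.refl R _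
  let eY : hookX R F G i a (Int.negSucc (k + 2) + 1) ≃ₗ[R]
      ext R F ((Module.finrank R F : ℤ) - i + (k + 1 : ℕ)) ⊗[R]
      schur R G ((Module.finrank R G : ℤ) - a) (((k + 1 : ℕ) : ℤ) + 1) := LinearEquiv.refl R _
  let eZ : hookX R F G i a (Int.negSucc (k + 2)) ≃ₗ[R]
      ext R F ((Module.finrank R F : ℤ) - i + (k + 2 : ℕ)) ⊗[R]
      schur R G ((Module.finrank R G : ℤ) - a) (((k + 2 : ℕ) : ℤ) + 1) := LinearEquiv.refl R _
  exact Hmod_congr eX eY eZ (fun _ => rfl) fun _ => rfl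

theorem hookHomology_equiv_schurOneHomology (i a : ℤ) {p r₀ r r₂ : ℤ} (h : r = r₀ + (p + 1))
    (hr₂ : r₂ = r + 1) (h1 : r = (Module.finrank R F : ℤ) - i)
    (h3 : p = (Module.finrank R G : ℤ) - a) :
    Nonempty (hookHomology Φ i a (Int.negSucc 1) ≃ₗ[R] schurOneHomology Φ h hr₂) := by
  obtain rfl : r₀ = (Module.finrank R F : ℤ) - Module.finrank R G + a - i - 1 := by omega
  obtain rfl : r = (Module.finrank R F : ℤ) - i + (0 : ℕ) := by push_cast; omega
  obtain rfl : r₂ = (Module.finrank R F : ℤ) - i + (1 : ℕ) := by push_cast at *; omega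
  subst h3
  let eX : hookX R F G i a (Int.negSucc 1 + 1 + 1) ≃ₗ[R]
      ext R F ((Module.finrank R F : ℤ) - Module.finrank R G + a - i - 1) := LinearEquiv.refl R _
  let eY : hookX R F G i a (Int.negSucc 1 + 1) ≃ₗ[R]
      ext R F ((Module.finrank R F : ℤ) - i + (0 : ℕ)) ⊗[R]
      schur R G ((Module.finrank R G : ℤ) - a) 1 := LinearEquiv.refl R _
  let eZ : hookX R F G i a (Int.negSucc 1) ≃ₗ[R]
      ext R F ((Module.finrank R F : ℤ) - i + (1 : ℕ)) ⊗[R]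
      schur R G ((Module.finrank R G : ℤ) - a) 2 := LinearEquiv.refl R _
  exact Hmod_congr eX eY eZ (fun _ => rfl) fun _ => rfl

theorem hookHomology_equiv_middleHomology (i a : ℤ) {p s t t' : ℤ} (h : t = s + a)
    (h' : t' = t + (p + 1))
    (h1 : t = (Module.finrank R F : ℤ) - Module.finrank R G + a - i - 1)
    (h3 : p = (Module.finrank R G : ℤ) - a) :
    Nonempty (hookHomology Φ i a (Int.negSucc 0) ≃ₗ[R] middleHomology Φ h h') := by
  obtain rfl : s = (Module.finrank R F : ℤ) - Module.finrank R G - i - 1 - (0 : ℕ) := by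
    push_cast; omega
  obtain rfl : t' = (Module.finrank R F : ℤ) - i + (0 : ℕ) := by push_cast; omega
  subst h1 h3
  let eX : hookX R F G i a (Int.negSucc 0 + 1 + 1) ≃ₗ[R]
      ext R F ((Module.finrank R F : ℤ) - Module.finrank R G - i - 1 - (0 : ℕ)) ⊗[R]
      weyl R G a 0 := LinearEquiv.refl R _
  let eY : hookX R F G i a (Int.negSucc 0 + 1) ≃ₗ[R]
      ext R F ((Module.finrank R F : ℤ) - Module.finrank R G + a - i - 1) := LinearEquiv.refl R _
  let eZ : hookX R F G i a (Int.negSucc 0) ≃ₗ[R]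
      ext R F ((Module.finrank R F : ℤ) - i + (0 : ℕ)) ⊗[R]
      schur R G ((Module.finrank R G : ℤ) - a) 1 := LinearEquiv.refl R _
  exact Hmod_congr eX eY eZ (fun _ => rfl) fun _ => rfl

set_option maxHeartbeats 1000000 in
private theorem hookHomology_equiv_weylZeroHomology (i a : ℤ) {s₀ s t : ℤ} (hs : s = s₀ + 1)
    (h : t = s + a) (h1 : s = (Module.finrank R F : ℤ) - Module.finrank R G - i - 1) :
    Nonempty (hookHomology Φ i a (Int.ofNat 0) ≃ₗ[R] weylZeroHomology Φ hs h) := by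
  obtain rfl : t = (Module.finrank R F : ℤ) - Module.finrank R G + a - i - 1 := by omega
  obtain rfl : s₀ = (Module.finrank R F : ℤ) - Module.finrank R G - i - 1 - (1 : ℕ) := by
    push_cast; omega
  obtain rfl : s = (Module.finrank R F : ℤ) - Module.finrank R G - i - 1 - (0 : ℕ) := by
    push_cast; omega
  let eX : hookX R F G i a (Int.ofNat 0 + 1 + 1) ≃ₗ[R]
      ext R F ((Module.finrank R F : ℤ) - Module.finrank R G - i - 1 - (1 : ℕ)) ⊗[R]
      weyl R G a 1 := LinearEquiv.refl R _
  let eY : hookX R F G i a (Int.ofNat 0 + 1) ≃ₗ[R]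
      ext R F ((Module.finrank R F : ℤ) - Module.finrank R G - i - 1 - (0 : ℕ)) ⊗[R]
      weyl R G a 0 := LinearEquiv.refl R _
  let eZ : hookX R F G i a (Int.ofNat 0) ≃ₗ[R]
      ext R F ((Module.finrank R F : ℤ) - Module.finrank R G + a - i - 1) := LinearEquiv.refl R _
  exact Hmod_congr eX eY eZ (fun _ => rfl) fun _ => rfl

set_option maxHeartbeats 1000000 in
private theorem hookHomology_equiv_weylHomology (i a : ℤ) (k : ℕ) {s₀ s s₂ q₀ q q₂ : ℤ}
    (hs : s = s₀ + 1)
    (hs₂ : s₂ = s + 1) (hq : q₀ = q + 1) (hq₂ : q = q₂ + 1)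
    (h1 : s₂ = (Module.finrank R F : ℤ) - Module.finrank R G - i - 1 - k) (h2 : q₂ = k) :
    Nonempty (hookHomology Φ i a (Int.ofNat (k + 1)) ≃ₗ[R] weylHomology Φ a hs hs₂ hq hq₂) := by
  obtain rfl : s₀ = (Module.finrank R F : ℤ) - Module.finrank R G - i - 1 - (k + 2 : ℕ) := by
    push_cast; omega
  obtain rfl : s = (Module.finrank R F : ℤ) - Module.finrank R G - i - 1 - (k + 1 : ℕ) := by
    push_cast; omega
  obtain rfl : q₀ = (k + 2 : ℕ) := by push_cast; omega
  obtain rfl : q = (k + 1 : ℕ) := by push_cast; omega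
  subst h1 h2
  let eX : hookX R F G i a (Int.ofNat (k + 1) + 1 + 1) ≃ₗ[R]
      ext R F ((Module.finrank R F : ℤ) - Module.finrank R G - i - 1 - (k + 2 : ℕ)) ⊗[R]
      weyl R G a (k + 2 : ℕ) := LinearEquiv.refl R _
  let eY : hookX R F G i a (Int.ofNat (k + 1) + 1) ≃ₗ[R]
      ext R F ((Module.finrank R F : ℤ) - Module.finrank R G - i - 1 - (k + 1 : ℕ)) ⊗[R]
      weyl R G a (k + 1 : ℕ) := LinearEquiv.refl R _
  let eZ : hookX R F G i a (Int.ofNat (k + 1)) ≃ₗ[R]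
      ext R F ((Module.finrank R F : ℤ) - Module.finrank R G - i - 1 - (k : ℕ)) ⊗[R]
      weyl R G a (k : ℕ) := LinearEquiv.refl R _
  exact Hmod_congr eX eY eZ (fun _ => rfl) fun _ => rfl

end HookHomology

section StepHook

variable {R : Type u} [CommRing R] {F G F₁ G₁ : Type u} [AddCommGroup F] [Module R F]
  [AddCommGroup G] [Module R G] [Module.Free R G] [Module.Finite R G]
  [AddCommGroup F₁] [Module R F₁] [Module.Free R F₁]
  [AddCommGroup G₁] [Module R G₁] [Module.Free R G₁] [Module.Finite R G₁]
  {σ : SplitOff R G G₁} {τ : SplitOff R F F₁} {Φ : Module.Dual R G →ₗ[R] F}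
  {Φ₁ : Module.Dual R G₁ →ₗ[R] F₁}

theorem nonempty_equiv_prod_trans {R A B C A' B' C' : Type*} [CommRing R] [AddCommMonoid A]
    [Module R A] [AddCommMonoid B] [Module R B] [AddCommMonoid C] [Module R C] [AddCommMonoid A']
    [Module R A'] [AddCommMonoid B'] [Module R B'] [AddCommMonoid C'] [Module R C']
    (h : Nonempty (A' ≃ₗ[R] B' × C')) (hA : Nonempty (A ≃ₗ[R] A')) (hB : Nonempty (B ≃ₗ[R] B'))
    (hC : Nonempty (C ≃ₗ[R] C')) : Nonempty (A ≃ₗ[R] B × C) := by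
  obtain ⟨e⟩ := h
  obtain ⟨eA⟩ := hA
  obtain ⟨eB⟩ := hB
  obtain ⟨eC⟩ := hC
  exact ⟨eA.trans (e.trans (eB.symm.prodCongr eC.symm))⟩

theorem nonempty_equiv_trans {R A B A' B' : Type*} [CommRing R] [AddCommMonoid A]
    [Module R A] [AddCommMonoid B] [Module R B] [AddCommMonoid A']
    [Module R A'] [AddCommMonoid B'] [Module R B']
    (h : Nonempty (A' ≃ₗ[R] B')) (hA : Nonempty (A ≃ₗ[R] A')) (hB : Nonempty (B ≃ₗ[R] B')) :
    Nonempty (A ≃ₗ[R] B) := by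
  obtain ⟨e⟩ := h
  obtain ⟨eA⟩ := hA
  obtain ⟨eB⟩ := hB
  exact ⟨eA.trans (e.trans eB.symm)⟩

theorem subsingleton_Hmod_of_forall_eq_zero {R X Y Z : Type*} [CommRing R] [AddCommGroup X]
    [Module R X] [AddCommGroup Y] [Module R Y] [AddCommGroup Z] [Module R Z] (f : X →ₗ[R] Y)
    (g : Y →ₗ[R] Z) (h : ∀ y : Y, y = 0) : Subsingleton (Hmod f g) :=
  Hmod_subsingleton f g fun y _ => ⟨0, (map_zero f).trans (h y).symm⟩

theorem subsingleton_weylZeroHomology (Φ : Module.Dual R G →ₗ[R] F) {s₀ s t a : ℤ}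
    (hs : s = s₀ + 1) (h : t = s + a) (h0 : ∀ b : weyl R G a 0, b = 0) :
    Subsingleton (weylZeroHomology Φ hs h) :=
  subsingleton_Hmod_of_forall_eq_zero (X := ext R F s₀ ⊗[R] weyl R G a 1)
    (Y := ext R F s ⊗[R] weyl R G a 0) (Z := ext R F t) _ _ (tensor_eq_zero_right h0)

theorem subsingleton_weylHomology (Φ : Module.Dual R G →ₗ[R] F) {a s₀ s s₂ q₀ q q₂ : ℤ}
    (hs : s = s₀ + 1) (hs₂ : s₂ = s + 1) (hq : q₀ = q + 1) (hq₂ : q = q₂ + 1)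
    (h0 : ∀ b : weyl R G a q, b = 0) : Subsingleton (weylHomology Φ a hs hs₂ hq hq₂) :=
  subsingleton_Hmod_of_forall_eq_zero (X := ext R F s₀ ⊗[R] weyl R G a q₀)
    (Y := ext R F s ⊗[R] weyl R G a q) (Z := ext R F s₂ ⊗[R] weyl R G a q₂) _ _
    (tensor_eq_zero_right h0)

theorem subsingleton_schurOneHomology (Φ : Module.Dual R G →ₗ[R] F) {r₀ r r₂ p : ℤ}
    (h : r = r₀ + (p + 1)) (hr₂ : r₂ = r + 1) (h0 : ∀ b : schur R G p 1, b = 0) :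
    Subsingleton (schurOneHomology Φ h hr₂) :=
  subsingleton_Hmod_of_forall_eq_zero (X := ext R F r₀) (Y := ext R F r ⊗[R] schur R G p 1)
    (Z := ext R F r₂ ⊗[R] schur R G p 2) _ _ (tensor_eq_zero_right h0)

theorem subsingleton_schurHomology (Φ : Module.Dual R G →ₗ[R] F) {p r₀ r r₂ q₀ q q₂ : ℤ}
    (hr : r = r₀ + 1) (hr₂ : r₂ = r + 1) (hq : q = q₀ + 1) (hq₂ : q₂ = q + 1)
    (h0 : ∀ b : schur R G p q, b = 0) : Subsingleton (schurHomology Φ p hr hr₂ hq hq₂) :=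
  subsingleton_Hmod_of_forall_eq_zero (X := ext R F r₀ ⊗[R] schur R G p q₀)
    (Y := ext R F r ⊗[R] schur R G p q) (Z := ext R F r₂ ⊗[R] schur R G p q₂) _ _
    (tensor_eq_zero_right h0)

/-- After splitting off an isomorphism of rank one, the homology of `C^{i,a}_Φ` for `a < g` is the
sum of the homology of the complexes of `Φ₁` for `a` and for `a - 1`. The five cases are the five
kinds of terms in the complex. -/
theorem IsSplit.hookHomology_equiv_prod (H : IsSplit σ τ Φ Φ₁)
    (hG : Module.finrank R G = Module.finrank R G₁ + 1)
    (hF : Module.finrank R F = Module.finrank R F₁ + 1) (i n : ℤ) {a a' : ℤ} (ha : a' = 1 + a)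
    (h0 : a' ≠ 0) (hp : (Module.finrank R G : ℤ) - a' ≠ 0) :
    Nonempty (hookHomology Φ i a' n ≃ₗ[R] hookHomology Φ₁ i a' n × hookHomology Φ₁ i a n) := by
  rcases n with (_ | k) | (_ | _ | k)
  · refine nonempty_equiv_prod_trans
      (IsSplit.weylZeroHomology_equiv H
        (s₀ := (Module.finrank R F : ℤ) - Module.finrank R G - i - 2)
        (s := (Module.finrank R F : ℤ) - Module.finrank R G - i - 1) (by ring) ha rfl rfl h0)
      (hookHomology_equiv_weylZeroHomology Φ i a' _ _ rfl)
      (hookHomology_equiv_weylZeroHomology Φ₁ i a' _ _ (by rw [hF, hG]; push_cast; ring))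
      (hookHomology_equiv_weylZeroHomology Φ₁ i a _ _ (by rw [hF, hG]; push_cast; ring))
  · refine nonempty_equiv_prod_trans
      (IsSplit.weylHomology_equiv H
        (s₀ := (Module.finrank R F : ℤ) - Module.finrank R G - i - 1 - k - 2)
        (s := (Module.finrank R F : ℤ) - Module.finrank R G - i - 1 - k - 1)
        (s₂ := (Module.finrank R F : ℤ) - Module.finrank R G - i - 1 - k)
        (q₀ := (k : ℤ) + 2) (q := (k : ℤ) + 1) (q₂ := k)
        (by ring) (by ring) ha (by ring) (by ring) h0)
      (hookHomology_equiv_weylHomology Φ i a' k _ _ _ _ rfl rfl)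
      (hookHomology_equiv_weylHomology Φ₁ i a' k _ _ _ _ (by rw [hF, hG]; push_cast; ring) rfl)
      (hookHomology_equiv_weylHomology Φ₁ i a k _ _ _ _ (by rw [hF, hG]; push_cast; ring) rfl)
  · refine nonempty_equiv_prod_trans
      (IsSplit.middleHomology_equiv H
        (s := (Module.finrank R F : ℤ) - Module.finrank R G - i - 1)
        (t₁ := (Module.finrank R F : ℤ) - Module.finrank R G + a - i - 1)
        (t := (Module.finrank R F : ℤ) - Module.finrank R G + a' - i - 1)
        (t' := (Module.finrank R F : ℤ) - i) (s' := (Module.finrank R F : ℤ) - i - 1)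
        (p := (Module.finrank R G : ℤ) - a') (p' := (Module.finrank R G : ℤ) - a' - 1)
        ha (by ring) h0 hp (by ring) (by ring) (by rw [ha]; ring) (by ring) (by ring)
        (by rw [ha]; ring) (by ring) (by linarith))
      (hookHomology_equiv_middleHomology Φ i a' _ _ rfl rfl)
      (hookHomology_equiv_middleHomology Φ₁ i a' _ _ (by rw [hF, hG]; push_cast; ring)
        (by rw [hG]; push_cast; ring))
      (hookHomology_equiv_middleHomology Φ₁ i a _ _ (by rw [hF, hG]; push_cast; ring)
        (by rw [hG, ha]; push_cast; ring))
  · refine nonempty_equiv_prod_trans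
      (IsSplit.schurOneHomology_equiv H
        (s₀ := (Module.finrank R F : ℤ) - Module.finrank R G + a - i - 1)
        (r₀ := (Module.finrank R F : ℤ) - Module.finrank R G + a' - i - 1)
        (s := (Module.finrank R F : ℤ) - i - 1) (r := (Module.finrank R F : ℤ) - i)
        (r₂ := (Module.finrank R F : ℤ) - i + 1)
        (p := (Module.finrank R G : ℤ) - a') (p' := (Module.finrank R G : ℤ) - a' - 1)
        (by rw [ha]; ring) (by ring) (by ring) (by rw [ha]; ring) (by ring) (by ring) (by ring))
      (hookHomology_equiv_schurOneHomology Φ i a' _ _ rfl rfl)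
      (hookHomology_equiv_schurOneHomology Φ₁ i a' _ _ (by rw [hF]; push_cast; ring)
        (by rw [hG]; push_cast; ring))
      (hookHomology_equiv_schurOneHomology Φ₁ i a _ _ (by rw [hF]; push_cast; ring)
        (by rw [hG, ha]; push_cast; ring))
  · refine nonempty_equiv_prod_trans
      (IsSplit.schurHomology_equiv H
        (s₀ := (Module.finrank R F : ℤ) - i + k - 1) (s := (Module.finrank R F : ℤ) - i + k)
        (r := (Module.finrank R F : ℤ) - i + k + 1) (r₂ := (Module.finrank R F : ℤ) - i + k + 2)
        (p := (Module.finrank R G : ℤ) - a') (p' := (Module.finrank R G : ℤ) - a' - 1)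
        (q₀ := (k : ℤ) + 1) (q := (k : ℤ) + 2) (q₂ := (k : ℤ) + 3)
        (by ring) (by ring) (by ring) (by ring) (by ring) (by ring) (by omega))
      (hookHomology_equiv_schurHomology Φ i a' k _ _ _ _ rfl rfl rfl)
      (hookHomology_equiv_schurHomology Φ₁ i a' k _ _ _ _ (by rw [hF]; push_cast; ring) rfl
        (by rw [hG]; push_cast; ring))
      (hookHomology_equiv_schurHomology Φ₁ i a k _ _ _ _ (by rw [hF]; push_cast; ring) rfl
        (by rw [hG, ha]; push_cast; ring))

/-- For `a = g` only the complex of `Φ₁` for `a - 1` contributes, since `K^g_q` and `L^{-1}_q`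
vanish for a module of rank `g - 1`. -/
theorem IsSplit.hookHomology_equiv_of_eq_finrank (H : IsSplit σ τ Φ Φ₁)
    (hG : Module.finrank R G = Module.finrank R G₁ + 1)
    (hF : Module.finrank R F = Module.finrank R F₁ + 1) (i n : ℤ) {a a' : ℤ} (ha : a' = 1 + a)
    (h0 : a' ≠ 0) (hp : (Module.finrank R G : ℤ) = a') :
    Nonempty (hookHomology Φ i a' n ≃ₗ[R] hookHomology Φ₁ i a n) := by
  have hw : (Module.finrank R G₁ : ℤ) < a' := by rw [← hp, hG]; push_cast; omega
  rcases n with (_ | k) | (_ | _ | k)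
  · obtain ⟨e⟩ := IsSplit.weylZeroHomology_equiv H
      (s₀ := (Module.finrank R F : ℤ) - Module.finrank R G - i - 2)
      (s := (Module.finrank R F : ℤ) - Module.finrank R G - i - 1) (by ring) ha rfl rfl h0
    have := subsingleton_weylZeroHomology Φ₁
      (s₀ := (Module.finrank R F : ℤ) - Module.finrank R G - i - 2)
      (s := (Module.finrank R F : ℤ) - Module.finrank R G - i - 1) (by ring) rfl
      (fun b => weyl_eq_zero_of_lt hw b)
    exact nonempty_equiv_trans (nonempty_equiv_of_prod_right e)
      (hookHomology_equiv_weylZeroHomology Φ i a' _ _ rfl)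
      (hookHomology_equiv_weylZeroHomology Φ₁ i a _ _ (by rw [hF, hG]; push_cast; ring))
  · obtain ⟨e⟩ := IsSplit.weylHomology_equiv H
      (s₀ := (Module.finrank R F : ℤ) - Module.finrank R G - i - 1 - k - 2)
      (s := (Module.finrank R F : ℤ) - Module.finrank R G - i - 1 - k - 1)
      (s₂ := (Module.finrank R F : ℤ) - Module.finrank R G - i - 1 - k)
      (q₀ := (k : ℤ) + 2) (q := (k : ℤ) + 1) (q₂ := k)
      (by ring) (by ring) ha (by ring) (by ring) h0
    have := subsingleton_weylHomology Φ₁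
      (s₀ := (Module.finrank R F : ℤ) - Module.finrank R G - i - 1 - k - 2)
      (s := (Module.finrank R F : ℤ) - Module.finrank R G - i - 1 - k - 1)
      (s₂ := (Module.finrank R F : ℤ) - Module.finrank R G - i - 1 - k)
      (q₀ := (k : ℤ) + 2) (q := (k : ℤ) + 1) (q₂ := k)
      (by ring) (by ring) (by ring) (by ring) (fun b => weyl_eq_zero_of_lt hw b)
    exact nonempty_equiv_trans (nonempty_equiv_of_prod_right e)
      (hookHomology_equiv_weylHomology Φ i a' k _ _ _ _ rfl rfl)
      (hookHomology_equiv_weylHomology Φ₁ i a k _ _ _ _ (by rw [hF, hG]; push_cast; ring) rfl)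
  · exact nonempty_equiv_trans
      (IsSplit.middleHomology_equiv_zero H
        (s := (Module.finrank R F : ℤ) - Module.finrank R G - i - 1)
        (t₁ := (Module.finrank R F : ℤ) - Module.finrank R G + a - i - 1)
        (t := (Module.finrank R F : ℤ) - Module.finrank R G + a' - i - 1)
        (t' := (Module.finrank R F : ℤ) - i)
        ha h0 (by ring) (by ring) (by rw [ha]; ring) (by rw [hp]; ring) (by rw [ha]; ring)
        (by linarith))
      (hookHomology_equiv_middleHomology Φ i a' _ _ rfl (by rw [hp]; ring))
      (hookHomology_equiv_middleHomology Φ₁ i a _ _ (by rw [hF, hG]; push_cast; ring)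
        (by rw [hG, ha] at hp; push_cast at hp; linarith))
  · obtain ⟨e⟩ := IsSplit.schurOneHomology_equiv H
      (s₀ := (Module.finrank R F : ℤ) - Module.finrank R G + a - i - 1)
      (r₀ := (Module.finrank R F : ℤ) - Module.finrank R G + a' - i - 1)
      (s := (Module.finrank R F : ℤ) - i - 1) (r := (Module.finrank R F : ℤ) - i)
      (r₂ := (Module.finrank R F : ℤ) - i + 1)
      (p := 0) (p' := -1)
      (by rw [ha]; ring) (by rw [hp]; ring) (by rw [hp]; ring) (by rw [hp, ha]; ring) (by ring)
      (by ring) (by ring)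
    have := subsingleton_schurOneHomology Φ₁
      (r₀ := (Module.finrank R F : ℤ) - Module.finrank R G + a' - i - 1)
      (r := (Module.finrank R F : ℤ) - i - 1) (r₂ := (Module.finrank R F : ℤ) - i) (p := -1)
      (by rw [hp]; ring) (by ring) (fun b => schur_eq_zero_of_neg (by norm_num) b)
    exact nonempty_equiv_trans (nonempty_equiv_of_prod_right e)
      (hookHomology_equiv_schurOneHomology Φ i a' _ _ rfl (by rw [hp]; ring))
      (hookHomology_equiv_schurOneHomology Φ₁ i a _ _ (by rw [hF]; push_cast; ring)
        (by rw [hG, ha] at hp; push_cast at hp; linarith))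
  · obtain ⟨e⟩ := IsSplit.schurHomology_equiv H
      (s₀ := (Module.finrank R F : ℤ) - i + k - 1) (s := (Module.finrank R F : ℤ) - i + k)
      (r := (Module.finrank R F : ℤ) - i + k + 1) (r₂ := (Module.finrank R F : ℤ) - i + k + 2)
      (p := 0) (p' := -1)
      (q₀ := (k : ℤ) + 1) (q := (k : ℤ) + 2) (q₂ := (k : ℤ) + 3)
      (by ring) (by ring) (by ring) (by ring) (by ring) (by ring) (by omega)
    have := subsingleton_schurHomology Φ₁
      (r₀ := (Module.finrank R F : ℤ) - i + k - 1) (r := (Module.finrank R F : ℤ) - i + k)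
      (r₂ := (Module.finrank R F : ℤ) - i + k + 1) (p := -1)
      (q₀ := (k : ℤ) + 1) (q := (k : ℤ) + 2) (q₂ := (k : ℤ) + 3)
      (by ring) (by ring) (by ring) (by ring) (fun b => schur_eq_zero_of_neg (by norm_num) b)
    exact nonempty_equiv_trans (nonempty_equiv_of_prod_right e)
      (hookHomology_equiv_schurHomology Φ i a' k _ _ _ _ rfl rfl (by rw [hp]; ring))
      (hookHomology_equiv_schurHomology Φ₁ i a k _ _ _ _ (by rw [hF]; push_cast; ring) rfl
        (by rw [hG, ha] at hp; push_cast at hp; linarith))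

/-- The module `K^0_0 (G^*)` is generated by an element that corresponds to the unit of
`⋀⁰ (G^*)`. -/
theorem exists_weylZero_eq_one : ∃ k : weyl R G 0 0, (weylZero 0 k).1 = 1 ∧
    ∀ x : weyl R G 0 0, ∃ c : R, x = c • k := by
  let ε : Module.Dual R (sym R G 0) :=
    (SymmetricAlgebra.algebraMapInv (R := R) (M := G)).toLinearMap ∘ₗ (sym R G 0).subtype
  have hε : divZero R G ε = 1 := map_one (SymmetricAlgebra.algebraMapInv (R := R) (M := G))
  have h0 (φ : Module.Dual R (sym R G (-1))) : φ = 0 := LinearMap.ext fun x => by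
    rw [show x = 0 from Subtype.ext x.2, map_zero, map_zero]
  have hφ (φ : Module.Dual R (sym R G 0)) :
      φ = φ ⟨1, one_mem_sym⟩ • ε := LinearMap.ext fun x => by
    obtain ⟨c, rfl⟩ := exists_smul_one_of_mem_sym x
    rw [map_smul, map_smul]
    refine congrArg (c • ·) ?_
    change _ = φ ⟨1, one_mem_sym⟩ * divZero R G ε
    rw [hε, mul_one]
  have hx (x : ext R (Module.Dual R G) 0 ⊗[R] divPow R G 0) :
      ∃ c : R, x = c • (⟨1, one_mem_ext⟩ ⊗ₜ[R] ε) := by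
    induction x using TensorProduct.induction_on with
    | zero => exact ⟨0, (zero_smul _ _).symm⟩
    | tmul a b =>
      obtain ⟨c, rfl⟩ := exists_smul_one_of_mem_ext a
      refine ⟨c * divZero R G b, Eq.trans ?_ (TensorProduct.smul_tmul_smul c _ _ _)⟩
      exact congrArg (TensorProduct.mk R (ext R (Module.Dual R G) 0) (divPow R G 0) _) (hφ b)
    | add a b ha hb =>
      obtain ⟨c, hc⟩ := ha
      obtain ⟨d, hd⟩ := hb
      exact ⟨c + d, (congrArg₂ (· + ·) hc hd).trans (add_smul c d _).symm⟩
  refine ⟨⟨⟨1, one_mem_ext⟩ ⊗ₜ ε, (mem_weyl (q' := -1) rfl (by ring)).2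
    (tensor_eq_zero h0 _)⟩, ?_, fun x => ?_⟩
  · have h1 : evalZero R G 0 (⟨1, one_mem_ext⟩ ⊗ₜ ε) = ⟨1, one_mem_ext⟩ := by
      change divZero R G ε • (⟨1, one_mem_ext⟩ : ext R (Module.Dual R G) 0) = _
      rw [hε, one_smul]
    exact congrArg Subtype.val h1
  · obtain ⟨c, hc⟩ := hx x.1
    exact ⟨c, Subtype.ext hc⟩

theorem exists_unit_tmul {E L : Type*} [AddCommMonoid E] [Module R E] [AddCommMonoid L] [Module R L]
    {k : L} (hk : ∀ x, ∃ c : R, x = c • k) (z : E ⊗[R] L) : ∃ f, z = f ⊗ₜ k := by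
  induction z using TensorProduct.induction_on with
  | zero => exact ⟨0, (TensorProduct.zero_tmul _ _).symm⟩
  | tmul a b =>
    obtain ⟨c, rfl⟩ := hk b
    exact ⟨c • a, (TensorProduct.smul_tmul _ _ _).symm⟩
  | add a b ha hb =>
    obtain ⟨c, rfl⟩ := ha
    obtain ⟨d, rfl⟩ := hb
    exact ⟨c + d, (TensorProduct.add_tmul _ _ _).symm⟩

theorem subsingleton_weylZeroHomology_zero (Φ : Module.Dual R G →ₗ[R] F) {s₀ s t : ℤ}
    (hs : s = s₀ + 1) (h : t = s + 0) : Subsingleton (weylZeroHomology Φ hs h) := by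
  refine Hmod_subsingleton (X := ext R F s₀ ⊗[R] weyl R G 0 1)
    (Y := ext R F s ⊗[R] weyl R G 0 0) (Z := ext R F t) _ _ fun y hy => ⟨0, ?_⟩
  obtain ⟨k, hk, hk'⟩ := exists_weylZero_eq_one (R := R) (G := G)
  obtain ⟨f, rfl⟩ := exists_unit_tmul hk' y
  have h1 : f = 0 := by
    refine Subtype.ext ?_
    have h2 := congrArg Subtype.val hy
    rw [spliceIn_tmul, hk, map_one, mul_one] at h2
    exact h2
  rw [h1, TensorProduct.zero_tmul]
  exact map_zero _

theorem subsingleton_middleHomology_zero (Φ : Module.Dual R G →ₗ[R] F) {s t t' p : ℤ}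
    (h : t = s + 0) (h' : t' = t + (p + 1)) : Subsingleton (middleHomology Φ h h') := by
  refine Hmod_subsingleton (X := ext R F s ⊗[R] weyl R G 0 0) (Y := ext R F t)
    (Z := ext R F t' ⊗[R] schur R G p 1) _ _ fun y hy => ?_
  obtain ⟨k, hk, hk'⟩ := exists_weylZero_eq_one (R := R) (G := G)
  obtain rfl : t = s := by omega
  refine ⟨y ⊗ₜ k, Subtype.ext ?_⟩
  rw [spliceIn_tmul, hk, map_one, mul_one]

/-- The complex `C^{i,0}_Φ` is acyclic: its only nonzero differential is an isomorphism. -/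
theorem subsingleton_hookHomology_zero (Φ : Module.Dual R G →ₗ[R] F) (i n : ℤ) :
    Subsingleton (hookHomology Φ i 0 n) := by
  rcases n with (_ | k) | (_ | _ | k)
  · obtain ⟨e⟩ := hookHomology_equiv_weylZeroHomology Φ i 0
      (s₀ := (Module.finrank R F : ℤ) - Module.finrank R G - i - 2)
      (s := (Module.finrank R F : ℤ) - Module.finrank R G - i - 1) (by ring) rfl rfl
    have := subsingleton_weylZeroHomology_zero Φ
      (s₀ := (Module.finrank R F : ℤ) - Module.finrank R G - i - 2)
      (s := (Module.finrank R F : ℤ) - Module.finrank R G - i - 1) (by ring) rfl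
    exact e.toEquiv.subsingleton
  · obtain ⟨e⟩ := hookHomology_equiv_weylHomology Φ i 0 k
      (s₀ := (Module.finrank R F : ℤ) - Module.finrank R G - i - 1 - k - 2)
      (s := (Module.finrank R F : ℤ) - Module.finrank R G - i - 1 - k - 1)
      (s₂ := (Module.finrank R F : ℤ) - Module.finrank R G - i - 1 - k)
      (q₀ := (k : ℤ) + 2) (q := (k : ℤ) + 1) (q₂ := k)
      (by ring) (by ring) (by ring) (by ring) rfl rfl
    have := subsingleton_weylHomology Φ
      (s₀ := (Module.finrank R F : ℤ) - Module.finrank R G - i - 1 - k - 2)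
      (s := (Module.finrank R F : ℤ) - Module.finrank R G - i - 1 - k - 1)
      (s₂ := (Module.finrank R F : ℤ) - Module.finrank R G - i - 1 - k)
      (q₀ := (k : ℤ) + 2) (q := (k : ℤ) + 1) (q₂ := k)
      (by ring) (by ring) (by ring) (by ring) (fun b => weyl_zero_eq (by omega) b)
    exact e.toEquiv.subsingleton
  · obtain ⟨e⟩ := hookHomology_equiv_middleHomology Φ i 0
      (s := (Module.finrank R F : ℤ) - Module.finrank R G - i - 1)
      (t := (Module.finrank R F : ℤ) - Module.finrank R G + 0 - i - 1)
      (t' := (Module.finrank R F : ℤ) - i) (p := (Module.finrank R G : ℤ) - 0)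
      (by ring) (by ring) rfl rfl
    have := subsingleton_middleHomology_zero Φ
      (s := (Module.finrank R F : ℤ) - Module.finrank R G - i - 1)
      (t := (Module.finrank R F : ℤ) - Module.finrank R G + 0 - i - 1)
      (t' := (Module.finrank R F : ℤ) - i) (p := (Module.finrank R G : ℤ) - 0)
      (by ring) (by ring)
    exact e.toEquiv.subsingleton
  · obtain ⟨e⟩ := hookHomology_equiv_schurOneHomology Φ i 0
      (r₀ := (Module.finrank R F : ℤ) - Module.finrank R G + 0 - i - 1)
      (r := (Module.finrank R F : ℤ) - i)
      (r₂ := (Module.finrank R F : ℤ) - i + 1) (p := (Module.finrank R G : ℤ) - 0)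
      (by ring) rfl rfl rfl
    have := subsingleton_schurOneHomology Φ
      (r₀ := (Module.finrank R F : ℤ) - Module.finrank R G + 0 - i - 1)
      (r := (Module.finrank R F : ℤ) - i)
      (r₂ := (Module.finrank R F : ℤ) - i + 1) (p := (Module.finrank R G : ℤ) - 0)
      (by ring) rfl (fun b => schur_eq_zero_of_le (by omega) one_ne_zero b)
    exact e.toEquiv.subsingleton
  · obtain ⟨e⟩ := hookHomology_equiv_schurHomology Φ i 0 k
      (r₀ := (Module.finrank R F : ℤ) - i + k) (r := (Module.finrank R F : ℤ) - i + k + 1)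
      (r₂ := (Module.finrank R F : ℤ) - i + k + 2) (p := (Module.finrank R G : ℤ) - 0)
      (q₀ := (k : ℤ) + 1) (q := (k : ℤ) + 2) (q₂ := (k : ℤ) + 3)
      (by ring) (by ring) (by ring) (by ring) rfl rfl rfl
    have := subsingleton_schurHomology Φ
      (r₀ := (Module.finrank R F : ℤ) - i + k) (r := (Module.finrank R F : ℤ) - i + k + 1)
      (r₂ := (Module.finrank R F : ℤ) - i + k + 2) (p := (Module.finrank R G : ℤ) - 0)
      (q₀ := (k : ℤ) + 1) (q := (k : ℤ) + 2) (q₂ := (k : ℤ) + 3)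
      (by ring) (by ring) (by ring) (by ring)
      (fun b => schur_eq_zero_of_le (by omega) (by omega) b)
    exact e.toEquiv.subsingleton

end StepHook

/-! ### Splitting off an isomorphism of arbitrary rank -/

theorem intChoose_succ (n : ℕ) (k : ℤ) :
    intChoose (n + 1) k = intChoose n k + intChoose n (k - 1) := by
  rcases k with (_ | k) | k
  · change (n + 1).choose 0 = n.choose 0 + 0
    simp
  · rw [show Int.ofNat (k + 1) - 1 = Int.ofNat k by simp]
    change (n + 1).choose (k + 1) = n.choose (k + 1) + n.choose k
    rw [Nat.choose_succ_succ, add_comm]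
  · rfl

theorem intChoose_of_neg (n : ℕ) {k : ℤ} (hk : k < 0) : intChoose n k = 0 := by
  rcases k with k | k
  · exact absurd hk (not_lt.2 (Int.natCast_nonneg k))
  · rfl

theorem intChoose_of_lt (n : ℕ) {k : ℤ} (hk : (n : ℤ) < k) : intChoose n k = 0 := by
  rcases k with k | k
  · exact Nat.choose_eq_zero_of_lt (Int.ofNat_lt.1 hk)
  · rfl

theorem intChoose_zero_of_ne {k : ℤ} (hk : k ≠ 0) : intChoose 0 k = 0 := by
  rcases lt_or_gt_of_ne hk with h | h
  · exact intChoose_of_neg 0 h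
  · exact intChoose_of_lt 0 (by exact_mod_cast h)

section BinomSum

variable (R : Type u) [CommRing R] (M : ℤ → Type u) [∀ β, AddCommGroup (M β)]
  [∀ β, Module R (M β)] (g : ℕ)

/-- The direct sum of the modules `(M β)^(n choose a - β)` for `1 ≤ β ≤ g`. -/
abbrev BinomSum (n : ℕ) (a : ℤ) : Type u :=
  ∀ β : Finset.Icc (1 : ℤ) g, Fin (intChoose n (a - β)) → M β

/-- Pascal's rule for `BinomSum`. -/
theorem BinomSum.succ_equiv (n : ℕ) (a : ℤ) :
    Nonempty (BinomSum M g (n + 1) a ≃ₗ[R] BinomSum M g n a × BinomSum M g n (a - 1)) := by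
  have h (β : ℤ) : intChoose n (a - β) + intChoose n (a - 1 - β) = intChoose (n + 1) (a - β) := by
    rw [intChoose_succ, sub_right_comm]
  let e (β : Finset.Icc (1 : ℤ) g) : (Fin (intChoose (n + 1) (a - β)) → M β) ≃ₗ[R]
      (Fin (intChoose n (a - β)) → M β) × (Fin (intChoose n (a - 1 - β)) → M β) :=
    (LinearEquiv.funCongrLeft R (M β) (finSumFinEquiv.trans (finCongr (h β)))).trans
      (LinearEquiv.sumArrowLequivProdArrow _ _ R _)
  let e' : (∀ β : Finset.Icc (1 : ℤ) g, (Fin (intChoose n (a - β)) → M β) ×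
      (Fin (intChoose n (a - 1 - β)) → M β)) ≃ₗ[R] BinomSum M g n a × BinomSum M g n (a - 1) :=
    { toFun := fun x => (fun β => (x β).1, fun β => (x β).2)
      invFun := fun y β => (y.1 β, y.2 β)
      map_add' := fun _ _ => rfl
      map_smul' := fun _ _ => rfl }
  exact ⟨(LinearEquiv.piCongrRight e).trans e'⟩

theorem BinomSum.subsingleton (n : ℕ) (a : ℤ)
    (h : ∀ β : ℤ, 1 ≤ β → β ≤ g → intChoose n (a - β) = 0) : Subsingleton (BinomSum M g n a) := by
  have hβ (β : Finset.Icc (1 : ℤ) g) : IsEmpty (Fin (intChoose n (a - β))) := by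
    have h1 := Finset.mem_Icc.1 β.2
    rw [h β h1.1 h1.2]
    infer_instance
  infer_instance

theorem BinomSum.zero_equiv {a : ℤ} (h : 1 ≤ a) (h' : a ≤ g) :
    Nonempty (BinomSum M g 0 a ≃ₗ[R] M a) := by
  have h1 : intChoose 0 (a - a) = 1 := by rw [sub_self]; rfl
  let j : Fin (intChoose 0 (a - a)) := ⟨0, by rw [h1]; exact one_pos⟩
  have hj (l) : l = j := Fin.ext (Nat.lt_one_iff.1 (l.2.trans_eq h1))
  let f : BinomSum M g 0 a →ₗ[R] M a :=
    LinearMap.proj j ∘ₗ LinearMap.proj (φ := fun β : Finset.Icc (1 : ℤ) g =>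
      Fin (intChoose 0 (a - β)) → M β) ⟨a, Finset.mem_Icc.2 ⟨h, h'⟩⟩
  refine ⟨LinearEquiv.ofBijective f ⟨fun x y hxy => ?_, fun m => ?_⟩⟩
  · funext ⟨β, hβ⟩ l
    by_cases hb : a = β
    · subst hb
      rw [hj l]
      exact hxy
    · exact absurd (l.2.trans_eq (intChoose_zero_of_ne (sub_ne_zero.2 hb))) (Nat.not_lt_zero _)
  · refine ⟨fun β _ => if hb : a = β then hb ▸ m else 0, ?_⟩
    exact dif_pos rfl

end BinomSum

section Step

variable {R : Type u} [CommRing R] {F G F₁ G₁ : Type u} [AddCommGroup F] [Module R F]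
  [AddCommGroup G] [Module R G] [Module.Free R G] [Module.Finite R G]
  [AddCommGroup F₁] [Module R F₁] [Module.Free R F₁]
  [AddCommGroup G₁] [Module R G₁] [Module.Free R G₁] [Module.Finite R G₁]
  {σ : SplitOff R G G₁} {τ : SplitOff R F F₁} {Φ : Module.Dual R G →ₗ[R] F}
  {Φ₁ : Module.Dual R G₁ →ₗ[R] F₁}

theorem nonempty_equiv_of_subsingleton {R A B : Type*} [CommRing R] [AddCommGroup A] [Module R A]
    [AddCommGroup B] [Module R B] (hA : Subsingleton A) (hB : Subsingleton B) :
    Nonempty (A ≃ₗ[R] B) :=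
  ⟨{ toFun := 0, invFun := 0, map_add' := fun _ _ => Subsingleton.elim _ _,
     map_smul' := fun _ _ => Subsingleton.elim _ _, left_inv := fun _ => Subsingleton.elim _ _,
     right_inv := fun _ => Subsingleton.elim _ _ }⟩

theorem nonempty_equiv_prod_of_subsingleton {R A B C : Type*} [CommRing R] [AddCommGroup A]
    [Module R A] [AddCommGroup B] [Module R B] [AddCommGroup C] [Module R C]
    (h : Nonempty (A ≃ₗ[R] C)) (hB : Subsingleton B) : Nonempty (A ≃ₗ[R] B × C) := by
  obtain ⟨e⟩ := h
  exact ⟨e.trans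
    { toFun := fun c => (0, c), invFun := Prod.snd,
      map_add' := fun _ _ => Prod.ext (add_zero 0).symm rfl,
      map_smul' := fun _ _ => Prod.ext (smul_zero _).symm rfl, left_inv := fun _ => rfl,
      right_inv := fun _ => Prod.ext (Subsingleton.elim _ _) rfl }⟩

theorem nonempty_equiv_prod_congr {R A B C B' C' : Type*} [CommRing R] [AddCommGroup A]
    [Module R A] [AddCommGroup B] [Module R B] [AddCommGroup C] [Module R C] [AddCommGroup B']
    [Module R B'] [AddCommGroup C'] [Module R C'] (h : Nonempty (A ≃ₗ[R] B × C))
    (hB : Nonempty (B ≃ₗ[R] B')) (hC : Nonempty (C ≃ₗ[R] C')) : Nonempty (A ≃ₗ[R] B' × C') := by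
  obtain ⟨e⟩ := h
  obtain ⟨eB⟩ := hB
  obtain ⟨eC⟩ := hC
  exact ⟨e.trans (eB.prodCongr eC)⟩

theorem nonempty_equiv_trans_symm {R A B C : Type*} [CommRing R] [AddCommGroup A]
    [Module R A] [AddCommGroup B] [Module R B] [AddCommGroup C] [Module R C]
    (h : Nonempty (A ≃ₗ[R] C)) (h' : Nonempty (B ≃ₗ[R] C)) : Nonempty (A ≃ₗ[R] B) := by
  obtain ⟨e⟩ := h
  obtain ⟨e'⟩ := h'
  exact ⟨e.trans e'.symm⟩

/-- The induction step: the recursion of the homology under splitting off a rank one isomorphism is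
Pascal's rule. The case `a = 0`, in which both sides vanish, is needed to start the recursion in
`a`. -/
theorem IsSplit.hookHomology_equiv_binomSum (H : IsSplit σ τ Φ Φ₁)
    (hG : Module.finrank R G = Module.finrank R G₁ + 1)
    (hF : Module.finrank R F = Module.finrank R F₁ + 1) (i m : ℤ) (M : ℤ → Type u)
    [∀ β, AddCommGroup (M β)] [∀ β, Module R (M β)] (g n : ℕ)
    (hn : Module.finrank R G₁ = g + n)
    (ih : ∀ a : ℤ, 0 ≤ a → a ≤ Module.finrank R G₁ →
      Nonempty (hookHomology Φ₁ i a m ≃ₗ[R] BinomSum M g n a))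
    (a : ℤ) (ha : 0 ≤ a) (hag : a ≤ Module.finrank R G) :
    Nonempty (hookHomology Φ i a m ≃ₗ[R] BinomSum M g (n + 1) a) := by
  rcases eq_or_ne a 0 with rfl | h0
  · exact nonempty_equiv_of_subsingleton (subsingleton_hookHomology_zero Φ i m)
      (BinomSum.subsingleton M g (n + 1) 0 fun β h _ => intChoose_of_neg _ (by omega))
  refine nonempty_equiv_trans_symm ?_ (BinomSum.succ_equiv R M g n a)
  rcases eq_or_ne (Module.finrank R G : ℤ) a with hp | hp
  · have hW : Subsingleton (BinomSum M g n a) := BinomSum.subsingleton M g n a fun β _ h' =>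
      intChoose_of_lt _ (by rw [← hp, hG, hn]; push_cast; omega)
    refine nonempty_equiv_prod_of_subsingleton ?_ hW
    obtain ⟨e⟩ := IsSplit.hookHomology_equiv_of_eq_finrank H hG hF i m (a := a - 1) (a' := a)
      (by ring) h0 hp
    obtain ⟨e'⟩ := ih (a - 1) (by omega) (by omega)
    exact ⟨e.trans e'⟩
  · exact nonempty_equiv_prod_congr
      (IsSplit.hookHomology_equiv_prod H hG hF i m (a := a - 1) (a' := a) (by ring) h0
        (sub_ne_zero.2 hp)) (ih a ha (by omega)) (ih (a - 1) (by omega) (by omega))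

/-- The start of the induction, where no isomorphism is split off. -/
theorem hookHomology_equiv_binomSum_zero (Φ : Module.Dual R G →ₗ[R] F) (i m : ℤ) (a : ℤ)
    (ha : 0 ≤ a) (hag : a ≤ Module.finrank R G) :
    Nonempty (hookHomology Φ i a m ≃ₗ[R]
      BinomSum (fun β => hookHomology Φ i β m) (Module.finrank R G) 0 a) := by
  rcases eq_or_ne a 0 with rfl | h0
  · exact nonempty_equiv_of_subsingleton (subsingleton_hookHomology_zero Φ i m)
      (BinomSum.subsingleton _ _ 0 0 fun β h _ => intChoose_of_neg _ (by omega))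
  · obtain ⟨e⟩ := BinomSum.zero_equiv R (fun β => hookHomology Φ i β m) (Module.finrank R G)
      (a := a) (by omega) hag
    exact ⟨e.symm⟩

end Step

section Chain

variable {R : Type u} [CommRing R]

/-- The splitting of `M` given by an isomorphism of `M` with `M₁ × R`. -/
def SplitOff.ofEquiv {M M₁ : Type*} [AddCommGroup M] [Module R M] [AddCommGroup M₁] [Module R M₁]
    (α : M ≃ₗ[R] M₁ × R) : SplitOff R M M₁ where
  inc := α.symm.toLinearMap ∘ₗ LinearMap.inl R M₁ R
  proj := LinearMap.fst R M₁ R ∘ₗ α.toLinearMap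
  e := α.symm (0, 1)
  ε := LinearMap.snd R M₁ R ∘ₗ α.toLinearMap
  proj_inc x := by simp
  ε_inc x := by simp
  proj_e := by simp
  ε_e := by simp
  decomp x := α.injective (by
    rw [map_add, map_smul]
    change α (α.symm ((α x).1, 0)) + (α x).2 • α (α.symm (0, 1)) = α x
    rw [LinearEquiv.apply_symm_apply, LinearEquiv.apply_symm_apply]
    ext <;> simp)

/-- The isomorphism of `N × Rⁿ⁺¹` with `(N × Rⁿ) × R`, which splits off the first coordinate. -/
def consProdEquiv (R N : Type*) [CommRing R] [AddCommGroup N] [Module R N] (n : ℕ) :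
    (N × (Fin (n + 1) → R)) ≃ₗ[R] (N × (Fin n → R)) × R where
  toFun x := ((x.1, fun k => x.2 k.succ), x.2 0)
  invFun y := (y.1.1, Fin.cons y.2 y.1.2)
  map_add' _ _ := rfl
  map_smul' _ _ := rfl
  left_inv x := Prod.ext rfl (Fin.cons_self_tail x.2)
  right_inv _ := rfl

variable {F' G' : Type u} [AddCommGroup F'] [Module R F'] [AddCommGroup G'] [Module R G']
  (Φ' : Module.Dual R G' →ₗ[R] F')

/-- The direct sum of `Φ'` and of the identity matrix of size `n`. -/
def stdBlock (n : ℕ) : Module.Dual R (G' × (Fin n → R)) →ₗ[R] F' × (Fin n → R) :=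
  (Φ' ∘ₗ (LinearMap.inl R G' (Fin n → R)).dualMap).prod
    (LinearMap.pi fun k => Module.Dual.eval R _ (0, Pi.single k 1))

/-- Up to the isomorphisms `α` and `β`, the map `Φ` is the direct sum of `Φ'` and of the identity
matrix of size `n`. -/
def IsBlock {n : ℕ} {F G : Type u} [AddCommGroup F] [Module R F] [AddCommGroup G] [Module R G]
    (α : G ≃ₗ[R] G' × (Fin n → R)) (β : F ≃ₗ[R] F' × (Fin n → R))
    (Φ : Module.Dual R G →ₗ[R] F) : Prop :=
  ∀ ψ, β (Φ ψ) = stdBlock Φ' n (ψ ∘ₗ α.symm.toLinearMap)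

variable {Φ'}

theorem single_succ_eq_cons {n : ℕ} (k : Fin n) :
    (Pi.single k.succ 1 : Fin (n + 1) → R) = Fin.cons 0 (Pi.single k 1) := by
  funext l
  refine Fin.cases ?_ (fun l => ?_) l
  · exact Pi.single_eq_of_ne (Fin.succ_ne_zero k).symm 1
  · rw [Fin.cons_succ, Pi.single_apply, Pi.single_apply]
    simp only [Fin.succ_inj]

theorem single_zero_eq_cons {n : ℕ} :
    (Pi.single 0 1 : Fin (n + 1) → R) = Fin.cons 1 0 := by
  funext l
  refine Fin.cases ?_ (fun l => ?_) l
  · exact Pi.single_eq_same 0 1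
  · exact Pi.single_eq_of_ne (Fin.succ_ne_zero l) 1

theorem IsBlock.isSplit {n : ℕ} {F G : Type u} [AddCommGroup F] [Module R F] [AddCommGroup G]
    [Module R G] {α : G ≃ₗ[R] G' × (Fin (n + 1) → R)} {β : F ≃ₗ[R] F' × (Fin (n + 1) → R)}
    {Φ : Module.Dual R G →ₗ[R] F} (H : IsBlock Φ' α β Φ) :
    IsSplit (SplitOff.ofEquiv (α.trans (consProdEquiv R G' n)))
      (SplitOff.ofEquiv (β.trans (consProdEquiv R F' n))) Φ (stdBlock Φ' n) := by
  intro ψ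
  refine β.injective ?_
  rw [H, map_add, map_smul]
  change _ = β (β.symm _) + _ • β (β.symm _)
  rw [LinearEquiv.apply_symm_apply, LinearEquiv.apply_symm_apply]
  refine Prod.ext ?_ (funext fun k => ?_)
  · change Φ' _ = Φ' _ + _ • (0 : F')
    rw [smul_zero, add_zero]
    refine congrArg Φ' (LinearMap.ext fun x => ?_)
    exact congrArg (fun y => ψ (α.symm (x, y))) Matrix.cons_zero_zero.symm
  · refine Fin.cases ?_ (fun k => ?_) k
    · change ψ (α.symm (0, Pi.single 0 1)) = 0 + ψ (α.symm (0, Fin.cons 1 0)) * 1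
      rw [zero_add, mul_one, single_zero_eq_cons]
    · change ψ (α.symm (0, Pi.single k.succ 1)) =
        ψ (α.symm (0, Fin.cons 0 (Pi.single k 1))) + ψ (α.symm (0, Fin.cons 1 0)) * 0
      rw [mul_zero, add_zero, single_succ_eq_cons]

theorem IsBlock.isSplit_zero {F G : Type u} [AddCommGroup F] [Module R F] [AddCommGroup G]
    [Module R G] {α : G ≃ₗ[R] G' × (Fin 1 → R)} {β : F ≃ₗ[R] F' × (Fin 1 → R)}
    {Φ : Module.Dual R G →ₗ[R] F} (H : IsBlock Φ' α β Φ) :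
    IsSplit (SplitOff.ofEquiv (α.trans
        ((LinearEquiv.refl R G').prodCongr (LinearEquiv.funUnique (Fin 1) R R))))
      (SplitOff.ofEquiv (β.trans
        ((LinearEquiv.refl R F').prodCongr (LinearEquiv.funUnique (Fin 1) R R)))) Φ Φ' := by
  intro ψ
  refine β.injective ?_
  rw [H, map_add, map_smul]
  change _ = β (β.symm _) + _ • β (β.symm _)
  rw [LinearEquiv.apply_symm_apply, LinearEquiv.apply_symm_apply]
  have h0 : (LinearEquiv.funUnique (Fin 1) R R).symm 1 = Pi.single 0 1 := by
    funext l
    rw [Subsingleton.elim l 0, Pi.single_eq_same]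
    rfl
  refine Prod.ext ?_ (funext fun k => ?_)
  · change Φ' _ = Φ' _ + _ • (0 : F')
    rw [smul_zero, add_zero]
    rfl
  · rw [Subsingleton.elim k 0]
    change ψ (α.symm (0, Pi.single 0 1)) =
      0 + ψ (α.symm (0, (LinearEquiv.funUnique (Fin 1) R R).symm 1)) * 1
    rw [zero_add, mul_one, h0]

theorem isBlock_stdBlock (n : ℕ) : IsBlock Φ' (LinearEquiv.refl R _) (LinearEquiv.refl R _)
    (stdBlock Φ' n) := fun _ => rfl

variable [Module.Free R F'] [Module.Finite R F'] [Module.Free R G'] [Module.Finite R G']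

theorem finrank_prod_fin [Nontrivial R] (N : Type u) [AddCommGroup N] [Module R N] [Module.Free R N]
    [Module.Finite R N] (n : ℕ) :
    Module.finrank R (N × (Fin n → R)) = Module.finrank R N + n := by
  rw [Module.finrank_prod, Module.finrank_fin_fun]

/-- The homology of `C^{i,a}_Φ` for the direct sum `Φ` of `Φ'` and of an isomorphism of rank
`n + 1`. -/
theorem IsBlock.hookHomology_equiv_binomSum [Nontrivial R] (i m : ℤ) (n : ℕ) {F G : Type u}
    [AddCommGroup F] [Module R F] [AddCommGroup G] [Module R G]
    [Module.Free R G] [Module.Finite R G] {α : G ≃ₗ[R] G' × (Fin (n + 1) → R)}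
    {β : F ≃ₗ[R] F' × (Fin (n + 1) → R)} {Φ : Module.Dual R G →ₗ[R] F} (H : IsBlock Φ' α β Φ)
    (a : ℤ) (ha : 0 ≤ a) (hag : a ≤ Module.finrank R G) :
    Nonempty (hookHomology Φ i a m ≃ₗ[R]
      BinomSum (fun γ => hookHomology Φ' i γ m) (Module.finrank R G') (n + 1) a) := by
  have hG := α.finrank_eq
  have hF := β.finrank_eq
  rw [finrank_prod_fin] at hG hF
  induction n generalizing F G a with
  | zero =>
    exact IsSplit.hookHomology_equiv_binomSum (IsBlock.isSplit_zero H) hG hF i m _ _ 0 rfl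
      (hookHomology_equiv_binomSum_zero Φ' i m) a ha hag
  | succ n ih =>
    have h1 := finrank_prod_fin (R := R) G' (n + 1)
    have h2 := finrank_prod_fin (R := R) F' (n + 1)
    exact IsSplit.hookHomology_equiv_binomSum (IsBlock.isSplit H) (by omega) (by omega) i m _ _
      (n + 1) h1 (fun a ha hag => ih (isBlock_stdBlock (n + 1)) a ha hag h1 h2) a ha hag

end Chain

section Direct

variable {R : Type u} [CommRing R]
    {F' F'' G' G'' : Type u}
    [AddCommGroup F'] [Module R F'] [Module.Free R F'] [Module.Finite R F']
    [AddCommGroup F''] [Module R F''] [Module.Free R F''] [Module.Finite R F'']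
    [AddCommGroup G'] [Module R G'] [Module.Free R G'] [Module.Finite R G']
    [AddCommGroup G''] [Module R G''] [Module.Free R G''] [Module.Finite R G'']

theorem isBlock_blockDiag {n : ℕ} (b : Module.Basis (Fin n) R G'')
    (Φ' : Module.Dual R G' →ₗ[R] F') (Φ'' : Module.Dual R G'' ≃ₗ[R] F'') :
    IsBlock Φ' ((LinearEquiv.refl R G').prodCongr b.equivFun)
      ((LinearEquiv.refl R F').prodCongr (b.dualBasis.map Φ'').equivFun)
      (blockDiag Φ' Φ''.toLinearMap) := by
  intro ψ
  refine Prod.ext ?_ (funext fun k => ?_)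
  · change Φ' _ = Φ' _
    refine congrArg Φ' (LinearMap.ext fun x => ?_)
    change ψ (x, 0) = ψ (x, b.equivFun.symm 0)
    rw [map_zero]
  · change b.dualBasis.repr (Φ''.symm (Φ'' (ψ ∘ₗ LinearMap.inr R G' G''))) k =
      ψ (0, b.equivFun.symm (Pi.single k 1))
    have h1 : b.equivFun.symm (Pi.single k 1) = b k :=
      b.equivFun.injective (funext fun l => by
        rw [LinearEquiv.apply_symm_apply, Module.Basis.equivFun_self, Pi.single_apply]
        simp only [eq_comm])
    rw [LinearEquiv.symm_apply_apply, Module.Basis.dualBasis_repr, LinearMap.comp_apply, h1]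
    rfl

theorem nonempty_equiv_directSum {R : Type*} [CommRing R] {A : Type*} [AddCommGroup A] [Module R A]
    (M N : ℤ → Type u) [∀ β, AddCommGroup (M β)] [∀ β, Module R (M β)] [∀ β, AddCommGroup (N β)]
    [∀ β, Module R (N β)] (hMN : ∀ β, Nonempty (N β ≃ₗ[R] M β)) (g n : ℕ) (a k : ℤ) (hk : k = g)
    (h : Nonempty (A ≃ₗ[R] BinomSum M g n a)) :
    Nonempty (A ≃ₗ[R]
      DirectSum (Finset.Icc (1 : ℤ) k) fun β => Fin (intChoose n (a - β)) → N β) := by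
  subst hk
  obtain ⟨e⟩ := h
  have e' (β) := (hMN β).some
  exact ⟨e.trans ((LinearEquiv.piCongrRight fun β : Finset.Icc (1 : ℤ) g =>
    LinearEquiv.piCongrRight fun _ => (e' β).symm).trans
      (DirectSum.linearEquivFunOnFintype R _ _).symm)⟩

/-- The homology of `C^{i,a}_Φ` for the direct sum `Φ` of `Φ'` and of an isomorphism of positive
rank `r`. -/
theorem blockDiag_homology_equiv [Nontrivial R] (g r : ℕ)
    (hg : Module.finrank R (G' × G'') = g) (hG'' : Module.finrank R G'' = r) (hr : 1 ≤ r)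
    (Φ' : Module.Dual R G' →ₗ[R] F') (Φ'' : Module.Dual R G'' ≃ₗ[R] F'')
    (i a : ℤ) (ha : 1 ≤ a) (hag : a ≤ g) (j : ℤ) :
    Nonempty ((hookComplex (blockDiag Φ' Φ''.toLinearMap) i a).homology j ≃ₗ[R]
      DirectSum (Finset.Icc (1 : ℤ) ((g : ℤ) - r)) fun β =>
        (Fin (intChoose r (a - β)) → (hookComplex Φ' i β).homology j)) := by
  obtain ⟨n, rfl⟩ : ∃ n, r = n + 1 := ⟨r - 1, by omega⟩
  have h1 := IsBlock.hookHomology_equiv_binomSum i (j - i - 2) n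
    (isBlock_blockDiag (Module.finBasisOfFinrankEq R G'' hG'') Φ' Φ'') a (by omega)
    (by rw [hg]; exact hag)
  obtain ⟨e⟩ := hookComplex_homology_equiv (blockDiag Φ' Φ''.toLinearMap) i a j (j - i - 2)
    (by ring)
  obtain ⟨e'⟩ := h1
  have h2 : Module.finrank R (G' × G'') = Module.finrank R G' + Module.finrank R G'' :=
    Module.finrank_prod
  exact nonempty_equiv_directSum (fun γ => hookHomology Φ' i γ (j - i - 2))
    (fun γ => (hookComplex Φ' i γ).homology j)
    (fun γ => hookComplex_homology_equiv Φ' i γ j (j - i - 2) (by ring)) _ _ _ _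
    (by rw [hg, hG''] at h2; rw [h2]; push_cast; ring) ⟨e.trans e'⟩

/-- A direct sum over the one-element index set `{1}` is its only summand. -/
theorem directSum_Icc_one_equiv {R : Type*} [CommRing R] {A : Type*} [AddCommGroup A] [Module R A]
    (N : ℤ → Type*) [∀ β, AddCommGroup (N β)] [∀ β, Module R (N β)] (n m : ℕ) (a k : ℤ)
    (hk : k = 1) (hm : m = n)
    (h : Nonempty (A ≃ₗ[R]
      DirectSum (Finset.Icc (1 : ℤ) k) fun β => Fin (intChoose n (a - β)) → N β)) :
    Nonempty (A ≃ₗ[R] (Fin (intChoose m (a - 1)) → N 1)) := by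
  subst hk hm
  obtain ⟨e⟩ := h
  let hu : Unique (Finset.Icc (1 : ℤ) 1) :=
    { default := ⟨1, Finset.mem_Icc.2 ⟨le_rfl, le_rfl⟩⟩
      uniq := fun β => Subtype.ext (le_antisymm (Finset.mem_Icc.1 β.2).2 (Finset.mem_Icc.1 β.2).1) }
  exact ⟨e.trans ((DirectSum.linearEquivFunOnFintype R _ _).trans
    (LinearEquiv.piUnique R fun β : Finset.Icc (1 : ℤ) 1 =>
      Fin (intChoose m (a - β)) → N β))⟩

end Direct

/-! ### The complexes `C^{i,1}_Φ` for `G` of rank one -/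

section RankOne

/-- If `L` is free on one generator `k` with coordinate `l`, then `E ⊗ L` is `E`. -/
def tmulGenEquiv {R E L : Type*} [CommRing R] [AddCommMonoid E] [Module R E] [AddCommMonoid L]
    [Module R L] (k : L) (l : L →ₗ[R] R) (hl : l k = 1) (hk : ∀ x, ∃ c : R, x = c • k) :
    E ≃ₗ[R] E ⊗[R] L :=
  { (TensorProduct.mk R E L).flip k with
    invFun := fun z => TensorProduct.rid R E (TensorProduct.map LinearMap.id l z)
    left_inv := fun x => by
      change TensorProduct.rid R E (TensorProduct.map LinearMap.id l (x ⊗ₜ k)) = x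
      rw [TensorProduct.map_tmul, hl, TensorProduct.rid_tmul, one_smul, LinearMap.id_apply]
    right_inv := fun z => by
      obtain ⟨f, rfl⟩ := exists_unit_tmul hk z
      change TensorProduct.rid R E (TensorProduct.map LinearMap.id l (f ⊗ₜ k)) ⊗ₜ k = f ⊗ₜ k
      rw [TensorProduct.map_tmul, hl, TensorProduct.rid_tmul, one_smul, LinearMap.id_apply] }

variable {R : Type*} [CommRing R] {G F : Type*} [AddCommGroup G] [Module R G]
  [AddCommGroup F] [Module R F] (v : G) (γ : Module.Dual R G)

/-- The power `v^q` in `Sym_q G`. -/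
def symPow (v : G) : ∀ q : ℤ, sym R G q
  | Int.ofNat n => ⟨SymmetricAlgebra.ι R G v ^ n, Submodule.pow_mem_pow _
    (LinearMap.mem_range_self _ v) n⟩
  | Int.negSucc _ => 0

theorem symMul_symPow {q q' : ℤ} (h : q' = q + 1) (hq : 0 ≤ q) :
    symMul (R := R) h v (symPow v q) = symPow v q' := by
  subst h
  obtain ⟨n, rfl⟩ := Int.eq_ofNat_of_zero_le hq
  exact Subtype.ext (pow_succ' (SymmetricAlgebra.ι R G v) n).symm

/-- The form on `Sym_q G` induced by `γ ∈ G^*`, which takes a product of `q` vectors to the product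
of the values of `γ`. -/
def symForm (q : ℤ) : Module.Dual R (sym R G q) :=
  (SymmetricAlgebra.lift γ).toLinearMap ∘ₗ (sym R G q).subtype

/-- The form `symForm γ q` as an element of the divided power `D_q(G^*)`. -/
def divGen (q : ℤ) : divPow R G q := symForm γ q

variable {v γ}

theorem symForm_symPow (hγ : γ v = 1) {q : ℤ} (hq : 0 ≤ q) : symForm γ q (symPow v q) = 1 := by
  obtain ⟨n, rfl⟩ := Int.eq_ofNat_of_zero_le hq
  change SymmetricAlgebra.lift γ (SymmetricAlgebra.ι R G v ^ n) = 1
  rw [map_pow, SymmetricAlgebra.lift_ι_apply, hγ, one_pow]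

theorem divAct_divGen (hγ : γ v = 1) {q q' : ℤ} (h : q = q' + 1) :
    divAct h v (divGen γ q) = divGen γ q' := by
  refine LinearMap.ext fun x => ?_
  change SymmetricAlgebra.lift γ (SymmetricAlgebra.ι R G v * x.1) = SymmetricAlgebra.lift γ x.1
  rw [map_mul, SymmetricAlgebra.lift_ι_apply, hγ, one_mul]

theorem range_eq_span_singleton {A : Type*} [AddCommMonoid A] [Module R A] (f : G →ₗ[R] A)
    (hv : ∀ x, γ x • v = x) : LinearMap.range f = Submodule.span R {f v} := by
  refine le_antisymm ?_ (Submodule.span_le.2 (Set.singleton_subset_iff.2 ⟨v, rfl⟩))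
  rintro _ ⟨x, rfl⟩
  rw [← hv x, map_smul]
  exact Submodule.smul_mem _ _ (Submodule.mem_span_singleton_self _)

theorem exists_smul_symPow (hv : ∀ x, γ x • v = x) {q : ℤ} (hq : 0 ≤ q) (x : sym R G q) :
    ∃ c : R, x = c • symPow v q := by
  obtain ⟨n, rfl⟩ := Int.eq_ofNat_of_zero_le hq
  obtain ⟨x, hx⟩ := x
  have hx' : x ∈ LinearMap.range (SymmetricAlgebra.ι R G) ^ n := hx
  rw [range_eq_span_singleton _ hv, Submodule.span_pow, Set.singleton_pow] at hx'
  obtain ⟨c, rfl⟩ := Submodule.mem_span_singleton.1 hx'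
  exact ⟨c, rfl⟩

theorem eq_smul_symForm (hγ : γ v = 1) (hv : ∀ x, γ x • v = x) {q : ℤ} (hq : 0 ≤ q)
    (φ : Module.Dual R (sym R G q)) : φ = φ (symPow v q) • symForm γ q := by
  refine LinearMap.ext fun x => ?_
  obtain ⟨c, rfl⟩ := exists_smul_symPow hv hq x
  rw [map_smul, LinearMap.smul_apply, map_smul, symForm_symPow hγ hq, smul_eq_mul, smul_eq_mul,
    smul_eq_mul, mul_one, mul_comm]

theorem wedgeHom_comp_of_rank_one (Φ : Module.Dual R G →ₗ[R] F) (hv : ∀ x, γ x • v = x) {r r' : ℤ}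
    (h : r' = r + 1) :
    wedgeHom h ∘ₗ Φ = (Module.Dual.eval R G v).smulRight (wedge h (Φ γ)) := by
  refine LinearMap.ext fun c => ?_
  have hc : c = c v • γ := LinearMap.ext fun x => by
    conv_lhs => rw [← hv x, map_smul]
    exact mul_comm _ _
  conv_lhs => rw [hc, map_smul]
  rfl

variable [Module.Free R G] [Module.Finite R G]

/-- The generator `1 ⊗ v^q` of `L^0_q G`. -/
noncomputable def schurGen (v : G) (q : ℤ) : schur R G 0 q :=
  ⟨⟨1, one_mem_ext⟩ ⊗ₜ symPow v q, (mem_schur (p' := -1) (by ring) rfl).2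
    (tensor_eq_zero' (fun b => (subsingleton_ext_of_neg (by norm_num)).elim b 0) _)⟩

/-- The coordinate on `L^0_q G` dual to `schurGen`. -/
noncomputable def schurGenCoord (γ : Module.Dual R G) (q : ℤ) : schur R G 0 q →ₗ[R] R :=
  TensorProduct.lift ((LinearMap.mul R R).compl₁₂
    ((ExteriorAlgebra.algebraMapInv (R := R) (M := G)).toLinearMap ∘ₗ (ext R G 0).subtype)
    (symForm γ q)) ∘ₗ (schur R G 0 q).subtype

theorem schurGenCoord_schurGen (hγ : γ v = 1) {q : ℤ} (hq : 0 ≤ q) :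
    schurGenCoord γ q (schurGen v q) = 1 := by
  change ExteriorAlgebra.algebraMapInv (R := R) (M := G) 1 * symForm γ q (symPow v q) = 1
  rw [map_one, symForm_symPow hγ hq, one_mul]

theorem exists_smul_tmul {E L : Type*} [AddCommMonoid E] [Module R E] [AddCommMonoid L]
    [Module R L] {e : E} {l : L} (he : ∀ x, ∃ c : R, x = c • e) (hl : ∀ x, ∃ c : R, x = c • l)
    (z : E ⊗[R] L) : ∃ c : R, z = c • (e ⊗ₜ l) := by
  obtain ⟨f, rfl⟩ := exists_unit_tmul hl z
  obtain ⟨c, rfl⟩ := he f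
  exact ⟨c, rfl⟩

theorem exists_smul_schurGen (hv : ∀ x, γ x • v = x) {q : ℤ} (hq : 0 ≤ q) (x : schur R G 0 q) :
    ∃ c : R, x = c • schurGen v q := by
  obtain ⟨c, hc⟩ := exists_smul_tmul exists_smul_one_of_mem_ext (exists_smul_symPow hv hq) x.1
  exact ⟨c, Subtype.ext hc⟩

theorem schurMul_schurGen {q q' : ℤ} (h : q' = q + 1) (hq : 0 ≤ q) :
    schurMul (R := R) h v (schurGen v q) = schurGen v q' :=
  Subtype.ext (congrArg (TensorProduct.mk R (ext R G 0) (sym R G q') ⟨1, one_mem_ext⟩)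
    (symMul_symPow v h hq))

/-- The generator `γ ⊗ divGen γ q` of `K^1_q (G^*)`. -/
noncomputable def weylGen (γ : Module.Dual R G) (h1 : Module.finrank R G = 1) (q : ℤ) :
    weyl R G 1 q :=
  ⟨⟨ExteriorAlgebra.ι R γ, ι_mem_ext γ⟩ ⊗ₜ divGen γ q, (mem_weyl (p' := 2) rfl
    (q' := q - 1) (by ring)).2 (tensor_eq_zero' (fun b => Subtype.ext (ext_eq_zero (by
      rw [h1]; norm_num) b)) _)⟩

/-- The coordinate on `K^1_q (G^*)` dual to `weylGen`. -/
noncomputable def weylGenCoord (v : G) (q : ℤ) : weyl R G 1 q →ₗ[R] R :=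
  TensorProduct.lift ((LinearMap.mul R R).compl₁₂
    ((ExteriorAlgebra.algebraMapInv (R := R) (M := Module.Dual R G)).toLinearMap ∘ₗ
      (CliffordAlgebra.contractLeft (Q := (0 : QuadraticForm R (Module.Dual R G)))
        (Module.Dual.eval R G v)) ∘ₗ (ext R (Module.Dual R G) 1).subtype)
    (Module.Dual.eval R (sym R G q) (symPow v q))) ∘ₗ (weyl R G 1 q).subtype

theorem weylGenCoord_weylGen (hγ : γ v = 1) (h1 : Module.finrank R G = 1) {q : ℤ} (hq : 0 ≤ q) :
    weylGenCoord v q (weylGen γ h1 q) = 1 := by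
  have h2 := CliffordAlgebra.contractLeft_ι (Q := (0 : QuadraticForm R (Module.Dual R G)))
    (d := Module.Dual.eval R G v) γ
  change ExteriorAlgebra.algebraMapInv (R := R) (M := Module.Dual R G)
    (CliffordAlgebra.contractLeft (Q := (0 : QuadraticForm R (Module.Dual R G)))
        (Module.Dual.eval R G v) (CliffordAlgebra.ι _ γ)) * symForm γ q (symPow v q) = 1
  rw [h2, symForm_symPow hγ hq, mul_one]
  exact (AlgHom.commutes ExteriorAlgebra.algebraMapInv _).trans hγ

theorem exists_smul_weylGen (hγ : γ v = 1) (hv : ∀ x, γ x • v = x) (h1 : Module.finrank R G = 1)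
    {q : ℤ} (hq : 0 ≤ q) (x : weyl R G 1 q) : ∃ c : R, x = c • weylGen γ h1 q := by
  have hv' (c : Module.Dual R G) : Module.Dual.eval R G v c • γ = c := LinearMap.ext fun x => by
    conv_rhs => rw [← hv x, map_smul]
    exact mul_comm _ _
  have he (y : ext R (Module.Dual R G) 1) :
      ∃ c : R, y = c • ⟨ExteriorAlgebra.ι R γ, ι_mem_ext γ⟩ := by
    obtain ⟨y, hy⟩ := y
    have hy' : y ∈ LinearMap.range (ExteriorAlgebra.ι R (M := Module.Dual R G)) ^ 1 := hy
    rw [pow_one, range_eq_span_singleton _ hv'] at hy'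
    obtain ⟨c, rfl⟩ := Submodule.mem_span_singleton.1 hy'
    exact ⟨c, rfl⟩
  have hl (φ : divPow R G q) : ∃ c : R, φ = c • divGen γ q := ⟨_, eq_smul_symForm hγ hv hq φ⟩
  obtain ⟨c, hc⟩ := exists_smul_tmul he hl x.1
  exact ⟨c, Subtype.ext hc⟩

theorem weylAct_weylGen (hγ : γ v = 1) (h1 : Module.finrank R G = 1) {q q' : ℤ} (h : q = q' + 1) :
    weylAct h v (weylGen γ h1 q) = weylGen γ h1 q' :=
  Subtype.ext (congrArg (TensorProduct.mk R (ext R (Module.Dual R G) 1) (divPow R G q')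
    ⟨ExteriorAlgebra.ι R γ, ι_mem_ext γ⟩) (divAct_divGen hγ h))

theorem weylZero_weylGen (h1 : Module.finrank R G = 1) :
    weylZero 1 (weylGen γ h1 0) = ⟨ExteriorAlgebra.ι R γ, ι_mem_ext γ⟩ := by
  have h2 : divZero R G (divGen γ 0) = 1 := map_one (SymmetricAlgebra.lift γ)
  change divZero R G (divGen γ 0) • (⟨ExteriorAlgebra.ι R γ, ι_mem_ext γ⟩ :
    ext R (Module.Dual R G) 1) = _
  rw [h2, one_smul]

variable (Φ : Module.Dual R G →ₗ[R] F)

theorem kosMap_schurGen (hv : ∀ x, γ x • v = x) {r r' q q' : ℤ} (hr : r' = r + 1)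
    (hq : q' = q + 1) (h0 : 0 ≤ q) (x : ext R F r) :
    kosMap Φ hr hq (x ⊗ₜ schurGen v q) = wedge hr (Φ γ) x ⊗ₜ schurGen v q' := by
  rw [kosMap_eq_koszulMap, wedgeHom_comp_of_rank_one Φ hv, koszulMap_smulRight,
    TensorProduct.map_tmul, schurMulHom_apply, schurMul_schurGen hq h0]

private theorem etaMap_weylGen (hγ : γ v = 1) (hv : ∀ x, γ x • v = x) (h1 : Module.finrank R G = 1)
    {r r' q q' : ℤ} (hr : r' = r + 1)
    (hq : q = q' + 1) (x : ext R F r) :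
    etaMap Φ hr hq (x ⊗ₜ weylGen γ h1 q) = wedge hr (Φ γ) x ⊗ₜ weylGen γ h1 q' := by
  rw [etaMap_eq_koszulMap, wedgeHom_comp_of_rank_one Φ hv, koszulMap_smulRight,
    TensorProduct.map_tmul, weylActHom_apply, weylAct_weylGen hγ h1 hq]

private theorem spliceIn_weylGen (h1 : Module.finrank R G = 1) {r r' : ℤ} (hr : r' = r + 1)
    (x : ext R F r) : spliceIn Φ hr (x ⊗ₜ weylGen γ h1 0) = wedge hr (Φ γ) x := by
  refine Subtype.ext ?_
  rw [spliceIn_tmul, weylZero_weylGen h1, ExteriorAlgebra.map_apply_ι]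
  rfl

theorem spliceOut_schurGen (hv : ∀ x, γ x • v = x) {r r' : ℤ} (hr : r' = r + 1)
    (h' : r' = r + (0 + 1)) (x : ext R F r) :
    spliceOut Φ h' x = wedge hr (Φ γ) x ⊗ₜ schurGen v 1 := by
  have h0 : schurOne = schurGen v 0 := Subtype.ext (congrArg
    (TensorProduct.mk R (ext R G 0) (sym R G 0) ⟨1, one_mem_ext⟩)
      (Subtype.ext (pow_zero (SymmetricAlgebra.ι R G v)).symm))
  rw [← kosMap_schurOne Φ hr h', h0]
  exact kosMap_schurGen Φ hv hr (zero_add 1).symm le_rfl x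

/-- The equivalence `x ↦ x ⊗ schurGen v q`. -/
noncomputable def tmulSchurGenEquiv (E : Type*) [AddCommMonoid E] [Module R E] (hγ : γ v = 1)
    (hv : ∀ x, γ x • v = x) {q : ℤ} (hq : 0 ≤ q) : E ≃ₗ[R] E ⊗[R] schur R G 0 q :=
  tmulGenEquiv (schurGen v q) (schurGenCoord γ q) (schurGenCoord_schurGen hγ hq)
    (exists_smul_schurGen hv hq)

/-- The equivalence `x ↦ x ⊗ weylGen γ h1 q`. -/
noncomputable def tmulWeylGenEquiv (E : Type*) [AddCommMonoid E] [Module R E] (hγ : γ v = 1)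
    (hv : ∀ x, γ x • v = x) (h1 : Module.finrank R G = 1) {q : ℤ} (hq : 0 ≤ q) :
    E ≃ₗ[R] E ⊗[R] weyl R G 1 q :=
  tmulGenEquiv (weylGen γ h1 q) (weylGenCoord v q) (weylGenCoord_weylGen hγ h1 hq)
    (exists_smul_weylGen hγ hv h1 hq)

/-- The homology at `⋀ʳ F` of the Koszul complex of `φ ∈ F`. -/
abbrev koszulHomology (φ : F) {r₀ r r₂ : ℤ} (hr : r = r₀ + 1) (hr₂ : r₂ = r + 1) : Type _ :=
  Hmod (wedge (R := R) hr φ) (wedge (R := R) hr₂ φ)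

attribute [local irreducible] kosMap etaMap spliceIn spliceOut schurGen weylGen

theorem koszulHomology_equiv_schurHomology (hγ : γ v = 1) (hv : ∀ x, γ x • v = x)
    {r₀ r r₂ q₀ q q₂ : ℤ} (hr : r = r₀ + 1)
    (hr₂ : r₂ = r + 1) (hq : q = q₀ + 1) (hq₂ : q₂ = q + 1) (h0 : 0 ≤ q₀) :
    Nonempty (koszulHomology (R := R) (Φ γ) hr hr₂ ≃ₗ[R] schurHomology Φ 0 hr hr₂ hq hq₂) :=
  Hmod_congr (X' := ext R F r₀ ⊗[R] schur R G 0 q₀) (Y' := ext R F r ⊗[R] schur R G 0 q)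
    (Z' := ext R F r₂ ⊗[R] schur R G 0 q₂) (tmulSchurGenEquiv _ hγ hv h0)
    (tmulSchurGenEquiv _ hγ hv (by omega)) (tmulSchurGenEquiv _ hγ hv (by omega))
    (fun x => (kosMap_schurGen Φ hv hr hq h0 x).symm)
    (fun x => (kosMap_schurGen Φ hv hr₂ hq₂ (by omega) x).symm)

theorem koszulHomology_equiv_schurOneHomology (hγ : γ v = 1) (hv : ∀ x, γ x • v = x)
    {r₀ r r₂ : ℤ} (hr : r = r₀ + 1) (hr' : r = r₀ + (0 + 1)) (hr₂ : r₂ = r + 1) :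
    Nonempty (koszulHomology (R := R) (Φ γ) hr hr₂ ≃ₗ[R] schurOneHomology Φ hr' hr₂) :=
  Hmod_congr (Y' := ext R F r ⊗[R] schur R G 0 1)
    (Z' := ext R F r₂ ⊗[R] schur R G 0 2) (LinearEquiv.refl R (ext R F r₀))
    (tmulSchurGenEquiv _ hγ hv (by omega)) (tmulSchurGenEquiv _ hγ hv (by omega))
    (fun x => (spliceOut_schurGen Φ hv hr hr' x).symm)
    (fun x => (kosMap_schurGen Φ hv hr₂ one_add_one_eq_two.symm (by omega) x).symm)

theorem koszulHomology_equiv_middleHomology (hγ : γ v = 1) (hv : ∀ x, γ x • v = x)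
    (h1 : Module.finrank R G = 1)
    {r₀ r r₂ : ℤ} (hr : r = r₀ + 1) (hr₂ : r₂ = r + 1) (hr₂' : r₂ = r + (0 + 1)) :
    Nonempty (koszulHomology (R := R) (Φ γ) hr hr₂ ≃ₗ[R] middleHomology Φ hr hr₂') :=
  Hmod_congr (X' := ext R F r₀ ⊗[R] weyl R G 1 0)
    (Z' := ext R F r₂ ⊗[R] schur R G 0 1)
    (tmulWeylGenEquiv _ hγ hv h1 (by omega)) (LinearEquiv.refl R (ext R F r))
    (tmulSchurGenEquiv _ hγ hv (by omega))
    (fun x => (spliceIn_weylGen Φ h1 hr x).symm)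
    (fun x => (spliceOut_schurGen Φ hv hr₂ hr₂' x).symm)

private theorem koszulHomology_equiv_weylZeroHomology (hγ : γ v = 1) (hv : ∀ x, γ x • v = x)
    (h1 : Module.finrank R G = 1) {r₀ r r₂ : ℤ} (hr : r = r₀ + 1) (hr₂ : r₂ = r + 1) :
    Nonempty (koszulHomology (R := R) (Φ γ) hr hr₂ ≃ₗ[R] weylZeroHomology (a := 1) Φ hr hr₂) :=
  Hmod_congr (X' := ext R F r₀ ⊗[R] weyl R G 1 1) (Y' := ext R F r ⊗[R] weyl R G 1 0)
    (tmulWeylGenEquiv _ hγ hv h1 (by omega)) (tmulWeylGenEquiv _ hγ hv h1 (by omega))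
    (LinearEquiv.refl R (ext R F r₂))
    (fun x => (etaMap_weylGen Φ hγ hv h1 hr (zero_add 1).symm x).symm)
    (fun x => (spliceIn_weylGen Φ h1 hr₂ x).symm)

private theorem koszulHomology_equiv_weylHomology (hγ : γ v = 1) (hv : ∀ x, γ x • v = x)
    (h1 : Module.finrank R G = 1) {r₀ r r₂ q₀ q q₂ : ℤ} (hr : r = r₀ + 1) (hr₂ : r₂ = r + 1)
    (hq : q₀ = q + 1) (hq₂ : q = q₂ + 1) (h0 : 0 ≤ q₂) :
    Nonempty (koszulHomology (R := R) (Φ γ) hr hr₂ ≃ₗ[R] weylHomology Φ 1 hr hr₂ hq hq₂) :=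
  Hmod_congr (X' := ext R F r₀ ⊗[R] weyl R G 1 q₀) (Y' := ext R F r ⊗[R] weyl R G 1 q)
    (Z' := ext R F r₂ ⊗[R] weyl R G 1 q₂)
    (tmulWeylGenEquiv _ hγ hv h1 (by omega)) (tmulWeylGenEquiv _ hγ hv h1 (by omega))
    (tmulWeylGenEquiv _ hγ hv h1 h0)
    (fun x => (etaMap_weylGen Φ hγ hv h1 hr hq x).symm)
    (fun x => (etaMap_weylGen Φ hγ hv h1 hr₂ hq₂ x).symm)

end RankOne

section RankOneHook

variable {R : Type u} [CommRing R] {F G : Type u} [AddCommGroup F] [Module R F]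
  [AddCommGroup G] [Module R G] [Module.Free R G] [Module.Finite R G]
  (Φ : Module.Dual R G →ₗ[R] F) {v : G} {γ : Module.Dual R G}

/-- For `G` of rank one, generated by `v` with coordinate `γ`, the complex `C^{i,1}_Φ` is the
Koszul complex of `Φ γ`. -/
theorem hookHomology_equiv_koszulHomology (hγ : γ v = 1) (hv : ∀ x, γ x • v = x)
    (h1 : Module.finrank R G = 1) (i n : ℤ) {r₀ r r₂ : ℤ} (hr : r = r₀ + 1) (hr₂ : r₂ = r + 1)
    (h : r = (Module.finrank R F : ℤ) - i - 2 - n) :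
    Nonempty (hookHomology Φ i 1 n ≃ₗ[R] koszulHomology (R := R) (Φ γ) hr hr₂) := by
  have h1' : (Module.finrank R G : ℤ) = 1 := by exact_mod_cast h1
  rcases n with (_ | k) | (_ | _ | k)
  · exact nonempty_equiv_trans_symm
      (hookHomology_equiv_weylZeroHomology Φ i 1 (s₀ := r₀) (s := r) hr hr₂
        (by simp only [Int.ofNat_eq_natCast, Nat.cast_zero] at h; omega))
      (koszulHomology_equiv_weylZeroHomology Φ hγ hv h1 hr hr₂)
  · exact nonempty_equiv_trans_symm
      (hookHomology_equiv_weylHomology Φ i 1 k (q₀ := (k : ℤ) + 2) (q := (k : ℤ) + 1) (q₂ := k)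
        hr hr₂ (by ring) (by ring)
        (by simp only [Int.ofNat_eq_natCast, Nat.cast_add, Nat.cast_one] at h; omega) rfl)
      (koszulHomology_equiv_weylHomology Φ hγ hv h1 hr hr₂ _ _ (by omega))
  · exact nonempty_equiv_trans_symm
      (hookHomology_equiv_middleHomology Φ i 1 (p := 0) hr hr₂
        (by simp only [Int.negSucc_eq, Nat.cast_zero] at h; omega) (by omega))
      (koszulHomology_equiv_middleHomology Φ hγ hv h1 hr hr₂ hr₂)
  · exact nonempty_equiv_trans_symm
      (hookHomology_equiv_schurOneHomology Φ i 1 (p := 0) hr hr₂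
        (by simp only [Int.negSucc_eq, zero_add, Nat.cast_one] at h; omega) (by omega))
      (koszulHomology_equiv_schurOneHomology Φ hγ hv hr hr hr₂)
  · exact nonempty_equiv_trans_symm
      (hookHomology_equiv_schurHomology Φ i 1 k (p := 0) (q₀ := (k : ℤ) + 1) (q := (k : ℤ) + 2)
        (q₂ := (k : ℤ) + 3) hr hr₂ (by ring) (by ring)
        (by simp only [Int.negSucc_eq, Nat.cast_add, Nat.cast_one] at h; omega) rfl (by omega))
      (koszulHomology_equiv_schurHomology Φ hγ hv hr hr₂ _ _ (by omega))

end RankOneHook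

/-! ### The Koszul complex of a vector of a free module -/

section Koszul

variable {R : Type u} [CommRing R] {F : Type u} [AddCommGroup F] [Module R F]

theorem neg_smul_eq_of_eq_add {R A : Type*} [CommRing R] [AddCommGroup A] [Module R A] {c d : R}
    (hc : c * c = 1) {y z : A} (h : 0 = y + (c * d) • z) : -c • y = d • z := by
  rw [eq_neg_of_add_eq_zero_left h.symm, smul_neg, neg_smul, neg_neg, smul_smul, ← mul_assoc, hc,
    one_mul]

/-- Contraction with `ψ` is a homotopy between multiplication by `ψ φ` and zero, up to sign. -/
theorem exists_wedge_eq_smul (φ : F) (ψ : Module.Dual R F) {r₀ r r₂ : ℤ} (hr : r = r₀ + 1)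
    (hr₂ : r₂ = r + 1) (M : Type*) [AddCommGroup M] [Module R M] (z : ext R F r ⊗[R] M)
    (hz : LinearMap.rTensor M (wedge hr₂ φ) z = 0) :
    ∃ y, LinearMap.rTensor M (wedge hr φ) y = ψ φ • z := by
  have h := LinearMap.congr_fun (congrArg (LinearMap.rTensor M) (contract_wedge hr₂ hr ψ φ)) z
  rw [LinearMap.rTensor_comp, LinearMap.rTensor_add, LinearMap.comp_apply, LinearMap.add_apply, hz,
    map_zero, LinearMap.rTensor_comp, LinearMap.comp_apply,
    ← Int.cast_smul_eq_zsmul R (sgn r) (ψ φ • (LinearMap.id : ext R F r →ₗ[R] ext R F r)),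
    smul_smul, LinearMap.rTensor_smul, LinearMap.rTensor_id,
    LinearMap.smul_apply, LinearMap.id_apply] at h
  refine ⟨-((sgn r : ℤ) : R) • LinearMap.rTensor M (contract hr ψ) z, ?_⟩
  have h2 : ((sgn r : ℤ) : R) * ((sgn r : ℤ) : R) = 1 := by
    rw [← Int.cast_mul, sgn_mul_self, Int.cast_one]
  have h3 := neg_smul_eq_of_eq_add (A := ext R F r ⊗[R] M) h2 h
  exact (map_smul _ _ _).trans h3

theorem rTensor_wedge_wedge (φ : F) {r₀ r r₂ : ℤ} (hr : r = r₀ + 1)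
    (hr₂ : r₂ = r + 1) (M : Type*) [AddCommGroup M] [Module R M] (z : ext R F r₀ ⊗[R] M) :
    LinearMap.rTensor M (wedge hr₂ φ) (LinearMap.rTensor M (wedge hr φ) z) = 0 := by
  rw [← LinearMap.comp_apply, ← LinearMap.rTensor_comp, wedge_wedge_self, LinearMap.rTensor_zero,
    LinearMap.zero_apply]

theorem rTensor_lTensor {R A B M N : Type*} [CommRing R] [AddCommGroup A] [Module R A]
    [AddCommGroup B] [Module R B] [AddCommGroup M] [Module R M] [AddCommGroup N] [Module R N]
    (f : A →ₗ[R] B) (g : M →ₗ[R] N) (z : A ⊗[R] M) :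
    LinearMap.rTensor N f (LinearMap.lTensor A g z) =
      LinearMap.lTensor B g (LinearMap.rTensor M f z) := by
  rw [← LinearMap.comp_apply, ← LinearMap.comp_apply, LinearMap.rTensor_comp_lTensor,
    LinearMap.lTensor_comp_rTensor]

open scoped Pointwise in
theorem exists_smul_eq_of_lTensor_mkQ {R E M : Type*} [CommRing R] [AddCommGroup E] [Module R E]
    [AddCommGroup M] [Module R M] (x : R) (y : E ⊗[R] M)
    (hy : LinearMap.lTensor E (x • (⊤ : Submodule R M)).mkQ y = 0) :
    ∃ u, x • u = y := by
  have hex : Function.Exact (LinearMap.lsmul R M x) (x • (⊤ : Submodule R M)).mkQ := by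
    intro m
    rw [Submodule.mkQ_apply, Submodule.Quotient.mk_eq_zero, Submodule.mem_smul_pointwise_iff_exists]
    constructor
    · rintro ⟨b, -, rfl⟩
      exact ⟨b, rfl⟩
    · rintro ⟨b, rfl⟩
      exact ⟨b, Submodule.mem_top, rfl⟩
  obtain ⟨u, hu⟩ := (lTensor_exact E hex (Submodule.mkQ_surjective _) y).1 hy
  refine ⟨u, Eq.trans ?_ hu⟩
  have h : (LinearMap.lsmul R M x : M →ₗ[R] M) = x • LinearMap.id := rfl
  rw [h, LinearMap.lTensor_smul, LinearMap.lTensor_id, LinearMap.smul_apply, LinearMap.id_apply]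

open scoped Pointwise in
theorem lTensor_mkQ_smul {R E M : Type*} [CommRing R] [AddCommGroup E] [Module R E]
    [AddCommGroup M] [Module R M] (x : R) (z : E ⊗[R] M) :
    LinearMap.lTensor E (x • (⊤ : Submodule R M)).mkQ (x • z) = 0 := by
  have h : x • (x • (⊤ : Submodule R M)).mkQ = 0 := LinearMap.ext fun m =>
    (Submodule.Quotient.mk_eq_zero _).2 (Submodule.smul_mem_pointwise_smul m x ⊤ Submodule.mem_top)
  rw [map_smul, ← LinearMap.smul_apply, ← LinearMap.lTensor_smul, h, LinearMap.lTensor_zero,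
    LinearMap.zero_apply]

theorem smul_tensor_injective {R E M : Type*} [CommRing R] [AddCommGroup E] [Module R E]
    [Module.Flat R E] [AddCommGroup M] [Module R M] {x : R} (hx : IsSMulRegular M x)
    {u w : E ⊗[R] M} (h : x • u = x • w) : u = w := by
  have h1 := Module.Flat.lTensor_preserves_injective_linearMap (M := E) (LinearMap.lsmul R M x) hx
  have h2 : (LinearMap.lsmul R M x : M →ₗ[R] M) = x • LinearMap.id := rfl
  rw [h2, LinearMap.lTensor_smul, LinearMap.lTensor_id] at h1
  exact h1 h

open scoped Pointwise in
/-- The Koszul complex of `φ` with coefficients in `M` is acyclic below the length of an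
`M`-regular sequence in the ideal of the values at `φ` of the linear forms. -/
theorem exists_rTensor_wedge_eq [Module.Free R F] (φ : F) (s : List R) :
    ∀ (M : Type u) [AddCommGroup M] [Module R M], RingTheory.Sequence.IsWeaklyRegular M s →
      (∀ x ∈ s, ∃ ψ : Module.Dual R F, ψ φ = x) → ∀ {r₀ r r₂ : ℤ} (hr : r = r₀ + 1)
      (hr₂ : r₂ = r + 1), r < s.length → ∀ z : ext R F r ⊗[R] M,
      LinearMap.rTensor M (wedge hr₂ φ) z = 0 → ∃ y, LinearMap.rTensor M (wedge hr φ) y = z := by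
  induction s with
  | nil =>
    intro M _ _ _ _ r₀ r r₂ hr hr₂ h z _
    have hs := subsingleton_ext_of_neg (R := R) (M := F) (r := r) (by simpa using h)
    exact ⟨0, (map_zero _).trans (tensor_eq_zero' (fun b => hs.elim b 0) z).symm⟩
  | cons x s ih =>
    intro M _ _ hreg hx r₀ r r₂ hr hr₂ h z hz
    obtain ⟨hx1, hx2⟩ := (RingTheory.Sequence.isWeaklyRegular_cons_iff M x s).1 hreg
    obtain ⟨ψ, hψ⟩ := hx x List.mem_cons_self
    obtain ⟨y, hy⟩ := exists_wedge_eq_smul φ ψ hr hr₂ M z hz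
    rw [hψ] at hy
    let π : M →ₗ[R] QuotSMulTop x M := (x • (⊤ : Submodule R M)).mkQ
    have hπ : Function.Surjective (LinearMap.lTensor (ext R F (r₀ - 1)) π) :=
      LinearMap.lTensor_surjective _ (Submodule.mkQ_surjective _)
    have h0 : LinearMap.rTensor _ (wedge hr φ) (LinearMap.lTensor _ π y) = 0 := by
      rw [rTensor_lTensor, hy]
      exact lTensor_mkQ_smul x z
    obtain ⟨w', hw'⟩ := ih (QuotSMulTop x M) hx2 (fun x' hx' => hx x' (List.mem_cons_of_mem x hx'))
      (r₀ := r₀ - 1) (r := r₀) (by ring) hr (by rw [List.length_cons] at h; push_cast at h; omega)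
      (LinearMap.lTensor _ π y) h0
    obtain ⟨w, rfl⟩ := hπ w'
    rw [rTensor_lTensor] at hw'
    obtain ⟨u, hu⟩ := exists_smul_eq_of_lTensor_mkQ x
      (y - LinearMap.rTensor M (wedge (by ring) φ) w)
      (by rw [map_sub, sub_eq_zero]; exact hw'.symm)
    refine ⟨u, smul_tensor_injective hx1 ?_⟩
    rw [← map_smul, hu, map_sub, rTensor_wedge_wedge]
    exact (sub_zero _).trans hy

end Koszul

section KoszulHomology

variable {R : Type u} [CommRing R] {F : Type u} [AddCommGroup F] [Module R F]

theorem exists_map_eq_of_rTensor {R A B : Type*} [CommRing R] [AddCommGroup A] [Module R A]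
    [AddCommGroup B] [Module R B] (f : A →ₗ[R] B) (z : B)
    (h : ∃ y, LinearMap.rTensor R f y = z ⊗ₜ 1) : ∃ y, f y = z := by
  obtain ⟨y, hy⟩ := h
  obtain ⟨y, rfl⟩ := exists_unit_tmul (k := (1 : R)) (fun c => ⟨c, (mul_one c).symm⟩) y
  have h1 := congrArg (TensorProduct.rid R B) hy
  rw [LinearMap.rTensor_tmul, TensorProduct.rid_tmul, TensorProduct.rid_tmul, one_smul,
    one_smul] at h1
  exact ⟨y, h1⟩

theorem exists_wedge_eq (φ : F) (ψ : Module.Dual R F) {r₀ r r₂ : ℤ} (hr : r = r₀ + 1)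
    (hr₂ : r₂ = r + 1) (z : ext R F r) (hz : wedge hr₂ φ z = 0) :
    ∃ y, wedge hr φ y = ψ φ • z := by
  refine exists_map_eq_of_rTensor _ _ ?_
  obtain ⟨y, hy⟩ := exists_wedge_eq_smul φ ψ hr hr₂ R (z ⊗ₜ 1)
    (by rw [LinearMap.rTensor_tmul, hz, TensorProduct.zero_tmul])
  exact ⟨y, hy⟩

theorem subsingleton_koszulHomology (φ : F) {ψ : Module.Dual R F} (h : ψ φ = 1) {r₀ r r₂ : ℤ}
    (hr : r = r₀ + 1) (hr₂ : r₂ = r + 1) : Subsingleton (koszulHomology (R := R) φ hr hr₂) :=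
  Hmod_subsingleton _ _ fun z hz => by
    obtain ⟨y, hy⟩ := exists_wedge_eq φ ψ hr hr₂ z hz
    rw [h, one_smul] at hy
    exact ⟨y, hy⟩

theorem subsingleton_koszulHomology_of_regular [Module.Free R F] (φ : F) {s : List R}
    (hs : RingTheory.Sequence.IsWeaklyRegular R s)
    (hx : ∀ x ∈ s, x ∈ LinearMap.range (Module.Dual.eval R F φ)) {r₀ r r₂ : ℤ} (hr : r = r₀ + 1)
    (hr₂ : r₂ = r + 1) (h : r < s.length) : Subsingleton (koszulHomology (R := R) φ hr hr₂) :=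
  Hmod_subsingleton _ _ fun z hz => exists_map_eq_of_rTensor _ _
    (exists_rTensor_wedge_eq φ s R hs hx hr hr₂ h (z ⊗ₜ 1)
      (by rw [LinearMap.rTensor_tmul, hz, TensorProduct.zero_tmul]))

variable [Module.Free R F] [Module.Finite R F]

/-- The top exterior power of a finite free module is free of rank one. -/
theorem exists_extTop_equiv [Nontrivial R] :
    Nonempty (ext R F (Module.finrank R F) ≃ₗ[R] R) := by
  let b := (Module.finBasis R F).exteriorPower (Module.finrank R F)
  have hu (s : Set.powersetCard (Fin (Module.finrank R F)) (Module.finrank R F)) :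
      s.1 = Finset.univ :=
    Finset.eq_univ_of_card _ (s.2.trans (Fintype.card_fin _).symm)
  let : Unique (Set.powersetCard (Fin (Module.finrank R F)) (Module.finrank R F)) :=
    { default := ⟨Finset.univ, Finset.card_fin _⟩
      uniq := fun s => Subtype.ext (hu s) }
  have e : (⋀[R]^(Module.finrank R F) F) ≃ₗ[R] R :=
    b.equivFun.trans (LinearEquiv.funUnique _ R R)
  exact ⟨e⟩

/-- The homology of the Koszul complex of `φ` at the top exterior power is the quotient of `R` by
the ideal of the values at `φ` of the linear forms. -/
theorem koszulHomology_top_equiv [Nontrivial R] (φ : F) (I : Ideal R)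
    (hI : I = LinearMap.range (Module.Dual.eval R F φ)) {r₀ r r₂ : ℤ}
    (hr : r = r₀ + 1) (hr₂ : r₂ = r + 1) (h : r = Module.finrank R F) :
    Nonempty (koszulHomology (R := R) φ hr hr₂ ≃ₗ[R] R ⧸ I) := by
  subst h
  obtain ⟨e⟩ := exists_extTop_equiv (R := R) (F := F)
  have h0 (y : ext R F (Module.finrank R F)) : wedge hr₂ φ y = 0 :=
    ext_eq_zero_of_lt (by omega) _
  refine Hmod_equiv_of_surjective _ _
    (Submodule.mkQ I ∘ₗ e.toLinearMap ∘ₗ (LinearMap.ker (wedge hr₂ φ)).subtype)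
    (fun x => ?_) fun y => ?_
  · obtain ⟨c, rfl⟩ := Submodule.mkQ_surjective _ x
    exact ⟨⟨e.symm c, h0 _⟩, congrArg _ (e.apply_symm_apply c)⟩
  · change Submodule.mkQ I (e y.1) = 0 ↔ _
    rw [Submodule.mkQ_apply, Submodule.Quotient.mk_eq_zero, hI]
    constructor
    · rintro ⟨ψ, hψ⟩
      obtain ⟨z, hz⟩ := exists_wedge_eq φ ψ hr hr₂ (e.symm 1) (h0 _)
      refine ⟨z, hz.trans (e.injective ?_)⟩
      rw [map_smul, e.apply_symm_apply, smul_eq_mul, mul_one]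
      exact hψ
    · rintro ⟨x, hx⟩
      rw [← hx]
      exact ⟨e.toLinearMap ∘ₗ (wedgeHom hr).flip x, rfl⟩

end KoszulHomology

section RankOneAcyclic

variable {R : Type u} [CommRing R] {F G : Type u} [AddCommGroup F] [Module R F]
  [AddCommGroup G] [Module R G] [Module.Free R G] [Module.Finite R G]
  (Φ : Module.Dual R G →ₗ[R] F) {v : G} {γ : Module.Dual R G}

/-- For `G` of rank one, `C^{i,1}_Φ` is acyclic if a linear form takes the value `1` on the image of
the generator. -/
theorem subsingleton_hookHomology_rank_one (hγ : γ v = 1) (hv : ∀ x, γ x • v = x)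
    (h1 : Module.finrank R G = 1) {ψ : Module.Dual R F} (h : ψ (Φ γ) = 1) (i n : ℤ) :
    Subsingleton (hookHomology Φ i 1 n) := by
  obtain ⟨e⟩ := hookHomology_equiv_koszulHomology Φ hγ hv h1 i n
    (r₀ := (Module.finrank R F : ℤ) - i - 2 - n - 1) (by ring) rfl rfl
  have := subsingleton_koszulHomology (Φ γ) h (r₀ := (Module.finrank R F : ℤ) - i - 2 - n - 1)
    (r := (Module.finrank R F : ℤ) - i - 2 - n) (by ring) rfl
  exact e.toEquiv.subsingleton

variable [Module.Free R F] [Module.Finite R F]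

/-- For `G` of rank one, `C^{i,1}_Φ` has no homology outside degree zero if the ideal of the
coordinates of the image of the generator contains a regular sequence of length the rank of `F`. -/
theorem subsingleton_hookHomology_rank_one_of_regular (hγ : γ v = 1) (hv : ∀ x, γ x • v = x)
    (h1 : Module.finrank R G = 1) {s : List R} (hs : RingTheory.Sequence.IsWeaklyRegular R s)
    (hx : ∀ x ∈ s, x ∈ LinearMap.range (Module.Dual.eval R F (Φ γ)))
    (hl : Module.finrank R F ≤ s.length) (i n : ℤ) (h0 : n + i + 2 ≠ 0) :
    Subsingleton (hookHomology Φ i 1 n) := by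
  obtain ⟨e⟩ := hookHomology_equiv_koszulHomology Φ hγ hv h1 i n
    (r₀ := (Module.finrank R F : ℤ) - i - 2 - n - 1) (by ring) rfl rfl
  have : Subsingleton (koszulHomology (R := R) (Φ γ)
      (r₀ := (Module.finrank R F : ℤ) - i - 2 - n - 1)
      (r := (Module.finrank R F : ℤ) - i - 2 - n) (by ring) rfl) := by
    rcases lt_or_ge (n + i + 2) 0 with h | h
    · exact subsingleton_Hmod_of_forall_eq_zero _ _ fun y => ext_eq_zero_of_lt (by omega) y
    · exact subsingleton_koszulHomology_of_regular (Φ γ) hs hx _ _ (by omega)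
  exact e.toEquiv.subsingleton

/-- For `G` of rank one, the homology of `C^{i,1}_Φ` in degree zero is the quotient of `R` by the
ideal of the coordinates of the image of the generator. -/
theorem hookHomology_rank_one_equiv [Nontrivial R] (hγ : γ v = 1) (hv : ∀ x, γ x • v = x)
    (h1 : Module.finrank R G = 1) (I : Ideal R)
    (hI : I = LinearMap.range (Module.Dual.eval R F (Φ γ))) (i n : ℤ) (h0 : n + i + 2 = 0) :
    Nonempty (hookHomology Φ i 1 n ≃ₗ[R] R ⧸ I) := by
  obtain ⟨e⟩ := hookHomology_equiv_koszulHomology Φ hγ hv h1 i n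
    (r₀ := (Module.finrank R F : ℤ) - 1) (r := Module.finrank R F) (by ring) rfl (by omega)
  obtain ⟨e'⟩ := koszulHomology_top_equiv (Φ γ) I hI
    (r₀ := (Module.finrank R F : ℤ) - 1) (r := Module.finrank R F) (by ring) rfl rfl
  exact ⟨e.trans e'⟩

end RankOneAcyclic

section Minors

variable {R : Type u} [CommRing R]

/-! ### Ideals of minors -/

theorem mem_of_forall_basis {R M ι κ : Type*} [CommRing R] [AddCommGroup M] [Module R M] [Finite ι]
    (b : Module.Basis κ R M) (I : Ideal R) (f : MultilinearMap R (fun _ : ι => M) R)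
    (h : ∀ p : ι → κ, f (fun j => b (p j)) ∈ I) (v : ι → M) : f v ∈ I := by
  have h1 : (Submodule.mkQ I).compMultilinearMap f = 0 :=
    Module.Basis.ext_multilinear (fun _ => b) fun p =>
      (Submodule.Quotient.mk_eq_zero I).2 (h p)
  exact (Submodule.Quotient.mk_eq_zero I).1 (congrArg (fun g => g v) h1)

/-- The determinant of the matrix `ℓ i (φ (v j))`, as a multilinear map in `ℓ`. -/
noncomputable def detRows {M N : Type*} [AddCommGroup M] [Module R M] [AddCommGroup N] [Module R N]
    {k : ℕ} (φ : M →ₗ[R] N) (v : Fin k → M) :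
    MultilinearMap R (fun _ : Fin k => Module.Dual R N) R :=
  (Matrix.detRowAlternating (n := Fin k) (R := R)).toMultilinearMap.compLinearMap fun _ =>
    LinearMap.pi fun j => Module.Dual.eval R N (φ (v j))

theorem detRows_apply {M N : Type*} [AddCommGroup M] [Module R M] [AddCommGroup N] [Module R N]
    {k : ℕ} (φ : M →ₗ[R] N) (v : Fin k → M) (l : Fin k → Module.Dual R N) :
    detRows φ v l = (Matrix.of fun i j => l i (φ (v j))).det := rfl

/-- The determinant of the matrix `ℓ i (φ (v j))`, as a multilinear map in `v`. -/
noncomputable def detCols {M N : Type*} [AddCommGroup M] [Module R M] [AddCommGroup N] [Module R N]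
    {k : ℕ} (φ : M →ₗ[R] N) (l : Fin k → Module.Dual R N) :
    MultilinearMap R (fun _ : Fin k => M) R :=
  (Matrix.detRowAlternating (n := Fin k) (R := R)).toMultilinearMap.compLinearMap fun _ =>
    LinearMap.pi fun i => l i ∘ₗ φ

theorem detCols_apply {M N : Type*} [AddCommGroup M] [Module R M] [AddCommGroup N] [Module R N]
    {k : ℕ} (φ : M →ₗ[R] N) (l : Fin k → Module.Dual R N) (v : Fin k → M) :
    detCols φ l v = (Matrix.of fun i j => l i (φ (v j))).det :=
  (Matrix.det_transpose _).symm

/-- A determinant of values of linear forms on values of `φ` is a combination of minors in the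
chosen bases, by multilinearity in the forms and in the vectors. -/
theorem det_mem_minors {M N : Type*} [AddCommGroup M] [Module R M] [Module.Free R M]
    [Module.Finite R M] [AddCommGroup N] [Module R N] [Module.Free R N] [Module.Finite R N]
    {k : ℕ} (φ : M →ₗ[R] N) (l : Fin k → Module.Dual R N) (v : Fin k → M) :
    (Matrix.of fun i j => l i (φ (v j))).det ∈ minors k φ := by
  rw [← detCols_apply]
  refine mem_of_forall_basis (freeBasis R M) _ _ (fun p => ?_) v
  rw [detCols_apply, ← detRows_apply φ (fun j => freeBasis R M (p j))]
  refine mem_of_forall_basis (freeBasis R N).dualBasis _ _ (fun p' => ?_) l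
  rw [detRows_apply]
  refine Ideal.subset_span ⟨(p', p), ?_⟩
  refine congrArg Matrix.det (Matrix.ext fun i j => ?_)
  rw [Matrix.submatrix_apply, LinearMap.toMatrix_apply, Matrix.of_apply, Module.Basis.coe_dualBasis,
    Module.Basis.coord_apply]

/-- To bound the ideal of minors it is enough to use any one basis of the source and arbitrary
linear forms on the target. -/
theorem minors_le {M N : Type*} [AddCommGroup M] [Module R M] [Module.Free R M]
    [Module.Finite R M] [AddCommGroup N] [Module R N] [Module.Free R N] [Module.Finite R N]
    {k : ℕ} (φ : M →ₗ[R] N) (I : Ideal R) {κ : Type*} (b : Module.Basis κ R M)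
    (h : ∀ (l : Fin k → Module.Dual R N) (p : Fin k → κ),
      (Matrix.of fun i j => l i (φ (b (p j)))).det ∈ I) : minors k φ ≤ I := by
  refine Ideal.span_le.2 ?_
  rintro _ ⟨⟨p', p⟩, rfl⟩
  have h1 := mem_of_forall_basis b I (detCols φ fun i => (freeBasis R N).coord (p' i))
    (fun p => by rw [detCols_apply]; exact h _ p) fun j => freeBasis R M (p j)
  rw [detCols_apply] at h1
  have h2 : (LinearMap.toMatrix (freeBasis R M) (freeBasis R N) φ).submatrix p' p =
      Matrix.of fun i j => (freeBasis R N).coord (p' i) (φ (freeBasis R M (p j))) :=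
    Matrix.ext fun i j => by
      rw [Matrix.submatrix_apply, LinearMap.toMatrix_apply, Matrix.of_apply,
        Module.Basis.coord_apply]
  rw [← h2] at h1
  exact h1

theorem det_mem_of_column_mem {R n : Type*} [CommRing R] [Fintype n] [DecidableEq n] (I : Ideal R)
    (A : Matrix n n R) (j : n) (h : ∀ i, A i j ∈ I) : A.det ∈ I := by
  rw [Matrix.det_apply]
  exact Ideal.sum_mem _ fun σ _ => Submodule.smul_of_tower_mem _ _
    (Ideal.prod_mem I (Finset.mem_univ j) (h _))

variable {F' F'' G' G'' : Type u}
    [AddCommGroup F'] [Module R F'] [Module.Free R F'] [Module.Finite R F']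
    [AddCommGroup F''] [Module R F''] [Module.Free R F''] [Module.Finite R F'']
    [AddCommGroup G'] [Module R G'] [Module.Free R G'] [Module.Finite R G']
    [AddCommGroup G''] [Module R G''] [Module.Free R G''] [Module.Finite R G'']

/-- For the direct sum `Φ` of `Φ' : R → F'` and of an isomorphism, the ideal of maximal minors is
generated by the coordinates of `Φ' 1`. -/
theorem minors_blockDiag {r : ℕ} (b' : Module.Basis (Fin 1) R G') (b'' : Module.Basis (Fin r) R G'')
    (Φ' : Module.Dual R G' →ₗ[R] F') (Φ'' : Module.Dual R G'' ≃ₗ[R] F'') :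
    minors (r + 1) (blockDiag Φ' Φ''.toLinearMap) =
      LinearMap.range (Module.Dual.eval R F' (Φ' (b'.coord 0))) := by
  classical
  let b := (b'.prod b'').dualBasis
  have hb0 : blockDiag Φ' Φ''.toLinearMap (b (Sum.inl 0)) = (Φ' (b'.coord 0), 0) := by
    refine Prod.ext (congrArg Φ' (LinearMap.ext fun x => ?_))
      ((congrArg Φ'' (LinearMap.ext fun x => ?_)).trans (map_zero Φ''))
    · change b (Sum.inl 0) (x, 0) = _
      simp [b]
    · change b (Sum.inl 0) (0, x) = _
      simp [b]
  have hb1 (k : Fin r) : blockDiag Φ' Φ''.toLinearMap (b (Sum.inr k)) = (0, Φ'' (b''.coord k)) := by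
    refine Prod.ext ((congrArg Φ' (LinearMap.ext fun x => ?_)).trans (map_zero Φ'))
      (congrArg Φ'' (LinearMap.ext fun x => ?_))
    · change b (Sum.inr k) (x, 0) = _
      simp [b]
    · change b (Sum.inr k) (0, x) = _
      simp [b]
  refine le_antisymm (minors_le _ _ b fun l p => ?_) ?_
  · by_cases hp : Function.Injective p
    · have hs := (Fintype.bijective_iff_injective_and_card p).2 ⟨hp, by simp [add_comm]⟩
      obtain ⟨j, hj⟩ := hs.2 (Sum.inl 0)
      refine det_mem_of_column_mem _ _ j fun i => ⟨l i ∘ₗ LinearMap.inl R F' F'', ?_⟩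
      rw [Matrix.of_apply, hj, hb0]
      rfl
    · obtain ⟨j, j', h, hj⟩ := Function.not_injective_iff.1 hp
      rw [Matrix.det_zero_of_column_eq hj fun i => by rw [Matrix.of_apply, Matrix.of_apply, h]]
      exact Submodule.zero_mem _
  · rintro _ ⟨ψ, rfl⟩
    let e : Fin (r + 1) ≃ Fin 1 ⊕ Fin r := ((finCongr (add_comm r 1)).trans finSumFinEquiv.symm)
    let u := (b''.dualBasis.map Φ'')
    let l : Fin 1 ⊕ Fin r → Module.Dual R (F' × F'') := Sum.elim
      (fun _ => ψ ∘ₗ LinearMap.fst R F' F'')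
      fun k => u.coord k ∘ₗ LinearMap.snd R F' F''
    have h := det_mem_minors (blockDiag Φ' Φ''.toLinearMap) (fun i => l (e i)) (fun j => b (e j))
    have h1 : (Matrix.of fun i j => l (e i) (blockDiag Φ' Φ''.toLinearMap (b (e j)))) =
        (Matrix.fromBlocks (Matrix.of fun _ _ : Fin 1 => ψ (Φ' (b'.coord 0))) 0 0
          (1 : Matrix (Fin r) (Fin r) R)).submatrix e e := by
      ext i j
      rw [Matrix.submatrix_apply, Matrix.of_apply]
      rcases e i with i | i <;> rcases e j with j | j
      · rw [Subsingleton.elim j 0, hb0]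
        rfl
      · rw [hb1]
        exact map_zero ψ
      · rw [Subsingleton.elim j 0, hb0]
        exact map_zero (u.coord i)
      · rw [hb1, Matrix.fromBlocks_apply₂₂, Matrix.one_apply]
        change u.repr (Φ'' (b''.coord j)) i = _
        have h2 : Φ'' (b''.coord j) = u j := by simp [u]
        rw [h2, Module.Basis.repr_self, Finsupp.single_apply]
        simp only [eq_comm]
    rw [h1, Matrix.det_submatrix_equiv_self, Matrix.det_fromBlocks_zero₂₁, Matrix.det_one, mul_one,
      Matrix.det_unique] at h
    exact h

end Minors

/-! ### Projectivity of the terms of the complexes -/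

section SymProjective

variable {R : Type*} [CommRing R] {M : Type*} [AddCommGroup M] [Module R M]

/-- The homomorphism `Sym M → (Sym M)[X]` that multiplies the elements of degree `n` by `Xⁿ`. -/
noncomputable def symGrade (R M : Type*) [CommRing R] [AddCommGroup M] [Module R M] :
    SymmetricAlgebra R M →ₐ[R] Polynomial (SymmetricAlgebra R M) :=
  SymmetricAlgebra.lift ((Polynomial.monomial 1).restrictScalars R ∘ₗ SymmetricAlgebra.ι R M)

theorem symGrade_ι (v : M) :
    symGrade R M (SymmetricAlgebra.ι R M v) = Polynomial.monomial 1 (SymmetricAlgebra.ι R M v) :=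
  SymmetricAlgebra.lift_ι_apply _ _

theorem coeff_symGrade_mem (s : SymmetricAlgebra R M) (n : ℕ) :
    (symGrade R M s).coeff n ∈ LinearMap.range (SymmetricAlgebra.ι R M) ^ n := by
  induction s using SymmetricAlgebra.induction generalizing n with
  | algebraMap c =>
    rw [AlgHom.commutes, Polynomial.algebraMap_apply, Polynomial.coeff_C]
    split_ifs with h
    · rw [h, pow_zero]
      exact Submodule.algebraMap_mem c
    · exact Submodule.zero_mem _
  | ι v =>
    rw [symGrade_ι, Polynomial.coeff_monomial]
    split_ifs with h
    · rw [← h, pow_one]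
      exact LinearMap.mem_range_self _ v
    · exact Submodule.zero_mem _
  | mul s t hs ht =>
    rw [map_mul, Polynomial.coeff_mul]
    refine Submodule.sum_mem _ fun p hp => ?_
    rw [← Finset.HasAntidiagonal.mem_antidiagonal.1 hp, pow_add]
    exact Submodule.mul_mem_mul (hs _) (ht _)
  | add s t hs ht =>
    rw [map_add, Polynomial.coeff_add]
    exact Submodule.add_mem _ (hs n) (ht n)

theorem symGrade_of_mem (n : ℕ) {s : SymmetricAlgebra R M}
    (hs : s ∈ LinearMap.range (SymmetricAlgebra.ι R M) ^ n) :
    symGrade R M s = Polynomial.monomial n s := by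
  induction n generalizing s with
  | zero =>
    rw [pow_zero] at hs
    obtain ⟨c, rfl⟩ := Submodule.mem_one.1 hs
    rw [AlgHom.commutes]
    rfl
  | succ n ih =>
    rw [pow_succ'] at hs
    refine Submodule.mul_induction_on hs ?_ ?_
    · rintro _ ⟨v, rfl⟩ t ht
      rw [map_mul, symGrade_ι, ih ht, Polynomial.monomial_mul_monomial, add_comm 1 n]
    · intro s t hs ht
      rw [map_add, hs, ht, map_add]

/-- A symmetric power is a direct summand of the symmetric algebra. -/
theorem projective_sym [Module.Free R M] (q : ℤ) : Module.Projective R (sym R M q) := by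
  rcases q with n | n
  · let π : SymmetricAlgebra R M →ₗ[R] sym R M (Int.ofNat n) := LinearMap.codRestrict _
      ((Polynomial.lcoeff (SymmetricAlgebra R M) n).restrictScalars R ∘ₗ (symGrade R M).toLinearMap)
      fun s => coeff_symGrade_mem s n
    refine Module.Projective.of_split (sym R M (Int.ofNat n)).subtype π
      (LinearMap.ext fun s => Subtype.ext ?_)
    change (symGrade R M s.1).coeff n = s.1
    rw [symGrade_of_mem n s.2, Polynomial.coeff_monomial, if_pos rfl]
  · have : Subsingleton (sym R M (Int.negSucc n)) :=
      inferInstanceAs (Subsingleton (⊥ : Submodule R (SymmetricAlgebra R M)))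
    infer_instance

theorem finite_sym [Module.Finite R M] (q : ℤ) : Module.Finite R (sym R M q) := by
  refine Module.Finite.iff_fg.2 ?_
  rcases q with n | n
  · have h : (LinearMap.range (SymmetricAlgebra.ι R M)).FG :=
      LinearMap.range_eq_map (SymmetricAlgebra.ι R M) ▸ Module.Finite.fg_top.map _
    exact h.pow n
  · exact Submodule.fg_bot

theorem projective_divPow [Module.Free R M] [Module.Finite R M] (q : ℤ) :
    Module.Projective R (divPow R M q) := by
  have := projective_sym (R := R) (M := M) q
  have := finite_sym (R := R) (M := M) q
  exact inferInstanceAs (Module.Projective R (Module.Dual R (sym R M q)))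

theorem projective_ext [Module.Free R M] (r : ℤ) : Module.Projective R (ext R M r) := by
  rcases r with n | n
  · exact inferInstanceAs (Module.Projective R (⋀[R]^n M))
  · have : Subsingleton (ext R M (Int.negSucc n)) :=
      inferInstanceAs (Subsingleton (⊥ : Submodule R (ExteriorAlgebra R M)))
    infer_instance

/-- The kernel of a surjection between projective modules is projective. -/
theorem projective_of_surjective {A B : Type*} [AddCommGroup A] [Module R A] [AddCommMonoid B]
    [Module R B] [Module.Projective R A] [Module.Projective R B] (f : A →ₗ[R] B)
    (hf : Function.Surjective f) (S : Submodule R A) (hS : ∀ x, x ∈ S ↔ f x = 0) :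
    Module.Projective R S := by
  obtain ⟨s, hs⟩ := Module.projective_lifting_property f LinearMap.id hf
  have hs' (x) : f (s x) = x := LinearMap.congr_fun hs x
  have hmem (x : A) : (LinearMap.id - s ∘ₗ f : A →ₗ[R] A) x ∈ S := (hS _).2 (by
    have h1 : f (-(s (f x))) + f (s (f x)) = 0 := by rw [← map_add, neg_add_cancel, map_zero]
    rw [hs'] at h1
    change f (x - s (f x)) = 0
    rw [sub_eq_add_neg, map_add, add_comm]
    exact h1)
  refine Module.Projective.of_split S.subtype ((LinearMap.id - s ∘ₗ f).codRestrict S hmem)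
    (LinearMap.ext fun x => Subtype.ext ?_)
  change x.1 - s (f x.1) = x.1
  rw [(hS x.1).1 x.2, map_zero, sub_zero]

variable [Module.Free R M] [Module.Finite R M]

/-- The modules `L^p_q` with `q ≥ 1` are projective, as kernels in an exact Koszul complex. -/
theorem projective_schur (p : ℤ) : ∀ q : ℤ, 0 < q → Module.Projective R (schur R M p q) := by
  have h0 (p q : ℤ) (hp : p < 0) : Module.Projective R (schur R M p q) := by
    have : Subsingleton (schur R M p q) := ⟨fun x y =>
      (schur_eq_zero_of_neg hp x).trans (schur_eq_zero_of_neg hp y).symm⟩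
    infer_instance
  rcases lt_or_ge p 0 with hp | hp
  · exact fun _ _ => h0 _ _ hp
  · refine Int.leInduction (motive := fun p _ => ∀ q : ℤ, 0 < q →
      Module.Projective R (schur R M p q)) (m := -1) (fun _ _ => h0 _ _ (by norm_num)) ?_ p
      (by omega)
    intro p _ ih q hq
    have := ih (q + 1) (by omega)
    have := projective_ext (R := R) (M := M) (p + 1)
    have := projective_sym (R := R) (M := M) q
    refine projective_of_surjective (A := ext R M (p + 1) ⊗[R] sym R M q)
      (kappaCod (R := R) (G := M) (p' := p) (q' := q + 1) rfl rfl)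
      (kappaCod_surjective rfl rfl (Or.inr (by omega))) _ fun x => ?_
    rw [mem_schur (p' := p) (q' := q + 1) rfl rfl]
    exact ⟨fun h => Subtype.ext h, fun h => congrArg Subtype.val h⟩

/-- The modules `K^a_q` with `a ≥ 0` are projective, as kernels in an exact Koszul complex. -/
theorem projective_weyl (q : ℤ) : ∀ a : ℤ, 0 ≤ a → Module.Projective R (weyl R M a q) := by
  have h0 (a q : ℤ) (hq : q < 0) : Module.Projective R (weyl R M a q) := by
    have : Subsingleton (weyl R M a q) := ⟨fun x y =>
      (weyl_neg_eq_zero hq x).trans (weyl_neg_eq_zero hq y).symm⟩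
    infer_instance
  rcases lt_or_ge q 0 with hq | hq
  · exact fun _ _ => h0 _ _ hq
  · refine Int.leInduction (motive := fun q _ => ∀ a : ℤ, 0 ≤ a →
      Module.Projective R (weyl R M a q)) (m := -1) (fun _ _ => h0 _ _ (by norm_num)) ?_ q
      (by omega)
    intro q _ ih a ha
    have := ih (a + 1) (by omega)
    have := projective_ext (R := R) (M := Module.Dual R M) a
    have := projective_divPow (R := R) (M := M) (q + 1)
    refine projective_of_surjective (A := ext R (Module.Dual R M) a ⊗[R] divPow R M (q + 1))
      (etaCod (R := R) (G := M) (p' := a + 1) (q' := q) rfl rfl)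
      (etaCod_surjective rfl rfl (Or.inl (by omega))) _ fun x => ?_
    rw [mem_weyl (p' := a + 1) (q' := q) rfl rfl]
    exact ⟨fun h => Subtype.ext h, fun h => congrArg Subtype.val h⟩

end SymProjective

section HookProjective

variable {R : Type u} [CommRing R] {F G : Type u} [AddCommGroup F] [Module R F] [Module.Free R F]
  [AddCommGroup G] [Module R G] [Module.Free R G] [Module.Finite R G]

theorem projective_hookX (i : ℤ) {a : ℤ} (ha : 0 ≤ a) (m : ℤ) :
    Module.Projective R (hookX R F G i a m) := by
  rcases m with (_ | k) | k
  · exact projective_ext (R := R) (M := F) _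
  · have := projective_ext (R := R) (M := F)
      ((Module.finrank R F : ℤ) - Module.finrank R G - i - 1 - k)
    have := projective_weyl (R := R) (M := G) k a ha
    exact inferInstanceAs (Module.Projective R
      (ext R F ((Module.finrank R F : ℤ) - Module.finrank R G - i - 1 - k) ⊗[R] weyl R G a k))
  · have := projective_ext (R := R) (M := F) ((Module.finrank R F : ℤ) - i + k)
    have := projective_schur (R := R) (M := G) ((Module.finrank R G : ℤ) - a) (k + 1)
      (by omega)
    exact inferInstanceAs (Module.Projective R
      (ext R F ((Module.finrank R F : ℤ) - i + k) ⊗[R]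
        schur R G ((Module.finrank R G : ℤ) - a) (k + 1)))

variable [Module.Finite R F]

theorem subsingleton_hookX (i a : ℤ) {m : ℤ} (hm : m < 0) (h : m + i + 1 < 0) :
    Subsingleton (hookX R F G i a m) := by
  rcases m with k | k
  · exact absurd hm (by simp)
  · have hb (b : ext R F ((Module.finrank R F : ℤ) - i + k)) : b = 0 :=
      ext_eq_zero_of_lt (R := R) (G := F) (n := (Module.finrank R F : ℤ) - i + k)
        (by rw [Int.negSucc_eq] at h; omega) b
    have h0 (x : ext R F ((Module.finrank R F : ℤ) - i + k) ⊗[R]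
        schur R G ((Module.finrank R G : ℤ) - a) (k + 1)) : x = 0 := by
      induction x with
      | zero => rfl
      | tmul b c => rw [hb b, TensorProduct.zero_tmul]
      | add x y hx hy => rw [hx, hy, add_zero]
    exact ⟨fun x y => (h0 x).trans (h0 y).symm⟩

end HookProjective

/-! ### Bounded exact complexes of projective modules -/

section Contractible

variable {R : Type u} [CommRing R]

/-- In a degree where the homology vanishes, cycles are boundaries. -/
theorem exists_d_eq_of_subsingleton_homology (C : ChainComplex (ModuleCat.{u} R) ℤ) (j k : ℤ)
    (hk : k + 1 = j) [Subsingleton (C.homology j)] (x : C.X j) (hx : (C.d j k).hom x = 0) :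
    ∃ y, (C.d (j + 1) j).hom y = x := by
  obtain ⟨e⟩ := moduleCat_homology_equiv (C.sc' (j + 1) j k)
  have e' := (C.homologyIsoSc' (j + 1) j k (by simp) (by simp [← hk])).toLinearEquiv
  have : Subsingleton (Hmod (C.sc' (j + 1) j k).f.hom (C.sc' (j + 1) j k).g.hom) :=
    (e.symm.trans e'.symm).toEquiv.subsingleton
  exact exists_eq_of_Hmod_subsingleton (C.sc' (j + 1) j k).f.hom (C.sc' (j + 1) j k).g.hom hx

/-- A bounded below exact complex of projective modules is contractible. -/
theorem splitExact_of_projective (C : ChainComplex (ModuleCat.{u} R) ℤ) (m : ℤ)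
    (hm : ∀ j < m, Subsingleton (C.X j)) (hp : ∀ j, Module.Projective R (C.X j))
    (hC : ∀ j, Subsingleton (C.homology j)) : SplitExact C := by
  let Z (j : ℤ) : Submodule R (C.X j) := LinearMap.ker (C.d j (j - 1)).hom
  have hZ {j k : ℤ} (h : k + 1 = j) (x : C.X j) : x ∈ Z j ↔ (C.d j k).hom x = 0 := by
    obtain rfl : k = j - 1 := by omega
    exact Iff.rfl
  have hdd (i j k : ℤ) (x : C.X i) : (C.d j k).hom ((C.d i j).hom x) = 0 :=
    LinearMap.congr_fun (congrArg ModuleCat.Hom.hom (C.d_comp_d i j k)) x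
  let δ (i j : ℤ) (h : i + 1 = j) : C.X j →ₗ[R] Z i :=
    (C.d j i).hom.codRestrict (Z i) fun x => hdd j i (i - 1) x
  have hδ (i j : ℤ) (h : i + 1 = j) : Function.Surjective (δ i j h) := fun z => by
    subst h
    obtain ⟨y, hy⟩ := exists_d_eq_of_subsingleton_homology C i (i - 1) (by ring) z.1 z.2
    exact ⟨y, Subtype.ext hy⟩
  have hZp (j : ℤ) : Module.Projective R (Z j) := by
    have h0 (j) (hj : j < m) : Module.Projective R (Z j) := by
      have := hm j hj
      infer_instance
    rcases lt_or_ge j m with hj | hj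
    · exact h0 j hj
    · refine Int.leInduction (motive := fun j _ => Module.Projective R (Z j)) (m := m - 1)
        (h0 _ (by omega)) (fun j _ ih => ?_) j (by omega)
      have := hp (j + 1)
      refine projective_of_surjective (δ j (j + 1) rfl) (hδ j (j + 1) rfl) (Z (j + 1)) fun x => ?_
      rw [hZ rfl]
      exact ⟨fun h => Subtype.ext h, fun h => congrArg Subtype.val h⟩
  have hs (i j : ℤ) (h : i + 1 = j) : ∃ s : Z i →ₗ[R] C.X j, δ i j h ∘ₗ s = LinearMap.id :=
    Module.projective_lifting_property _ _ (hδ i j h)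
  choose s hs using hs
  have hs' (i j : ℤ) (h : i + 1 = j) (z : Z i) : (C.d j i).hom (s i j h z) = z.1 :=
    congrArg Subtype.val (LinearMap.congr_fun (hs i j h) z)
  -- The contraction: project to the cycles along the chosen complement, and then lift.
  have hmem (i : ℤ) (x : C.X i) :
      (LinearMap.id - s (i - 1) i (by ring) ∘ₗ δ (i - 1) i (by ring) : C.X i
        →ₗ[R] C.X i) x ∈ Z i := by
    change (C.d i (i - 1)).hom (x - s (i - 1) i (by ring) (δ (i - 1) i (by ring) x)) = 0
    rw [map_sub, hs', sub_eq_zero]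
    rfl
  let π (i : ℤ) : C.X i →ₗ[R] Z i :=
    (LinearMap.id - s (i - 1) i (by ring) ∘ₗ δ (i - 1) i (by ring)).codRestrict (Z i) (hmem i)
  have hπ (i k : ℤ) (h : k + 1 = i) (x : C.X i) :
      (π i x).1 = x - s k i h (δ k i h x) := by
    obtain rfl : k = i - 1 := by omega
    rfl
  have hπZ (i : ℤ) (z : Z i) : π i z.1 = z := Subtype.ext (by
    rw [hπ i (i - 1) (by ring)]
    have h1 : δ (i - 1) i (by ring) z.1 = 0 := Subtype.ext z.2
    rw [h1, map_zero, sub_zero])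
  refine ⟨{ hom := fun i j => if h : i + 1 = j then ModuleCat.ofHom (s i j h ∘ₗ π i) else 0,
            zero := fun i j h => dif_neg h, comm := fun i => ?_ }⟩
  obtain ⟨k, rfl⟩ : ∃ k, i = k + 1 := ⟨i - 1, by ring⟩
  rw [dNext_eq _ (show (ComplexShape.down ℤ).Rel (k + 1) k from rfl),
    prevD_eq _ (show (ComplexShape.down ℤ).Rel (k + 1 + 1) (k + 1) from rfl), dif_pos rfl,
    dif_pos rfl]
  refine ModuleCat.hom_ext (LinearMap.ext fun x => ?_)
  change x = s k (k + 1) rfl (π k ((C.d (k + 1) k).hom x)) +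
    (C.d (k + 1 + 1) (k + 1)).hom (s (k + 1) (k + 1 + 1) rfl (π (k + 1) x)) + 0
  have h1 : π k ((C.d (k + 1) k).hom x) = δ k (k + 1) rfl x := hπZ k (δ k (k + 1) rfl x)
  rw [hs', hπ (k + 1) k rfl, h1, add_zero, add_sub_cancel]

end Contractible

/-! ### The conclusions when `Φ'` has rank one source -/

section Grade

variable {R : Type*} [CommRing R]

theorem exists_isWeaklyRegular_of_le_grade {I : Ideal R} (hI : I ≠ ⊤) {n : ℕ}
    (hn : (n : ℕ∞) ≤ grade I) :
    ∃ s : List R, RingTheory.Sequence.IsWeaklyRegular R s ∧ (∀ x ∈ s, x ∈ I) ∧ n ≤ s.length := by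
  rcases n with _ | n
  · exact ⟨[], RingTheory.Sequence.IsWeaklyRegular.nil R R, by simp, Nat.zero_le _⟩
  · have h : (n : ℕ∞) < grade I := lt_of_lt_of_le (by exact_mod_cast n.lt_succ_self) hn
    rw [grade, if_neg hI, lt_iSup_iff] at h
    obtain ⟨s, h⟩ := h
    obtain ⟨hs, h⟩ := lt_iSup_iff.1 h
    exact ⟨s, hs.1.toIsWeaklyRegular, hs.2, by exact_mod_cast h⟩

end Grade

section RankOne

variable {R : Type u} [CommRing R] {F G : Type u} [AddCommGroup F] [Module R F]
  [Module.Free R F] [Module.Finite R F]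
  [AddCommGroup G] [Module R G] [Module.Free R G] [Module.Finite R G]
  (Φ : Module.Dual R G →ₗ[R] F) (b : Module.Basis (Fin 1) R G)

theorem coord_zero_smul (x : G) : b.coord 0 x • b 0 = x := by
  conv_rhs => rw [← b.sum_repr x]
  simp

theorem subsingleton_homology_rank_one [Nontrivial R] {I : Ideal R}
    (hI : I = LinearMap.range (Module.Dual.eval R F (Φ (b.coord 0)))) (h : I = ⊤) (i j : ℤ) :
    Subsingleton ((hookComplex Φ i 1).homology j) := by
  obtain ⟨ψ, hψ⟩ : (1 : R) ∈ LinearMap.range (Module.Dual.eval R F (Φ (b.coord 0))) := by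
    rw [← hI, h]
    exact Submodule.mem_top
  have h1 : Module.finrank R G = 1 := by simpa using Module.finrank_eq_card_basis b
  obtain ⟨e⟩ := hookComplex_homology_equiv Φ i 1 j (j - i - 2) (by ring)
  have := subsingleton_hookHomology_rank_one Φ (v := b 0) (γ := b.coord 0) (by simp)
    (coord_zero_smul b) h1 hψ i (j - i - 2)
  exact e.toEquiv.subsingleton

/-- For `G` of rank one, `C^{i,1}_Φ` resolves `R / I` if the ideal `I` of the coordinates has grade
at least the rank of `F`. -/
theorem resolves_rank_one [Nontrivial R] {I : Ideal R}
    (hI : I = LinearMap.range (Module.Dual.eval R F (Φ (b.coord 0)))) (h : I ≠ ⊤)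
    (hg : (Module.finrank R F : ℕ∞) ≤ grade I) (i : ℤ) :
    Resolves (hookComplex Φ i 1) (R ⧸ I) := by
  have h1 : Module.finrank R G = 1 := by simpa using Module.finrank_eq_card_basis b
  refine ⟨fun j hj => ?_, ?_⟩
  · obtain ⟨s, hs, hx, hl⟩ := exists_isWeaklyRegular_of_le_grade h hg
    obtain ⟨e⟩ := hookComplex_homology_equiv Φ i 1 j (j - i - 2) (by ring)
    have := subsingleton_hookHomology_rank_one_of_regular Φ (v := b 0) (γ := b.coord 0) (by simp)
      (coord_zero_smul b) h1 hs (fun x h => hI ▸ hx x h) hl i (j - i - 2) (by omega)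
    exact e.toEquiv.subsingleton
  · obtain ⟨e⟩ := hookComplex_homology_equiv Φ i 1 0 (0 - i - 2) (by ring)
    obtain ⟨e'⟩ := hookHomology_rank_one_equiv Φ (v := b 0) (γ := b.coord 0) (by simp)
      (coord_zero_smul b) h1 I hI i (0 - i - 2) (by ring)
    exact ⟨e.trans e'⟩

end RankOne

section Transfer

variable {R : Type u} [CommRing R]

theorem Resolves.of_homology_equiv_pi {C D : ChainComplex (ModuleCat.{u} R) ℤ} {M : Type u}
    [AddCommGroup M] [Module R M] {k : ℕ}
    (e : ∀ j, Nonempty (C.homology j ≃ₗ[R] (Fin k → D.homology j))) (h : Resolves D M) :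
    Resolves C (Fin k → M) := by
  refine ⟨fun j hj => ?_, ?_⟩
  · have := h.1 j hj
    obtain ⟨e⟩ := e j
    exact e.toEquiv.subsingleton
  · obtain ⟨e⟩ := e 0
    obtain ⟨e'⟩ := h.2
    exact ⟨e.trans (LinearEquiv.piCongrRight fun _ => e')⟩

variable {F G : Type u} [AddCommGroup F] [Module R F]
  [Module.Free R F] [Module.Finite R F]
  [AddCommGroup G] [Module R G] [Module.Free R G] [Module.Finite R G]
  (Φ : Module.Dual R G →ₗ[R] F)

theorem subsingleton_hookComplex_X (i a : ℤ) {j : ℤ} (hj : j < 0) (hji : j < i + 1) :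
    Subsingleton ((hookComplex Φ i a).X j) :=
  subsingleton_hookX (F := F) (G := G) i a (m := j - i - 1) (by omega) (by omega)

/-- An acyclic complex `C^{i,a}_Φ` is split exact, since it is bounded below and its terms are
projective. -/
theorem splitExact_hookComplex (i : ℤ) {a : ℤ} (ha : 0 ≤ a)
    (h : ∀ j, Subsingleton ((hookComplex Φ i a).homology j)) : SplitExact (hookComplex Φ i a) :=
  splitExact_of_projective _ (min 0 (i + 1))
    (fun _ hj => subsingleton_hookComplex_X Φ i a (lt_of_lt_of_le hj (min_le_left _ _))
      (lt_of_lt_of_le hj (min_le_right _ _)))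
    (fun j => projective_hookX (F := F) (G := G) i ha (j - i - 1)) h

end Transfer

end HookComplex

open HookComplex in
theorem mainTheorem5 (R : Type u) [CommRing R] [IsNoetherianRing R]
    (F' F'' G' G'' : Type u)
    [AddCommGroup F'] [Module R F'] [Module.Free R F'] [Module.Finite R F']
    [AddCommGroup F''] [Module R F''] [Module.Free R F''] [Module.Finite R F'']
    [AddCommGroup G'] [Module R G'] [Module.Free R G'] [Module.Finite R G']
    [AddCommGroup G''] [Module R G''] [Module.Free R G''] [Module.Finite R G'']
    (f g r : ℕ) (hf : Module.finrank R (F' × F'') = f) (hg : Module.finrank R (G' × G'') = g)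
    (hgf : g ≤ f) (hF'' : Module.finrank R F'' = r) (hG'' : Module.finrank R G'' = r)
    (hr : 1 ≤ r) (hrg : r + 1 ≤ g)
    (Φ' : Module.Dual R G' →ₗ[R] F') (Φ'' : Module.Dual R G'' ≃ₗ[R] F'')
    (Φ : Module.Dual R (G' × G'') →ₗ[R] F' × F'') (hΦ : Φ = blockDiag Φ' Φ''.toLinearMap)
    (i a : ℤ) (ha : 1 ≤ a) (hag : a ≤ g) :
    (∀ j : ℤ, Nonempty ((hookComplex Φ i a).homology j ≃ₗ[R]
      ⨁ β : Finset.Icc (1 : ℤ) ((g : ℤ) - r),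
        (Fin (intChoose r (a - β)) → (hookComplex Φ' i β).homology j))) ∧
    (r + 1 = g →
      (∀ j : ℤ, Nonempty ((hookComplex Φ i a).homology j ≃ₗ[R]
        (Fin (intChoose (g - 1) (a - 1)) → (hookComplex Φ' i 1).homology j))) ∧
      (minors g Φ = ⊤ → SplitExact (hookComplex Φ i a)) ∧
      (minors g Φ ≠ ⊤ → ((f - g + 1 : ℕ) : ℕ∞) ≤ grade (minors g Φ) →
        (-1 ≤ i → ∀ j : ℤ, j < 0 → Subsingleton ((hookComplex Φ i a).X j)) ∧
        Resolves (hookComplex Φ i a) (Fin (intChoose (g - 1) (a - 1)) → R ⧸ minors g Φ))) := by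
  subst hΦ
  rcases subsingleton_or_nontrivial R with hR | hR
  · -- Over the zero ring every module has rank one, which contradicts `2 ≤ g`.
    have : Module.finrank R (G' × G'') = 1 := Module.finrank_subsingleton
    omega
  have hA (j : ℤ) := blockDiag_homology_equiv g r hg hG'' hr Φ' Φ'' i a ha hag j
  refine ⟨hA, fun hrg' => ?_⟩
  have hF' : Module.finrank R F' = f - g + 1 := by
    rw [Module.finrank_prod] at hf
    omega
  have hG' : Module.finrank R G' = 1 := by
    rw [Module.finrank_prod] at hg
    omega
  have hB (j : ℤ) : Nonempty ((hookComplex (blockDiag Φ' Φ''.toLinearMap) i a).homology j ≃ₗ[R]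
      (Fin (intChoose (g - 1) (a - 1)) → (hookComplex Φ' i 1).homology j)) :=
    directSum_Icc_one_equiv (fun β => (hookComplex Φ' i β).homology j) r (g - 1) a ((g : ℤ) - r)
      (by omega) (by omega) (hA j)
  let b' := Module.finBasisOfFinrankEq R G' hG'
  have hI : minors g (blockDiag Φ' Φ''.toLinearMap) =
      LinearMap.range (Module.Dual.eval R F' (Φ' (b'.coord 0))) := by
    rw [← hrg']
    exact minors_blockDiag b' (Module.finBasisOfFinrankEq R G'' hG'') Φ' Φ''
  refine ⟨hB, fun h => splitExact_hookComplex _ i (by omega) fun j => ?_,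
    fun h hgr => ⟨fun hi j hj =>
    subsingleton_hookComplex_X _ i a hj (by omega), Resolves.of_homology_equiv_pi hB
      (resolves_rank_one Φ' b' hI h (by rw [hF']; exact hgr) i)⟩⟩
  have := subsingleton_homology_rank_one Φ' b' hI h i j
  obtain ⟨e⟩ := hB j
  exact e.toEquiv.subsingleton
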